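/- **Conventions.** $Y_{lm}$ ($l\ge0$, $|m|\le l$) are the orthonormal spherical harmonics with Condon–Shortley phase, $j_l$ and $h^{(1)}_l$ the spherical Bessel and Hankel functions, $d\Omega$ the surface measure on the unit sphere, $A\cdot B=\sum_iA_iB_i$ (no conjugation), $\hat r=\vec r/|\vec r|$. Put $e_{\pm1}=\mp(e_x\pm ie_y)/\sqrt2$, $e_0=e_z$ and let $\vec Y_{jlm}=\sum_{q=-1}^{1}\langle l\,(m-q)\,1\,q\,|\,j\,m\rangle\,Y_{l,m-q}\,e_q$ be the vector spherical harmonics. For $j\ge1$, $|m|\le j$, set $$\vec Y^{(0)}_{jm}=\vec Y_{j,j,m},\qquad \vec Y^{(1)}_{jm}=\sqrt{\tfrac{j+1}{2j+1}}\,\vec Y_{j,j-1,m}+\sqrt{\tfrac{j}{2j+1}}\,\vec Y_{j,j+1,m}.$$ For $\omega>0$ let $|jlm\rangle(\vec r)=\sqrt{2\omega^2/\pi}\;j_l(\omega r)\,\vec Y_{jlm}(\hat r)$, and define the TE wave ($\alpha=0$) and the TM wave ($\alpha=1$) by $$|jm0\rangle=|j\,j\,m\rangle,\qquad |jm1\rangle=\sqrt{\tfrac{j+1}{2j+1}}\,|j,j-1,m\rangle-\sqrt{\tfrac{j}{2j+1}}\,|j,j+1,m\rangle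 .$$ For points $P_A,P_B$ and $X=A,B$ write $|(jm\alpha)_X\rangle(\vec x)=|jm\alpha\rangle(\vec x-P_X)$ for the waves centred at $P_X$, and let $\vec a=P_B-P_A$. The propagator is $$\mathcal D_0(\vec x,\vec y)_{ik}=\Big(\delta_{ik}+\frac1{\omega^2}\partial_i\partial_k\Big)\Big(-\frac{e^{i\omega|\vec x-\vec y|}}{4\pi|\vec x-\vec y|}\Big)\qquad(\vec x\ne\vec y),$$ i.e. the outgoing solution of $\nabla\times\nabla\times\mathcal D_0-\omega^2\mathcal D_0=-\delta(\vec x-\vec y)\,\mathbf 1$ in the gauge $A^0=0$. **Expansion.** Define $$\mathcal C_{jm\alpha;j'm'\alpha'}=-\frac{2i\pi^2}{\omega}\sum_{l''m''}i^{\,l''+j'-j+\alpha-\alpha'}\,h^{(1)}_{l''}(\omega a)\,Y_{l''m''}(\hat a)\int d\Omega\;Y^*_{l''m''}\big(\vec Y^{(\alpha)}_{jm}\cdot\vec Y^{(\alpha')*}_{j'm'}\big),$$ a sum with only finitely many non-zero terms. Then $$\mathcal D_0=\sum_{jm\alpha;\,j'm'\alpha'}|(j'm'\alpha')_B\rangle\;\mathcal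 C_{jm\alpha;j'm'\alpha'}\;\langle(jm\alpha)_A|,$$ that is, for all $i,k$, $$\mathcal D_0(\vec y,\vec x)_{ik}=\sum_{jm\alpha;\,j'm'\alpha'}|(j'm'\alpha')_B\rangle(\vec y)_i\;\mathcal C_{jm\alpha;j'm'\alpha'}\;\overline{|(jm\alpha)_A\rangle(\vec x)_k}.$$ The double series converges unconditionally when $|\vec x-P_A|+|\vec y-P_B|<|\vec a|$. On the larger domain $|\vec y-P_B|<|\vec a|$, $|\vec x-P_A|<|\vec y-P_A|$ the identity holds as an iterated series: for each $(jm\alpha)$ the sum over $(j'm'\alpha')$ is summable, and the resulting sum over $(jm\alpha)$ converges unconditionally to $\mathcal D_0(\vec y,\vec x)_{ik}$. **Angular integrals.** For $j_1,j_2\ge1$, $j_3\ge0$, $|m_i|\le j_i$, let $$I=\int d\Omega\,Y_{j_3m_3}\big(\vec Y^{(\alpha)*}_{j_1m_1}\cdot\vec Y^{(\alpha')}_{j_2m_2}\big).$$ Then $I$ equals its complex conjugate, which is the integral appearing in $\mathcal C_{j_1m_1\alpha;j_2m_2\alpha'}$ with $(l'',m'')=(j_3,m_3)$, and, in terms of Wigner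 3j symbols: * if $\alpha=\alpha'$, then $$I=(-1)^{m_1}\frac{j_1(j_1+1)+j_2(j_2+1)-j_3(j_3+1)}{2\sqrt{j_1(j_1+1)j_2(j_2+1)}}\sqrt{\frac{(2j_1+1)(2j_2+1)(2j_3+1)}{4\pi}}\begin{pmatrix}j_1&j_2&j_3\\0&0&0\end{pmatrix}\begin{pmatrix}j_1&j_2&j_3\\-m_1&m_2&m_3\end{pmatrix},$$ and $I=0$ if $j_1+j_2+j_3$ is odd; * if $\alpha\ne\alpha'$, then $I=0$ if $j_1+j_2+j_3$ is even, and if $j_1+j_2+j_3$ is odd $$I=(-1)^{m_1+1}\sqrt{\frac{(2j_1+1)(2j_2+1)(2j_3+1)}{4\pi}}\begin{pmatrix}j_1&j_2&j_3\\1&-1&0\end{pmatrix}\begin{pmatrix}j_1&j_2&j_3\\-m_1&m_2&m_3\end{pmatrix}.$$ -/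

import Mathlib

open scoped BigOperators Nat ComplexConjugate

noncomputable section

namespace EMWaves

/-- Physical space, with its Euclidean norm. -/
abbrev Space := EuclideanSpace ℝ (Fin 3)

/-- The unit sphere of directions. -/
abbrev Dir := Metric.sphere (0 : Space) 1

/-- The surface measure `dΩ` on the unit sphere (total mass `4π`). -/
def solidAngle : MeasureTheory.Measure Dir :=
  (MeasureTheory.volume : MeasureTheory.Measure Space).toSphere

/-- The direction `r̂ = r / |r|` (and `0` for `r = 0`). -/
def direction (r : Space) : Space := ‖r‖⁻¹ • r

/-! ### Spherical harmonics, 3j symbols, vector spherical harmonics -/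

/-- `Y_{lm}` for `m ≥ 0` as a function of a unit vector `n = (n₀, n₁, n₂)`, with the Condon-Shortley
phase: `(-1)^m √((2l+1)/(4π) · (l-m)!/(l+m)!) (n₀ + i n₁)^m · (1/(2^l l!)) (d/dt)^{l+m} (t²-1)^l`
at `t = n₂ = cos θ`. Here `(n₀ + i n₁)^m = (sin θ)^m e^{imφ}`. -/
def sphericalHarmonicNat (l m : ℕ) (n : Space) : ℂ :=
  (-1 : ℂ) ^ m
    * ((Real.sqrt ((2 * (l : ℝ) + 1) / (4 * Real.pi) * (((l - m)! : ℕ) : ℝ) / (((l + m)! : ℕ) : ℝ))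
        : ℝ) : ℂ)
    * ((n 0 : ℂ) + Complex.I * (n 1 : ℂ)) ^ m
    * (((Polynomial.derivative^[l + m] ((Polynomial.X ^ 2 - 1) ^ l : Polynomial ℝ)).eval (n 2)
        / (2 ^ l * ((l ! : ℕ) : ℝ)) : ℝ) : ℂ)

/-- The spherical harmonic `Y_{lm}`, with `Y_{l,-m} = (-1)^m conj Y_{lm}`. -/
def sphericalHarmonic (l : ℕ) (m : ℤ) (n : Space) : ℂ :=
  if 0 ≤ m then sphericalHarmonicNat l m.natAbs n
  else (-1 : ℂ) ^ m.natAbs * conj (sphericalHarmonicNat l m.natAbs n)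

/-- The Wigner 3j symbol `(a b c; m₁ m₂ m₃)` for integer spins, through the Racah formula. -/
def threeJ (a b c : ℕ) (m₁ m₂ m₃ : ℤ) : ℝ :=
  if m₁ + m₂ + m₃ = 0 ∧ |m₁| ≤ (a : ℤ) ∧ |m₂| ≤ (b : ℤ) ∧ |m₃| ≤ (c : ℤ)
      ∧ c ≤ a + b ∧ a ≤ b + c ∧ b ≤ a + c then
    (-1 : ℝ) ^ ((a : ℤ) - b - m₃)
      * Real.sqrt ((((a + b - c)! * (a + c - b)! * (b + c - a)! : ℕ) : ℝ)
          / (((a + b + c + 1)! : ℕ) : ℝ))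
      * Real.sqrt (((((a : ℤ) + m₁).toNat ! * ((a : ℤ) - m₁).toNat !
          * (((b : ℤ) + m₂).toNat ! * ((b : ℤ) - m₂).toNat !)
          * (((c : ℤ) + m₃).toNat ! * ((c : ℤ) - m₃).toNat !) : ℕ)) : ℝ)
      * ∑ t ∈ Finset.range (a + b - c + 1),
          if 0 ≤ (c : ℤ) - b + t + m₁ ∧ 0 ≤ (c : ℤ) - a + t - m₂
              ∧ 0 ≤ (a : ℤ) - t - m₁ ∧ 0 ≤ (b : ℤ) - t + m₂ then
            (-1 : ℝ) ^ t
              / ((t ! * (a + b - c - t)!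
                  * (((c : ℤ) - b + t + m₁).toNat ! * ((c : ℤ) - a + t - m₂).toNat !)
                  * (((a : ℤ) - t - m₁).toNat ! * ((b : ℤ) - t + m₂).toNat !) : ℕ) : ℝ)
          else 0
  else 0

/-- The Clebsch-Gordan coefficient `⟨a m₁ b m₂ | j m⟩`. -/
def clebschGordan (a : ℕ) (m₁ : ℤ) (b : ℕ) (m₂ : ℤ) (j : ℕ) (m : ℤ) : ℝ :=
  (-1 : ℝ) ^ ((a : ℤ) - b + m) * Real.sqrt (2 * (j : ℝ) + 1) * threeJ a b j m₁ m₂ (-m)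

/-- The spherical basis `e_{±1} = ∓ (e_x ± i e_y)/√2`, `e_0 = e_z`. -/
def sphericalBasis (q : ℤ) : Fin 3 → ℂ :=
  if q = 1 then ![-1 / (Real.sqrt 2 : ℂ), -Complex.I / (Real.sqrt 2 : ℂ), 0]
  else if q = 0 then ![0, 0, 1]
  else if q = -1 then ![1 / (Real.sqrt 2 : ℂ), -Complex.I / (Real.sqrt 2 : ℂ), 0]
  else 0

/-- The vector spherical harmonic
`Y_{jlm} = ∑_q ⟨l (m-q) 1 q | j m⟩ Y_{l,m-q} e_q`. -/
def vectorHarmonic (j l : ℕ) (m : ℤ) (n : Space) (i : Fin 3) : ℂ :=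
  ∑ q ∈ Finset.Icc (-1 : ℤ) 1,
    (clebschGordan l (m - q) 1 q j m : ℂ) * sphericalHarmonic l (m - q) n * sphericalBasis q i

/-- The transverse harmonics: `Y^{(0)}_{jm} = Y_{j,j,m}` and
`Y^{(1)}_{jm} = √((j+1)/(2j+1)) Y_{j,j-1,m} + √(j/(2j+1)) Y_{j,j+1,m}` (used for `j ≥ 1`). -/
def transverseHarmonic (j : ℕ) (m : ℤ) (α : Fin 2) (n : Space) (i : Fin 3) : ℂ :=
  if α = 0 then vectorHarmonic j j m n i
  else
    (Real.sqrt (((j : ℝ) + 1) / (2 * (j : ℝ) + 1)) : ℂ) * vectorHarmonic j (j - 1) m n i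
      + (Real.sqrt ((j : ℝ) / (2 * (j : ℝ) + 1)) : ℂ) * vectorHarmonic j (j + 1) m n i

/-! ### Spherical Bessel and Hankel functions, spherical waves -/

/-- The spherical Bessel function
`j_l(x) = ∑_k (-1)^k x^{l+2k} / (2^k k! (2l+2k+1)!!)`. -/
def sphericalBessel (l : ℕ) (x : ℝ) : ℝ :=
  ∑' k : ℕ, (-1 : ℝ) ^ k * x ^ (l + 2 * k)
    / ((2 ^ k * k ! * Nat.doubleFactorial (2 * l + 2 * k + 1) : ℕ) : ℝ)

/-- The spherical Hankel function of the first kind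
`h_l^{(1)}(x) = (-i)^{l+1} (e^{ix}/x) ∑_{k=0}^{l} i^k (l+k)! / (k! (l-k)! (2x)^k)`. -/
def sphericalHankel (l : ℕ) (x : ℝ) : ℂ :=
  (-Complex.I) ^ (l + 1) * (Complex.exp (Complex.I * (x : ℂ)) / (x : ℂ))
    * ∑ k ∈ Finset.range (l + 1),
        Complex.I ^ k * (((l + k)! : ℕ) : ℂ)
          / (((k ! * (l - k)! : ℕ) : ℂ) * (2 * (x : ℂ)) ^ k)

/-- The labels `(l, m)` of scalar spherical harmonics: `|m| ≤ l`. -/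
structure ScalarIndex where
  l : ℕ
  m : ℤ
  abs_m_le : |m| ≤ (l : ℤ)

/-- The labels `(j, m, α)` of the transverse multipoles: `j ≥ 1`, `|m| ≤ j`, and
`α = 0` (TE) or `α = 1` (TM). -/
structure Mode where
  j : ℕ
  m : ℤ
  α : Fin 2
  one_le_j : 1 ≤ j
  abs_m_le : |m| ≤ (j : ℤ)

/-- The free vector spherical wave `|j l m⟩ = √(2ω²/π) j_l(ω r) Y_{jlm}(r̂)`. -/
def vectorWave (ω : ℝ) (j l : ℕ) (m : ℤ) (r : Space) (i : Fin 3) : ℂ :=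
  (Real.sqrt (2 * ω ^ 2 / Real.pi) : ℂ) * (sphericalBessel l (ω * ‖r‖) : ℂ)
    * vectorHarmonic j l m (direction r) i

/-- The TE wave `|j j m⟩` and the TM wave
`√((j+1)/(2j+1)) |j, j-1, m⟩ - √(j/(2j+1)) |j, j+1, m⟩`, as functions of the position `r`
relative to the centre of the wave. -/
def modeWave (ω : ℝ) (p : Mode) (r : Space) (i : Fin 3) : ℂ :=
  if p.α = 0 then vectorWave ω p.j p.j p.m r i
  else
    (Real.sqrt (((p.j : ℝ) + 1) / (2 * (p.j : ℝ) + 1)) : ℂ) * vectorWave ω p.j (p.j - 1) p.m r i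
      - (Real.sqrt ((p.j : ℝ) / (2 * (p.j : ℝ) + 1)) : ℂ) * vectorWave ω p.j (p.j + 1) p.m r i

/-! ### The propagator -/

/-- The scalar outgoing propagator `-e^{iω|z|}/(4π|z|)`. -/
def scalarPropagator (ω : ℝ) (z : Space) : ℂ :=
  -Complex.exp (Complex.I * (ω : ℂ) * (‖z‖ : ℂ)) / (4 * (Real.pi : ℂ) * (‖z‖ : ℂ))

/-- The partial derivative `∂_i f`. -/
def partialDeriv (i : Fin 3) (f : Space → ℂ) (z : Space) : ℂ :=
  fderiv ℝ f z (EuclideanSpace.single i 1)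

/-- The kernel at distinct points `x`, `y` of the electromagnetic propagator in the gauge `A⁰ = 0`,
`D₀(x, y)_{ik} = (δ_{ik} + ω⁻² ∂_i ∂_k) (-e^{iω|x-y|}/(4π|x-y|))`: the outgoing solution of
`∇ × ∇ × D₀ - ω² D₀ = -δ(x - y) 1`. -/
def emPropagator (ω : ℝ) (x y : Space) (i k : Fin 3) : ℂ :=
  (if i = k then scalarPropagator ω (x - y) else 0)
    + 1 / (ω : ℂ) ^ 2 * partialDeriv i (partialDeriv k (scalarPropagator ω)) (x - y)

/-! ### The expansion coefficients -/

/-- `∫ dΩ Y_{j₃m₃} (conj Y^{(α)}_{j₁m₁} · Y^{(α')}_{j₂m₂})`. -/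
def tripleIntegral (p q : Mode) (s : ScalarIndex) : ℂ :=
  ∫ n : Dir, sphericalHarmonic s.l s.m n
    * ∑ i, conj (transverseHarmonic p.j p.m p.α n i) * transverseHarmonic q.j q.m q.α n i
    ∂solidAngle

/-- `∫ dΩ conj Y_{l''m''} (Y^{(α)}_{jm} · conj Y^{(α')}_{j'm'})`. -/
def couplingIntegral (p q : Mode) (s : ScalarIndex) : ℂ :=
  ∫ n : Dir, conj (sphericalHarmonic s.l s.m n)
    * ∑ i, transverseHarmonic p.j p.m p.α n i * conj (transverseHarmonic q.j q.m q.α n i)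
    ∂solidAngle

/-- The `(l'', m'')` summand of the coefficient `C_{jmα;j'm'α'}`:
`i^{l''+j'-j+α-α'} h_{l''}^{(1)}(ω|a|) Y_{l''m''}(â) ∫ dΩ conj Y_{l''m''} (Y · conj Y')`. -/
def couplingTerm (ω : ℝ) (a : Space) (p q : Mode) (s : ScalarIndex) : ℂ :=
  Complex.I ^ ((s.l : ℤ) + q.j - p.j + ((p.α : ℕ) : ℤ) - ((q.α : ℕ) : ℤ))
    * sphericalHankel s.l (ω * ‖a‖) * sphericalHarmonic s.l s.m (direction a)
    * couplingIntegral p q s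

/-- The coefficient `C_{jmα;j'm'α'}` for `p = (j, m, α)` and `q = (j', m', α')`. -/
def coupling (ω : ℝ) (a : Space) (p q : Mode) : ℂ :=
  -(2 * Complex.I * (Real.pi : ℂ) ^ 2 / (ω : ℂ)) * ∑' s : ScalarIndex, couplingTerm ω a p q s

/-- The common factor `√((2j₁+1)(2j₂+1)(2j₃+1)/(4π))`. -/
def dimFactor (j₁ j₂ j₃ : ℕ) : ℝ :=
  Real.sqrt ((2 * (j₁ : ℝ) + 1) * (2 * (j₂ : ℝ) + 1) * (2 * (j₃ : ℝ) + 1) / (4 * Real.pi))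

/-- The closed form of the angular integral for equal polarisations. -/
def equalPolarisationValue (j₁ j₂ j₃ : ℕ) (m₁ m₂ m₃ : ℤ) : ℝ :=
  (-1 : ℝ) ^ m₁
    * (((j₁ : ℝ) * (j₁ + 1) + (j₂ : ℝ) * (j₂ + 1) - (j₃ : ℝ) * (j₃ + 1))
        / (2 * Real.sqrt ((j₁ : ℝ) * (j₁ + 1) * ((j₂ : ℝ) * (j₂ + 1)))))
    * dimFactor j₁ j₂ j₃ * threeJ j₁ j₂ j₃ 0 0 0 * threeJ j₁ j₂ j₃ (-m₁) m₂ m₃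

/-- The closed form of the angular integral for different polarisations, `j₁ + j₂ + j₃` odd. -/
def mixedPolarisationValue (j₁ j₂ j₃ : ℕ) (m₁ m₂ m₃ : ℤ) : ℝ :=
  (-1 : ℝ) ^ (m₁ + 1)
    * dimFactor j₁ j₂ j₃ * threeJ j₁ j₂ j₃ 1 (-1) 0 * threeJ j₁ j₂ j₃ (-m₁) m₂ m₃

end EMWaves

end

open EMWaves
open scoped ComplexConjugate

open scoped BigOperators Nat ComplexConjugate

noncomputable section

namespace EMWaves

open MeasureTheory

/-! ### The Racah sum -/

/-! The central object is the outgoing wave `outgoing ω r F` with a polynomial angular spectrum `F`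
on the sphere. Formally it is the plane wave integral ∫ e^{iω r·n} F(n) dΩ with each `j_l` replaced
by `h_l`. The Hankel functions obey the same recurrences as the Bessel functions, so the main
property of plane waves survives: differentiation along `w` multiplies the spectrum by iω w·n
(`hasDerivAt_outgoingPath`). Two facts follow. The propagator is, up to a constant, the outgoing
wave with spectrum δ_ik - n_i n_k (`emPropagator_eq`). Moving the point from `a` to `a + w`
multiplies the spectrum by the Taylor series of e^{iω w·n}, which converges for |w| < |a| because
the wave is holomorphic along the complex line a + t w for |t| |w| < |a| (`hasSum_outgoing_add`).

The tangential plane wave e^{iω v·n} (δ_ik - n_i n_k) expands, degree by degree in `v`, into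
multipole waves at `v` times conjugate transverse harmonics of `n` (`planeWave_mul_tangential`,
`hasSum_waveTerm`). Around P_A this writes the propagator through outgoing waves at y - P_A with
spectrum Y^(α)_jm. Around P_B it writes each of these through outgoing waves at `a` with spectrum
Y^(α) · conj Y^(α'), which are the coefficients of the theorem (`coupling_eq`). That is the iterated
series.

Convergence rests on growth estimates. A wave of degree `j` is of size y^j / (2^j j!), and the
coupling involves Hankel functions of order at most j + j' + 2, of size 2^L L! / x^(L+1) with x =
ω|a|. The product is a polynomial times the binomial term (j+j' choose j) (y/x)^j (y'/x)^j',
summable for y + y' < x (`summable_majorant`). The double series then agrees with the iterated one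
by Fubini.

The angular part uses infinitesimal rotations about two axes only. A vector multiplet is determined
on the sphere by its value at the pole (`IsVectorMultiplet.eq_zero_of_pole`), so each identity
between vector harmonics reduces to a few Clebsch-Gordan coefficients ⟨l 0 1 m | j m⟩. The integral
of a product of three multiplets is an invariant tensor, such tensors are multiples of the 3j symbol
(`IsInvariantTensor.eq_threeJ`), and the multiple is again read off at the pole
(`IsTripleMultiplet.integral_eq`). The Racah formula serves to establish the ladder relations, the
normalisation and these special values. -/

/-- `1 / k!`, extended by zero to negative integers. -/
def invFact (k : ℤ) : ℝ := if 0 ≤ k then 1 / ((k.toNat ! : ℕ) : ℝ) else 0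

lemma invFact_of_neg {k : ℤ} (h : k < 0) : invFact k = 0 := by
  simp [invFact, not_le.mpr h]

lemma invFact_natCast (k : ℕ) : invFact (k : ℤ) = 1 / ((k ! : ℕ) : ℝ) := by
  simp [invFact]

lemma mul_invFact (k : ℤ) : (k : ℝ) * invFact k = invFact (k - 1) := by
  rcases lt_trichotomy k 0 with h | h | h
  · rw [invFact_of_neg h, invFact_of_neg (by omega), mul_zero]
  · subst h; rw [invFact_of_neg (k := 0 - 1) (by omega)]; simp
  · obtain ⟨n, rfl⟩ : ∃ n : ℕ, k = (n : ℤ) + 1 := ⟨(k - 1).toNat, by omega⟩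
    have : ((n : ℤ) + 1 - 1) = (n : ℤ) := by ring
    rw [this, invFact_natCast, show ((n : ℤ) + 1) = ((n + 1 : ℕ) : ℤ) by push_cast; ring,
      invFact_natCast, Nat.factorial_succ]
    have : ((n ! : ℕ) : ℝ) ≠ 0 := by positivity
    have : ((n : ℝ) + 1) ≠ 0 := by positivity
    push_cast
    field_simp

/-- The alternating sum in the Racah formula. -/
def racahSum (n : ℕ) (α β γ δ : ℤ) : ℝ :=
  ∑ t ∈ Finset.range (n + 1), (-1 : ℝ) ^ t * (invFact t * invFact (n - t)
    * (invFact (α + t) * invFact (γ + t)) * (invFact (β - t) * invFact (δ - t)))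

/-- Summation by parts: `U` is a certificate for which the t-th term of the combination is (-1)^t (U
t + U (t-1)), so the sum collapses to its last value. `U` vanishes at t = -1 and at t = n because of
the reciprocal factorials. This is the whole combinatorial content of the raising relation for 3j
symbols. -/
lemma racahSum_raise (n : ℕ) (α β γ δ : ℤ) :
    (n + α + 1 : ℝ) * racahSum n (α + 1) (β - 1) γ δ
      + (δ + 1 : ℝ) * racahSum n α β (γ - 1) (δ + 1)
      - (γ + β : ℝ) * racahSum n α β γ δ = 0 := by
  set U : ℤ → ℝ := fun t => invFact t * invFact (n - t - 1)
    * (invFact (α + t + 1) * invFact (γ + t)) * (invFact (β - t - 1) * invFact (δ - t)) with hU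
  have tele : ∀ N : ℕ, ∑ t ∈ Finset.range (N + 1), (-1 : ℝ) ^ t * (U t + U ((t : ℤ) - 1))
      = (-1 : ℝ) ^ N * U N := by
    intro N
    induction N with
    | zero =>
      have : U ((0 : ℕ) - 1) = 0 := by simp [hU, invFact_of_neg]
      simp only [zero_add, Finset.range_one, Finset.sum_singleton, pow_zero, this]; simp
    | succ N ih =>
      rw [Finset.sum_range_succ, ih]
      have : (((N + 1 : ℕ) : ℤ) - 1) = N := by push_cast; ring
      rw [this, pow_succ]; ring
  have hUn : U n = 0 := by
    have : ((n : ℤ) - n - 1) < 0 := by omega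
    simp only [hU]
    rw [invFact_of_neg this]; ring
  have key : ∀ t : ℕ,
      (n + α + 1 : ℝ) * ((-1 : ℝ) ^ t * (invFact t * invFact (n - t)
        * (invFact (α + 1 + t) * invFact (γ + t)) * (invFact (β - 1 - t) * invFact (δ - t))))
      + (δ + 1 : ℝ) * ((-1 : ℝ) ^ t * (invFact t * invFact (n - t)
        * (invFact (α + t) * invFact (γ - 1 + t)) * (invFact (β - t) * invFact (δ + 1 - t))))
      - (γ + β : ℝ) * ((-1 : ℝ) ^ t * (invFact t * invFact (n - t)
        * (invFact (α + t) * invFact (γ + t)) * (invFact (β - t) * invFact (δ - t))))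
      = (-1 : ℝ) ^ t * (U t + U ((t : ℤ) - 1)) := by
    intro t
    have h1 := mul_invFact ((n : ℤ) - t)
    have h2 := mul_invFact (α + t + 1)
    have h3 := mul_invFact (t : ℤ)
    have h4 := mul_invFact (δ + 1 - t)
    have h5 := mul_invFact (γ + t)
    have h6 := mul_invFact (β - t)
    simp only [hU]
    have e1 : (n : ℤ) - (t - 1) - 1 = n - t := by ring
    have e2 : α + ((t : ℤ) - 1) + 1 = α + t := by ring
    have e3 : γ + ((t : ℤ) - 1) = γ + t - 1 := by ring
    have e4 : β - ((t : ℤ) - 1) - 1 = β - t := by ring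
    have e5 : δ - ((t : ℤ) - 1) = δ + 1 - t := by ring
    have e6 : α + 1 + (t : ℤ) = α + t + 1 := by ring
    have e7 : β - 1 - (t : ℤ) = β - t - 1 := by ring
    have e8 : γ - 1 + (t : ℤ) = γ + t - 1 := by ring
    rw [e1, e2, e3, e4, e5, e6, e7, e8]
    rw [show α + (t : ℤ) + 1 - 1 = α + t by ring] at h2
    rw [show δ + 1 - (t : ℤ) - 1 = δ - t by ring] at h4
    push_cast at h1 h2 h3 h4 h5 h6
    rw [← h1, ← h3, ← h5, ← h6, ← h2, ← h4]
    ring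
  unfold racahSum
  rw [Finset.mul_sum, Finset.mul_sum, Finset.mul_sum, ← Finset.sum_add_distrib,
    ← Finset.sum_sub_distrib, Finset.sum_congr rfl (fun t _ => key t), tele, hUn, mul_zero]

/-- The substitution t ↦ n - t. On the parameters of a 3j symbol it realises the reversal of all
projections. -/
lemma racahSum_reflect (n : ℕ) (α β γ δ : ℤ) :
    racahSum n (β - n) (α + n) (δ - n) (γ + n) = (-1 : ℝ) ^ n * racahSum n α β γ δ := by
  unfold racahSum
  rw [← Finset.sum_range_reflect, Finset.mul_sum]
  refine Finset.sum_congr rfl fun t ht => ?_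
  have ht' : t ≤ n := by simpa [Nat.lt_succ_iff] using ht
  have e : n + 1 - 1 - t = n - t := by omega
  rw [e]
  have e0 : ((n - t : ℕ) : ℤ) = n - t := by omega
  have hs : (-1 : ℝ) ^ (n - t) = (-1) ^ n * (-1) ^ t := by
    have : (-1 : ℝ) ^ n = (-1) ^ (n - t) * (-1) ^ t := by rw [← pow_add]; congr 1; omega
    rw [this, mul_assoc, ← pow_add, ← two_mul, pow_mul]; simp
  rw [e0, hs, show β - (n : ℤ) + (n - t) = β - t by ring, show (n : ℤ) - (n - t) = t by ring,
    show α + (n : ℤ) - (n - t) = α + t by ring, show δ - (n : ℤ) + (n - t) = δ - t by ring,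
    show γ + (n : ℤ) - (n - t) = γ + t by ring]
  ring

/-- `√((l+m)! (l-m)!)`. -/
def ladderWeight (l : ℕ) (m : ℤ) : ℝ :=
  Real.sqrt ((((l : ℤ) + m).toNat ! * ((l : ℤ) - m).toNat ! : ℕ) : ℝ)

lemma ladderWeight_pos (l : ℕ) (m : ℤ) : 0 < ladderWeight l m :=
  Real.sqrt_pos.mpr (by positivity)

lemma ladderWeight_neg (l : ℕ) (m : ℤ) : ladderWeight l (-m) = ladderWeight l m := by
  unfold ladderWeight
  rw [show (l : ℤ) + -m = l - m by ring, show (l : ℤ) - -m = l + m by ring, mul_comm]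

/-- The matrix element `√((l-m)(l+m+1))` of the ladder operators. -/
def ladder (l : ℕ) (m : ℤ) : ℝ := Real.sqrt (((l : ℝ) - m) * (l + m + 1))

lemma ladder_eq_zero_of_le {l : ℕ} {m : ℤ} (h : (l : ℤ) ≤ m) : ladder l m = 0 := by
  apply Real.sqrt_eq_zero_of_nonpos
  have : (l : ℝ) ≤ m := by exact_mod_cast h
  have : (0 : ℝ) ≤ l := by positivity
  nlinarith

lemma ladder_eq_zero_of_lt {l : ℕ} {m : ℤ} (h : m < -(l : ℤ)) : ladder l m = 0 := by
  apply Real.sqrt_eq_zero_of_nonpos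
  have : (m : ℝ) + 1 ≤ -l := by exact_mod_cast h
  have : (0 : ℝ) ≤ l := by positivity
  nlinarith

lemma ladder_pos {l : ℕ} {m : ℤ} (h1 : -(l : ℤ) ≤ m) (h2 : m < l) : 0 < ladder l m := by
  apply Real.sqrt_pos.mpr
  have : (m : ℝ) < l := by exact_mod_cast h2
  have : -(l : ℝ) ≤ m := by exact_mod_cast h1
  apply mul_pos <;> linarith

lemma ladder_neg (l : ℕ) (m : ℤ) : ladder l (-m) = ladder l (m - 1) := by
  unfold ladder
  congr 1
  push_cast
  ring

lemma ladder_mul_ladderWeight {l : ℕ} {m : ℤ} (h1 : -(l : ℤ) ≤ m) (h2 : m < l) :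
    ladder l m * ladderWeight l (m + 1) = (l + m + 1) * ladderWeight l m := by
  have a1 : (l : ℝ) + m + 1 ≥ 0 := by
    have : -(l : ℝ) ≤ m := by exact_mod_cast h1
    linarith
  have a2 : (0 : ℝ) ≤ ((l : ℝ) - m) * (l + m + 1) := by
    have : (m : ℝ) < l := by exact_mod_cast h2
    apply mul_nonneg <;> linarith
  unfold ladder ladderWeight
  rw [← Real.sqrt_mul a2]
  nth_rewrite 2 [← Real.sqrt_sq a1]
  rw [← Real.sqrt_mul (sq_nonneg _)]
  congr 1
  obtain ⟨p, hp⟩ : ∃ p : ℕ, (l : ℤ) + m = p := ⟨((l : ℤ) + m).toNat, by omega⟩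
  obtain ⟨q, hq⟩ : ∃ q : ℕ, (l : ℤ) - m = (q : ℤ) + 1 := ⟨((l : ℤ) - m - 1).toNat, by omega⟩
  rw [show (l : ℤ) + (m + 1) = ((p + 1 : ℕ) : ℤ) by push_cast; omega,
    show (l : ℤ) - (m + 1) = (q : ℤ) by omega, hp,
    show (l : ℤ) - m = ((q + 1 : ℕ) : ℤ) by push_cast; omega]
  simp only [Int.toNat_natCast, Nat.factorial_succ]
  have hp' : (l : ℝ) + m = p := by exact_mod_cast hp
  have hq' : (l : ℝ) - m = q + 1 := by exact_mod_cast hq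
  rw [hq', hp']
  push_cast
  ring

/-! ### The 3j symbols -/

/-- The selection rules of the 3j symbol. -/
def ThreeJAdm (a b c : ℕ) (m₁ m₂ m₃ : ℤ) : Prop :=
  m₁ + m₂ + m₃ = 0 ∧ |m₁| ≤ (a : ℤ) ∧ |m₂| ≤ (b : ℤ) ∧ |m₃| ≤ (c : ℤ)
      ∧ c ≤ a + b ∧ a ≤ b + c ∧ b ≤ a + c

/-- The triangle coefficient. -/
def triangleCoeff (a b c : ℕ) : ℝ :=
  Real.sqrt ((((a + b - c)! * (a + c - b)! * (b + c - a)! : ℕ) : ℝ)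
          / (((a + b + c + 1)! : ℕ) : ℝ))

lemma triangleCoeff_pos (a b c : ℕ) : 0 < triangleCoeff a b c :=
  Real.sqrt_pos.mpr (by positivity)

lemma threeJ_of_not {a b c : ℕ} {m₁ m₂ m₃ : ℤ} (h : ¬ ThreeJAdm a b c m₁ m₂ m₃) :
    threeJ a b c m₁ m₂ m₃ = 0 := by
  unfold threeJ
  exact if_neg h

/-- The guard inside the Racah sum disappears because a term with a negative argument contains a
vanishing `invFact`. In this form the recurrences can be proved without range conditions on the
summation index. -/
lemma threeJ_of {a b c : ℕ} {m₁ m₂ m₃ : ℤ} (h : ThreeJAdm a b c m₁ m₂ m₃) :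
    threeJ a b c m₁ m₂ m₃ = (-1 : ℝ) ^ ((a : ℤ) - b - m₃) * triangleCoeff a b c
      * (ladderWeight a m₁ * ladderWeight b m₂ * ladderWeight c m₃)
      * racahSum (a + b - c) (c - b + m₁) (a - m₁) (c - a - m₂) (b + m₂) := by
  unfold threeJ
  unfold ThreeJAdm at h
  rw [if_pos h]
  have hw : Real.sqrt (((((a : ℤ) + m₁).toNat ! * ((a : ℤ) - m₁).toNat !
          * (((b : ℤ) + m₂).toNat ! * ((b : ℤ) - m₂).toNat !)
          * (((c : ℤ) + m₃).toNat ! * ((c : ℤ) - m₃).toNat !) : ℕ)) : ℝ)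
      = ladderWeight a m₁ * ladderWeight b m₂ * ladderWeight c m₃ := by
    unfold ladderWeight
    rw [← Real.sqrt_mul (by positivity), ← Real.sqrt_mul (by positivity)]
    congr 1; push_cast; ring
  rw [hw]
  unfold triangleCoeff racahSum
  congr 1
  refine Finset.sum_congr rfl fun t ht => ?_
  have ht' : t ≤ a + b - c := by simpa [Nat.lt_succ_iff] using ht
  have e1 : invFact t = 1 / ((t ! : ℕ) : ℝ) := invFact_natCast t
  have e2 : invFact (((a + b - c : ℕ) : ℤ) - t) = 1 / (((a + b - c - t)! : ℕ) : ℝ) := by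
    rw [← invFact_natCast]; congr 1; omega
  rw [e1, e2]
  split_ifs with hc
  · obtain ⟨h1, h2, h3, h4⟩ := hc
    rw [show (c : ℤ) - b + m₁ + t = c - b + t + m₁ by ring,
      show (a : ℤ) - m₁ - t = a - t - m₁ by ring,
      show (c : ℤ) - a - m₂ + t = c - a + t - m₂ by ring,
      show (b : ℤ) + m₂ - t = b - t + m₂ by ring]
    simp only [invFact, if_pos h1, if_pos h2, if_pos h3, if_pos h4]
    push_cast
    field_simp
  · have : invFact ((c : ℤ) - b + m₁ + t) = 0 ∨ invFact ((c : ℤ) - a - m₂ + t) = 0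
        ∨ invFact ((a : ℤ) - m₁ - t) = 0 ∨ invFact ((b : ℤ) + m₂ - t) = 0 := by
      by_contra hne
      push Not at hne
      obtain ⟨n1, n2, n3, n4⟩ := hne
      apply hc
      refine ⟨?_, ?_, ?_, ?_⟩ <;> by_contra hlt <;> push Not at hlt
      · exact n1 (invFact_of_neg (by omega))
      · exact n2 (invFact_of_neg (by omega))
      · exact n3 (invFact_of_neg (by omega))
      · exact n4 (invFact_of_neg (by omega))
    rcases this with h | h | h | h <;> rw [h] <;> ring

/-- Reversal of the Racah sum; its sign (-1)^(a+b-c) equals (-1)^(a+b+c). -/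
lemma threeJ_neg (a b c : ℕ) (m₁ m₂ m₃ : ℤ) :
    threeJ a b c (-m₁) (-m₂) (-m₃) = (-1 : ℝ) ^ (a + b + c) * threeJ a b c m₁ m₂ m₃ := by
  by_cases h : ThreeJAdm a b c m₁ m₂ m₃
  · have h' : ThreeJAdm a b c (-m₁) (-m₂) (-m₃) := by
      obtain ⟨h0, h1, h2, h3, h4⟩ := h
      refine ⟨by omega, ?_, ?_, ?_, h4⟩ <;> rwa [abs_neg]
    rw [threeJ_of h, threeJ_of h', ladderWeight_neg, ladderWeight_neg, ladderWeight_neg]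
    obtain ⟨-, -, -, -, h4, -⟩ := h
    set n := a + b - c with hn
    have hn' : (n : ℤ) = a + b - c := by omega
    have := racahSum_reflect n ((c : ℤ) - b + m₁) (a - m₁) (c - a - m₂) (b + m₂)
    rw [show (a : ℤ) - m₁ - n = c - b + -m₁ by omega, show (c : ℤ) - b + m₁ + n = a - -m₁ by omega,
      show (b : ℤ) + m₂ - n = c - a - -m₂ by omega,
      show (c : ℤ) - a - m₂ + n = b + -m₂ by omega] at this
    rw [this]
    have s1 : (-1 : ℝ) ^ ((a : ℤ) - b - -m₃) = (-1 : ℝ) ^ ((a : ℤ) - b - m₃) := by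
      rw [show (a : ℤ) - b - -m₃ = (a - b - m₃) + 2 * m₃ by ring, zpow_add₀ (by norm_num),
        zpow_mul]
      norm_num
    have s2 : (-1 : ℝ) ^ (a + b + c) = (-1) ^ n := by
      rw [show a + b + c = n + 2 * c by omega, pow_add, pow_mul]; norm_num
    rw [s1, s2]; ring
  · rw [threeJ_of_not h, threeJ_of_not, mul_zero]
    rintro ⟨h0, h1, h2, h3, h4⟩
    rw [abs_neg] at h1 h2 h3
    exact h ⟨by omega, h1, h2, h3, h4⟩

/-- The 3j symbol is annihilated by the total raising operator. Once the common prefactor `P` is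
extracted, `ladder_mul_ladderWeight` turns the square roots into linear factors and the relation
becomes `racahSum_raise`. -/
lemma threeJ_raise (a b c : ℕ) {m₁ m₂ m₃ : ℤ} (h : m₁ + m₂ + m₃ = -1) :
    ladder a m₁ * threeJ a b c (m₁ + 1) m₂ m₃ + ladder b m₂ * threeJ a b c m₁ (m₂ + 1) m₃
      + ladder c m₃ * threeJ a b c m₁ m₂ (m₃ + 1) = 0 := by
  by_cases htri : c ≤ a + b ∧ a ≤ b + c ∧ b ≤ a + c
  swap
  · have : ∀ x y z, threeJ a b c x y z = 0 := fun x y z =>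
      threeJ_of_not fun hh => htri hh.2.2.2.2
    simp [this]
  have out : ∀ x y z, (¬ |x| ≤ (a : ℤ) ∨ ¬ |y| ≤ (b : ℤ) ∨ ¬ |z| ≤ (c : ℤ)) →
      threeJ a b c x y z = 0 := by
    rintro x y z hx
    refine threeJ_of_not fun ⟨_, h1, h2, h3, _⟩ => ?_
    rcases hx with hx | hx | hx <;> contradiction
  by_cases hr : |m₁| ≤ (a : ℤ) ∧ |m₂| ≤ (b : ℤ) ∧ |m₃| ≤ (c : ℤ)
  swap
  -- If some |mᵢ| exceeds its spin, the two terms that keep this mᵢ vanish by the selection rules.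
  -- The third, in which mᵢ + 1 may be admissible, is killed by its ladder coefficient.
  · have lz : ∀ (l : ℕ) (m : ℤ), ¬ |m| ≤ (l : ℤ) → ladder l m = 0 := by
      intro l m hm
      rw [abs_le] at hm
      by_cases h1 : m < -(l : ℤ)
      · exact ladder_eq_zero_of_lt h1
      · exact ladder_eq_zero_of_le (by omega)
    have : ¬ |m₁| ≤ (a : ℤ) ∨ ¬ |m₂| ≤ (b : ℤ) ∨ ¬ |m₃| ≤ (c : ℤ) := by tauto
    rcases this with hx | hx | hx
    · rw [lz _ _ hx, out m₁ _ _ (Or.inl hx), out m₁ _ _ (Or.inl hx)]; ring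
    · rw [lz _ _ hx, out _ m₂ _ (Or.inr (Or.inl hx)), out _ m₂ _ (Or.inr (Or.inl hx))]; ring
    · rw [lz _ _ hx, out _ _ m₃ (Or.inr (Or.inr hx)), out _ _ m₃ (Or.inr (Or.inr hx))]; ring
  obtain ⟨r1, r2, r3⟩ := hr
  have q1 := abs_le.mp r1
  have q2 := abs_le.mp r2
  have q3 := abs_le.mp r3
  set n := a + b - c with hn
  have hn' : (n : ℤ) = a + b - c := by omega
  have hnr : (n : ℝ) = a + b - c := by exact_mod_cast hn'
  set P := (-1 : ℝ) ^ ((a : ℤ) - b - m₃) * triangleCoeff a b c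
      * (ladderWeight a m₁ * ladderWeight b m₂ * ladderWeight c m₃) with hP
  have t1 : ladder a m₁ * threeJ a b c (m₁ + 1) m₂ m₃ = P * ((a + m₁ + 1)
      * racahSum n (c - b + m₁ + 1) (a - m₁ - 1) (c - a - m₂) (b + m₂)) := by
    rcases lt_or_ge m₁ (a : ℤ) with hlt | hge
    · rw [threeJ_of ⟨by omega, abs_le.mpr ⟨by omega, by omega⟩, r2, r3, htri⟩, ← hn, hP,
        show (c : ℤ) - b + (m₁ + 1) = c - b + m₁ + 1 by ring,
        show (a : ℤ) - (m₁ + 1) = a - m₁ - 1 by ring]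
      linear_combination ((-1 : ℝ) ^ ((a : ℤ) - b - m₃) * triangleCoeff a b c * ladderWeight b m₂
        * ladderWeight c m₃ * racahSum n (c - b + m₁ + 1) (a - m₁ - 1) (c - a - m₂) (b + m₂))
        * ladder_mul_ladderWeight (l := a) (m := m₁) (by omega) hlt
    -- At the top of the multiplet the ladder coefficient vanishes. The Racah sum with the raised
    -- parameter vanishes too, so the formula with prefactor `P` needs no exception.
    · have : racahSum n (c - b + m₁ + 1) (a - m₁ - 1) (c - a - m₂) (b + m₂) = 0 := by
        refine Finset.sum_eq_zero fun t _ => ?_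
        rw [invFact_of_neg (k := (a : ℤ) - m₁ - 1 - t) (by omega)]; ring
      rw [ladder_eq_zero_of_le hge, this]; ring
  have t2 : ladder b m₂ * threeJ a b c m₁ (m₂ + 1) m₃ = P * ((b + m₂ + 1)
      * racahSum n (c - b + m₁) (a - m₁) (c - a - m₂ - 1) (b + m₂ + 1)) := by
    rcases lt_or_ge m₂ (b : ℤ) with hlt | hge
    · rw [threeJ_of ⟨by omega, r1, abs_le.mpr ⟨by omega, by omega⟩, r3, htri⟩, ← hn, hP,
        show (c : ℤ) - a - (m₂ + 1) = c - a - m₂ - 1 by ring,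
        show (b : ℤ) + (m₂ + 1) = b + m₂ + 1 by ring]
      linear_combination ((-1 : ℝ) ^ ((a : ℤ) - b - m₃) * triangleCoeff a b c * ladderWeight a m₁
        * ladderWeight c m₃ * racahSum n (c - b + m₁) (a - m₁) (c - a - m₂ - 1) (b + m₂ + 1))
        * ladder_mul_ladderWeight (l := b) (m := m₂) (by omega) hlt
    · have : racahSum n (c - b + m₁) (a - m₁) (c - a - m₂ - 1) (b + m₂ + 1) = 0 := by
        refine Finset.sum_eq_zero fun t ht => ?_
        have ht' : t ≤ n := by simpa [Nat.lt_succ_iff] using ht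
        rw [invFact_of_neg (k := (c : ℤ) - a - m₂ - 1 + t) (by omega)]; ring
      rw [ladder_eq_zero_of_le hge, this]; ring
  have t3 : ladder c m₃ * threeJ a b c m₁ m₂ (m₃ + 1) = - (P * ((c + m₃ + 1)
      * racahSum n (c - b + m₁) (a - m₁) (c - a - m₂) (b + m₂))) := by
    rcases lt_or_ge m₃ (c : ℤ) with hlt | hge
    · have hs : (-1 : ℝ) ^ ((a : ℤ) - b - (m₃ + 1)) = - (-1 : ℝ) ^ ((a : ℤ) - b - m₃) := by
        rw [show (a : ℤ) - b - (m₃ + 1) = (a - b - m₃) - 1 by ring, zpow_sub₀ (by norm_num)]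
        norm_num [div_neg]
      rw [threeJ_of ⟨by omega, r1, r2, abs_le.mpr ⟨by omega, by omega⟩, htri⟩, ← hn, hP, hs]
      linear_combination (-(-1 : ℝ) ^ ((a : ℤ) - b - m₃) * triangleCoeff a b c * ladderWeight a m₁
        * ladderWeight b m₂ * racahSum n (c - b + m₁) (a - m₁) (c - a - m₂) (b + m₂))
        * ladder_mul_ladderWeight (l := c) (m := m₃) (by omega) hlt
    · have : racahSum n (c - b + m₁) (a - m₁) (c - a - m₂) (b + m₂) = 0 := by
        refine Finset.sum_eq_zero fun t ht => ?_
        by_cases hh : (c : ℤ) - b + m₁ + t < 0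
        · rw [invFact_of_neg hh]; ring
        · rw [invFact_of_neg (k := (b : ℤ) + m₂ - t) (by omega)]; ring
      rw [ladder_eq_zero_of_le hge, this]; ring
  have h' : (m₁ : ℝ) + m₂ + m₃ = -1 := by exact_mod_cast h
  have key := racahSum_raise n ((c : ℤ) - b + m₁) (a - m₁) (c - a - m₂) (b + m₂)
  rw [t1, t2, t3]
  push_cast at key
  -- The coefficient γ + β of the Racah recurrence is c - m₁ - m₂, which is c + m₃ + 1 on the plane
  -- m₁ + m₂ + m₃ = -1.
  rw [hnr, show (c : ℝ) + m₃ + 1 = c - m₁ - m₂ by linarith] at *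
  linear_combination P * key

lemma threeJ_lower (a b c : ℕ) {m₁ m₂ m₃ : ℤ} (h : m₁ + m₂ + m₃ = 1) :
    ladder a (m₁ - 1) * threeJ a b c (m₁ - 1) m₂ m₃
      + ladder b (m₂ - 1) * threeJ a b c m₁ (m₂ - 1) m₃
      + ladder c (m₃ - 1) * threeJ a b c m₁ m₂ (m₃ - 1) = 0 := by
  have := threeJ_raise a b c (m₁ := -m₁) (m₂ := -m₂) (m₃ := -m₃) (by omega)
  rw [show -m₁ + 1 = -(m₁ - 1) by ring, show -m₂ + 1 = -(m₂ - 1) by ring,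
    show -m₃ + 1 = -(m₃ - 1) by ring, threeJ_neg, threeJ_neg, threeJ_neg, ladder_neg, ladder_neg,
    ladder_neg] at this
  have hne : (-1 : ℝ) ^ (a + b + c) ≠ 0 := by positivity
  apply mul_left_cancel₀ hne
  linear_combination this

lemma threeJ_zero_of_odd {a b c : ℕ} (h : Odd (a + b + c)) : threeJ a b c 0 0 0 = 0 := by
  have := threeJ_neg a b c 0 0 0
  rw [h.neg_one_pow] at this
  simp only [neg_zero] at this
  linarith

/-- The Casimir relation between the 3j symbols `(0 0 0)`, `(1 -1 0)` and `(-1 1 0)`. -/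
lemma threeJ_casimir (a b c : ℕ) :
    Real.sqrt ((a : ℝ) * (a + 1)) * Real.sqrt ((b : ℝ) * (b + 1))
        * (threeJ a b c 1 (-1) 0 + threeJ a b c (-1) 1 0)
      = ((c : ℝ) * (c + 1) - a * (a + 1) - b * (b + 1)) * threeJ a b c 0 0 0 := by
  have L0 : ∀ l : ℕ, ladder l 0 = Real.sqrt ((l : ℝ) * (l + 1)) := by
    intro l; simp [ladder]
  have L1 : ∀ l : ℕ, ladder l (-1) = Real.sqrt ((l : ℝ) * (l + 1)) := by
    intro l; unfold ladder; congr 1; push_cast; ring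
  have S : ∀ l : ℕ, Real.sqrt ((l : ℝ) * (l + 1)) * Real.sqrt ((l : ℝ) * (l + 1)) = l * (l + 1) :=
    fun l => Real.mul_self_sqrt (by positivity)
  -- Three ladder relations around the symbol (0 0 0). Eliminating (1 0 -1) and (0 1 -1) between
  -- them expresses that J₃² - J₁² - J₂² acts as 2 J₁·J₂ on an invariant tensor.
  have r := threeJ_raise a b c (m₁ := 0) (m₂ := 0) (m₃ := -1) (by norm_num)
  have s1 := threeJ_lower a b c (m₁ := 1) (m₂ := 0) (m₃ := 0) (by norm_num)
  have s2 := threeJ_lower a b c (m₁ := 0) (m₂ := 1) (m₃ := 0) (by norm_num)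
  norm_num at r s1 s2
  simp only [L0, L1] at r s1 s2
  set A := Real.sqrt ((a : ℝ) * (a + 1))
  set B := Real.sqrt ((b : ℝ) * (b + 1))
  set C := Real.sqrt ((c : ℝ) * (c + 1))
  linear_combination A * s1 + B * s2 - C * r + threeJ a b c 0 0 0 * (S c - S a - S b)

/-! ### Sum rules for the 3j symbols -/

/-- Summation over a multiplet can be shifted by one when the summand carries a ladder coefficient,
since the latter vanishes at `l` and at `-l - 1`. Every adjointness argument for ladder operators
below uses this. -/
lemma sum_Icc_shift {M : Type*} [AddCommMonoid M] (l : ℕ) (G : ℤ → M) (h1 : G l = 0)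
    (h2 : G (-(l : ℤ) - 1) = 0) :
    ∑ m ∈ Finset.Icc (-(l : ℤ)) l, G m = ∑ m ∈ Finset.Icc (-(l : ℤ)) l, G (m - 1) := by
  have e : ∑ m ∈ Finset.Icc (-(l : ℤ)) l, G (m - 1)
      = ∑ m ∈ Finset.Icc (-(l : ℤ) - 1) (l - 1), G m := by
    refine Finset.sum_nbij' (fun m => m - 1) (fun m => m + 1) ?_ ?_ ?_ ?_ ?_
    · intro m hm; simp only [Finset.mem_Icc] at *; omega
    · intro m hm; simp only [Finset.mem_Icc] at *; omega
    · intro m _; ring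
    · intro m _; ring
    · intro m _; rfl
  rw [e]
  have s1 : ∑ m ∈ Finset.Icc (-(l : ℤ)) l, G m = ∑ m ∈ Finset.Icc (-(l : ℤ) - 1) l, G m := by
    refine Finset.sum_subset ?_ ?_
    · intro m hm; simp only [Finset.mem_Icc] at *; omega
    · intro m hm hm'
      simp only [Finset.mem_Icc] at *
      rw [show m = -(l : ℤ) - 1 by omega, h2]
  have s2 : ∑ m ∈ Finset.Icc (-(l : ℤ) - 1) (l - 1), G m
      = ∑ m ∈ Finset.Icc (-(l : ℤ) - 1) l, G m := by
    refine Finset.sum_subset ?_ ?_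
    · intro m hm; simp only [Finset.mem_Icc] at *; omega
    · intro m hm hm'
      simp only [Finset.mem_Icc] at *
      rw [show m = l by omega, h1]
  rw [s1, s2]

lemma ladder_self (l : ℕ) : ladder l l = 0 := ladder_eq_zero_of_le le_rfl

lemma ladder_bot (l : ℕ) : ladder l (-(l : ℤ) - 1) = 0 := ladder_eq_zero_of_lt (by omega)

/-- `∑_{m₁ m₂}` of the product of two 3j symbols with the same third projection. -/
def threeJGram (a b c c' : ℕ) (m : ℤ) : ℝ :=
  ∑ m₁ ∈ Finset.Icc (-(a : ℤ)) a, ∑ m₂ ∈ Finset.Icc (-(b : ℤ)) b,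
    threeJ a b c m₁ m₂ m * threeJ a b c' m₁ m₂ m

lemma threeJ_eq_zero_of_sum {a b c : ℕ} {m₁ m₂ m₃ : ℤ} (h : m₁ + m₂ + m₃ ≠ 0) :
    threeJ a b c m₁ m₂ m₃ = 0 := threeJ_of_not fun hh => h hh.1

/-- Adjointness of raising and lowering. The raising relation for the second symbol and the lowering
relation for the first move the operator from the third index to the first two; both sides become
the same double sum up to an index shift. -/
lemma threeJGram_step (a b c c' : ℕ) (m : ℤ) :
    ladder c' m * threeJGram a b c c' (m + 1) = ladder c m * threeJGram a b c c' m := by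
  set X := threeJ a b c with hX
  set X' := threeJ a b c' with hX'
  set G : ℤ → ℤ → ℝ := fun m₁ m₂ => ladder a m₁ * (X m₁ m₂ (m + 1) * X' (m₁ + 1) m₂ m) with hG
  set H : ℤ → ℤ → ℝ := fun m₁ m₂ => ladder b m₂ * (X m₁ m₂ (m + 1) * X' m₁ (m₂ + 1) m) with hH
  have e1 : ∀ m₁ m₂, ladder c' m * (X m₁ m₂ (m + 1) * X' m₁ m₂ (m + 1))
      = -(G m₁ m₂ + H m₁ m₂) := by
    intro m₁ m₂
    by_cases h : m₁ + m₂ + m = -1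
    · have := threeJ_raise a b c' h
      simp only [hG, hH, hX, hX']
      linear_combination (threeJ a b c m₁ m₂ (m + 1)) * this
    · have : X m₁ m₂ (m + 1) = 0 := threeJ_eq_zero_of_sum (by omega)
      simp [hG, hH, this]
  have e2 : ∀ m₁ m₂, ladder c m * (X m₁ m₂ m * X' m₁ m₂ m)
      = -(G (m₁ - 1) m₂ + H m₁ (m₂ - 1)) := by
    intro m₁ m₂
    by_cases h : m₁ + m₂ + (m + 1) = 1
    · have := threeJ_lower a b c h
      simp only [hG, hH, hX, hX', sub_add_cancel]
      rw [add_sub_cancel_right] at this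
      linear_combination (threeJ a b c' m₁ m₂ m) * this
    · have : X' m₁ m₂ m = 0 := threeJ_eq_zero_of_sum (by omega)
      simp [hG, hH, this]
  have sG : ∑ m₁ ∈ Finset.Icc (-(a : ℤ)) a, ∑ m₂ ∈ Finset.Icc (-(b : ℤ)) b, G m₁ m₂
      = ∑ m₁ ∈ Finset.Icc (-(a : ℤ)) a, ∑ m₂ ∈ Finset.Icc (-(b : ℤ)) b, G (m₁ - 1) m₂ :=
    sum_Icc_shift a (fun m₁ => ∑ m₂ ∈ Finset.Icc (-(b : ℤ)) b, G m₁ m₂)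
      (by simp [hG, ladder_self]) (by simp [hG, ladder_bot])
  have sH : ∑ m₁ ∈ Finset.Icc (-(a : ℤ)) a, ∑ m₂ ∈ Finset.Icc (-(b : ℤ)) b, H m₁ m₂
      = ∑ m₁ ∈ Finset.Icc (-(a : ℤ)) a, ∑ m₂ ∈ Finset.Icc (-(b : ℤ)) b, H m₁ (m₂ - 1) :=
    Finset.sum_congr rfl fun m₁ _ => sum_Icc_shift b (fun m₂ => H m₁ m₂)
      (by simp [hH, ladder_self]) (by simp [hH, ladder_bot])
  unfold threeJGram
  simp only [Finset.mul_sum]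
  rw [Finset.sum_congr rfl fun m₁ _ => Finset.sum_congr rfl fun m₂ _ => e1 m₁ m₂,
    Finset.sum_congr rfl fun m₁ _ => Finset.sum_congr rfl fun m₂ _ => e2 m₁ m₂]
  simp only [Finset.sum_neg_distrib, Finset.sum_add_distrib]
  rw [sG, sH]

lemma threeJGram_eq_zero_of_out {a b c c' : ℕ} {m : ℤ} (h : ¬ |m| ≤ (c : ℤ)) :
    threeJGram a b c c' m = 0 := by
  refine Finset.sum_eq_zero fun m₁ _ => Finset.sum_eq_zero fun m₂ _ => ?_
  rw [threeJ_of_not fun hh => h hh.2.2.2.1, zero_mul]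

lemma threeJGram_comm (a b c c' : ℕ) (m : ℤ) :
    threeJGram a b c c' m = threeJGram a b c' c m := by
  unfold threeJGram
  simp only [mul_comm]

/-- Schur's lemma by climbing: one step below the smaller multiplet its ladder coefficient is zero
while that of the larger is positive, so the Gram sum vanishes at m = -c, and then at each higher m.
-/
lemma threeJGram_of_lt {a b c c' : ℕ} (h : c < c') (m : ℤ) : threeJGram a b c c' m = 0 := by
  by_cases hm : |m| ≤ (c : ℤ)
  swap
  · exact threeJGram_eq_zero_of_out hm
  have key : ∀ k : ℕ, threeJGram a b c c' (-(c : ℤ) + k) = 0 := by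
    intro k
    induction k with
    | zero =>
      have := threeJGram_step a b c c' (-(c : ℤ) - 1)
      rw [ladder_bot, zero_mul, sub_add_cancel] at this
      have hp := ladder_pos (l := c') (m := -(c : ℤ) - 1) (by omega) (by omega)
      simpa [hp.ne'] using this
    | succ k ih =>
      have := threeJGram_step a b c c' (-(c : ℤ) + k)
      rw [ih, mul_zero, add_assoc] at this
      by_cases hk : -(c : ℤ) + k < c'
      · have hp := ladder_pos (l := c') (m := -(c : ℤ) + k) (by omega) hk
        simpa [hp.ne'] using this
      · refine threeJGram_eq_zero_of_out fun hh => ?_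
        rw [abs_le] at hh
        push_cast at hh
        omega
  rw [abs_le] at hm
  have := key (m + c).toNat
  rwa [show -(c : ℤ) + ((m + c).toNat : ℤ) = m by omega] at this

lemma threeJGram_of_ne {a b c c' : ℕ} (h : c ≠ c') (m : ℤ) : threeJGram a b c c' m = 0 := by
  rcases lt_or_gt_of_ne h with h | h
  · exact threeJGram_of_lt h m
  · rw [threeJGram_comm]; exact threeJGram_of_lt h m

/-- Comparison of the n-th coefficients in (1-X)^-(q+1) (1-X)^-(p+1) = (1-X)^-(p+q+2). -/
lemma sum_choose_mul_choose (p q n : ℕ) :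
    ∑ i ∈ Finset.range (n + 1), (q + i).choose q * (p + (n - i)).choose p
      = (p + q + 1 + n).choose (p + q + 1) := by
  have h := PowerSeries.invOneSubPow_add ℤ (q + 1) (p + 1)
  have h2 := congrArg
    (fun u : (PowerSeries ℤ)ˣ => PowerSeries.coeff n (u : PowerSeries ℤ)) h
  simp only [Units.val_mul, PowerSeries.invOneSubPow_val_succ_eq_mk_add_choose,
    show q + 1 + (p + 1) = (p + q + 1) + 1 by ring, PowerSeries.coeff_mul, PowerSeries.coeff_mk,
    Finset.Nat.sum_antidiagonal_eq_sum_range_succ_mk] at h2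
  exact_mod_cast h2.symm

/-- At the lowest third projection the Racah sum for m₁ = a - i has the single term t = i. The
squared symbols are therefore products of two binomial coefficients up to a constant, and they add
up by `sum_choose_mul_choose`. -/
lemma threeJGram_self_bot {a b c : ℕ} (h : c ≤ a + b ∧ a ≤ b + c ∧ b ≤ a + c) :
    threeJGram a b c c (-(c : ℤ)) = 1 / (2 * c + 1) := by
  set n := a + b - c with hn
  set p := a + c - b with hp
  set q := b + c - a with hq
  have hpq : p + q = 2 * c := by omega
  set K : ℝ := (n ! * (2 * c)! : ℕ) / ((a + b + c + 1)! : ℕ) with hK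
  have term : ∀ i : ℕ, i ≤ n → threeJ a b c (a - i) (c - (a - i)) (-(c : ℤ)) ^ 2
      = K * ((q + i).choose q * (p + (n - i)).choose p : ℕ) := by
    intro i hi
    rw [threeJ_of ⟨by omega, abs_le.mpr ⟨by omega, by omega⟩, abs_le.mpr ⟨by omega, by omega⟩,
      by simp, h⟩]
    have hr : racahSum n ((c : ℤ) - b + (a - i)) (a - (a - i)) (c - a - (c - (a - i)))
        (b + (c - (a - i))) = (-1) ^ i * (1 / (i ! : ℕ) * (1 / ((n - i)! : ℕ))
          * (1 / (p ! : ℕ)) * (1 / (q ! : ℕ))) := by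
      unfold racahSum
      rw [Finset.sum_eq_single i]
      · rw [show (n : ℤ) - i = ((n - i : ℕ) : ℤ) by omega,
          show (c : ℤ) - b + (a - i) + i = (p : ℤ) by omega,
          show (c : ℤ) - a - (c - (a - i)) + i = ((0 : ℕ) : ℤ) by push_cast; ring,
          show (a : ℤ) - (a - i) - i = ((0 : ℕ) : ℤ) by push_cast; ring,
          show (b : ℤ) + (c - (a - i)) - i = (q : ℤ) by omega]
        simp only [invFact_natCast, Nat.factorial_zero, Nat.cast_one]
        ring
      · intro t _ hne
        rcases lt_or_gt_of_ne hne with hlt | hgt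
        · rw [invFact_of_neg (k := (c : ℤ) - a - (c - (a - i)) + t) (by omega)]; ring
        · rw [invFact_of_neg (k := (a : ℤ) - (a - i) - t) (by omega)]; ring
      · intro hnot; exfalso; apply hnot; simp; omega
    rw [← hn, hr]
    have s1 : ∀ k : ℤ, ((-1 : ℝ) ^ k) ^ 2 = 1 := by
      intro k; rw [← zpow_natCast, ← zpow_mul, mul_comm, zpow_mul]; norm_num
    have s2 : ((-1 : ℝ) ^ i) ^ 2 = 1 := by rw [← pow_mul, mul_comm, pow_mul]; norm_num
    have s3 : triangleCoeff a b c ^ 2 = (n ! * p ! * q ! : ℕ) / ((a + b + c + 1)! : ℕ) :=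
      Real.sq_sqrt (by positivity)
    have s4 : ∀ l m, ladderWeight l m ^ 2 = (((l : ℤ) + m).toNat ! * ((l : ℤ) - m).toNat ! : ℕ) :=
      fun l m => Real.sq_sqrt (by positivity)
    rw [mul_pow, mul_pow, mul_pow, mul_pow, mul_pow, mul_pow, s1, s2, s3, s4, s4, s4]
    rw [show ((a : ℤ) + (a - i)).toNat = p + (n - i) by omega,
      show ((a : ℤ) - (a - i)).toNat = i by omega,
      show ((b : ℤ) + (c - (a - i))).toNat = q + i by omega,
      show ((b : ℤ) - (c - (a - i))).toNat = n - i by omega,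
      show ((c : ℤ) + -c).toNat = 0 by omega, show ((c : ℤ) - -c).toNat = 2 * c by omega]
    have c1 : (((q + i).choose q : ℕ) : ℝ) = (q + i)! / (q ! * i !) := by
      rw [Nat.cast_add_choose]
    have c2 : (((p + (n - i)).choose p : ℕ) : ℝ) = (p + (n - i))! / (p ! * (n - i)!) := by
      rw [Nat.cast_add_choose]
    rw [Nat.cast_mul ((q + i).choose q), c1, c2, hK]
    push_cast [Nat.factorial_zero]
    field_simp
  have sum1 : threeJGram a b c c (-(c : ℤ))
      = ∑ m₁ ∈ Finset.Icc (-(a : ℤ)) a, threeJ a b c m₁ (c - m₁) (-(c : ℤ)) ^ 2 := by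
    unfold threeJGram
    refine Finset.sum_congr rfl fun m₁ _ => ?_
    by_cases hm : (c : ℤ) - m₁ ∈ Finset.Icc (-(b : ℤ)) b
    · rw [Finset.sum_eq_single_of_mem _ hm]
      · ring
      · intro m₂ _ hne
        rw [threeJ_eq_zero_of_sum (by omega), zero_mul]
    · have : threeJ a b c m₁ (c - m₁) (-(c : ℤ)) = 0 := by
        refine threeJ_of_not fun hh => hm ?_
        have := abs_le.mp hh.2.2.1
        simp only [Finset.mem_Icc]; omega
      rw [this]
      rw [Finset.sum_eq_zero]
      · ring
      intro m₂ h2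
      rw [threeJ_eq_zero_of_sum, zero_mul]
      intro h0
      apply hm
      rwa [show (c : ℤ) - m₁ = m₂ by omega]
  have sum2 : ∑ m₁ ∈ Finset.Icc (-(a : ℤ)) a, threeJ a b c m₁ (c - m₁) (-(c : ℤ)) ^ 2
      = ∑ i ∈ Finset.range (n + 1), threeJ a b c (a - i) (c - (a - i)) (-(c : ℤ)) ^ 2 := by
    symm
    refine Finset.sum_of_injOn (fun i : ℕ => (a : ℤ) - i) ?_ ?_ ?_ ?_
    · intro i _ j _ hij; simp only at hij; omega
    · intro i hi; simp only [Finset.coe_range, Set.mem_Iio, Finset.coe_Icc, Set.mem_Icc] at *; omega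
    · intro m₁ hm hnot
      rw [threeJ_of_not, zero_pow (by norm_num)]
      intro hh
      apply hnot
      have h1 := abs_le.mp hh.2.1
      have h2 := abs_le.mp hh.2.2.1
      refine ⟨((a : ℤ) - m₁).toNat, ?_, ?_⟩
      · simp only [Finset.coe_range, Set.mem_Iio]; omega
      · simp only; omega
    · intro i _; rfl
  rw [sum1, sum2, Finset.sum_congr rfl fun i hi => term i (by simpa [Nat.lt_succ_iff] using hi),
    ← Finset.mul_sum, ← Nat.cast_sum, sum_choose_mul_choose, hK, hpq,
    Nat.cast_add_choose,
    show 2 * c + 1 + n = a + b + c + 1 by omega, Nat.factorial_succ (2 * c)]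
  push_cast
  have : ((a + b + c + 1)! : ℝ) ≠ 0 := by positivity
  have : ((2 * c)! : ℝ) ≠ 0 := by positivity
  have : ((n)! : ℝ) ≠ 0 := by positivity
  field_simp

lemma threeJGram_self {a b c : ℕ} (h : c ≤ a + b ∧ a ≤ b + c ∧ b ≤ a + c) {m : ℤ}
    (hm : |m| ≤ (c : ℤ)) : threeJGram a b c c m = 1 / (2 * c + 1) := by
  have key : ∀ k : ℕ, k ≤ 2 * c → threeJGram a b c c (-(c : ℤ) + k) = 1 / (2 * c + 1) := by
    intro k
    induction k with
    | zero => intro _; simpa using threeJGram_self_bot h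
    | succ k ih =>
      intro hk
      have := threeJGram_step a b c c (-(c : ℤ) + k)
      have hp := ladder_pos (l := c) (m := -(c : ℤ) + k) (by omega) (by omega)
      rw [ih (by omega)] at this
      have := mul_left_cancel₀ hp.ne' this
      rw [← this]; congr 1; push_cast; ring
  rw [abs_le] at hm
  have := key (m + c).toNat (by omega)
  rwa [show -(c : ℤ) + ((m + c).toNat : ℤ) = m by omega] at this

/-! ### Uniqueness of invariant tensors -/

/-- Tensors of spins `(a, b, c)` annihilated by the total angular momentum. -/
structure IsInvariantTensor (a b c : ℕ) (X : ℤ → ℤ → ℤ → ℂ) : Prop where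
  support : ∀ m₁ m₂ m₃, ¬ (m₁ + m₂ + m₃ = 0 ∧ |m₁| ≤ (a : ℤ) ∧ |m₂| ≤ (b : ℤ) ∧ |m₃| ≤ (c : ℤ)) →
    X m₁ m₂ m₃ = 0
  raise : ∀ m₁ m₂ m₃, m₁ + m₂ + m₃ = -1 →
    (ladder a m₁ : ℂ) * X (m₁ + 1) m₂ m₃ + (ladder b m₂ : ℂ) * X m₁ (m₂ + 1) m₃
      + (ladder c m₃ : ℂ) * X m₁ m₂ (m₃ + 1) = 0
  lower : ∀ m₁ m₂ m₃, m₁ + m₂ + m₃ = 1 →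
    (ladder a (m₁ - 1) : ℂ) * X (m₁ - 1) m₂ m₃ + (ladder b (m₂ - 1) : ℂ) * X m₁ (m₂ - 1) m₃
      + (ladder c (m₃ - 1) : ℂ) * X m₁ m₂ (m₃ - 1) = 0

lemma isInvariantTensor_threeJ (a b c : ℕ) :
    IsInvariantTensor a b c fun m₁ m₂ m₃ => (threeJ a b c m₁ m₂ m₃ : ℂ) where
  support m₁ m₂ m₃ h := by
    rw [threeJ_of_not, Complex.ofReal_zero]
    exact fun hh => h ⟨hh.1, hh.2.1, hh.2.2.1, hh.2.2.2.1⟩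
  raise m₁ m₂ m₃ h := by exact_mod_cast threeJ_raise a b c h
  lower m₁ m₂ m₃ h := by exact_mod_cast threeJ_lower a b c h

namespace IsInvariantTensor

variable {a b c : ℕ} {X Z : ℤ → ℤ → ℤ → ℂ}

lemma sub_smul (hX : IsInvariantTensor a b c X) (hZ : IsInvariantTensor a b c Z) (k : ℂ) :
    IsInvariantTensor a b c fun m₁ m₂ m₃ => X m₁ m₂ m₃ - k * Z m₁ m₂ m₃ where
  support m₁ m₂ m₃ h := by rw [hX.support _ _ _ h, hZ.support _ _ _ h]; ring
  raise m₁ m₂ m₃ h := by linear_combination hX.raise _ _ _ h - k * hZ.raise _ _ _ h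
  lower m₁ m₂ m₃ h := by linear_combination hX.lower _ _ _ h - k * hZ.lower _ _ _ h

/-- The raising relation determines the slice m₃ + 1 from the slice m₃, since the ladder coefficient
of the third spin is nonzero below the top. -/
lemma eq_zero_of_bot (hX : IsInvariantTensor a b c X) (h0 : ∀ m₁ m₂, X m₁ m₂ (-(c : ℤ)) = 0)
    (m₁ m₂ m₃ : ℤ) : X m₁ m₂ m₃ = 0 := by
  by_cases hm : |m₃| ≤ (c : ℤ)
  swap
  · exact hX.support _ _ _ fun hh => hm hh.2.2.2
  have key : ∀ k : ℕ, k ≤ 2 * c → ∀ m₁ m₂, X m₁ m₂ (-(c : ℤ) + k) = 0 := by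
    intro k
    induction k with
    | zero => intro _ m₁ m₂; simpa using h0 m₁ m₂
    | succ k ih =>
      intro hk m₁ m₂
      by_cases hs : m₁ + m₂ + (-(c : ℤ) + k) = -1
      · have := hX.raise m₁ m₂ _ hs
        rw [ih (by omega), ih (by omega)] at this
        have hp := ladder_pos (l := c) (m := -(c : ℤ) + k) (by omega) (by omega)
        rw [show -(c : ℤ) + (k + 1 : ℕ) = -(c : ℤ) + k + 1 by push_cast; ring]
        simpa [hp.ne'] using this
      · exact hX.support _ _ _ fun hh => hs (by have := hh.1; push_cast at this; omega)
  rw [abs_le] at hm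
  have := key (m₃ + c).toNat (by omega) m₁ m₂
  rwa [show -(c : ℤ) + ((m₃ + c).toNat : ℤ) = m₃ by omega] at this

/-- On the lowest slice the third lowering term drops out and a two-term recurrence in m₁ remains.
-/
lemma bot_relation (hX : IsInvariantTensor a b c X) (m₁ m₂ : ℤ) (h : m₁ + m₂ = c + 1) :
    (ladder a (m₁ - 1) : ℂ) * X (m₁ - 1) m₂ (-(c : ℤ))
      + (ladder b (m₂ - 1) : ℂ) * X m₁ (m₂ - 1) (-(c : ℤ)) = 0 := by
  have := hX.lower m₁ m₂ (-(c : ℤ)) (by omega)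
  rwa [ladder_bot, Complex.ofReal_zero, zero_mul, add_zero] at this

/-- The two-term recurrence propagates one corner entry through the whole lowest slice. Hence the
space of invariant tensors is at most one-dimensional. -/
lemma eq_zero_of_top (hX : IsInvariantTensor a b c X) (h0 : X a (c - a) (-(c : ℤ)) = 0)
    (m₁ m₂ m₃ : ℤ) : X m₁ m₂ m₃ = 0 := by
  refine hX.eq_zero_of_bot (fun m₁ m₂ => ?_) m₁ m₂ m₃
  by_cases hm : m₁ + m₂ = c ∧ |m₁| ≤ (a : ℤ)
  swap
  · exact hX.support _ _ _ fun hh => hm ⟨by have := hh.1; omega, hh.2.1⟩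
  obtain ⟨hs, hm⟩ := hm
  have key : ∀ k : ℕ, k ≤ 2 * a → X (a - k) (c - (a - k)) (-(c : ℤ)) = 0 := by
    intro k
    induction k with
    | zero => intro _; simpa using h0
    | succ k ih =>
      intro hk
      have := hX.bot_relation (a - k) (c - (a - k) + 1) (by ring)
      rw [add_sub_cancel_right, ih (by omega), mul_zero, add_zero] at this
      have hp := ladder_pos (l := a) (m := (a : ℤ) - k - 1) (by omega) (by omega)
      have := (mul_eq_zero.mp this).resolve_left (by exact_mod_cast hp.ne')
      rw [← this]
      congr 1 <;> push_cast <;> ring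
  rw [abs_le] at hm
  have := key (a - m₁).toNat (by omega)
  rwa [show (a : ℤ) - ((a - m₁).toNat : ℤ) = m₁ by omega, show (c : ℤ) - m₁ = m₂ by omega] at this

/-- If c > a + b or a > b + c, the corner entry already lies outside the support. If b > a + c, the
recurrence on the lowest slice is started at m₁ = -a, where it has one term only because the ladder
coefficient of `a` vanishes there. -/
lemma eq_zero_of_not_triangle (hX : IsInvariantTensor a b c X)
    (h : ¬ (c ≤ a + b ∧ a ≤ b + c ∧ b ≤ a + c)) (m₁ m₂ m₃ : ℤ) : X m₁ m₂ m₃ = 0 := by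
  by_cases hb : b ≤ a + c
  · refine hX.eq_zero_of_top (hX.support _ _ _ fun hh => h ?_) m₁ m₂ m₃
    have := abs_le.mp hh.2.2.1
    omega
  · refine hX.eq_zero_of_bot (fun m₁ m₂ => ?_) m₁ m₂ m₃
    by_cases hm : m₁ + m₂ = c ∧ |m₁| ≤ (a : ℤ)
    swap
    · exact hX.support _ _ _ fun hh => hm ⟨by have := hh.1; omega, hh.2.1⟩
    obtain ⟨hs, hm⟩ := hm
    have key : ∀ k : ℕ, k ≤ 2 * a → X (-a + k) (c - (-a + k)) (-(c : ℤ)) = 0 := by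
      intro k
      induction k with
      | zero =>
        intro _
        have := hX.bot_relation (-a) (c + a + 1) (by ring)
        rw [ladder_bot, Complex.ofReal_zero, zero_mul, zero_add, add_sub_cancel_right] at this
        have hp := ladder_pos (l := b) (m := (c : ℤ) + a) (by omega) (by omega)
        have := (mul_eq_zero.mp this).resolve_left (by exact_mod_cast hp.ne')
        rw [← this]
        congr 1 <;> push_cast <;> ring
      | succ k ih =>
        intro hk
        have := hX.bot_relation (-a + k + 1) (c - (-a + k)) (by ring)
        rw [add_sub_cancel_right, ih (by omega), mul_zero, zero_add] at this
        have hp := ladder_pos (l := b) (m := (c : ℤ) - (-a + k) - 1) (by omega) (by omega)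
        have := (mul_eq_zero.mp this).resolve_left (by exact_mod_cast hp.ne')
        rw [← this]
        congr 1 <;> push_cast <;> ring
    rw [abs_le] at hm
    have := key (a + m₁).toNat (by omega)
    rwa [show -(a : ℤ) + ((a + m₁).toNat : ℤ) = m₁ by omega, show (c : ℤ) - m₁ = m₂ by omega]
      at this

/-- Every invariant tensor is a multiple of the 3j symbol. -/
theorem eq_threeJ (hX : IsInvariantTensor a b c X) (m₁ m₂ m₃ : ℤ) :
    X m₁ m₂ m₃ = (∑ n₃ ∈ Finset.Icc (-(c : ℤ)) c, ∑ n₁ ∈ Finset.Icc (-(a : ℤ)) a,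
      ∑ n₂ ∈ Finset.Icc (-(b : ℤ)) b, (threeJ a b c n₁ n₂ n₃ : ℂ) * X n₁ n₂ n₃)
        * threeJ a b c m₁ m₂ m₃ := by
  by_cases h : c ≤ a + b ∧ a ≤ b + c ∧ b ≤ a + c
  swap
  · rw [hX.eq_zero_of_not_triangle h, threeJ_of_not fun hh => h hh.2.2.2.2]; simp
  -- The 3j symbols have total square sum one, so the factor of proportionality is the inner product
  -- with the 3j tensor.
  have norm1 : ∑ n₃ ∈ Finset.Icc (-(c : ℤ)) c, ∑ n₁ ∈ Finset.Icc (-(a : ℤ)) a,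
      ∑ n₂ ∈ Finset.Icc (-(b : ℤ)) b, (threeJ a b c n₁ n₂ n₃ * threeJ a b c n₁ n₂ n₃) = 1 := by
    have : ∀ n₃ ∈ Finset.Icc (-(c : ℤ)) c, ∑ n₁ ∈ Finset.Icc (-(a : ℤ)) a,
        ∑ n₂ ∈ Finset.Icc (-(b : ℤ)) b, (threeJ a b c n₁ n₂ n₃ * threeJ a b c n₁ n₂ n₃)
          = 1 / (2 * c + 1) := by
      intro n₃ hn
      rw [Finset.mem_Icc] at hn
      exact threeJGram_self h (abs_le.mpr hn)
    rw [Finset.sum_congr rfl this, Finset.sum_const, Int.card_Icc, nsmul_eq_mul,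
      show ((c : ℤ) + 1 - -c).toNat = 2 * c + 1 by omega]
    push_cast
    field_simp
  have hJ := isInvariantTensor_threeJ a b c
  -- Were the corner entry zero, the whole 3j tensor would vanish, against its normalisation.
  have hne : threeJ a b c a (c - a) (-(c : ℤ)) ≠ 0 := by
    intro h0
    have hz := hJ.eq_zero_of_top (by simp [h0])
    have hz' : ∀ x y z, threeJ a b c x y z = 0 := fun x y z => by exact_mod_cast hz x y z
    simp [hz'] at norm1
  set k := X a (c - a) (-(c : ℤ)) / threeJ a b c a (c - a) (-(c : ℤ)) with hk
  have hXk : ∀ x y z, X x y z = k * threeJ a b c x y z := by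
    intro x y z
    have := (hX.sub_smul hJ k).eq_zero_of_top (by
      rw [hk, div_mul_cancel₀ _ (by exact_mod_cast hne), sub_self]) x y z
    linear_combination this
  have : ∑ n₃ ∈ Finset.Icc (-(c : ℤ)) c, ∑ n₁ ∈ Finset.Icc (-(a : ℤ)) a,
      ∑ n₂ ∈ Finset.Icc (-(b : ℤ)) b, (threeJ a b c n₁ n₂ n₃ : ℂ) * X n₁ n₂ n₃ = k := by
    have e : ∀ n₁ n₂ n₃, (threeJ a b c n₁ n₂ n₃ : ℂ) * X n₁ n₂ n₃
        = k * ((threeJ a b c n₁ n₂ n₃ * threeJ a b c n₁ n₂ n₃ : ℝ) : ℂ) := by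
      intro n₁ n₂ n₃; rw [hXk]; push_cast; ring
    simp only [e, ← Finset.mul_sum, ← Complex.ofReal_sum]
    rw [norm1]; simp
  rw [this, hXk]

end IsInvariantTensor

/-! ### Solid harmonics -/

/-- The coefficient of `s^(l+m)` in `(ξ s² + 2 z s - η)^l`: up to normalisation, the solid harmonic
of degree `l` and order `m` at the point with `x + iy = ξ`, `x - iy = η`. -/
def solid (ξ η z : ℂ) : ℕ → ℤ → ℂ
  | 0, m => if m = 0 then 1 else 0
  | l + 1, m => ξ * solid ξ η z l (m - 1) + 2 * z * solid ξ η z l m - η * solid ξ η z l (m + 1)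

/-- `l` times the solid harmonic of degree `l - 1`. -/
def solidLow (ξ η z : ℂ) : ℕ → ℤ → ℂ
  | 0, _ => 0
  | l + 1, m => (l + 1) * solid ξ η z l m

section Solid

variable (ξ η z : ℂ)

lemma solid_zero (m : ℤ) : solid ξ η z 0 m = if m = 0 then 1 else 0 := rfl

lemma solid_succ (l : ℕ) (m : ℤ) : solid ξ η z (l + 1) m
    = ξ * solid ξ η z l (m - 1) + 2 * z * solid ξ η z l m - η * solid ξ η z l (m + 1) := rfl

lemma solidLow_succ (l : ℕ) (m : ℤ) :
    solidLow ξ η z (l + 1) m = (l + 1) * solid ξ η z l m := rfl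

lemma solid_eq_zero (l : ℕ) : ∀ m : ℤ, (l : ℤ) < |m| → solid ξ η z l m = 0 := by
  induction l with
  | zero => intro m hm; rw [solid_zero, if_neg]; rintro rfl; simp at hm
  | succ l ih =>
    intro m hm
    rw [lt_abs] at hm
    push_cast at hm
    rw [solid_succ, ih _ (lt_abs.mpr (by omega)), ih _ (lt_abs.mpr (by omega)),
      ih _ (lt_abs.mpr (by omega))]
    ring

lemma solid_neg (l : ℕ) : ∀ m : ℤ, solid ξ η z l (-m) = (-1) ^ m * solid η ξ z l m := by
  induction l with
  | zero =>
    intro m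
    rw [solid_zero, solid_zero]
    by_cases h : m = 0
    · simp [h]
    · simp [h]
  | succ l ih =>
    intro m
    rw [solid_succ, solid_succ, show -m - 1 = -(m + 1) by ring, show -m + 1 = -(m - 1) by ring,
      ih, ih, ih, zpow_add₀ (by norm_num), zpow_sub₀ (by norm_num)]
    norm_num
    ring

/-- With P = ξ s² + 2 z s - η this compares coefficients in dP^l/ds = l P^(l-1) (2 ξ s + 2 z). -/
lemma solid_raise (l : ℕ) : ∀ m : ℤ, (l + m + 1 : ℂ) * solid ξ η z l (m + 1)
    = 2 * (ξ * solidLow ξ η z l m + z * solidLow ξ η z l (m + 1)) := by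
  induction l with
  | zero =>
    intro m
    by_cases h : m + 1 = 0
    · have : (m : ℂ) + 1 = 0 := by exact_mod_cast h
      simp [solidLow, this]
    · simp [solid_zero, solidLow, h]
  | succ l ih =>
    intro m
    cases l with
    | zero =>
      simp only [solidLow, solid_succ, solid_zero]
      rcases eq_or_ne m 0 with rfl | h0
      · norm_num
      rcases eq_or_ne m (-1) with rfl | h1
      · norm_num
      rcases eq_or_ne m (-2) with rfl | h2
      · norm_num
      · have : m + 1 ≠ 0 := by omega
        have : m + 1 + 1 ≠ 0 := by omega
        simp_all
    | succ l =>
      have i1 := ih (m - 1)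
      have i2 := ih m
      have i3 := ih (m + 1)
      have r1 := solid_succ ξ η z l m
      have r2 := solid_succ ξ η z l (m + 1)
      rw [solid_succ ξ η z (l + 1)]
      simp only [solidLow, sub_add_cancel, add_sub_cancel_right] at *
      push_cast at *
      linear_combination ξ * i1 + 2 * z * i2 - η * i3 - 2 * (l + 1) * ξ * r1 - 2 * (l + 1) * z * r2

lemma solidLow_neg (l : ℕ) (m : ℤ) :
    solidLow ξ η z l (-m) = (-1) ^ m * solidLow η ξ z l m := by
  cases l with
  | zero => simp [solidLow]
  | succ l => simp only [solidLow, solid_neg ξ η z l m]; ring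

/-- The mirror image of `solid_raise` under exchange of ξ and η, which reverses the order up to a
sign. -/
lemma solid_lower (l : ℕ) (m : ℤ) : (l - m + 1 : ℂ) * solid ξ η z l (m - 1)
    = 2 * (z * solidLow ξ η z l (m - 1) - η * solidLow ξ η z l m) := by
  have h := solid_raise η ξ z l (-m)
  rw [show -m + 1 = -(m - 1) by ring, solid_neg η ξ z, solidLow_neg η ξ z, solidLow_neg η ξ z,
    zpow_sub₀ (by norm_num)] at h
  have hne : (-1 : ℂ) ^ m ≠ 0 := zpow_ne_zero _ (by norm_num)
  apply mul_left_cancel₀ hne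
  push_cast at h
  norm_num at h
  linear_combination -h

/-- A coordinate times a harmonic of degree `l` is a harmonic of degree l + 1 plus r² times one of
degree l - 1, where r² = z² + ξ η. The relation follows by elimination between the raising and
lowering identities in degrees `l` and l + 1. -/
lemma xi_mul_solid (l : ℕ) (m : ℤ) : 2 * (2 * l + 1) * (ξ * solid ξ η z l m)
    = (l + m + 1) * (l + m + 2) / (l + 1) * solid ξ η z (l + 1) (m + 1)
      - 4 * (z ^ 2 + ξ * η) * solidLow ξ η z l (m + 1) := by
  have h1 := solid_raise ξ η z (l + 1) m
  have h2 := solid_raise ξ η z l m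
  have h3 := solid_lower ξ η z l (m + 1)
  simp only [solidLow_succ] at h1
  simp only [add_sub_cancel_right] at h3
  have hl : (l : ℂ) + 1 ≠ 0 := by exact_mod_cast Nat.succ_ne_zero l
  field_simp
  push_cast at h1 h3
  linear_combination -(l + m + 1) * h1 - 2 * (l + 1) * z * h2 + 2 * ξ * (l + 1) * h3

lemma z_mul_solid (l : ℕ) (m : ℤ) : 2 * (2 * l + 1) * (z * solid ξ η z l m)
    = (l + m + 1) * (l - m + 1) / (l + 1) * solid ξ η z (l + 1) m
      + 4 * (z ^ 2 + ξ * η) * solidLow ξ η z l m := by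
  have h1 := solid_raise ξ η z (l + 1) (m - 1)
  have h2 := xi_mul_solid ξ η z l (m - 1)
  simp only [solidLow_succ, sub_add_cancel] at h1 h2
  have hl : (l : ℂ) + 1 ≠ 0 := by exact_mod_cast Nat.succ_ne_zero l
  push_cast at h1 h2
  field_simp at h2 ⊢
  linear_combination -(2 * l + 1) * h1 - h2

lemma eta_mul_solid (l : ℕ) (m : ℤ) : 2 * (2 * l + 1) * (η * solid ξ η z l m)
    = -((l - m + 1) * (l - m + 2) / (l + 1) * solid ξ η z (l + 1) (m - 1))
      + 4 * (z ^ 2 + ξ * η) * solidLow ξ η z l (m - 1) := by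
  have h := xi_mul_solid η ξ z l (-m)
  rw [show -m + 1 = -(m - 1) by ring, solid_neg η ξ z, solid_neg η ξ z, solidLow_neg η ξ z,
    zpow_sub₀ (by norm_num)] at h
  have hne : (-1 : ℂ) ^ m ≠ 0 := zpow_ne_zero _ (by norm_num)
  apply mul_left_cancel₀ hne
  push_cast at h
  norm_num at h
  linear_combination h

/-- The derivative of a solid harmonic in the direction with components `ξ'`, `η'`, `z'`. -/
def solidDeriv (ξ' η' z' : ℂ) (l : ℕ) (m : ℤ) : ℂ :=
  ξ' * solidLow ξ η z l (m - 1) + 2 * z' * solidLow ξ η z l m - η' * solidLow ξ η z l (m + 1)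

/-- The part of degree `l + 1` in the product of a linear form with a solid harmonic. -/
def solidUp (ξ' η' z' : ℂ) (l : ℕ) (m : ℤ) : ℂ :=
  ((l + m + 1) * (l - m + 1) / (2 * (l + 1)) * z') * solid ξ η z (l + 1) m
    + ((l + m + 1) * (l + m + 2) / (4 * (l + 1)) * η') * solid ξ η z (l + 1) (m + 1)
    - ((l - m + 1) * (l - m + 2) / (4 * (l + 1)) * ξ') * solid ξ η z (l + 1) (m - 1)

/-- The same splitting for an arbitrary linear form. The lower part is the directional derivative of
the harmonic itself, which is what lets multiplication of spectra match differentiation of waves. -/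
lemma linear_mul_solid (ξ' η' z' : ℂ) (l : ℕ) (m : ℤ) :
    (2 * l + 1) * ((z * z' + (ξ * η' + η * ξ') / 2) * solid ξ η z l m)
      = solidUp ξ η z ξ' η' z' l m + (z ^ 2 + ξ * η) * solidDeriv ξ η z ξ' η' z' l m := by
  have h1 := xi_mul_solid ξ η z l m
  have h2 := z_mul_solid ξ η z l m
  have h3 := eta_mul_solid ξ η z l m
  have hl : (l : ℂ) + 1 ≠ 0 := by exact_mod_cast Nat.succ_ne_zero l
  unfold solidUp solidDeriv
  field_simp at h1 h2 h3 ⊢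
  linear_combination 2 * η' * h1 + 4 * z' * h2 + 2 * ξ' * h3

end Solid

/-- The derivative of P^l is l P^(l-1) times the derivative of P. The scalar field is left general
because both real rotation angles and complex line parameters occur. -/
lemma hasDerivAt_solid {𝕜 : Type*} [NontriviallyNormedField 𝕜] [NormedAlgebra 𝕜 ℂ]
    {ξ η z : 𝕜 → ℂ} {ξ' η' z' : ℂ} {t : 𝕜} (hξ : HasDerivAt ξ ξ' t) (hη : HasDerivAt η η' t)
    (hz : HasDerivAt z z' t) (l : ℕ) : ∀ m : ℤ,
    HasDerivAt (fun s => solid (ξ s) (η s) (z s) l m)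
      (solidDeriv (ξ t) (η t) (z t) ξ' η' z' l m) t := by
  induction l with
  | zero => intro m; simpa [solid, solidDeriv, solidLow] using hasDerivAt_const t _
  | succ l ih =>
    intro m
    have := ((hξ.mul (ih (m - 1))).add ((hz.const_mul 2).mul (ih m))).sub (hη.mul (ih (m + 1)))
    refine this.congr_deriv ?_
    cases l with
    | zero => simp [solidDeriv, solidLow]
    | succ l =>
      simp only [solidDeriv, solidLow, solid_succ, sub_add_cancel, add_sub_cancel_right]
      push_cast
      ring

lemma solid_pole (z : ℂ) (l : ℕ) : ∀ m : ℤ,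
    solid 0 0 z l m = if m = 0 then (2 * z) ^ l else 0 := by
  induction l with
  | zero => intro m; simp [solid_zero]
  | succ l ih =>
    intro m
    rw [solid_succ, ih m, pow_succ]
    split_ifs <;> ring

lemma solid_smul (c ξ η z : ℂ) (l : ℕ) : ∀ m : ℤ,
    solid (c * ξ) (c * η) (c * z) l m = c ^ l * solid ξ η z l m := by
  induction l with
  | zero => intro m; simp [solid_zero]
  | succ l ih => intro m; rw [solid_succ, solid_succ, ih, ih, ih, pow_succ]; ring

lemma conj_solid (ξ η z : ℂ) (l : ℕ) : ∀ m : ℤ,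
    conj (solid ξ η z l m) = solid (conj ξ) (conj η) (conj z) l m := by
  induction l with
  | zero => intro m; simp only [solid_zero]; split_ifs <;> simp
  | succ l ih => 
    intro m
    have : conj (2 : ℂ) = 2 := Complex.conj_eq_iff_real.mpr ⟨2, by norm_num⟩
    simp [solid_succ, ih, this]

/-! ### Rodrigues' formula -/

/-- Coefficients of a polynomial, extended by zero to negative integers. -/
def intCoeff (p : Polynomial ℝ) (k : ℤ) : ℝ := if 0 ≤ k then p.coeff k.toNat else 0

lemma intCoeff_X_mul (p : Polynomial ℝ) (k : ℤ) :
    intCoeff (Polynomial.X * p) k = intCoeff p (k - 1) := by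
  unfold intCoeff
  rcases lt_trichotomy k 0 with h | h | h
  · rw [if_neg (by omega), if_neg (by omega)]
  · subst h; simp
  · rw [if_pos (by omega), if_pos (by omega), show k.toNat = (k - 1).toNat + 1 by omega,
      Polynomial.coeff_X_mul]

lemma intCoeff_trinomial (p : Polynomial ℝ) (b c : ℝ) (k : ℤ) :
    intCoeff ((Polynomial.X ^ 2 + Polynomial.C b * Polynomial.X + Polynomial.C c) * p) k
      = intCoeff p (k - 2) + b * intCoeff p (k - 1) + c * intCoeff p k := by
  have h1 := intCoeff_X_mul (Polynomial.X * p) k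
  have h2 := intCoeff_X_mul p k
  rw [intCoeff_X_mul p (k - 1), show k - 1 - 1 = k - 2 by ring] at h1
  rw [← h1, ← h2]
  unfold intCoeff
  split_ifs
  · rw [show (Polynomial.X ^ 2 + Polynomial.C b * Polynomial.X + Polynomial.C c) * p
      = Polynomial.X * (Polynomial.X * p) + Polynomial.C b * (Polynomial.X * p)
        + Polynomial.C c * p by ring]
    simp only [Polynomial.coeff_add, Polynomial.coeff_C_mul]
  · ring

/-- For ξ η = 1 - z² the substitution X = ξ s turns ξ (ξ s² + 2 z s - η) into (X + z)² - 1. Both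
signs of the order are carried through the induction, with ξ^m multiplied on the side of -m, so that
no division by ξ is needed at the pole. -/
lemma solid_eq_intCoeff {ξ η : ℂ} {z : ℝ} (h : ξ * η = 1 - (z : ℂ) ^ 2) (l : ℕ) : ∀ m : ℕ,
    (solid ξ η z l m = ξ ^ m * (intCoeff ((Polynomial.X ^ 2 + Polynomial.C (2 * z) * Polynomial.X
        + Polynomial.C (z ^ 2 - 1)) ^ l) (l + m) : ℂ)) ∧
    (ξ ^ m * solid ξ η z l (-m) = (intCoeff ((Polynomial.X ^ 2 + Polynomial.C (2 * z) * Polynomial.X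
        + Polynomial.C (z ^ 2 - 1)) ^ l) (l - m) : ℂ)) := by
  induction l with
  | zero =>
    intro m
    rcases Nat.eq_zero_or_pos m with rfl | hm
    · simp [solid_zero, intCoeff]
    · have h1 : ¬ (m : ℤ) = 0 := by omega
      have h2 : ¬ -(m : ℤ) = 0 := by omega
      have h3 : ¬ (0 : ℤ) ≤ 0 - m := by omega
      have h4 : ¬ m = 0 := by omega
      simp [solid_zero, h4, intCoeff, Polynomial.coeff_one]
  | succ l ih =>
    intro m
    set p := (Polynomial.X ^ 2 + Polynomial.C (2 * z) * Polynomial.X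
        + Polynomial.C (z ^ 2 - 1)) with hp
    rw [pow_succ', intCoeff_trinomial, intCoeff_trinomial]
    push_cast
    cases m with
    | zero =>
      have a1 := (ih 1).1
      have a2 := (ih 1).2
      have a3 := (ih 0).1
      simp only [pow_zero, pow_one, one_mul, Nat.cast_zero, Nat.cast_one, neg_zero, add_zero,
        sub_zero, solid_succ, zero_sub, zero_add] at *
      rw [show (l : ℤ) + 1 - 2 = l - 1 by ring, show (l : ℤ) + 1 - 1 = l by ring]
      constructor <;>
      · rw [a1, a3]
        linear_combination a2 - (intCoeff (p ^ l) (l + 1) : ℂ) * h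
    | succ k =>
      have a1 := (ih k).1
      have a2 := (ih (k + 1)).1
      have a3 := (ih (k + 2)).1
      have b1 := (ih k).2
      have b2 := (ih (k + 1)).2
      have b3 := (ih (k + 2)).2
      constructor
      · rw [solid_succ]
        push_cast at *
        rw [show (k : ℤ) + 1 - 1 = k by ring, show (k : ℤ) + 1 + 1 = k + 2 by ring, a1, a2, a3,
          show (l : ℤ) + 1 + (k + 1) - 2 = l + k by ring,
          show (l : ℤ) + 1 + (k + 1) - 1 = l + (k + 1) by ring,
          show (l : ℤ) + 1 + (k + 1) = l + (k + 2) by ring]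
        linear_combination -ξ ^ (k + 1) * (intCoeff (p ^ l) (l + (k + 2)) : ℂ) * h
      · rw [solid_succ]
        push_cast at *
        rw [show -((k : ℤ) + 1) - 1 = -(k + 2) by ring, show -((k : ℤ) + 1) + 1 = -k by ring]
        rw [show (l : ℤ) + 1 - (k + 1) - 2 = l - (k + 2) by ring,
          show (l : ℤ) + 1 - (k + 1) - 1 = l - (k + 1) by ring,
          show (l : ℤ) + 1 - (k + 1) = l - k by ring]
        linear_combination b3 + 2 * z * b2 - ξ * η * b1 - (intCoeff (p ^ l) (l - k) : ℂ) * h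

/-! ### Spherical harmonics as homogeneous polynomials -/

/-- The normalisation constant of the spherical harmonics. -/
def harmonicNorm (l : ℕ) (m : ℤ) : ℝ :=
  (-1) ^ m * Real.sqrt ((2 * (l : ℝ) + 1) / (4 * Real.pi)) * ladderWeight l m / (2 ^ l * (l ! : ℕ))

/-- The solid harmonic of degree `l` and order `m` at a point of space, not normalised. -/
def solidAt (l : ℕ) (m : ℤ) (n : Space) : ℂ :=
  solid ((n 0 : ℂ) + Complex.I * n 1) ((n 0 : ℂ) - Complex.I * n 1) (n 2 : ℂ) l m

/-- The homogeneous polynomial which agrees with `Y_{lm}` on the unit sphere. -/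
def solidY (l : ℕ) (m : ℤ) (n : Space) : ℂ := harmonicNorm l m * solidAt l m n

lemma solidY_eq_zero {l : ℕ} {m : ℤ} (h : (l : ℤ) < |m|) (n : Space) : solidY l m n = 0 := by
  rw [solidY, solidAt, solid_eq_zero _ _ _ _ _ h, mul_zero]

lemma neg_one_zpow_mul_self (m : ℤ) : ((-1 : ℂ) ^ m) * (-1) ^ m = 1 := by
  rw [← mul_zpow]; norm_num

lemma harmonicNorm_neg (l : ℕ) (m : ℤ) : harmonicNorm l (-m) = harmonicNorm l m := by
  unfold harmonicNorm
  rw [ladderWeight_neg, zpow_neg, ← inv_zpow]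
  norm_num

lemma conj_solidAt (l : ℕ) (m : ℤ) (n : Space) :
    conj (solidAt l m n) = (-1) ^ m * solidAt l (-m) n := by
  unfold solidAt
  rw [solid_neg, ← mul_assoc, neg_one_zpow_mul_self, one_mul, conj_solid]
  simp [sub_eq_add_neg]

lemma conj_solidY (l : ℕ) (m : ℤ) (n : Space) :
    conj (solidY l m n) = (-1) ^ m * solidY l (-m) n := by
  unfold solidY
  rw [map_mul, conj_solidAt, Complex.conj_ofReal, harmonicNorm_neg]
  ring

lemma norm_sq_eq (n : Space) : ‖n‖ ^ 2 = n 0 ^ 2 + n 1 ^ 2 + n 2 ^ 2 := by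
  rw [EuclideanSpace.norm_sq_eq, Fin.sum_univ_three]
  simp

lemma sphericalHarmonicNat_eq {l m : ℕ} (hm : m ≤ l) {n : Space} (hn : ‖n‖ = 1) :
    sphericalHarmonicNat l m n = solidY l m n := by
  have h1 : n 0 ^ 2 + n 1 ^ 2 + n 2 ^ 2 = 1 := by rw [← norm_sq_eq, hn]; norm_num
  have hc : ((n 0 : ℂ) + Complex.I * n 1) * ((n 0 : ℂ) - Complex.I * n 1) = 1 - (n 2 : ℂ) ^ 2 := by
    have : ((n 0 : ℂ)) ^ 2 + (n 1 : ℂ) ^ 2 + (n 2 : ℂ) ^ 2 = 1 := by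
      simpa using congrArg Complex.ofReal h1
    linear_combination this - (n 1 : ℂ) ^ 2 * Complex.I_sq
  have hs := (solid_eq_intCoeff hc l m).1
  -- The derivative in Rodrigues' formula is (l+m)! times a Taylor coefficient of (X² - 1)^l at n₂.
  have hd : (Polynomial.derivative^[l + m] ((Polynomial.X ^ 2 - 1) ^ l : Polynomial ℝ)).eval (n 2)
      = ((l + m)! : ℕ) * intCoeff ((Polynomial.X ^ 2 + Polynomial.C (2 * n 2) * Polynomial.X
        + Polynomial.C (n 2 ^ 2 - 1)) ^ l) (l + m) := by
    have ht : Polynomial.taylor (n 2) ((Polynomial.X ^ 2 - 1) ^ l)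
        = (Polynomial.X ^ 2 + Polynomial.C (2 * n 2) * Polynomial.X
        + Polynomial.C (n 2 ^ 2 - 1)) ^ l := by
      simp only [Polynomial.taylor_apply, Polynomial.pow_comp, Polynomial.sub_comp,
        Polynomial.X_comp, Polynomial.one_comp, map_sub, map_mul, map_pow, map_one, map_ofNat]
      congr 1
      ring
    rw [← ht, ← Polynomial.factorial_smul_hasseDeriv]
    have e : ((l : ℤ) + m) = ((l + m : ℕ) : ℤ) := by push_cast; ring
    rw [e]
    simp only [intCoeff, Int.natCast_nonneg, if_true, Int.toNat_natCast, Polynomial.taylor_coeff]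
    simp
  unfold sphericalHarmonicNat solidY solidAt
  rw [hs, hd]
  have hw : Real.sqrt ((2 * (l : ℝ) + 1) / (4 * Real.pi) * (((l - m)! : ℕ) : ℝ) / (((l + m)! : ℕ) : ℝ))
      * ((l + m)! : ℕ) = Real.sqrt ((2 * (l : ℝ) + 1) / (4 * Real.pi)) * ladderWeight l m := by
    unfold ladderWeight
    rw [show ((l : ℤ) + m).toNat = l + m by omega, show ((l : ℤ) - m).toNat = l - m by omega,
      ← Real.sqrt_mul (by positivity)]
    have hf : (0 : ℝ) < ((l + m)! : ℕ) := by positivity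
    nth_rewrite 2 [← Real.sqrt_sq hf.le]
    rw [← Real.sqrt_mul (by positivity)]
    congr 1
    push_cast
    field_simp
  have hw' : ((Real.sqrt ((2 * (l : ℝ) + 1) / (4 * Real.pi) * (((l - m)! : ℕ) : ℝ)
      / (((l + m)! : ℕ) : ℝ)) : ℝ) : ℂ) * ((l + m)! : ℕ)
      = (Real.sqrt ((2 * (l : ℝ) + 1) / (4 * Real.pi)) : ℂ) * (ladderWeight l m : ℂ) := by
    exact_mod_cast hw
  unfold harmonicNorm
  push_cast at hw' ⊢
  rw [zpow_natCast]
  generalize Real.sqrt ((2 * (l : ℝ) + 1) / (4 * Real.pi) * ((l - m)! : ℝ) / ((l + m)! : ℝ)) = S at *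
  generalize Real.sqrt ((2 * (l : ℝ) + 1) / (4 * Real.pi)) = S' at *
  linear_combination ((-1 : ℂ) ^ m * ((n 0 : ℂ) + Complex.I * n 1) ^ m
    * (intCoeff ((Polynomial.X ^ 2 + Polynomial.C (2 * n 2) * Polynomial.X
        + Polynomial.C (n 2 ^ 2 - 1)) ^ l) (l + m) : ℂ) / (2 ^ l * (l ! : ℂ))) * hw'

lemma sphericalHarmonic_eq {l : ℕ} {m : ℤ} (hm : |m| ≤ (l : ℤ)) {n : Space} (hn : ‖n‖ = 1) :
    sphericalHarmonic l m n = solidY l m n := by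
  unfold sphericalHarmonic
  split_ifs with h
  · rw [sphericalHarmonicNat_eq (by rw [abs_le] at hm; omega) hn]
    congr 1; omega
  · rw [sphericalHarmonicNat_eq (by rw [abs_le] at hm; omega) hn, conj_solidY,
      show -((m.natAbs : ℕ) : ℤ) = m by omega, zpow_natCast, ← mul_assoc, ← mul_pow]
    norm_num

/-! ### Rotations -/

/-- The north pole of the unit sphere. -/
def pole : Space := !₂[0, 0, 1]

/-- Rotation about the second coordinate axis. -/
def rotY (t : ℝ) (n : Space) : Space :=
  !₂[n 0 * Real.cos t + n 2 * Real.sin t, n 1, -(n 0 * Real.sin t) + n 2 * Real.cos t]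

/-- Rotation about the third coordinate axis. -/
def rotZ (t : ℝ) (n : Space) : Space :=
  !₂[n 0 * Real.cos t - n 1 * Real.sin t, n 0 * Real.sin t + n 1 * Real.cos t, n 2]

section Coordinates

variable (t : ℝ) (n : Space)

@[simp] lemma pole_zero : pole 0 = 0 := rfl
@[simp] lemma pole_one : pole 1 = 0 := rfl
@[simp] lemma pole_two : pole 2 = 1 := rfl
lemma rotY_zero : rotY t n 0 = n 0 * Real.cos t + n 2 * Real.sin t := rfl
lemma rotY_one : rotY t n 1 = n 1 := rfl
lemma rotY_two : rotY t n 2 = -(n 0 * Real.sin t) + n 2 * Real.cos t := rfl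
lemma rotZ_zero : rotZ t n 0 = n 0 * Real.cos t - n 1 * Real.sin t := rfl
lemma rotZ_one : rotZ t n 1 = n 0 * Real.sin t + n 1 * Real.cos t := rfl
lemma rotZ_two : rotZ t n 2 = n 2 := rfl

end Coordinates

lemma space_ext {n k : Space} (h0 : n 0 = k 0) (h1 : n 1 = k 1) (h2 : n 2 = k 2) : n = k := by
  ext i
  fin_cases i <;> assumption

lemma norm_pole : ‖pole‖ = 1 := by
  have : ‖pole‖ ^ 2 = 1 := by rw [norm_sq_eq]; simp
  nlinarith [norm_nonneg pole]

lemma norm_rotY (t : ℝ) (n : Space) : ‖rotY t n‖ = ‖n‖ := by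
  have : ‖rotY t n‖ ^ 2 = ‖n‖ ^ 2 := by
    rw [norm_sq_eq, norm_sq_eq, rotY_zero, rotY_one, rotY_two]
    linear_combination (n 0 ^ 2 + n 2 ^ 2) * Real.sin_sq_add_cos_sq t
  exact (pow_left_inj₀ (norm_nonneg _) (norm_nonneg _) two_ne_zero).mp this

lemma norm_rotZ (t : ℝ) (n : Space) : ‖rotZ t n‖ = ‖n‖ := by
  have : ‖rotZ t n‖ ^ 2 = ‖n‖ ^ 2 := by
    rw [norm_sq_eq, norm_sq_eq, rotZ_zero, rotZ_one, rotZ_two]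
    linear_combination (n 0 ^ 2 + n 1 ^ 2) * Real.sin_sq_add_cos_sq t
  exact (pow_left_inj₀ (norm_nonneg _) (norm_nonneg _) two_ne_zero).mp this

lemma rotY_rotY_neg (t : ℝ) (n : Space) : rotY t (rotY (-t) n) = n := by
  apply space_ext
  · simp only [rotY_zero, rotY_two, Real.cos_neg, Real.sin_neg]
    linear_combination n 0 * Real.sin_sq_add_cos_sq t
  · rfl
  · simp only [rotY_zero, rotY_two, Real.cos_neg, Real.sin_neg]
    linear_combination n 2 * Real.sin_sq_add_cos_sq t

lemma rotZ_rotZ_neg (t : ℝ) (n : Space) : rotZ t (rotZ (-t) n) = n := by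
  apply space_ext
  · simp only [rotZ_zero, rotZ_one, Real.cos_neg, Real.sin_neg]
    linear_combination n 0 * Real.sin_sq_add_cos_sq t
  · simp only [rotZ_zero, rotZ_one, Real.cos_neg, Real.sin_neg]
    linear_combination n 1 * Real.sin_sq_add_cos_sq t
  · rfl

@[simp] lemma rotY_at_zero (n : Space) : rotY 0 n = n := by
  apply space_ext <;> simp [rotY_zero, rotY_one, rotY_two]

@[simp] lemma rotZ_at_zero (n : Space) : rotZ 0 n = n := by
  apply space_ext <;> simp [rotZ_zero, rotZ_one, rotZ_two]

lemma exists_rotation {n : Space} (hn : ‖n‖ = 1) : ∃ τ θ : ℝ, n = rotZ τ (rotY θ pole) := by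
  have h1 : n 0 ^ 2 + n 1 ^ 2 + n 2 ^ 2 = 1 := by rw [← norm_sq_eq, hn]; norm_num
  set w : ℂ := ⟨n 0, n 1⟩ with hw
  have hz : -1 ≤ n 2 ∧ n 2 ≤ 1 := by constructor <;> nlinarith [sq_nonneg (n 0), sq_nonneg (n 1)]
  have hs : Real.sin (Real.arccos (n 2)) = ‖w‖ := by
    rw [Real.sin_arccos, Complex.norm_def, Complex.normSq_mk]
    congr 1; linarith
  refine ⟨w.arg, Real.arccos (n 2), space_ext ?_ ?_ ?_⟩
  · rw [rotZ_zero, rotY_zero, rotY_one, hs]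
    have := Complex.norm_mul_cos_arg w
    simp only [pole_zero, pole_one, pole_two]
    linarith
  · rw [rotZ_one, rotY_zero, rotY_one, hs]
    have := Complex.norm_mul_sin_arg w
    simp only [pole_zero, pole_one, pole_two]
    linarith
  · rw [rotZ_two, rotY_two, Real.cos_arccos hz.1 hz.2]
    simp

lemma eq_of_hasDerivAt_zero {G : ℝ → ℂ} (h : ∀ t, HasDerivAt G 0 t) (s t : ℝ) : G s = G t :=
  is_const_of_deriv_eq_zero (fun x => (h x).differentiableAt) (fun x => (h x).deriv) s t

/-- A function which is constant along the rotations is constant on the sphere. -/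
lemma eq_pole_of_invariant {G : Space → ℂ}
    (hY : ∀ n t, HasDerivAt (fun s => G (rotY s n)) 0 t)
    (hZ : ∀ n t, HasDerivAt (fun s => G (rotZ s n)) 0 t) {n : Space} (hn : ‖n‖ = 1) :
    G n = G pole := by
  obtain ⟨τ, θ, rfl⟩ := exists_rotation hn
  have h1 := eq_of_hasDerivAt_zero (hZ (rotY θ pole)) τ 0
  have h2 := eq_of_hasDerivAt_zero (hY pole) θ 0
  simp only [rotY_at_zero, rotZ_at_zero] at h1 h2
  rw [h1, h2]

/-- A function of two directions which is constant along simultaneous rotations vanishes when it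
vanishes with the second direction at the pole. -/
lemma eq_zero_of_invariant_pair {G : Space → Space → ℂ}
    (hY : ∀ n k t, HasDerivAt (fun s => G (rotY s n) (rotY s k)) 0 t)
    (hZ : ∀ n k t, HasDerivAt (fun s => G (rotZ s n) (rotZ s k)) 0 t)
    (h0 : ∀ n, ‖n‖ = 1 → G n pole = 0) {n k : Space} (hn : ‖n‖ = 1) (hk : ‖k‖ = 1) :
    G n k = 0 := by
  obtain ⟨τ, θ, rfl⟩ := exists_rotation hk
  have h1 := eq_of_hasDerivAt_zero (hZ (rotZ (-τ) n) (rotY θ pole)) τ 0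
  have h2 := eq_of_hasDerivAt_zero (hY (rotY (-θ) (rotZ (-τ) n)) pole) θ 0
  simp only [rotY_at_zero, rotZ_at_zero, rotY_rotY_neg, rotZ_rotZ_neg] at h1 h2
  rw [h1, h2]
  exact h0 _ (by rw [norm_rotY, norm_rotZ, hn])

section CoordinateDerivatives

variable (n : Space) (t : ℝ)

lemma hasDerivAt_rotY_zero : HasDerivAt (fun s => ((rotY s n 0 : ℝ) : ℂ)) (rotY t n 2 : ℝ) t := by
  apply HasDerivAt.ofReal_comp
  simp only [rotY_zero, rotY_two]
  refine (((Real.hasDerivAt_cos t).const_mul (n 0)).add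
    ((Real.hasDerivAt_sin t).const_mul (n 2))).congr_deriv ?_
  ring

lemma hasDerivAt_rotY_one : HasDerivAt (fun s => ((rotY s n 1 : ℝ) : ℂ)) 0 t := by
  simp only [rotY_one]; exact hasDerivAt_const t _

lemma hasDerivAt_rotY_two :
    HasDerivAt (fun s => ((rotY s n 2 : ℝ) : ℂ)) (-(rotY t n 0 : ℝ) : ℂ) t := by
  rw [← Complex.ofReal_neg]
  apply HasDerivAt.ofReal_comp
  simp only [rotY_zero, rotY_two]
  refine (((Real.hasDerivAt_sin t).const_mul (n 0)).neg.add
    ((Real.hasDerivAt_cos t).const_mul (n 2))).congr_deriv ?_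
  ring

lemma hasDerivAt_rotZ_zero :
    HasDerivAt (fun s => ((rotZ s n 0 : ℝ) : ℂ)) (-(rotZ t n 1 : ℝ) : ℂ) t := by
  rw [← Complex.ofReal_neg]
  apply HasDerivAt.ofReal_comp
  simp only [rotZ_zero, rotZ_one]
  refine (((Real.hasDerivAt_cos t).const_mul (n 0)).sub
    ((Real.hasDerivAt_sin t).const_mul (n 1))).congr_deriv ?_
  ring

lemma hasDerivAt_rotZ_one : HasDerivAt (fun s => ((rotZ s n 1 : ℝ) : ℂ)) (rotZ t n 0 : ℝ) t := by
  apply HasDerivAt.ofReal_comp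
  simp only [rotZ_zero, rotZ_one]
  refine (((Real.hasDerivAt_sin t).const_mul (n 0)).add
    ((Real.hasDerivAt_cos t).const_mul (n 1))).congr_deriv ?_
  ring

lemma hasDerivAt_rotZ_two : HasDerivAt (fun s => ((rotZ s n 2 : ℝ) : ℂ)) 0 t := by
  simp only [rotZ_two]; exact hasDerivAt_const t _

end CoordinateDerivatives

/-! ### Multiplets -/

/-- The infinitesimal rotation about the second axis acting on a multiplet of spin `l`. -/
def ladderAct (l : ℕ) (f : ℤ → ℂ) (m : ℤ) : ℂ :=
  (ladder l m * f (m + 1) - ladder l (m - 1) * f (m - 1)) / 2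

lemma harmonicNorm_step (l : ℕ) (m : ℤ) : (harmonicNorm l m : ℂ) * (l + m + 1)
    * (if |m + 1| ≤ (l : ℤ) then 1 else 0)
    = -(ladder l m * harmonicNorm l (m + 1)) * (if |m + 1| ≤ (l : ℤ) then 1 else 0) := by
  split_ifs with h
  swap
  · simp
  rw [abs_le] at h
  have key : harmonicNorm l m * (l + m + 1) = -(ladder l m * harmonicNorm l (m + 1)) := by
    unfold harmonicNorm
    -- At m = -l - 1 both sides vanish by their ladder factors; the ratio of weights makes sense
    -- only from m = -l on.
    rcases eq_or_lt_of_le (show -(l : ℤ) - 1 ≤ m by omega) with h1 | h1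
    · rw [← h1, ladder_bot]; push_cast; ring
    have := ladder_mul_ladderWeight (l := l) (m := m) (by omega) (by omega)
    rw [zpow_add₀ (by norm_num : (-1 : ℝ) ≠ 0)]
    linear_combination -((-1) ^ m * Real.sqrt ((2 * (l : ℝ) + 1) / (4 * Real.pi))
      / (2 ^ l * (l ! : ℕ))) * this
  rw [mul_one, mul_one]
  exact_mod_cast key

/-- The normalisation constants match the symmetric ladder coefficients only inside the multiplet,
as `ladderWeight` takes truncated values outside. There the solid harmonic vanishes, so the product
relation holds for every order. -/
lemma harmonicNorm_mul_solid_succ (ξ η z : ℂ) (l : ℕ) (m : ℤ) :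
    (harmonicNorm l m : ℂ) * ((l + m + 1) * solid ξ η z l (m + 1))
      = -(ladder l m * (harmonicNorm l (m + 1) * solid ξ η z l (m + 1))) := by
  by_cases h : |m + 1| ≤ (l : ℤ)
  · have := harmonicNorm_step l m
    rw [if_pos h] at this
    linear_combination solid ξ η z l (m + 1) * this
  · rw [solid_eq_zero _ _ _ _ _ (not_le.mp h)]; ring

lemma harmonicNorm_mul_solid_pred (ξ η z : ℂ) (l : ℕ) (m : ℤ) :
    (harmonicNorm l m : ℂ) * ((l - m + 1) * solid ξ η z l (m - 1))
      = -(ladder l (m - 1) * (harmonicNorm l (m - 1) * solid ξ η z l (m - 1))) := by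
  have h := harmonicNorm_mul_solid_succ η ξ z l (-m)
  rw [show -m + 1 = -(m - 1) by ring, harmonicNorm_neg, harmonicNorm_neg, ladder_neg,
    solid_neg η ξ z] at h
  have hne : (-1 : ℂ) ^ (m - 1) ≠ 0 := zpow_ne_zero _ (by norm_num)
  apply mul_left_cancel₀ hne
  push_cast at h
  linear_combination h

/-- Here ξ and η both move with velocity z, and z with velocity -(ξ + η)/2. The raising and lowering
identities recast the resulting derivative in terms of the two neighbouring orders. -/
lemma hasDerivAt_solidY_rotY (l : ℕ) (m : ℤ) (n : Space) (t : ℝ) :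
    HasDerivAt (fun s => solidY l m (rotY s n)) (ladderAct l (fun k => solidY l k (rotY t n)) m) t := by
  have h0 := hasDerivAt_rotY_zero n t
  have h1 := hasDerivAt_rotY_one n t
  have h2 := hasDerivAt_rotY_two n t
  refine ((hasDerivAt_solid (h0.add (h1.const_mul Complex.I)) (h0.sub (h1.const_mul Complex.I))
    h2 l m).const_mul (harmonicNorm l m : ℂ)).congr_deriv ?_
  set ξ := ((rotY t n 0 : ℝ) : ℂ) + Complex.I * ((rotY t n 1 : ℝ) : ℂ) with hξ
  set η := ((rotY t n 0 : ℝ) : ℂ) - Complex.I * ((rotY t n 1 : ℝ) : ℂ) with hη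
  have e0 : ((rotY t n 0 : ℝ) : ℂ) = (ξ + η) / 2 := by rw [hξ, hη]; ring
  have r1 := solid_raise ξ η (rotY t n 2 : ℝ) l m
  have r2 := solid_lower ξ η (rotY t n 2 : ℝ) l m
  have s1 := harmonicNorm_mul_solid_succ ξ η (rotY t n 2 : ℝ) l m
  have s2 := harmonicNorm_mul_solid_pred ξ η (rotY t n 2 : ℝ) l m
  simp only [ladderAct, solidY, solidAt, solidDeriv, ← hξ, ← hη]
  rw [e0]
  linear_combination (s2 - s1) / 2 - (harmonicNorm l m : ℂ) * (r2 - r1) / 2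

lemma hasDerivAt_solidY_rotZ (l : ℕ) (m : ℤ) (n : Space) (t : ℝ) :
    HasDerivAt (fun s => solidY l m (rotZ s n)) (Complex.I * m * solidY l m (rotZ t n)) t := by
  have h0 := hasDerivAt_rotZ_zero n t
  have h1 := hasDerivAt_rotZ_one n t
  have h2 := hasDerivAt_rotZ_two n t
  refine ((hasDerivAt_solid (h0.add (h1.const_mul Complex.I)) (h0.sub (h1.const_mul Complex.I))
    h2 l m).const_mul (harmonicNorm l m : ℂ)).congr_deriv ?_
  set ξ := ((rotZ t n 0 : ℝ) : ℂ) + Complex.I * ((rotZ t n 1 : ℝ) : ℂ) with hξ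
  set η := ((rotZ t n 0 : ℝ) : ℂ) - Complex.I * ((rotZ t n 1 : ℝ) : ℂ) with hη
  have e0 : -((rotZ t n 1 : ℝ) : ℂ) + Complex.I * ((rotZ t n 0 : ℝ) : ℂ) = Complex.I * ξ := by
    rw [hξ]; linear_combination -((rotZ t n 1 : ℝ) : ℂ) * Complex.I_sq
  have e1 : -((rotZ t n 1 : ℝ) : ℂ) - Complex.I * ((rotZ t n 0 : ℝ) : ℂ) = -(Complex.I * η) := by
    rw [hη]; linear_combination -((rotZ t n 1 : ℝ) : ℂ) * Complex.I_sq
  have r1 := solid_raise ξ η (rotZ t n 2 : ℝ) l (m - 1)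
  have r2 := solid_lower ξ η (rotZ t n 2 : ℝ) l (m + 1)
  rw [sub_add_cancel] at r1
  rw [add_sub_cancel_right] at r2
  push_cast at r1 r2
  simp only [solidY, solidAt, solidDeriv, ← hξ, ← hη]
  rw [e0, e1]
  linear_combination (harmonicNorm l m : ℂ) * (-Complex.I * r1 / 2 + Complex.I * r2 / 2)

lemma solidY_pole (l : ℕ) (m : ℤ) : solidY l m pole
    = if m = 0 then (Real.sqrt ((2 * (l : ℝ) + 1) / (4 * Real.pi)) : ℂ) else 0 := by
  unfold solidY solidAt
  simp only [pole_zero, pole_one, pole_two, Complex.ofReal_zero, mul_zero, add_zero, sub_zero,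
    solid_pole, Complex.ofReal_one, mul_one]
  split_ifs with h
  · subst h
    have : ladderWeight l 0 = (l ! : ℕ) := by
      unfold ladderWeight
      simp only [add_zero, sub_zero, Int.toNat_natCast]
      push_cast
      exact Real.sqrt_mul_self (by positivity)
    unfold harmonicNorm
    rw [this]
    have : ((l ! : ℕ) : ℂ) ≠ 0 := by exact_mod_cast l.factorial_ne_zero
    push_cast
    field_simp
  · simp

lemma continuous_solidAt (l : ℕ) (m : ℤ) : Continuous (solidAt l m) := by
  unfold solidAt
  induction l generalizing m with
  | zero => simp only [solid_zero]; exact continuous_const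
  | succ l ih =>
    simp only [solid_succ]
    have := ih (m - 1)
    have := ih m
    have := ih (m + 1)
    fun_prop

lemma continuous_solidY (l : ℕ) (m : ℤ) : Continuous (solidY l m) :=
  continuous_const.mul (continuous_solidAt l m)

/-- The infinitesimal rotation is antisymmetric for the bilinear pairing of multiplets. Contractions
of two multiplets are therefore rotation invariant. -/
lemma sum_ladderAct_mul (l : ℕ) (f g : ℤ → ℂ) :
    ∑ m ∈ Finset.Icc (-(l : ℤ)) l, (ladderAct l f m * g m + f m * ladderAct l g m) = 0 := by
  have h1 := sum_Icc_shift l (fun m => (ladder l m : ℂ) * f (m + 1) * g m)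
    (by simp [ladder_self]) (by simp [ladder_bot])
  have h2 := sum_Icc_shift l (fun m => (ladder l m : ℂ) * f m * g (m + 1))
    (by simp [ladder_self]) (by simp [ladder_bot])
  simp only [sub_add_cancel] at h1 h2
  have e : ∀ m, ladderAct l f m * g m + f m * ladderAct l g m
      = (ladder l m * f (m + 1) * g m - ladder l (m - 1) * f m * g (m - 1)) / 2
        + (ladder l m * f m * g (m + 1) - ladder l (m - 1) * f (m - 1) * g m) / 2 := by
    intro m; unfold ladderAct; ring
  simp only [e, Finset.sum_add_distrib, ← Finset.sum_div, Finset.sum_sub_distrib, h1, h2]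
  ring

lemma conj_ladderAct (l : ℕ) (f : ℤ → ℂ) (m : ℤ) :
    conj (ladderAct l f m) = ladderAct l (fun k => conj (f k)) m := by
  have : conj (2 : ℂ) = 2 := Complex.conj_eq_iff_real.mpr ⟨2, by norm_num⟩
  simp [ladderAct, this]

/-! ### The addition theorem -/

/-- The invariant kernel `∑_m Y_{lm}(n) conj Y_{lm}(k)`. -/
def zonal (l : ℕ) (n k : Space) : ℂ :=
  ∑ m ∈ Finset.Icc (-(l : ℤ)) l, solidY l m n * conj (solidY l m k)

lemma hasDerivAt_conj_ofReal {f : ℝ → ℂ} {f' : ℂ} {t : ℝ} (h : HasDerivAt f f' t) :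
    HasDerivAt (fun s => conj (f s)) (conj f') t := by
  simpa using h.star

lemma hasDerivAt_zonal_rotY (l : ℕ) (n k : Space) (t : ℝ) :
    HasDerivAt (fun s => zonal l (rotY s n) (rotY s k)) 0 t := by
  have h : ∀ m ∈ Finset.Icc (-(l : ℤ)) l, HasDerivAt
      (fun s => solidY l m (rotY s n) * conj (solidY l m (rotY s k))) _ t := fun m _ =>
    (hasDerivAt_solidY_rotY l m n t).mul (hasDerivAt_conj_ofReal (hasDerivAt_solidY_rotY l m k t))
  refine (HasDerivAt.fun_sum h).congr_deriv ?_
  simp only [conj_ladderAct]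
  exact sum_ladderAct_mul l _ _

lemma hasDerivAt_zonal_rotZ (l : ℕ) (n k : Space) (t : ℝ) :
    HasDerivAt (fun s => zonal l (rotZ s n) (rotZ s k)) 0 t := by
  have h : ∀ m ∈ Finset.Icc (-(l : ℤ)) l, HasDerivAt
      (fun s => solidY l m (rotZ s n) * conj (solidY l m (rotZ s k))) _ t := fun m _ =>
    (hasDerivAt_solidY_rotZ l m n t).mul (hasDerivAt_conj_ofReal (hasDerivAt_solidY_rotZ l m k t))
  refine (HasDerivAt.fun_sum h).congr_deriv (Finset.sum_eq_zero fun m _ => ?_)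
  simp only [map_mul, Complex.conj_I, map_intCast]
  ring

/-- The sum is rotation invariant, hence constant on the sphere, and at the pole only the order m =
0 contributes. -/
lemma zonal_self (l : ℕ) {n : Space} (hn : ‖n‖ = 1) :
    zonal l n n = (2 * l + 1) / (4 * Real.pi) := by
  rw [eq_pole_of_invariant (G := fun n => zonal l n n) (fun n t => hasDerivAt_zonal_rotY l n n t)
    (fun n t => hasDerivAt_zonal_rotZ l n n t) hn]
  unfold zonal
  rw [Finset.sum_eq_single_of_mem 0 (by simp)]
  · rw [solidY_pole, if_pos rfl, Complex.conj_ofReal, ← Complex.ofReal_mul,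
      Real.mul_self_sqrt (by positivity)]
    push_cast; ring
  · intro m _ hm
    rw [solidY_pole, if_neg hm, zero_mul]

lemma norm_solidY_sq_le (l : ℕ) (m : ℤ) {n : Space} (hn : ‖n‖ = 1) :
    ‖solidY l m n‖ ^ 2 ≤ (2 * l + 1) / (4 * Real.pi) := by
  by_cases hm : |m| ≤ (l : ℤ)
  swap
  · rw [solidY_eq_zero (not_le.mp hm)]; simp; positivity
  have h : ∑ k ∈ Finset.Icc (-(l : ℤ)) l, ‖solidY l k n‖ ^ 2 = (2 * l + 1) / (4 * Real.pi) := by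
    have := zonal_self l hn
    unfold zonal at this
    simp only [Complex.mul_conj, Complex.normSq_eq_norm_sq] at this
    exact_mod_cast this
  rw [← h]
  exact Finset.single_le_sum (f := fun k => ‖solidY l k n‖ ^ 2) (fun _ _ => sq_nonneg _)
    (Finset.mem_Icc.mpr (abs_le.mp hm))

/-! ### The surface measure -/

instance : IsFiniteMeasure solidAngle :=
  inferInstanceAs (IsFiniteMeasure (volume : Measure Space).toSphere)

lemma solidAngle_univ : solidAngle.real Set.univ = 4 * Real.pi := by
  unfold solidAngle
  rw [Measure.toSphere_real_apply_univ, measureReal_def, EuclideanSpace.volume_ball_fin_three]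
  simp
  rw [ENNReal.toReal_ofReal (by positivity)]
  ring

lemma norm_dir (n : Dir) : ‖(n : Space)‖ = 1 := by simp

/-- The action of a linear isometry on directions. -/
def dirMap (e : Space ≃ₗᵢ[ℝ] Space) (n : Dir) : Dir :=
  ⟨e n, by simp⟩

lemma continuous_dirMap (e : Space ≃ₗᵢ[ℝ] Space) : Continuous (dirMap e) :=
  (e.continuous.comp continuous_subtype_val).subtype_mk _

-- The surface measure of a set is a multiple of the volume of the cone over it; isometries map
-- cones to cones and preserve volume.
open scoped Pointwise in
lemma measurePreserving_dirMap (e : Space ≃ₗᵢ[ℝ] Space) :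
    MeasurePreserving (dirMap e) solidAngle solidAngle := by
  refine ⟨(continuous_dirMap e).measurable, ?_⟩
  ext s hs
  rw [Measure.map_apply (continuous_dirMap e).measurable hs]
  unfold solidAngle
  rw [Measure.toSphere_apply' _ hs,
    Measure.toSphere_apply' _ ((continuous_dirMap e).measurable hs)]
  congr 1
  have hset : Set.Ioo (0 : ℝ) 1 • ((↑) '' (dirMap e ⁻¹' s) : Set Space)
      = e ⁻¹' (Set.Ioo (0 : ℝ) 1 • ((↑) '' s : Set Space)) := by
    ext x
    simp only [Set.mem_smul, Set.mem_preimage, Set.mem_image]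
    constructor
    · rintro ⟨c, hc, y, ⟨n, hn, rfl⟩, rfl⟩
      exact ⟨c, hc, e n, ⟨dirMap e n, hn, rfl⟩, by simp⟩
    · rintro ⟨c, hc, y, ⟨n, hn, rfl⟩, hx⟩
      refine ⟨c, hc, e.symm n, ⟨⟨e.symm n, by simp⟩, ?_, rfl⟩, ?_⟩
      · have : dirMap e ⟨e.symm n, by simp⟩ = n := Subtype.ext (e.apply_symm_apply _)
        show dirMap e _ ∈ s
        rwa [this]
      · rw [← e.symm_apply_apply x, ← hx]; simp
  rw [hset]
  exact (LinearIsometryEquiv.measurePreserving e).measure_preimage_equiv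
    (f := e.toHomeomorph.toMeasurableEquiv) _

lemma rotY_neg_rotY (t : ℝ) (n : Space) : rotY (-t) (rotY t n) = n := by
  have := rotY_rotY_neg (-t) n
  rwa [neg_neg] at this

lemma rotZ_neg_rotZ (t : ℝ) (n : Space) : rotZ (-t) (rotZ t n) = n := by
  have := rotZ_rotZ_neg (-t) n
  rwa [neg_neg] at this

/-- `rotY` as a linear isometry. -/
def rotYEquiv (t : ℝ) : Space ≃ₗᵢ[ℝ] Space where
  toFun := rotY t
  map_add' x y := by
    apply space_ext <;> simp only [rotY_zero, rotY_one, rotY_two, PiLp.add_apply] <;> ring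
  map_smul' c x := by
    apply space_ext <;> simp only [rotY_zero, rotY_one, rotY_two, PiLp.smul_apply, smul_eq_mul,
      RingHom.id_apply] <;> ring
  invFun := rotY (-t)
  left_inv := rotY_neg_rotY t
  right_inv := rotY_rotY_neg t
  norm_map' := norm_rotY t

/-- `rotZ` as a linear isometry. -/
def rotZEquiv (t : ℝ) : Space ≃ₗᵢ[ℝ] Space where
  toFun := rotZ t
  map_add' x y := by
    apply space_ext <;> simp only [rotZ_zero, rotZ_one, rotZ_two, PiLp.add_apply] <;> ring
  map_smul' c x := by
    apply space_ext <;> simp only [rotZ_zero, rotZ_one, rotZ_two, PiLp.smul_apply, smul_eq_mul,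
      RingHom.id_apply] <;> ring
  invFun := rotZ (-t)
  left_inv := rotZ_neg_rotZ t
  right_inv := rotZ_rotZ_neg t
  norm_map' := norm_rotZ t

lemma integral_dirMap (e : Space ≃ₗᵢ[ℝ] Space) (F : Dir → ℂ) (hF : Continuous F) :
    ∫ n, F (dirMap e n) ∂solidAngle = ∫ n, F n ∂solidAngle := by
  have h := measurePreserving_dirMap e
  rw [← integral_map h.measurable.aemeasurable (by rw [h.map_eq]; exact hF.aestronglyMeasurable),
    h.map_eq]

lemma integrable_dir {F : Dir → ℂ} (hF : Continuous F) : Integrable F solidAngle :=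
  hF.integrable_of_hasCompactSupport (HasCompactSupport.of_compactSpace F)

/-- The integral over the sphere of an infinitesimal rotation vanishes. -/
lemma integral_eq_zero_of_rotation {R : ℝ → Space ≃ₗᵢ[ℝ] Space} {p q : Space → ℂ}
    (hp : Continuous p) (hq : Continuous q)
    (h : ∀ n t, HasDerivAt (fun s => p (R s n)) (q (R t n)) t) :
    ∫ n : Dir, q n ∂solidAngle = 0 := by
  have hpd : Continuous fun n : Dir => p n := hp.comp continuous_subtype_val
  have hqd : Continuous fun n : Dir => q n := hq.comp continuous_subtype_val
  obtain ⟨C, hC⟩ := isCompact_univ.exists_bound_of_continuousOn hqd.continuousOn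
  have hd := (hasDerivAt_integral_of_dominated_loc_of_deriv_le (μ := solidAngle) (x₀ := (0 : ℝ))
    (F := fun s (n : Dir) => p (R s n)) (F' := fun s (n : Dir) => q (R s n)) (bound := fun _ => C)
    (s := Set.univ) Filter.univ_mem
    (Filter.Eventually.of_forall fun s => (hpd.comp (continuous_dirMap (R s))).aestronglyMeasurable)
    (integrable_dir (hpd.comp (continuous_dirMap (R 0))))
    (hqd.comp (continuous_dirMap (R 0))).aestronglyMeasurable
    (Filter.Eventually.of_forall fun n s _ => hC (dirMap (R s) n) (Set.mem_univ _))
    (integrable_const C) (Filter.Eventually.of_forall fun n s _ => h n s)).2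
  -- By invariance of the measure the integral does not depend on the parameter, so its derivative,
  -- computed under the integral sign, is zero.
  have hconst : (fun s => ∫ n : Dir, p (R s n) ∂solidAngle) = fun _ => ∫ n : Dir, p n ∂solidAngle :=
    funext fun s => integral_dirMap (R s) (fun n => p n) hpd
  rw [hconst] at hd
  have h0 := hd.unique (hasDerivAt_const _ _)
  have := integral_dirMap (R 0) (fun n => q n) hqd
  exact this.symm.trans h0

/-! ### Orthonormality -/

/-- The inner products of the solid harmonics over the sphere. -/
def harmonicInner (l : ℕ) (m : ℤ) (l' : ℕ) (m' : ℤ) : ℂ := ∫ n : Dir, solidY l m n * conj (solidY l' m' n) ∂solidAngle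

lemma continuous_conj_solidY (l : ℕ) (m : ℤ) : Continuous fun n => conj (solidY l m n) :=
  Complex.continuous_conj.comp (continuous_solidY l m)

lemma integrable_harmonicInner (l : ℕ) (m : ℤ) (l' : ℕ) (m' : ℤ) :
    Integrable (fun n : Dir => solidY l m n * conj (solidY l' m' n)) solidAngle :=
  integrable_dir (((continuous_solidY l m).mul (continuous_conj_solidY l' m')).comp
    continuous_subtype_val)

lemma harmonicInner_of_order_ne {l l' : ℕ} {m m' : ℤ} (h : m ≠ m') :
    harmonicInner l m l' m' = 0 := by
  have := integral_eq_zero_of_rotation (R := rotZEquiv)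
    (p := fun n => solidY l m n * conj (solidY l' m' n))
    (q := fun n => Complex.I * (m - m') * (solidY l m n * conj (solidY l' m' n)))
    ((continuous_solidY l m).mul (continuous_conj_solidY l' m'))
    (continuous_const.mul ((continuous_solidY l m).mul (continuous_conj_solidY l' m')))
    (fun n t => by
      refine ((hasDerivAt_solidY_rotZ l m n t).mul
        (hasDerivAt_conj_ofReal (hasDerivAt_solidY_rotZ l' m' n t))).congr_deriv ?_
      simp only [map_mul, Complex.conj_I, map_intCast]
      show _ = Complex.I * (m - m') * (solidY l m (rotZ t n) * conj (solidY l' m' (rotZ t n)))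
      ring)
  rw [integral_const_mul] at this
  refine (mul_eq_zero.mp this).resolve_left (mul_ne_zero Complex.I_ne_zero (sub_ne_zero.mpr ?_))
  exact_mod_cast h

/-- The derivative of Y_{lm} conj Y_{l',m+1} along rotations about the second axis integrates to
zero. Two of its four terms pair orders differing by two and vanish; the other two give the
relation. -/
lemma harmonicInner_step (l l' : ℕ) (m : ℤ) :
    (ladder l m : ℂ) * harmonicInner l (m + 1) l' (m + 1) = ladder l' m * harmonicInner l m l' m := by
  set q : Space → ℂ := fun n => (ladder l m / 2 : ℂ) * (solidY l (m + 1) n * conj (solidY l' (m + 1) n))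
    - (ladder l (m - 1) / 2 : ℂ) * (solidY l (m - 1) n * conj (solidY l' (m + 1) n))
    + (ladder l' (m + 1) / 2 : ℂ) * (solidY l m n * conj (solidY l' (m + 2) n))
    - (ladder l' m / 2 : ℂ) * (solidY l m n * conj (solidY l' m n)) with hq
  have hqc : Continuous q := by
    have := continuous_solidY l (m + 1)
    have := continuous_solidY l (m - 1)
    have := continuous_solidY l m
    have := continuous_conj_solidY l' (m + 1)
    have := continuous_conj_solidY l' (m + 2)
    have := continuous_conj_solidY l' m
    fun_prop
  have := integral_eq_zero_of_rotation (R := rotYEquiv)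
    (p := fun n => solidY l m n * conj (solidY l' (m + 1) n)) (q := q)
    ((continuous_solidY l m).mul (continuous_conj_solidY l' (m + 1))) hqc
    (fun n t => by
      refine ((hasDerivAt_solidY_rotY l m n t).mul
        (hasDerivAt_conj_ofReal (hasDerivAt_solidY_rotY l' (m + 1) n t))).congr_deriv ?_
      show _ = q (rotY t n)
      rw [conj_ladderAct]
      simp only [ladderAct, hq]
      rw [show m + 1 + 1 = m + 2 by ring, show m + 1 - 1 = m by ring]
      ring)
  have i1 := integrable_harmonicInner l (m + 1) l' (m + 1)
  have i2 := integrable_harmonicInner l (m - 1) l' (m + 1)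
  have i3 := integrable_harmonicInner l m l' (m + 2)
  have i4 := integrable_harmonicInner l m l' m
  simp only [hq] at this
  rw [integral_sub, integral_add, integral_sub, integral_const_mul, integral_const_mul,
    integral_const_mul, integral_const_mul] at this
  rotate_left
  · exact i1.const_mul _
  · exact i2.const_mul _
  · exact (i1.const_mul _).sub (i2.const_mul _)
  · exact i3.const_mul _
  · exact ((i1.const_mul _).sub (i2.const_mul _)).add (i3.const_mul _)
  · exact i4.const_mul _
  change _ * harmonicInner l (m + 1) l' (m + 1) - _ * harmonicInner l (m - 1) l' (m + 1)
    + _ * harmonicInner l m l' (m + 2) - _ * harmonicInner l m l' m = 0 at this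
  rw [harmonicInner_of_order_ne (show m - 1 ≠ m + 1 by omega),
    harmonicInner_of_order_ne (show m ≠ m + 2 by omega)] at this
  linear_combination 2 * this

lemma harmonicInner_conj (l : ℕ) (m : ℤ) (l' : ℕ) (m' : ℤ) :
    harmonicInner l' m' l m = conj (harmonicInner l m l' m') := by
  unfold harmonicInner
  rw [← integral_conj]
  congr 1
  funext n
  simp [mul_comm]

/-- The climbing argument used for the 3j Gram sums, started just below the multiplet of smaller
degree. -/
lemma harmonicInner_of_lt {l l' : ℕ} (h : l' < l) (m : ℤ) : harmonicInner l m l' m = 0 := by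
  have out : ∀ m : ℤ, ¬ |m| ≤ (l' : ℤ) → harmonicInner l m l' m = 0 := by
    intro m hm
    unfold harmonicInner
    simp [solidY_eq_zero (not_le.mp hm)]
  by_cases hm : |m| ≤ (l' : ℤ)
  swap
  · exact out m hm
  have key : ∀ k : ℕ, harmonicInner l (-(l' : ℤ) + k) l' (-(l' : ℤ) + k) = 0 := by
    intro k
    induction k with
    | zero =>
      have := harmonicInner_step l l' (-(l' : ℤ) - 1)
      rw [ladder_bot, Complex.ofReal_zero, zero_mul, sub_add_cancel] at this
      have hp := ladder_pos (l := l) (m := -(l' : ℤ) - 1) (by omega) (by omega)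
      simpa [hp.ne'] using this
    | succ k ih =>
      have := harmonicInner_step l l' (-(l' : ℤ) + k)
      rw [ih, mul_zero, add_assoc] at this
      by_cases hk : -(l' : ℤ) + k < l
      · have hp := ladder_pos (l := l) (m := -(l' : ℤ) + k) (by omega) hk
        simpa [hp.ne'] using this
      · refine out _ fun hh => ?_
        rw [abs_le] at hh
        push_cast at hh
        omega
  rw [abs_le] at hm
  have := key (m + l').toNat
  rwa [show -(l' : ℤ) + ((m + l').toNat : ℤ) = m by omega] at this

lemma harmonicInner_of_degree_ne {l l' : ℕ} (h : l ≠ l') (m m' : ℤ) :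
    harmonicInner l m l' m' = 0 := by
  rcases eq_or_ne m m' with rfl | hm
  · rcases lt_or_gt_of_ne h with h | h
    · rw [harmonicInner_conj, harmonicInner_of_lt h, map_zero]
    · exact harmonicInner_of_lt h m
  · exact harmonicInner_of_order_ne hm

/-- All 2l + 1 norms agree by the step relation, and their sum is the constant (2l+1)/(4π) of
`zonal_self` times the area 4π. -/
lemma harmonicInner_self {l : ℕ} {m : ℤ} (hm : |m| ≤ (l : ℤ)) : harmonicInner l m l m = 1 := by
  have key : ∀ k : ℕ, k ≤ 2 * l → harmonicInner l (-(l : ℤ) + k) l (-(l : ℤ) + k)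
      = harmonicInner l (-(l : ℤ)) l (-(l : ℤ)) := by
    intro k
    induction k with
    | zero => simp
    | succ k ih =>
      intro hk
      have := harmonicInner_step l l (-(l : ℤ) + k)
      have hp := ladder_pos (l := l) (m := -(l : ℤ) + k) (by omega) (by omega)
      rw [← ih (by omega), ← mul_left_cancel₀ (by exact_mod_cast hp.ne') this]
      push_cast
      rw [add_assoc]
  have all : ∀ k ∈ Finset.Icc (-(l : ℤ)) l, harmonicInner l k l k
      = harmonicInner l (-(l : ℤ)) l (-(l : ℤ)) := by
    intro k hk
    rw [Finset.mem_Icc] at hk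
    have := key (k + l).toNat (by omega)
    rwa [show -(l : ℤ) + ((k + l).toNat : ℤ) = k by omega] at this
  have tot : ∑ k ∈ Finset.Icc (-(l : ℤ)) l, harmonicInner l k l k = 2 * l + 1 := by
    unfold harmonicInner
    rw [← integral_finsetSum _ fun k _ => integrable_harmonicInner l k l k]
    have : ∀ n : Dir, ∑ k ∈ Finset.Icc (-(l : ℤ)) l, solidY l k n * conj (solidY l k n)
        = (2 * l + 1) / (4 * Real.pi) := fun n => zonal_self l (norm_dir n)
    simp only [this]
    rw [integral_const, solidAngle_univ]
    have : (Real.pi : ℂ) ≠ 0 := by exact_mod_cast Real.pi_ne_zero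
    simp only [Complex.real_smul]
    push_cast
    field_simp
  rw [Finset.sum_congr rfl all, Finset.sum_const, Int.card_Icc, nsmul_eq_mul,
    show ((l : ℤ) + 1 - -l).toNat = 2 * l + 1 by omega] at tot
  rw [all m (Finset.mem_Icc.mpr (abs_le.mp hm))]
  have hne : (2 * l + 1 : ℂ) ≠ 0 := by exact_mod_cast Nat.succ_ne_zero (2 * l)
  apply mul_left_cancel₀ hne
  push_cast at tot
  rw [tot, mul_one]

/-! ### Powers of a linear form -/

/-- The coefficient `1 / ((n-l)!! (n+l+1)!!)` of the plane wave expansion. -/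
def planeCoeff (n l : ℕ) : ℝ :=
  if l ≤ n ∧ Even (n - l) then 1 / (((n - l)‼ * (n + l + 1)‼ : ℕ) : ℝ) else 0

lemma planeCoeff_of_lt {n l : ℕ} (h : n < l) : planeCoeff n l = 0 := by
  rw [planeCoeff, if_neg]; omega

lemma planeCoeff_add (l k : ℕ) :
    planeCoeff (l + 2 * k) l = 1 / (((2 * k)‼ * (2 * l + 2 * k + 1)‼ : ℕ) : ℝ) := by
  rw [planeCoeff, if_pos ⟨by omega, by simp⟩, Nat.add_sub_cancel_left,
    show l + 2 * k + l + 1 = 2 * l + 2 * k + 1 by ring]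

lemma planeCoeff_of_odd {n l : ℕ} (h : ¬ Even (n + l)) : planeCoeff n l = 0 := by
  rw [planeCoeff, if_neg]
  rintro ⟨h1, h2⟩
  apply h
  rw [show n + l = (n - l) + 2 * l by omega]
  exact h2.add (even_two_mul l)

/-- This is the condition that the Legendre recurrence (2l+1) t P_l = (l+1) P_{l+1} + l P_{l-1}
imposes on the coefficients (2l+1) `planeCoeff n l` of t^n / n!. The truncated l - 1 at l = 0 is
harmless, as it is multiplied by `l`. -/
lemma planeCoeff_recurrence (n l : ℕ) :
    (l : ℝ) * planeCoeff n (l - 1) + (l + 1) * planeCoeff n (l + 1)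
      = (n + 1) * ((2 * l + 1) * planeCoeff (n + 1) l) := by
  by_cases hpar : Even (n + 1 + l)
  swap
  · rw [planeCoeff_of_odd hpar, planeCoeff_of_odd (l := l + 1) (by
      rwa [show n + (l + 1) = n + 1 + l by ring])]
    rcases Nat.eq_zero_or_pos l with rfl | hl
    · simp
    · rw [planeCoeff_of_odd (l := l - 1)]
      · ring
      · intro h
        apply hpar
        rw [show n + 1 + l = n + (l - 1) + 2 by omega]
        exact h.add even_two
  by_cases hle : l ≤ n + 1
  swap
  · rw [planeCoeff_of_lt (n := n) (l := l - 1) (by omega), planeCoeff_of_lt (n := n) (by omega),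
      planeCoeff_of_lt (n := n + 1) (by omega)]
    ring
  obtain ⟨k, hk⟩ : ∃ k, n + 1 = l + 2 * k := by
    obtain ⟨r, hr⟩ := hpar
    exact ⟨r - l, by omega⟩
  have dpos : ∀ j : ℕ, ((j‼ : ℕ) : ℝ) ≠ 0 := fun j => by
    exact_mod_cast (Nat.doubleFactorial_pos j).ne'
  have hn : (n : ℝ) + 1 = l + 2 * k := by exact_mod_cast hk
  rw [hk, planeCoeff_add, hn]
  have t1 : (l : ℝ) * planeCoeff n (l - 1)
      = l * ((2 * l + 2 * k + 1) / (((2 * k)‼ * (2 * l + 2 * k + 1)‼ : ℕ) : ℝ)) := by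
    rcases Nat.eq_zero_or_pos l with rfl | hl
    · simp
    · congr 1
      rw [show n = (l - 1) + 2 * k by omega, planeCoeff_add,
        show 2 * l + 2 * k + 1 = (2 * (l - 1) + 2 * k + 1) + 2 by omega,
        Nat.doubleFactorial_add_two]
      have e : ((2 * (l - 1) + 2 * k + 1 + 2 : ℕ) : ℝ) = 2 * l + 2 * k + 1 := by
        rw [show 2 * (l - 1) + 2 * k + 1 + 2 = 2 * l + 2 * k + 1 by omega]; push_cast; ring
      have h1 := dpos (2 * k)
      have h2 := dpos (2 * (l - 1) + 2 * k + 1)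
      have h3 : (2 * (l : ℝ) + 2 * k + 1) ≠ 0 := by positivity
      rw [Nat.cast_mul, Nat.cast_mul, Nat.cast_mul, e]
      field_simp
  have t2 : planeCoeff n (l + 1)
      = (2 * k) / (((2 * k)‼ * (2 * l + 2 * k + 1)‼ : ℕ) : ℝ) := by
    rcases Nat.eq_zero_or_pos k with rfl | hk0
    · rw [planeCoeff_of_lt (by omega)]; simp
    · obtain ⟨j, rfl⟩ : ∃ j, k = j + 1 := ⟨k - 1, by omega⟩
      rw [show n = (l + 1) + 2 * j by omega, planeCoeff_add,
        show 2 * (l + 1) + 2 * j + 1 = 2 * l + 2 * (j + 1) + 1 by ring,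
        show 2 * (j + 1) = 2 * j + 2 by ring, Nat.doubleFactorial_add_two]
      have h1 := dpos (2 * j)
      have h2 := dpos (2 * l + (2 * j + 2) + 1)
      have h3 : (2 * (j : ℝ) + 2) ≠ 0 := by positivity
      push_cast
      field_simp
  rw [t1, t2]
  ring

lemma pow_div_factorial_eq {k : Space} (hk : ‖k‖ = 1) (n : ℕ) :
    (k 2 : ℂ) ^ n / (n ! : ℕ) = ∑ l ∈ Finset.range (n + 1),
      ((2 * l + 1) * planeCoeff n l : ℝ) * (solidAt l 0 k / 2 ^ l) := by
  -- On the unit sphere `A l` is the Legendre polynomial P_l evaluated at k₂.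
  set A : ℕ → ℂ := fun l => solidAt l 0 k / 2 ^ l with hA
  have hr : ((k 2 : ℂ)) ^ 2 + ((k 0 : ℂ) + Complex.I * k 1) * ((k 0 : ℂ) - Complex.I * k 1) = 1 := by
    have h1 : k 0 ^ 2 + k 1 ^ 2 + k 2 ^ 2 = 1 := by rw [← norm_sq_eq, hk]; norm_num
    have h2 : ((k 0 : ℂ)) ^ 2 + (k 1 : ℂ) ^ 2 + (k 2 : ℂ) ^ 2 = 1 := by
      simpa using congrArg Complex.ofReal h1
    linear_combination h2 - (k 1 : ℂ) ^ 2 * Complex.I_sq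
  have rec1 : ∀ l : ℕ, (2 * l + 1) * ((k 2 : ℂ) * A l) = (l + 1) * A (l + 1) + l * A (l - 1) := by
    intro l
    have h := z_mul_solid ((k 0 : ℂ) + Complex.I * k 1) ((k 0 : ℂ) - Complex.I * k 1) (k 2 : ℂ) l 0
    rw [hr] at h
    have hl : (l : ℂ) + 1 ≠ 0 := by exact_mod_cast Nat.succ_ne_zero l
    simp only [hA, solidAt]
    cases l with
    | zero => simp [solidLow] at h ⊢; linear_combination h / 2
    | succ l =>
      simp only [solidLow_succ, Nat.add_sub_cancel, Int.cast_zero, add_zero, sub_zero] at h ⊢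
      push_cast at h hl ⊢
      rw [pow_succ (2 : ℂ) (l + 1), pow_succ (2 : ℂ) l]
      have : (2 : ℂ) ^ l ≠ 0 := pow_ne_zero _ two_ne_zero
      field_simp at h ⊢
      linear_combination h
  induction n with
  | zero => simp [planeCoeff, solidAt, solid_zero]
  | succ n ih =>
    have hn : (n : ℂ) + 1 ≠ 0 := by exact_mod_cast Nat.succ_ne_zero n
    apply mul_left_cancel₀ hn
    have step : (n + 1 : ℂ) * ((k 2 : ℂ) ^ (n + 1) / ((n + 1)! : ℕ))
        = (k 2 : ℂ) * ((k 2 : ℂ) ^ n / (n ! : ℕ)) := by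
      rw [Nat.factorial_succ, pow_succ]
      have : ((n ! : ℕ) : ℂ) ≠ 0 := by exact_mod_cast n.factorial_ne_zero
      push_cast
      field_simp
    rw [step, ih, Finset.mul_sum, Finset.mul_sum]
    have e1 : ∀ l ∈ Finset.range (n + 1), (k 2 : ℂ) * (((2 * l + 1) * planeCoeff n l : ℝ) * A l)
        = ((l + 1 : ℕ) : ℂ) * planeCoeff n (l + 1 - 1) * A (l + 1)
          + (l : ℂ) * planeCoeff n l * A (l - 1) := by
      intro l _
      rw [Nat.add_sub_cancel]
      push_cast
      linear_combination (planeCoeff n l : ℂ) * rec1 l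
    rw [Finset.sum_congr rfl e1, Finset.sum_add_distrib]
    have s1 := (Finset.sum_range_succ' (fun l => ((l : ℕ) : ℂ) * planeCoeff n (l - 1) * A l) (n + 1))
    have s2 : ∑ l ∈ Finset.range (n + 1), (l : ℂ) * planeCoeff n l * A (l - 1)
        = ∑ l ∈ Finset.range (n + 1 + 1), ((l + 1 : ℕ) : ℂ) * planeCoeff n (l + 1) * A l := by
      rw [Finset.sum_range_succ' _ n, Finset.sum_range_succ _ (n + 1), Finset.sum_range_succ _ n,
        planeCoeff_of_lt (l := n + 1 + 1) (by omega), planeCoeff_of_lt (l := n + 1) (by omega)]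
      simp
    rw [s2]
    simp only [Nat.cast_zero, zero_mul, add_zero] at s1
    rw [← s1, ← Finset.sum_add_distrib]
    refine Finset.sum_congr rfl fun l _ => ?_
    have := planeCoeff_recurrence n l
    have hc : (l : ℂ) * planeCoeff n (l - 1) + (l + 1) * planeCoeff n (l + 1)
      = (n + 1) * ((2 * l + 1) * planeCoeff (n + 1) l) := by exact_mod_cast this
    push_cast
    linear_combination A l * hc

/-- The scalar product of two vectors, in coordinates. -/
def dot (n k : Space) : ℝ := n 0 * k 0 + n 1 * k 1 + n 2 * k 2

/-- The plane wave expansion, degree by degree. -/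
lemma dot_pow_eq (N : ℕ) {n k : Space} (hn : ‖n‖ = 1) (hk : ‖k‖ = 1) :
    (dot n k : ℂ) ^ N / (N ! : ℕ)
      = ∑ l ∈ Finset.range (N + 1), (4 * Real.pi * planeCoeff N l : ℝ) * zonal l k n := by
  have dY : ∀ (n k : Space) (t : ℝ), HasDerivAt (fun s => ((dot (rotY s n) (rotY s k) : ℝ) : ℂ)) 0 t := by
    intro n k t
    have : ∀ s, dot (rotY s n) (rotY s k) = dot n k := by
      intro s
      simp only [dot, rotY_zero, rotY_one, rotY_two]
      linear_combination (n 0 * k 0 + n 2 * k 2) * Real.sin_sq_add_cos_sq s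
    simp only [this]
    exact hasDerivAt_const t _
  have dZ : ∀ (n k : Space) (t : ℝ), HasDerivAt (fun s => ((dot (rotZ s n) (rotZ s k) : ℝ) : ℂ)) 0 t := by
    intro n k t
    have : ∀ s, dot (rotZ s n) (rotZ s k) = dot n k := by
      intro s
      simp only [dot, rotZ_zero, rotZ_one, rotZ_two]
      linear_combination (n 0 * k 0 + n 1 * k 1) * Real.sin_sq_add_cos_sq s
    simp only [this]
    exact hasDerivAt_const t _
  -- Both sides are invariant under simultaneous rotations, so `n` may be placed at the pole. There
  -- only order zero survives and the claim is the Legendre expansion of a power.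
  have key := eq_zero_of_invariant_pair (G := fun k n => (dot n k : ℂ) ^ N / (N ! : ℕ)
      - ∑ l ∈ Finset.range (N + 1), (4 * Real.pi * planeCoeff N l : ℝ) * zonal l k n)
    (fun k n t => by
      refine ((((dY n k t).pow N).div_const _).sub (HasDerivAt.fun_sum fun l _ =>
        (hasDerivAt_zonal_rotY l k n t).const_mul _)).congr_deriv ?_
      simp)
    (fun k n t => by
      refine ((((dZ n k t).pow N).div_const _).sub (HasDerivAt.fun_sum fun l _ =>
        (hasDerivAt_zonal_rotZ l k n t).const_mul _)).congr_deriv ?_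
      simp)
    (fun k hk => by
      have e : dot pole k = k 2 := by simp [dot]
      rw [e, pow_div_factorial_eq hk, sub_eq_zero]
      refine Finset.sum_congr rfl fun l _ => ?_
      have z : zonal l k pole = (2 * l + 1) / (4 * Real.pi) * (solidAt l 0 k / 2 ^ l) := by
        unfold zonal
        rw [Finset.sum_eq_single_of_mem 0 (by simp)]
        · have hw : ladderWeight l 0 = (l ! : ℕ) := by
            unfold ladderWeight
            simp only [add_zero, sub_zero, Int.toNat_natCast]
            push_cast
            exact Real.sqrt_mul_self (by positivity)
          have hs : (Real.sqrt ((2 * (l : ℝ) + 1) / (4 * Real.pi)) : ℂ)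
              * Real.sqrt ((2 * (l : ℝ) + 1) / (4 * Real.pi)) = (2 * l + 1) / (4 * Real.pi) := by
            rw [← Complex.ofReal_mul, Real.mul_self_sqrt (by positivity)]
            push_cast; ring
          rw [solidY_pole, if_pos rfl, Complex.conj_ofReal, solidY, harmonicNorm, hw, ← hs]
          have : ((l ! : ℕ) : ℂ) ≠ 0 := by exact_mod_cast l.factorial_ne_zero
          push_cast
          field_simp
        · intro m _ hm
          rw [solidY_pole, if_neg hm, map_zero, mul_zero]
      rw [z]
      have : (Real.pi : ℂ) ≠ 0 := by exact_mod_cast Real.pi_ne_zero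
      push_cast
      field_simp)
    hk hn
  exact sub_eq_zero.mp key

/-! ### Clebsch-Gordan coefficients -/

lemma clebschGordan_eq_zero_of_sum {a b j : ℕ} {m₁ m₂ m : ℤ} (h : m₁ + m₂ ≠ m) :
    clebschGordan a m₁ b m₂ j m = 0 := by
  rw [clebschGordan, threeJ_eq_zero_of_sum (by omega), mul_zero]

lemma clebschGordan_eq_zero_of_not {a b j : ℕ} {m₁ m₂ m : ℤ}
    (h : ¬ (|m₁| ≤ (a : ℤ) ∧ |m₂| ≤ (b : ℤ) ∧ |m| ≤ (j : ℤ) ∧ j ≤ a + b ∧ a ≤ b + j ∧ b ≤ a + j)) :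
    clebschGordan a m₁ b m₂ j m = 0 := by
  rw [clebschGordan, threeJ_of_not, mul_zero]
  rintro ⟨_, h1, h2, h3, h4⟩
  rw [abs_neg] at h3
  exact h ⟨h1, h2, h3, h4⟩

lemma clebschGordan_raise (a b j : ℕ) (m₁ m₂ m : ℤ) :
    ladder a (m₁ - 1) * clebschGordan a (m₁ - 1) b m₂ j m
      + ladder b (m₂ - 1) * clebschGordan a m₁ b (m₂ - 1) j m
      = ladder j m * clebschGordan a m₁ b m₂ j (m + 1) := by
  by_cases h : m₁ + m₂ + -m = 1
  · have := threeJ_lower a b j h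
    rw [show -m - 1 = -(m + 1) by ring, ladder_neg, add_sub_cancel_right] at this
    unfold clebschGordan
    rw [show (a : ℤ) - b + (m + 1) = a - b + m + 1 by ring,
      zpow_add_one₀ (by norm_num : (-1 : ℝ) ≠ 0) ((a : ℤ) - b + m)]
    linear_combination ((-1 : ℝ) ^ ((a : ℤ) - b + m) * Real.sqrt (2 * (j : ℝ) + 1)) * this
  · rw [clebschGordan_eq_zero_of_sum (by omega), clebschGordan_eq_zero_of_sum (by omega),
      clebschGordan_eq_zero_of_sum (by omega)]
    ring

lemma clebschGordan_lower (a b j : ℕ) (m₁ m₂ m : ℤ) :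
    ladder a m₁ * clebschGordan a (m₁ + 1) b m₂ j m
      + ladder b m₂ * clebschGordan a m₁ b (m₂ + 1) j m
      = ladder j (m - 1) * clebschGordan a m₁ b m₂ j (m - 1) := by
  by_cases h : m₁ + m₂ + -m = -1
  · have := threeJ_raise a b j h
    rw [show -m + 1 = -(m - 1) by ring, ladder_neg] at this
    unfold clebschGordan
    rw [show (a : ℤ) - b + (m - 1) = a - b + m - 1 by ring,
      zpow_sub_one₀ (by norm_num : (-1 : ℝ) ≠ 0) ((a : ℤ) - b + m)]
    rw [show ((-1 : ℝ))⁻¹ = -1 by norm_num]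
    linear_combination ((-1 : ℝ) ^ ((a : ℤ) - b + m) * Real.sqrt (2 * (j : ℝ) + 1)) * this
  · rw [clebschGordan_eq_zero_of_sum (by omega), clebschGordan_eq_zero_of_sum (by omega),
      clebschGordan_eq_zero_of_sum (by omega)]
    ring

lemma clebschGordan_neg (a b j : ℕ) (m₁ m₂ m : ℤ) :
    clebschGordan a (-m₁) b (-m₂) j (-m) = (-1) ^ (a + b + j) * clebschGordan a m₁ b m₂ j m := by
  unfold clebschGordan
  rw [threeJ_neg]
  have s1 : (-1 : ℝ) ^ ((a : ℤ) - b + -m) = (-1 : ℝ) ^ ((a : ℤ) - b + m) := by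
    rw [show (a : ℤ) - b + -m = (a - b + m) + 2 * (-m) by ring, zpow_add₀ (by norm_num),
      zpow_mul]
    norm_num
  rw [s1]; ring

lemma zpow_neg_one_mul_self (k : ℤ) : (-1 : ℝ) ^ k * (-1) ^ k = 1 := by
  rw [← mul_zpow]; norm_num

lemma sum_clebschGordan_mul {a b j : ℕ} (h : j ≤ a + b ∧ a ≤ b + j ∧ b ≤ a + j) {m : ℤ}
    (hm : |m| ≤ (j : ℤ)) :
    ∑ m₁ ∈ Finset.Icc (-(a : ℤ)) a, ∑ m₂ ∈ Finset.Icc (-(b : ℤ)) b,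
      clebschGordan a m₁ b m₂ j m * clebschGordan a m₁ b m₂ j m = 1 := by
  have := threeJGram_self h (m := -m) (by rwa [abs_neg])
  unfold threeJGram at this
  have e : ∀ m₁ m₂, clebschGordan a m₁ b m₂ j m * clebschGordan a m₁ b m₂ j m
      = (2 * j + 1) * (threeJ a b j m₁ m₂ (-m) * threeJ a b j m₁ m₂ (-m)) := by
    intro m₁ m₂
    unfold clebschGordan
    have h1 := zpow_neg_one_mul_self ((a : ℤ) - b + m)
    have h2 : Real.sqrt (2 * (j : ℝ) + 1) * Real.sqrt (2 * (j : ℝ) + 1) = 2 * j + 1 :=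
      Real.mul_self_sqrt (by positivity)
    linear_combination (threeJ a b j m₁ m₂ (-m)) ^ 2 * (Real.sqrt (2 * (j : ℝ) + 1)
      * Real.sqrt (2 * (j : ℝ) + 1) * h1 + h2)
  simp only [e, ← Finset.mul_sum]
  rw [this]
  field_simp

lemma sum_clebschGordan_mul_of_ne {a b j j' : ℕ} (h : j ≠ j') (m : ℤ) :
    ∑ m₁ ∈ Finset.Icc (-(a : ℤ)) a, ∑ m₂ ∈ Finset.Icc (-(b : ℤ)) b,
      clebschGordan a m₁ b m₂ j m * clebschGordan a m₁ b m₂ j' m = 0 := by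
  have := threeJGram_of_ne (a := a) (b := b) h (-m)
  unfold threeJGram at this
  have e : ∀ m₁ m₂, clebschGordan a m₁ b m₂ j m * clebschGordan a m₁ b m₂ j' m
      = (Real.sqrt (2 * (j : ℝ) + 1) * Real.sqrt (2 * (j' : ℝ) + 1))
        * (threeJ a b j m₁ m₂ (-m) * threeJ a b j' m₁ m₂ (-m)) := by
    intro m₁ m₂
    unfold clebschGordan
    have h1 := zpow_neg_one_mul_self ((a : ℤ) - b + m)
    linear_combination (Real.sqrt (2 * (j : ℝ) + 1) * Real.sqrt (2 * (j' : ℝ) + 1)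
        * (threeJ a b j m₁ m₂ (-m) * threeJ a b j' m₁ m₂ (-m))) * h1
  simp only [e, ← Finset.mul_sum]
  rw [this, mul_zero]

lemma abs_clebschGordan_le (a b j : ℕ) (m₁ m₂ m : ℤ) : |clebschGordan a m₁ b m₂ j m| ≤ 1 := by
  by_cases h : |m₁| ≤ (a : ℤ) ∧ |m₂| ≤ (b : ℤ) ∧ |m| ≤ (j : ℤ) ∧ j ≤ a + b ∧ a ≤ b + j ∧ b ≤ a + j
  swap
  · rw [clebschGordan_eq_zero_of_not h]; simp
  obtain ⟨h1, h2, h3, h4⟩ := h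
  have hs := sum_clebschGordan_mul h4 h3
  have i1 := Finset.single_le_sum (f := fun m₁ => ∑ m₂ ∈ Finset.Icc (-(b : ℤ)) b,
      clebschGordan a m₁ b m₂ j m * clebschGordan a m₁ b m₂ j m)
      (fun _ _ => Finset.sum_nonneg fun _ _ => mul_self_nonneg _)
      (Finset.mem_Icc.mpr (abs_le.mp h1))
  have i2 := Finset.single_le_sum (f := fun m₂ =>
      clebschGordan a m₁ b m₂ j m * clebschGordan a m₁ b m₂ j m)
      (fun _ _ => mul_self_nonneg _) (Finset.mem_Icc.mpr (abs_le.mp h2))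
  rw [hs] at i1
  have : clebschGordan a m₁ b m₂ j m * clebschGordan a m₁ b m₂ j m ≤ 1 := i2.trans i1
  exact abs_le_one_iff_mul_self_le_one.mpr this

/-! ### Vector multiplets -/

/-- The infinitesimal rotation of a vector about the second axis. -/
def crossY (V : Fin 3 → ℂ) : Fin 3 → ℂ := ![V 2, 0, -V 0]

/-- The infinitesimal rotation of a vector about the third axis. -/
def crossZ (V : Fin 3 → ℂ) : Fin 3 → ℂ := ![-V 1, V 0, 0]

/-- Families of vector fields which transform under rotations as a multiplet of spin `j`. -/
structure IsVectorMultiplet (j : ℕ) (V : ℤ → Space → Fin 3 → ℂ) : Prop where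
  cont : ∀ m i, Continuous fun n => V m n i
  support : ∀ m, (j : ℤ) < |m| → ∀ n i, V m n i = 0
  rotY : ∀ m n t i, HasDerivAt (fun s => V m (rotY s n) i)
    (ladderAct j (fun k => V k (rotY t n) i) m + crossY (V m (rotY t n)) i) t
  rotZ : ∀ m n t i, HasDerivAt (fun s => V m (rotZ s n) i)
    (Complex.I * m * V m (rotZ t n) i + crossZ (V m (rotZ t n)) i) t

namespace IsVectorMultiplet

variable {j : ℕ} {V W : ℤ → Space → Fin 3 → ℂ}

lemma add_smul (hV : IsVectorMultiplet j V) (hW : IsVectorMultiplet j W) (a b : ℂ) :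
    IsVectorMultiplet j fun m n i => a * V m n i + b * W m n i where
  cont m i := (continuous_const.mul (hV.cont m i)).add (continuous_const.mul (hW.cont m i))
  support m hm n i := by rw [hV.support m hm, hW.support m hm]; ring
  rotY m n t i := by
    refine (((hV.rotY m n t i).const_mul a).add ((hW.rotY m n t i).const_mul b)).congr_deriv ?_
    fin_cases i <;> simp [ladderAct, crossY] <;> ring
  rotZ m n t i := by
    refine (((hV.rotZ m n t i).const_mul a).add ((hW.rotZ m n t i).const_mul b)).congr_deriv ?_
    fin_cases i <;> simp [crossZ] <;> ring

/-- The radial part of a multiplet of vector fields is a multiplet. -/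
lemma radial (hV : IsVectorMultiplet j V) :
    IsVectorMultiplet j fun m n i => (∑ k, (n k : ℂ) * V m n k) * n i where
  cont m i := by
    have := hV.cont m
    fun_prop
  support m hm n i := by simp [hV.support m hm]
  rotY m n t i := by
    have h0 := hasDerivAt_rotY_zero n t
    have h1 := hasDerivAt_rotY_one n t
    have h2 := hasDerivAt_rotY_two n t
    have hs := ((h0.mul (hV.rotY m n t 0)).add (h1.mul (hV.rotY m n t 1))).add
      (h2.mul (hV.rotY m n t 2))
    simp only [Fin.sum_univ_three]
    fin_cases i
    · refine (hs.mul h0).congr_deriv ?_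
      simp [ladderAct, crossY]; ring
    · refine (hs.mul h1).congr_deriv ?_
      simp [ladderAct, crossY]; ring
    · refine (hs.mul h2).congr_deriv ?_
      simp [ladderAct, crossY]; ring
  rotZ m n t i := by
    have h0 := hasDerivAt_rotZ_zero n t
    have h1 := hasDerivAt_rotZ_one n t
    have h2 := hasDerivAt_rotZ_two n t
    have hs := ((h0.mul (hV.rotZ m n t 0)).add (h1.mul (hV.rotZ m n t 1))).add
      (h2.mul (hV.rotZ m n t 2))
    simp only [Fin.sum_univ_three]
    fin_cases i
    · refine (hs.mul h0).congr_deriv ?_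
      simp [crossZ]; ring
    · refine (hs.mul h1).congr_deriv ?_
      simp [crossZ]; ring
    · refine (hs.mul h2).congr_deriv ?_
      simp [crossZ]; ring

/-- The conjugate multiplet. -/
lemma conj_neg (hV : IsVectorMultiplet j V) :
    IsVectorMultiplet j fun m n i => (-1) ^ m * conj (V (-m) n i) where
  cont m i := continuous_const.mul (Complex.continuous_conj.comp (hV.cont (-m) i))
  support m hm n i := by rw [hV.support _ (by rwa [abs_neg])]; simp
  rotY m n t i := by
    refine ((hasDerivAt_conj_ofReal (hV.rotY (-m) n t i)).const_mul ((-1) ^ m)).congr_deriv ?_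
    have e1 : (-1 : ℂ) ^ (m + 1) = -(-1) ^ m := by rw [zpow_add_one₀ (by norm_num)]; ring
    have e2 : (-1 : ℂ) ^ (m - 1) = -(-1) ^ m := by rw [zpow_sub_one₀ (by norm_num)]; norm_num
    have e3 : ladder j (-m - 1) = ladder j m := by
      rw [show -m - 1 = -(m + 1) by ring, ladder_neg, add_sub_cancel_right]
    rw [map_add, conj_ladderAct]
    simp only [ladderAct, e1, e2, ladder_neg, e3, show -(m + 1) = -m - 1 by ring,
      show -(m - 1) = -m + 1 by ring]
    generalize hp : (-1 : ℂ) ^ m = s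
    fin_cases i <;> simp [crossY] <;> ring
  rotZ m n t i := by
    refine ((hasDerivAt_conj_ofReal (hV.rotZ (-m) n t i)).const_mul ((-1) ^ m)).congr_deriv ?_
    fin_cases i <;> simp [crossZ] <;> ring

/-- A multiplet which vanishes at the pole vanishes on the whole sphere. -/
lemma eq_zero_of_pole (hV : IsVectorMultiplet j V) (h0 : ∀ m i, V m pole i = 0) (m : ℤ)
    {n : Space} (hn : ‖n‖ = 1) (i : Fin 3) : V m n i = 0 := by
  by_cases hm : |m| ≤ (j : ℤ)
  swap
  · exact hV.support m (not_le.mp hm) n i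
  -- The squared length of the whole multiplet, summed over orders and components, is rotation
  -- invariant because both the ladder action and the vector rotation are antisymmetric. It vanishes
  -- at the pole, hence everywhere on the sphere.
  set G : Space → ℂ := fun n => ∑ i, ∑ m ∈ Finset.Icc (-(j : ℤ)) j, V m n i * conj (V m n i) with hG
  have key : G n = G pole := by
    refine eq_pole_of_invariant (fun n t => ?_) (fun n t => ?_) hn
    · have h : ∀ i ∈ Finset.univ, HasDerivAt (fun s => ∑ m ∈ Finset.Icc (-(j : ℤ)) j,
          V m (EMWaves.rotY s n) i * conj (V m (EMWaves.rotY s n) i)) _ t := fun i _ =>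
        HasDerivAt.fun_sum fun m _ => (hV.rotY m n t i).mul (hasDerivAt_conj_ofReal (hV.rotY m n t i))
      refine (HasDerivAt.fun_sum h).congr_deriv ?_
      have e : ∀ i m, (ladderAct j (fun k => V k (EMWaves.rotY t n) i) m
            + crossY (V m (EMWaves.rotY t n)) i) * conj (V m (EMWaves.rotY t n) i)
          + V m (EMWaves.rotY t n) i * conj (ladderAct j (fun k => V k (EMWaves.rotY t n) i) m
            + crossY (V m (EMWaves.rotY t n)) i)
          = (ladderAct j (fun k => V k (EMWaves.rotY t n) i) m * conj (V m (EMWaves.rotY t n) i)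
            + V m (EMWaves.rotY t n) i
              * ladderAct j (fun k => conj (V k (EMWaves.rotY t n) i)) m)
          + (crossY (V m (EMWaves.rotY t n)) i * conj (V m (EMWaves.rotY t n) i)
            + V m (EMWaves.rotY t n) i * conj (crossY (V m (EMWaves.rotY t n)) i)) := by
        intro i m
        rw [map_add, conj_ladderAct]; ring
      simp only [e, Finset.sum_add_distrib (s := Finset.Icc (-(j : ℤ)) j)]
      simp only [← Finset.sum_add_distrib (s := Finset.Icc (-(j : ℤ)) j), sum_ladderAct_mul, zero_add]
      rw [Finset.sum_comm]
      refine Finset.sum_eq_zero fun m _ => ?_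
      simp [Fin.sum_univ_three, crossY]
    · have h : ∀ i ∈ Finset.univ, HasDerivAt (fun s => ∑ m ∈ Finset.Icc (-(j : ℤ)) j,
          V m (EMWaves.rotZ s n) i * conj (V m (EMWaves.rotZ s n) i)) _ t := fun i _ =>
        HasDerivAt.fun_sum fun m _ => (hV.rotZ m n t i).mul (hasDerivAt_conj_ofReal (hV.rotZ m n t i))
      refine (HasDerivAt.fun_sum h).congr_deriv ?_
      rw [Finset.sum_comm]
      refine Finset.sum_eq_zero fun m _ => ?_
      simp [Fin.sum_univ_three, crossZ]
      ring
  have hp : G pole = 0 := by simp [hG, h0]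
  have hsum : ∑ i, ∑ m ∈ Finset.Icc (-(j : ℤ)) j, ‖V m n i‖ ^ 2 = 0 := by
    have : G n = ((∑ i, ∑ m ∈ Finset.Icc (-(j : ℤ)) j, ‖V m n i‖ ^ 2 : ℝ) : ℂ) := by
      simp only [hG, Complex.mul_conj, Complex.normSq_eq_norm_sq]
      push_cast; rfl
    rw [key, hp] at this
    exact_mod_cast this.symm
  have h1 := (Finset.sum_eq_zero_iff_of_nonneg fun i _ =>
    Finset.sum_nonneg fun m _ => sq_nonneg ‖V m n i‖).mp hsum i (Finset.mem_univ i)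
  have h2 := (Finset.sum_eq_zero_iff_of_nonneg fun m _ => sq_nonneg ‖V m n i‖).mp h1 m
    (Finset.mem_Icc.mpr (abs_le.mp hm))
  simpa using h2

end IsVectorMultiplet

/-! ### Vector spherical harmonics as multiplets -/

/-- The polynomial vector field which agrees with `Y_{jlm}` on the unit sphere. -/
def solidVec (j l : ℕ) (m : ℤ) (n : Space) (i : Fin 3) : ℂ :=
  ∑ q ∈ Finset.Icc (-1 : ℤ) 1,
    (clebschGordan l (m - q) 1 q j m : ℂ) * solidY l (m - q) n * sphericalBasis q i

lemma vectorHarmonic_eq (j l : ℕ) (m : ℤ) {n : Space} (hn : ‖n‖ = 1) (i : Fin 3) :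
    vectorHarmonic j l m n i = solidVec j l m n i := by
  unfold vectorHarmonic solidVec
  refine Finset.sum_congr rfl fun q _ => ?_
  by_cases h : |m - q| ≤ (l : ℤ)
  · rw [sphericalHarmonic_eq h hn]
  · rw [clebschGordan_eq_zero_of_not fun hh => h hh.1]; simp

lemma ladder_one_zero : ladder 1 0 = Real.sqrt 2 := by
  unfold ladder; norm_num

lemma ladder_one_neg : ladder 1 (-1) = Real.sqrt 2 := by
  unfold ladder; norm_num

lemma sqrt_two_sq : (Real.sqrt 2 : ℂ) * Real.sqrt 2 = 2 := by
  rw [← Complex.ofReal_mul, Real.mul_self_sqrt (by norm_num)]; norm_num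

lemma sqrt_two_ne : (Real.sqrt 2 : ℂ) ≠ 0 := by
  exact_mod_cast (Real.sqrt_pos.mpr (by norm_num : (0 : ℝ) < 2)).ne'

/-- The constant fields `e_q` form a spin-one multiplet: their derivative is zero, so the rotation
of the value must cancel the ladder action on `q`. This explains the minus sign. -/
lemma crossY_sphericalBasis {q : ℤ} (hq : q ∈ Finset.Icc (-1 : ℤ) 1) (i : Fin 3) :
    crossY (sphericalBasis q) i = -(ladder 1 q * sphericalBasis (q + 1) i
      - ladder 1 (q - 1) * sphericalBasis (q - 1) i) / 2 := by
  have h2 := sqrt_two_sq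
  have hne := sqrt_two_ne
  have l1 : ladder 1 1 = 0 := ladder_self 1
  have l2 : ladder 1 (-1 - 1) = 0 := ladder_bot 1
  rw [Finset.mem_Icc] at hq
  obtain rfl | rfl | rfl : q = -1 ∨ q = 0 ∨ q = 1 := by omega
  · rw [l2, ladder_one_neg]
    fin_cases i <;> simp [crossY, sphericalBasis]
    field_simp
    linear_combination h2
  · rw [show (0 : ℤ) - 1 = -1 by ring, ladder_one_zero, ladder_one_neg]
    fin_cases i <;> (simp [crossY, sphericalBasis]; try (field_simp; ring))
  · rw [l1, show (1 : ℤ) - 1 = 0 by ring, ladder_one_zero]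
    fin_cases i <;> simp [crossY, sphericalBasis]
    field_simp
    linear_combination -h2

lemma crossZ_sphericalBasis {q : ℤ} (hq : q ∈ Finset.Icc (-1 : ℤ) 1) (i : Fin 3) :
    crossZ (sphericalBasis q) i = -(Complex.I * q * sphericalBasis q i) := by
  have hI := Complex.I_mul_I
  rw [Finset.mem_Icc] at hq
  obtain rfl | rfl | rfl : q = -1 ∨ q = 0 ∨ q = 1 := by omega
  · fin_cases i <;> simp [crossZ, sphericalBasis]
    · ring
    · rw [← mul_div_assoc, mul_neg, hI]; ring
  · fin_cases i <;> simp [crossZ, sphericalBasis]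
  · fin_cases i <;> simp [crossZ, sphericalBasis]
    · ring
    · rw [← mul_div_assoc, mul_neg, hI]; ring

/-- Rotating the argument acts on m - q, rotating the value acts on q, and the Clebsch-Gordan ladder
relations combine the two into the ladder action on `m`. -/
lemma isVectorMultiplet_solidVec (j l : ℕ) : IsVectorMultiplet j (solidVec j l) where
  cont m i := by
    unfold solidVec
    exact continuous_finsetSum _ fun q _ =>
      (continuous_const.mul (continuous_solidY l (m - q))).mul continuous_const
  support m hm n i := by
    refine Finset.sum_eq_zero fun q _ => ?_
    rw [clebschGordan_eq_zero_of_not fun hh => absurd hh.2.2.1 (not_le.mpr hm)]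
    simp
  rotY m n t i := by
    set N := rotY t n with hN
    have hd : HasDerivAt (fun s => solidVec j l m (rotY s n) i)
        (∑ q ∈ Finset.Icc (-1 : ℤ) 1, (clebschGordan l (m - q) 1 q j m : ℂ)
          * ladderAct l (fun k => solidY l k N) (m - q) * sphericalBasis q i) t :=
      HasDerivAt.fun_sum fun q _ =>
        ((hasDerivAt_solidY_rotY l (m - q) n t).const_mul _).mul_const _
    refine hd.congr_deriv ?_
    have hc : crossY (solidVec j l m N) i = ∑ q ∈ Finset.Icc (-1 : ℤ) 1,
        (clebschGordan l (m - q) 1 q j m : ℂ) * solidY l (m - q) N * crossY (sphericalBasis q) i := by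
      unfold solidVec
      fin_cases i <;> simp [crossY, Finset.sum_neg_distrib]
    -- Reindexing in `q` collects all terms on the same basis vector `e_q`.
    have s1 := sum_Icc_shift 1 (fun q => (ladder 1 q : ℂ) * (clebschGordan l (m - q) 1 q j m : ℂ)
      * solidY l (m - q) N * sphericalBasis (q + 1) i)
      (by simp only [ladder_self]; simp) (by simp only [ladder_bot]; simp)
    have s2 := sum_Icc_shift 1 (fun q => (ladder 1 q : ℂ)
      * (clebschGordan l (m - (q + 1)) 1 (q + 1) j m : ℂ)
      * solidY l (m - (q + 1)) N * sphericalBasis q i)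
      (by simp only [ladder_self]; simp) (by simp only [ladder_bot]; simp)
    simp only [sub_add_cancel, Nat.cast_one] at s1 s2
    have hc2 : crossY (solidVec j l m N) i = ∑ q ∈ Finset.Icc (-1 : ℤ) 1,
        ((ladder 1 q : ℂ) * (clebschGordan l (m - (q + 1)) 1 (q + 1) j m : ℂ)
          * solidY l (m - (q + 1)) N * sphericalBasis q i
        - (ladder 1 (q - 1) : ℂ) * (clebschGordan l (m - (q - 1)) 1 (q - 1) j m : ℂ)
          * solidY l (m - (q - 1)) N * sphericalBasis q i) / 2 := by
      rw [hc, ← Finset.sum_div, Finset.sum_sub_distrib, s2, ← s1, ← Finset.sum_sub_distrib,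
        Finset.sum_div]
      refine Finset.sum_congr rfl fun q hq => ?_
      rw [crossY_sphericalBasis hq]; ring
    rw [hc2]
    unfold ladderAct solidVec
    rw [Finset.mul_sum, Finset.mul_sum, ← Finset.sum_sub_distrib, Finset.sum_div,
      ← Finset.sum_add_distrib]
    refine Finset.sum_congr rfl fun q _ => ?_
    have r1 := clebschGordan_raise l 1 j (m - q + 1) q m
    have r2 := clebschGordan_lower l 1 j (m - q - 1) q m
    rw [add_sub_cancel_right] at r1
    rw [sub_add_cancel] at r2
    rw [show m + 1 - q = m - q + 1 by ring, show m - 1 - q = m - q - 1 by ring,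
      show m - (q + 1) = m - q - 1 by ring, show m - (q - 1) = m - q + 1 by ring]
    have c1 := congrArg Complex.ofReal r1
    have c2 := congrArg Complex.ofReal r2
    push_cast at c1 c2
    linear_combination (solidY l (m - q + 1) N * sphericalBasis q i / 2) * c1
      - (solidY l (m - q - 1) N * sphericalBasis q i / 2) * c2
  rotZ m n t i := by
    have hd : HasDerivAt (fun s => solidVec j l m (rotZ s n) i)
        (∑ q ∈ Finset.Icc (-1 : ℤ) 1, (clebschGordan l (m - q) 1 q j m : ℂ)
          * (Complex.I * (m - q : ℤ) * solidY l (m - q) (rotZ t n)) * sphericalBasis q i) t :=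
      HasDerivAt.fun_sum fun q _ =>
        ((hasDerivAt_solidY_rotZ l (m - q) n t).const_mul _).mul_const _
    refine hd.congr_deriv ?_
    have hc : crossZ (solidVec j l m (rotZ t n)) i = ∑ q ∈ Finset.Icc (-1 : ℤ) 1,
        (clebschGordan l (m - q) 1 q j m : ℂ) * solidY l (m - q) (rotZ t n)
          * crossZ (sphericalBasis q) i := by
      unfold solidVec
      fin_cases i <;> simp [crossZ, Finset.sum_neg_distrib]
    rw [hc]
    unfold solidVec
    rw [Finset.mul_sum, ← Finset.sum_add_distrib]
    refine Finset.sum_congr rfl fun q hq => ?_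
    rw [crossZ_sphericalBasis hq]
    push_cast
    ring

lemma sphericalBasis_eq_zero {q : ℤ} (h : q ∉ Finset.Icc (-1 : ℤ) 1) (i : Fin 3) :
    sphericalBasis q i = 0 := by
  rw [Finset.mem_Icc] at h
  unfold sphericalBasis
  rw [if_neg (by omega), if_neg (by omega), if_neg (by omega)]
  rfl

lemma solidVec_pole (j l : ℕ) (m : ℤ) (i : Fin 3) : solidVec j l m pole i
    = clebschGordan l 0 1 m j m * Real.sqrt ((2 * (l : ℝ) + 1) / (4 * Real.pi))
      * sphericalBasis m i := by
  unfold solidVec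
  by_cases hm : m ∈ Finset.Icc (-1 : ℤ) 1
  · rw [Finset.sum_eq_single_of_mem m hm]
    · rw [sub_self, solidY_pole, if_pos rfl]
    · intro q _ hq
      rw [solidY_pole, if_neg (by omega)]; ring
  · rw [sphericalBasis_eq_zero hm, mul_zero]
    refine Finset.sum_eq_zero fun q hq => ?_
    rw [solidY_pole, if_neg]
    · ring
    · intro h; exact hm (by rwa [show m = q by omega])

/-! ### The multiplets at the pole -/

lemma threeJ_eq_mul_racahSum {a b c : ℕ} {m₁ m₂ m₃ : ℤ} (h : ThreeJAdm a b c m₁ m₂ m₃) :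
    ∃ P : ℝ, 0 < P ∧ P ^ 2 = (((a + b - c)! * (a + c - b)! * (b + c - a)! : ℕ) : ℝ)
        / (((a + b + c + 1)! : ℕ) : ℝ) * (((((a : ℤ) + m₁).toNat ! * ((a : ℤ) - m₁).toNat !
          * (((b : ℤ) + m₂).toNat ! * ((b : ℤ) - m₂).toNat !)
          * (((c : ℤ) + m₃).toNat ! * ((c : ℤ) - m₃).toNat !) : ℕ)) : ℝ) ∧
      threeJ a b c m₁ m₂ m₃ = (-1 : ℝ) ^ ((a : ℤ) - b - m₃) * P
        * racahSum (a + b - c) (c - b + m₁) (a - m₁) (c - a - m₂) (b + m₂) := by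
  refine ⟨triangleCoeff a b c * (ladderWeight a m₁ * ladderWeight b m₂ * ladderWeight c m₃),
    mul_pos (triangleCoeff_pos _ _ _) (mul_pos (mul_pos (ladderWeight_pos _ _)
      (ladderWeight_pos _ _)) (ladderWeight_pos _ _)), ?_, ?_⟩
  · unfold triangleCoeff ladderWeight
    simp only [mul_pow]
    repeat rw [Real.sq_sqrt (by positivity)]
    push_cast
    ring
  · rw [threeJ_of h]; ring

/-- Clebsch-Gordan coefficients `⟨l 0 1 m | j m⟩` through a single positive factor. -/
lemma clebschGordan_zero_one {l j : ℕ} {m : ℤ} (h : ThreeJAdm l 1 j 0 m (-m)) :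
    ∃ P : ℝ, 0 < P ∧ P ^ 2 = (2 * j + 1) * ((((l + 1 - j)! * (l + j - 1)! * (1 + j - l)! : ℕ) : ℝ)
        / (((l + 1 + j + 1)! : ℕ) : ℝ) * ((l ! * l !
          * ((1 + m).toNat ! * (1 - m).toNat !)
          * (((j : ℤ) - m).toNat ! * ((j : ℤ) + m).toNat !) : ℕ) : ℝ)) ∧
      clebschGordan l 0 1 m j m = P
        * racahSum (l + 1 - j) (j - 1) l (j - l - m) (1 + m) := by
  obtain ⟨P, hP, hsq, hv⟩ := threeJ_eq_mul_racahSum h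
  refine ⟨Real.sqrt (2 * j + 1) * P, mul_pos (Real.sqrt_pos.mpr (by positivity)) hP, ?_, ?_⟩
  · rw [mul_pow, Real.sq_sqrt (by positivity), hsq]
    simp [sub_neg_eq_add, ← sub_eq_add_neg]
  · unfold clebschGordan
    rw [hv]
    have := zpow_neg_one_mul_self ((l : ℤ) - 1 + m)
    simp only [Nat.cast_one, sub_neg_eq_add, add_zero, sub_zero]
    linear_combination (Real.sqrt (2 * j + 1) * P
      * racahSum (l + 1 - j) (j - 1) l (j - l - m) (1 + m)) * this

lemma clebschGordan_zero_one_neg (l j : ℕ) (m : ℤ) :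
    clebschGordan l 0 1 (-m) j (-m) = (-1) ^ (l + 1 + j) * clebschGordan l 0 1 m j m := by
  have := clebschGordan_neg l 1 j 0 m m
  rwa [neg_zero] at this

/-- The amplitude at the pole of the harmonic `Y_{jlm}`. -/
def poleAmplitude (j l : ℕ) (m : ℤ) : ℝ :=
  clebschGordan l 0 1 m j m * Real.sqrt ((2 * (l : ℝ) + 1) / (4 * Real.pi))

lemma poleAmplitude_neg (j l : ℕ) (m : ℤ) :
    poleAmplitude j l (-m) = (-1) ^ (l + 1 + j) * poleAmplitude j l m := by
  unfold poleAmplitude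
  rw [clebschGordan_zero_one_neg]; ring

lemma mul_sqrt_eq_sqrt {x y z : ℝ} (hx : 0 < x) (h : x ^ 2 * y = z) :
    x * Real.sqrt y = Real.sqrt z := by
  rw [← h, Real.sqrt_mul (by positivity), Real.sqrt_sq hx.le]

/-- In this and the following pole amplitudes exactly one term of the Racah sum survives. The
remaining positive prefactor is identified through its square, which avoids manipulating nested
roots. -/
lemma poleAmplitude_self_one {j : ℕ} (hj : 1 ≤ j) :
    poleAmplitude j j 1 = -Real.sqrt ((2 * j + 1) / (8 * Real.pi)) := by
  obtain ⟨J, rfl⟩ : ∃ J, j = J + 1 := ⟨j - 1, by omega⟩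
  obtain ⟨P, hP, hsq, hv⟩ := clebschGordan_zero_one (l := J + 1) (j := J + 1) (m := 1)
    ⟨by ring, by simp; positivity, by simp, by simp, by omega, by omega, by omega⟩
  have hr : racahSum (J + 1 + 1 - (J + 1)) (((J + 1 : ℕ) : ℤ) - 1) ((J + 1 : ℕ) : ℤ)
      (((J + 1 : ℕ) : ℤ) - ((J + 1 : ℕ) : ℤ) - 1) (1 + 1)
      = -(1 / (((J + 1)! : ℕ) : ℝ) * (1 / ((J ! : ℕ) : ℝ))) := by
    rw [show J + 1 + 1 - (J + 1) = 1 by omega]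
    unfold racahSum
    simp only [Finset.sum_range_succ, Finset.range_zero, Finset.sum_empty]
    rw [invFact_of_neg (k := ((J + 1 : ℕ) : ℤ) - ((J + 1 : ℕ) : ℤ) - 1 + (0 : ℕ)) (by simp)]
    rw [show ((J + 1 : ℕ) : ℤ) - 1 + (1 : ℕ) = (J + 1 : ℕ) by push_cast; ring,
      show ((J + 1 : ℕ) : ℤ) - (1 : ℕ) = J by push_cast; ring, invFact_natCast, invFact_natCast]
    simp [invFact]
    omega
  rw [show J + 1 + 1 - (J + 1) = 1 by omega, show J + 1 + (J + 1) - 1 = 2 * J + 1 by omega,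
    show 1 + (J + 1) - (J + 1) = 1 by omega, show J + 1 + 1 + (J + 1) + 1 = 2 * J + 1 + 1 + 1 + 1 by omega,
    show (((J + 1 : ℕ) : ℤ) - 1).toNat = J by omega,
    show (((J + 1 : ℕ) : ℤ) + 1).toNat = J + 1 + 1 by omega] at hsq
  unfold poleAmplitude
  rw [hv, hr, mul_neg, neg_mul, neg_inj]
  refine mul_sqrt_eq_sqrt (by positivity) ?_
  rw [mul_pow, hsq]
  simp only [Nat.factorial_succ]
  have h1 := Nat.factorial_ne_zero (2 * J)
  have h2 := Nat.factorial_ne_zero J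
  push_cast
  field_simp
  norm_num
  ring

lemma poleAmplitude_pred_one {j : ℕ} (hj : 1 ≤ j) :
    poleAmplitude j (j - 1) 1 = Real.sqrt ((j + 1) / (8 * Real.pi)) := by
  obtain ⟨J, rfl⟩ : ∃ J, j = J + 1 := ⟨j - 1, by omega⟩
  rw [Nat.add_sub_cancel]
  obtain ⟨P, hP, hsq, hv⟩ := clebschGordan_zero_one (l := J) (j := J + 1) (m := 1)
    ⟨by ring, by simp, by simp, by simp, by omega, by omega, by omega⟩
  have hr : racahSum (J + 1 - (J + 1)) (((J + 1 : ℕ) : ℤ) - 1) (J : ℤ)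
      (((J + 1 : ℕ) : ℤ) - (J : ℤ) - 1) (1 + 1)
      = (1 / ((J ! : ℕ) : ℝ) * (1 / ((J ! : ℕ) : ℝ))) / 2 := by
    rw [show J + 1 - (J + 1) = 0 by omega]
    unfold racahSum
    simp only [Finset.sum_range_succ, Finset.range_zero, Finset.sum_empty]
    rw [show ((J + 1 : ℕ) : ℤ) - 1 + (0 : ℕ) = J by push_cast; ring,
      show ((J + 1 : ℕ) : ℤ) - (J : ℤ) - 1 + (0 : ℕ) = (0 : ℕ) by push_cast; ring,
      show (J : ℤ) - (0 : ℕ) = J by push_cast; ring,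
      show (1 + 1 : ℤ) - (0 : ℕ) = (2 : ℕ) by norm_num, invFact_natCast, invFact_natCast, invFact_natCast]
    simp [invFact]; ring
  rw [show J + 1 - (J + 1) = 0 by omega, show J + (J + 1) - 1 = 2 * J by omega,
    show 1 + (J + 1) - J = 2 by omega, show J + 1 + (J + 1) + 1 = 2 * J + 1 + 1 + 1 by omega,
    show (((J + 1 : ℕ) : ℤ) - 1).toNat = J by omega,
    show (((J + 1 : ℕ) : ℤ) + 1).toNat = J + 1 + 1 by omega] at hsq
  unfold poleAmplitude
  rw [hv, hr]
  refine mul_sqrt_eq_sqrt (by positivity) ?_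
  rw [mul_pow, hsq]
  simp only [Nat.factorial_succ]
  have h1 := Nat.factorial_ne_zero (2 * J)
  have h2 := Nat.factorial_ne_zero J
  push_cast
  field_simp
  norm_num
  ring

lemma poleAmplitude_pred_zero {j : ℕ} (hj : 1 ≤ j) :
    poleAmplitude j (j - 1) 0 = Real.sqrt (j / (4 * Real.pi)) := by
  obtain ⟨J, rfl⟩ : ∃ J, j = J + 1 := ⟨j - 1, by omega⟩
  rw [Nat.add_sub_cancel]
  obtain ⟨P, hP, hsq, hv⟩ := clebschGordan_zero_one (l := J) (j := J + 1) (m := 0)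
    ⟨by ring, by simp, by simp, by simp; positivity, by omega, by omega, by omega⟩
  have hr : racahSum (J + 1 - (J + 1)) (((J + 1 : ℕ) : ℤ) - 1) (J : ℤ)
      (((J + 1 : ℕ) : ℤ) - (J : ℤ) - 0) (1 + 0)
      = (1 / ((J ! : ℕ) : ℝ) * (1 / ((J ! : ℕ) : ℝ))) := by
    rw [show J + 1 - (J + 1) = 0 by omega]
    unfold racahSum
    simp only [Finset.sum_range_succ, Finset.range_zero, Finset.sum_empty]
    rw [show ((J + 1 : ℕ) : ℤ) - 1 + (0 : ℕ) = J by push_cast; ring,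
      show ((J + 1 : ℕ) : ℤ) - (J : ℤ) - 0 + (0 : ℕ) = (1 : ℕ) by push_cast; ring,
      show (J : ℤ) - (0 : ℕ) = J by push_cast; ring,
      show (1 + 0 : ℤ) - (0 : ℕ) = (1 : ℕ) by norm_num, invFact_natCast, invFact_natCast]
    simp [invFact]
  rw [show J + 1 - (J + 1) = 0 by omega, show J + (J + 1) - 1 = 2 * J by omega,
    show 1 + (J + 1) - J = 2 by omega, show J + 1 + (J + 1) + 1 = 2 * J + 1 + 1 + 1 by omega,
    show (((J + 1 : ℕ) : ℤ) - 0).toNat = J + 1 by omega,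
    show (((J + 1 : ℕ) : ℤ) + 0).toNat = J + 1 by omega] at hsq
  unfold poleAmplitude
  rw [hv, hr]
  refine mul_sqrt_eq_sqrt (by positivity) ?_
  rw [mul_pow, hsq]
  simp only [Nat.factorial_succ]
  have h1 := Nat.factorial_ne_zero (2 * J)
  have h2 := Nat.factorial_ne_zero J
  push_cast
  field_simp
  norm_num
  ring

lemma poleAmplitude_succ_one {j : ℕ} (hj : 1 ≤ j) :
    poleAmplitude j (j + 1) 1 = Real.sqrt (j / (8 * Real.pi)) := by
  obtain ⟨J, rfl⟩ : ∃ J, j = J + 1 := ⟨j - 1, by omega⟩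
  obtain ⟨P, hP, hsq, hv⟩ := clebschGordan_zero_one (l := J + 1 + 1) (j := J + 1) (m := 1)
    ⟨by ring, by simp; positivity, by simp, by simp, by omega, by omega, by omega⟩
  have hr : racahSum (J + 1 + 1 + 1 - (J + 1)) (((J + 1 : ℕ) : ℤ) - 1) ((J + 1 + 1 : ℕ) : ℤ)
      (((J + 1 : ℕ) : ℤ) - ((J + 1 + 1 : ℕ) : ℤ) - 1) (1 + 1)
      = 1 / (((J + 1 + 1)! : ℕ) : ℝ) * (1 / ((J ! : ℕ) : ℝ)) / 2 := by
    rw [show J + 1 + 1 + 1 - (J + 1) = 2 by omega]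
    unfold racahSum
    simp only [Finset.sum_range_succ, Finset.range_zero, Finset.sum_empty]
    rw [invFact_of_neg (k := ((J + 1 : ℕ) : ℤ) - ((J + 1 + 1 : ℕ) : ℤ) - 1 + (0 : ℕ))
        (by push_cast; omega),
      invFact_of_neg (k := ((J + 1 : ℕ) : ℤ) - ((J + 1 + 1 : ℕ) : ℤ) - 1 + (1 : ℕ))
        (by push_cast; omega)]
    rw [show ((J + 1 : ℕ) : ℤ) - 1 + (2 : ℕ) = (J + 1 + 1 : ℕ) by push_cast; ring,
      show ((J + 1 + 1 : ℕ) : ℤ) - (2 : ℕ) = J by push_cast; ring,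
      show ((J + 1 : ℕ) : ℤ) - ((J + 1 + 1 : ℕ) : ℤ) - 1 + (2 : ℕ) = (0 : ℕ) by push_cast; ring,
      invFact_natCast, invFact_natCast, invFact_natCast, invFact_natCast]
    simp [invFact]; ring
  rw [show J + 1 + 1 + 1 - (J + 1) = 2 by omega,
    show J + 1 + 1 + (J + 1) - 1 = 2 * J + 2 by omega,
    show 1 + (J + 1) - (J + 1 + 1) = 0 by omega,
    show J + 1 + 1 + 1 + (J + 1) + 1 = 2 * J + 2 + 1 + 1 + 1 by omega,
    show (((J + 1 : ℕ) : ℤ) - 1).toNat = J by omega,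
    show (((J + 1 : ℕ) : ℤ) + 1).toNat = J + 1 + 1 by omega] at hsq
  unfold poleAmplitude
  rw [hv, hr]
  refine mul_sqrt_eq_sqrt (by positivity) ?_
  rw [mul_pow, hsq]
  simp only [Nat.factorial_succ (2 * J + 2), Nat.factorial_succ (2 * J + 2 + 1),
    Nat.factorial_succ (2 * J + 2 + 1 + 1), Nat.factorial_succ J, Nat.factorial_succ (J + 1)]
  have h1 := Nat.factorial_ne_zero (2 * J + 2)
  have h2 := Nat.factorial_ne_zero J
  push_cast
  field_simp
  norm_num
  ring

lemma poleAmplitude_succ_zero {j : ℕ} (hj : 1 ≤ j) :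
    poleAmplitude j (j + 1) 0 = -Real.sqrt ((j + 1) / (4 * Real.pi)) := by
  obtain ⟨J, rfl⟩ : ∃ J, j = J + 1 := ⟨j - 1, by omega⟩
  obtain ⟨P, hP, hsq, hv⟩ := clebschGordan_zero_one (l := J + 1 + 1) (j := J + 1) (m := 0)
    ⟨by ring, by simp; positivity, by simp, by simp; positivity, by omega, by omega, by omega⟩
  have hr : racahSum (J + 1 + 1 + 1 - (J + 1)) (((J + 1 : ℕ) : ℤ) - 1) ((J + 1 + 1 : ℕ) : ℤ)
      (((J + 1 : ℕ) : ℤ) - ((J + 1 + 1 : ℕ) : ℤ) - 0) (1 + 0)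
      = -(1 / (((J + 1)! : ℕ) : ℝ) * (1 / (((J + 1)! : ℕ) : ℝ))) := by
    rw [show J + 1 + 1 + 1 - (J + 1) = 2 by omega]
    unfold racahSum
    simp only [Finset.sum_range_succ, Finset.range_zero, Finset.sum_empty]
    rw [invFact_of_neg (k := ((J + 1 : ℕ) : ℤ) - ((J + 1 + 1 : ℕ) : ℤ) - 0 + (0 : ℕ))
        (by push_cast; omega),
      invFact_of_neg (k := 1 + 0 - ((2 : ℕ) : ℤ)) (by norm_num)]
    rw [show ((J + 1 : ℕ) : ℤ) - 1 + (1 : ℕ) = (J + 1 : ℕ) by push_cast; ring,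
      show ((J + 1 + 1 : ℕ) : ℤ) - (1 : ℕ) = (J + 1 : ℕ) by push_cast; ring,
      show ((J + 1 : ℕ) : ℤ) - ((J + 1 + 1 : ℕ) : ℤ) - 0 + (1 : ℕ) = (0 : ℕ) by push_cast; ring,
      invFact_natCast (J + 1), invFact_natCast 0, invFact_natCast 1]
    simp [invFact]
  rw [show J + 1 + 1 + 1 - (J + 1) = 2 by omega,
    show J + 1 + 1 + (J + 1) - 1 = 2 * J + 2 by omega,
    show 1 + (J + 1) - (J + 1 + 1) = 0 by omega,
    show J + 1 + 1 + 1 + (J + 1) + 1 = 2 * J + 2 + 1 + 1 + 1 by omega,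
    show (((J + 1 : ℕ) : ℤ) - 0).toNat = J + 1 by omega,
    show (((J + 1 : ℕ) : ℤ) + 0).toNat = J + 1 by omega] at hsq
  unfold poleAmplitude
  rw [hv, hr, mul_neg, neg_mul, neg_inj]
  refine mul_sqrt_eq_sqrt (by positivity) ?_
  rw [mul_pow, hsq]
  simp only [Nat.factorial_succ (2 * J + 2), Nat.factorial_succ (2 * J + 2 + 1),
    Nat.factorial_succ (2 * J + 2 + 1 + 1), Nat.factorial_succ J, Nat.factorial_succ (J + 1)]
  have h1 := Nat.factorial_ne_zero (2 * J + 2)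
  have h2 := Nat.factorial_ne_zero J
  push_cast
  field_simp
  norm_num
  ring

lemma poleAmplitude_self_zero (j : ℕ) : poleAmplitude j j 0 = 0 := by
  have := poleAmplitude_neg j j 0
  rw [neg_zero, show j + 1 + j = 2 * j + 1 by ring, pow_succ, pow_mul] at this
  norm_num at this
  linarith

/-! ### Transverse multiplets -/

/-- The polynomial vector field which agrees with the transverse harmonic on the unit sphere. -/
def solidTransverse (α : Fin 2) (j : ℕ) (m : ℤ) (n : Space) (i : Fin 3) : ℂ :=
  if α = 0 then solidVec j j m n i
  else
    (Real.sqrt (((j : ℝ) + 1) / (2 * (j : ℝ) + 1)) : ℂ) * solidVec j (j - 1) m n i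
      + (Real.sqrt ((j : ℝ) / (2 * (j : ℝ) + 1)) : ℂ) * solidVec j (j + 1) m n i

lemma transverseHarmonic_eq (α : Fin 2) (j : ℕ) (m : ℤ) {n : Space} (hn : ‖n‖ = 1) (i : Fin 3) :
    transverseHarmonic j m α n i = solidTransverse α j m n i := by
  unfold transverseHarmonic solidTransverse
  simp only [vectorHarmonic_eq _ _ _ hn]

lemma isVectorMultiplet_solidTransverse (α : Fin 2) (j : ℕ) :
    IsVectorMultiplet j (solidTransverse α j) := by
  by_cases h : α = 0
  · have : solidTransverse α j = solidVec j j := by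
      funext m n i; simp [solidTransverse, h]
    rw [this]
    exact isVectorMultiplet_solidVec j j
  · have := (isVectorMultiplet_solidVec j (j - 1)).add_smul (isVectorMultiplet_solidVec j (j + 1))
      (Real.sqrt (((j : ℝ) + 1) / (2 * (j : ℝ) + 1)) : ℂ) (Real.sqrt ((j : ℝ) / (2 * (j : ℝ) + 1)) : ℂ)
    convert this using 4
    simp [solidTransverse, h]

/-- The amplitude at the pole of the transverse harmonics. -/
def transverseAmplitude (α : Fin 2) (j : ℕ) (m : ℤ) : ℝ :=
  if m = 1 then (if α = 0 then -1 else 1) * Real.sqrt ((2 * j + 1) / (8 * Real.pi))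
  else if m = -1 then Real.sqrt ((2 * j + 1) / (8 * Real.pi)) else 0

lemma solidVec_pole' (j l : ℕ) (m : ℤ) (i : Fin 3) :
    solidVec j l m pole i = poleAmplitude j l m * sphericalBasis m i := by
  rw [solidVec_pole, poleAmplitude]; push_cast; ring

lemma poleAmplitude_pred_neg_one {j : ℕ} (hj : 1 ≤ j) :
    poleAmplitude j (j - 1) (-1) = Real.sqrt ((j + 1) / (8 * Real.pi)) := by
  rw [poleAmplitude_neg, poleAmplitude_pred_one hj, show j - 1 + 1 + j = 2 * j by omega, pow_mul]
  norm_num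

lemma poleAmplitude_succ_neg_one {j : ℕ} (hj : 1 ≤ j) :
    poleAmplitude j (j + 1) (-1) = Real.sqrt (j / (8 * Real.pi)) := by
  rw [poleAmplitude_neg, poleAmplitude_succ_one hj, show j + 1 + 1 + j = 2 * (j + 1) by omega, pow_mul]
  norm_num

lemma poleAmplitude_self_neg_one {j : ℕ} (hj : 1 ≤ j) :
    poleAmplitude j j (-1) = Real.sqrt ((2 * j + 1) / (8 * Real.pi)) := by
  rw [poleAmplitude_neg, poleAmplitude_self_one hj, show j + 1 + j = 2 * j + 1 by omega, pow_succ, pow_mul]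
  norm_num

lemma sqrt_combination_one (j : ℕ) :
    Real.sqrt ((j + 1) / (2 * j + 1)) * Real.sqrt ((j + 1) / (8 * Real.pi))
      + Real.sqrt (j / (2 * j + 1)) * Real.sqrt (j / (8 * Real.pi))
      = Real.sqrt ((2 * j + 1) / (8 * Real.pi)) := by
  have h0 : (0 : ℝ) < 2 * j + 1 := by positivity
  simp only [Real.sqrt_div' _ h0.le, Real.sqrt_div' _ (show (0 : ℝ) ≤ 8 * Real.pi by positivity)]
  have s1' : Real.sqrt ((j : ℝ) + 1) ^ 2 = j + 1 := Real.sq_sqrt (by positivity)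
  have s2' : Real.sqrt (j : ℝ) ^ 2 = j := Real.sq_sqrt (by positivity)
  have s3' : Real.sqrt (2 * (j : ℝ) + 1) ^ 2 = 2 * j + 1 := Real.sq_sqrt (by positivity)
  have s4 : Real.sqrt (2 * (j : ℝ) + 1) ≠ 0 := (Real.sqrt_pos.mpr h0).ne'
  have s5 : Real.sqrt (8 * Real.pi) ≠ 0 := (Real.sqrt_pos.mpr (by positivity)).ne'
  field_simp
  rw [mul_comm (j : ℝ) 2, s1', s2', s3']
  ring

/-- This cancels the radial components of Y_{j,j-1,0} and Y_{j,j+1,0} at the pole, and so makes the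
combination Y^(1) tangential. -/
lemma sqrt_combination_zero (j : ℕ) :
    Real.sqrt ((j + 1) / (2 * j + 1)) * Real.sqrt (j / (4 * Real.pi))
      = Real.sqrt (j / (2 * j + 1)) * Real.sqrt ((j + 1) / (4 * Real.pi)) := by
  rw [← Real.sqrt_mul (by positivity), ← Real.sqrt_mul (by positivity)]
  congr 1
  ring

lemma transverseAmplitude_one (α : Fin 2) (j : ℕ) : transverseAmplitude α j 1
    = (if α = 0 then -1 else 1) * Real.sqrt ((2 * j + 1) / (8 * Real.pi)) := by
  simp [transverseAmplitude]

lemma transverseAmplitude_neg_one (α : Fin 2) (j : ℕ) : transverseAmplitude α j (-1)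
    = Real.sqrt ((2 * j + 1) / (8 * Real.pi)) := by
  unfold transverseAmplitude
  rw [if_neg (by norm_num), if_pos rfl]

lemma transverseAmplitude_zero (α : Fin 2) (j : ℕ) : transverseAmplitude α j 0 = 0 := by
  simp [transverseAmplitude]

lemma solidTransverse_pole (α : Fin 2) {j : ℕ} (hj : 1 ≤ j) (m : ℤ) (i : Fin 3) :
    solidTransverse α j m pole i = transverseAmplitude α j m * sphericalBasis m i := by
  by_cases hm : m ∈ Finset.Icc (-1 : ℤ) 1
  swap
  · simp only [solidTransverse, solidVec_pole', sphericalBasis_eq_zero hm]; simp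
  have a1 := congrArg Complex.ofReal (sqrt_combination_one j)
  have a0 := congrArg Complex.ofReal (sqrt_combination_zero j)
  rw [Complex.ofReal_add, Complex.ofReal_mul, Complex.ofReal_mul] at a1
  rw [Complex.ofReal_mul, Complex.ofReal_mul] at a0
  rw [Finset.mem_Icc] at hm
  unfold solidTransverse
  obtain rfl | rfl | rfl : m = -1 ∨ m = 0 ∨ m = 1 := by omega
  · simp only [solidVec_pole', poleAmplitude_pred_neg_one hj, poleAmplitude_succ_neg_one hj,
      poleAmplitude_self_neg_one hj, transverseAmplitude_neg_one]
    by_cases h : α = 0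
    · rw [if_pos h]
    · rw [if_neg h, ← a1]; ring
  · simp only [solidVec_pole', poleAmplitude_pred_zero hj, poleAmplitude_succ_zero hj,
      poleAmplitude_self_zero, transverseAmplitude_zero]
    by_cases h : α = 0
    · rw [if_pos h]
    · rw [if_neg h, Complex.ofReal_neg, Complex.ofReal_zero]
      linear_combination (sphericalBasis 0 i) * a0
  · simp only [solidVec_pole', poleAmplitude_pred_one hj, poleAmplitude_succ_one hj,
      poleAmplitude_self_one hj, transverseAmplitude_one]
    by_cases h : α = 0
    · rw [if_pos h, if_pos h, neg_one_mul]
    · rw [if_neg h, if_neg h, one_mul, ← a1]; ring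

/-- Comparison of the tangential part of a multiplet with a tangential multiplet, at the pole. -/
lemma IsVectorMultiplet.tangential_eq {j : ℕ} {V T : ℤ → Space → Fin 3 → ℂ}
    (hV : IsVectorMultiplet j V) (hT : IsVectorMultiplet j T) {A B : ℤ → ℝ} (d : ℝ)
    (hA : ∀ m i, V m pole i = A m * sphericalBasis m i)
    (hB : ∀ m i, T m pole i = B m * sphericalBasis m i)
    (h1 : A 1 = d * B 1) (h2 : A (-1) = d * B (-1)) (h0 : d * B 0 = 0)
    (m : ℤ) {n : Space} (hn : ‖n‖ = 1) (i : Fin 3) :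
    V m n i - (∑ k, (n k : ℂ) * V m n k) * n i = d * T m n i := by
  -- The difference of the two sides is again a multiplet. At the pole the radial part is exactly
  -- the component with m = 0, so the hypotheses make the difference vanish there.
  have key := ((hV.add_smul hV.radial 1 (-1)).add_smul hT 1 (-d)).eq_zero_of_pole ?_ m hn i
  · linear_combination key
  · intro m i
    simp only [hA, hB]
    by_cases hm : m ∈ Finset.Icc (-1 : ℤ) 1
    swap
    · simp [sphericalBasis_eq_zero hm]
    rw [Finset.mem_Icc] at hm
    obtain rfl | rfl | rfl : m = -1 ∨ m = 0 ∨ m = 1 := by omega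
    · rw [h2]
      fin_cases i <;> simp [Fin.sum_univ_three, sphericalBasis] <;> ring
    · fin_cases i <;> simp [Fin.sum_univ_three, sphericalBasis]
      simpa using h0
    · rw [h1]
      fin_cases i <;> simp [Fin.sum_univ_three, sphericalBasis] <;> ring

/-- Comparison of the multiplet with itself: having no component m = 0 at the pole, it equals its
own tangential part, so (n·T) n = 0, and `n` is a unit vector. -/
lemma solidTransverse_tangential (α : Fin 2) {j : ℕ} (hj : 1 ≤ j) (m : ℤ) {n : Space} (hn : ‖n‖ = 1) :
    ∑ k, (n k : ℂ) * solidTransverse α j m n k = 0 := by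
  have hT := isVectorMultiplet_solidTransverse α j
  have h := fun i => hT.tangential_eq hT 1 (solidTransverse_pole α hj) (solidTransverse_pole α hj)
    (by ring) (by ring) (by simp [transverseAmplitude]) m hn i
  have e := norm_sq_eq n
  rw [hn] at e
  have e' : (n 0 : ℂ) ^ 2 + (n 1 : ℂ) ^ 2 + (n 2 : ℂ) ^ 2 = 1 := by exact_mod_cast (by linarith)
  set S := ∑ k, (n k : ℂ) * solidTransverse α j m n k
  have h' : ∀ i, S * n i = 0 := fun i => by have := h i; push_cast at this; linear_combination -this
  linear_combination (n 0 : ℂ) * h' 0 + (n 1 : ℂ) * h' 1 + (n 2 : ℂ) * h' 2 - S * e'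

/-- The expansion coefficients of the tangential part of `Y_{jlm}`. -/
def tangentialCoeff (α : Fin 2) (j l : ℕ) : ℝ :=
  if j = 0 then 0 else if α = 0 then (if l = j then 1 else 0)
  else if l + 1 = j then Real.sqrt ((j + 1) / (2 * j + 1))
  else if l = j + 1 then Real.sqrt (j / (2 * j + 1)) else 0

lemma tangentialCoeff_eq_zero {α : Fin 2} {j l : ℕ} (h : ¬ (j ≤ l + 1 ∧ l ≤ j + 1)) :
    tangentialCoeff α j l = 0 := by
  unfold tangentialCoeff
  split_ifs <;> first | rfl | omega

lemma solidVec_eq_zero {j l : ℕ} (h : ¬ (j ≤ l + 1 ∧ l ≤ 1 + j ∧ 1 ≤ l + j)) (m : ℤ) (n : Space)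
    (i : Fin 3) : solidVec j l m n i = 0 := by
  unfold solidVec
  refine Finset.sum_eq_zero fun q _ => ?_
  rw [clebschGordan_eq_zero_of_not fun hh => h hh.2.2.2]
  simp

/-- At the pole the tangential part has only the components m = ±1. Both are proportional, with the
same factor, to those of a single transverse multiplet: the TE one for l = j, the TM one for l = j ±
1. -/
lemma solidVec_sub_radial (j l : ℕ) (m : ℤ) {n : Space} (hn : ‖n‖ = 1) (i : Fin 3) :
    solidVec j l m n i - (∑ k, (n k : ℂ) * solidVec j l m n k) * n i
      = ∑ α, (tangentialCoeff α j l : ℂ) * solidTransverse α j m n i := by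
  have hV := isVectorMultiplet_solidVec j l
  by_cases h : j ≤ l + 1 ∧ l ≤ 1 + j ∧ 1 ≤ l + j
  swap
  · have hz := solidVec_eq_zero h m n
    rw [Fin.sum_univ_two]
    by_cases hj : j = 0
    · simp only [hz]; simp [tangentialCoeff, hj]
    · rw [tangentialCoeff_eq_zero (by omega), tangentialCoeff_eq_zero (by omega)]
      simp [hz]
  rw [Fin.sum_univ_two]
  rcases Nat.eq_zero_or_pos j with rfl | hj
  · have := hV.tangential_eq hV 0 (solidVec_pole' 0 l) (solidVec_pole' 0 l)
      (by rw [zero_mul, poleAmplitude, clebschGordan_eq_zero_of_not (by simp), zero_mul])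
      (by rw [zero_mul, poleAmplitude, clebschGordan_eq_zero_of_not (by simp), zero_mul])
      (by ring) m hn i
    rw [this]; simp [tangentialCoeff]
  have p1 := sqrt_combination_one j
  have hj0 : j ≠ 0 := by omega
  have s0 : (0 : ℝ) < 2 * j + 1 := by positivity
  have hq : Real.sqrt (2 * (j : ℝ) + 1) ≠ 0 := (Real.sqrt_pos.mpr s0).ne'
  have c1 : Real.sqrt ((j + 1) / (8 * Real.pi))
      = Real.sqrt ((j + 1) / (2 * j + 1)) * Real.sqrt ((2 * j + 1) / (8 * Real.pi)) := by
    rw [← Real.sqrt_mul (by positivity)]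
    congr 1; field_simp
  have c2 : Real.sqrt (j / (8 * Real.pi))
      = Real.sqrt (j / (2 * j + 1)) * Real.sqrt ((2 * j + 1) / (8 * Real.pi)) := by
    rw [← Real.sqrt_mul (by positivity)]
    congr 1; field_simp
  obtain rfl | rfl | hl : l = j ∨ l = j + 1 ∨ l + 1 = j := by omega
  · rw [hV.tangential_eq (isVectorMultiplet_solidTransverse 0 l) 1 (solidVec_pole' l l)
      (solidTransverse_pole 0 hj)
      (by rw [poleAmplitude_self_one hj]; simp [transverseAmplitude])
      (by rw [poleAmplitude_self_neg_one hj]; simp [transverseAmplitude])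
      (by simp [transverseAmplitude]) m hn i]
    simp [tangentialCoeff, hj0]
  · rw [hV.tangential_eq (isVectorMultiplet_solidTransverse 1 j) (Real.sqrt (j / (2 * j + 1)))
      (solidVec_pole' j (j + 1)) (solidTransverse_pole 1 hj)
      (by rw [poleAmplitude_succ_one hj, c2]; simp [transverseAmplitude])
      (by rw [poleAmplitude_succ_neg_one hj, c2]; simp [transverseAmplitude])
      (by simp [transverseAmplitude]) m hn i]
    have : ¬ (j + 1 + 1 = j) := by omega
    simp [tangentialCoeff, hj0, this]
  · obtain rfl : l = j - 1 := by omega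
    rw [hV.tangential_eq (isVectorMultiplet_solidTransverse 1 j) (Real.sqrt ((j + 1) / (2 * j + 1)))
      (solidVec_pole' j (j - 1)) (solidTransverse_pole 1 hj)
      (by rw [poleAmplitude_pred_one hj, c1]; simp [transverseAmplitude])
      (by rw [poleAmplitude_pred_neg_one hj, c1]; simp [transverseAmplitude])
      (by simp [transverseAmplitude]) m hn i]
    have : ¬ (j - 1 = j) := by omega
    simp [tangentialCoeff, hj0, this, hl]

/-! ### Angular integrals of three multiplets -/

/-- The infinitesimal rotation about the second axis of a tensor with three indices. -/
def tripleAct (a b c : ℕ) (F : ℤ → ℤ → ℤ → ℂ) (m₁ m₂ m₃ : ℤ) : ℂ :=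
  ladderAct a (fun k => F k m₂ m₃) m₁ + ladderAct b (fun k => F m₁ k m₃) m₂
    + ladderAct c (fun k => F m₁ m₂ k) m₃

/-- The tensor lives on total projection zero. Hence the rotation about the second axis reduces to
its raising half at total projection -1, to its lowering half at +1, and to nothing elsewhere. -/
lemma IsInvariantTensor.tripleAct_eq_zero {a b c : ℕ} {X : ℤ → ℤ → ℤ → ℂ}
    (hX : IsInvariantTensor a b c X) (m₁ m₂ m₃ : ℤ) : tripleAct a b c X m₁ m₂ m₃ = 0 := by
  have out : ∀ x y z : ℤ, x + y + z ≠ 0 → X x y z = 0 := fun x y z h =>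
    hX.support x y z fun hh => h hh.1
  simp only [tripleAct, ladderAct]
  by_cases h1 : m₁ + m₂ + m₃ = -1
  · rw [out (m₁ - 1) _ _ (by omega), out _ (m₂ - 1) _ (by omega), out _ _ (m₃ - 1) (by omega)]
    linear_combination (1 / 2 : ℂ) * hX.raise _ _ _ h1
  by_cases h2 : m₁ + m₂ + m₃ = 1
  · rw [out (m₁ + 1) _ _ (by omega), out _ (m₂ + 1) _ (by omega), out _ _ (m₃ + 1) (by omega)]
    linear_combination (-1 / 2 : ℂ) * hX.lower _ _ _ h2
  rw [out (m₁ - 1) _ _ (by omega), out _ (m₂ - 1) _ (by omega), out _ _ (m₃ - 1) (by omega),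
    out (m₁ + 1) _ _ (by omega), out _ (m₂ + 1) _ (by omega), out _ _ (m₃ + 1) (by omega)]
  ring

lemma sum_tripleAct_mul (a b c : ℕ) (F G : ℤ → ℤ → ℤ → ℂ) :
    ∑ m₃ ∈ Finset.Icc (-(c : ℤ)) c, ∑ m₁ ∈ Finset.Icc (-(a : ℤ)) a,
      ∑ m₂ ∈ Finset.Icc (-(b : ℤ)) b,
        (tripleAct a b c F m₁ m₂ m₃ * G m₁ m₂ m₃ + F m₁ m₂ m₃ * tripleAct a b c G m₁ m₂ m₃) = 0 := by
  have e : ∀ m₁ m₂ m₃, tripleAct a b c F m₁ m₂ m₃ * G m₁ m₂ m₃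
      + F m₁ m₂ m₃ * tripleAct a b c G m₁ m₂ m₃
      = (ladderAct a (fun k => F k m₂ m₃) m₁ * G m₁ m₂ m₃
          + F m₁ m₂ m₃ * ladderAct a (fun k => G k m₂ m₃) m₁)
        + (ladderAct b (fun k => F m₁ k m₃) m₂ * G m₁ m₂ m₃
          + F m₁ m₂ m₃ * ladderAct b (fun k => G m₁ k m₃) m₂)
        + (ladderAct c (fun k => F m₁ m₂ k) m₃ * G m₁ m₂ m₃
          + F m₁ m₂ m₃ * ladderAct c (fun k => G m₁ m₂ k) m₃) := by
    intro m₁ m₂ m₃; unfold tripleAct; ring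
  simp only [e]
  have h1 : ∑ m₃ ∈ Finset.Icc (-(c : ℤ)) c, ∑ m₁ ∈ Finset.Icc (-(a : ℤ)) a,
      ∑ m₂ ∈ Finset.Icc (-(b : ℤ)) b, (ladderAct a (fun k => F k m₂ m₃) m₁ * G m₁ m₂ m₃
          + F m₁ m₂ m₃ * ladderAct a (fun k => G k m₂ m₃) m₁) = 0 := by
    refine Finset.sum_eq_zero fun m₃ _ => ?_
    rw [Finset.sum_comm]
    exact Finset.sum_eq_zero fun m₂ _ => sum_ladderAct_mul a (fun k => F k m₂ m₃) fun k => G k m₂ m₃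
  have h2 : ∑ m₃ ∈ Finset.Icc (-(c : ℤ)) c, ∑ m₁ ∈ Finset.Icc (-(a : ℤ)) a,
      ∑ m₂ ∈ Finset.Icc (-(b : ℤ)) b, (ladderAct b (fun k => F m₁ k m₃) m₂ * G m₁ m₂ m₃
          + F m₁ m₂ m₃ * ladderAct b (fun k => G m₁ k m₃) m₂) = 0 :=
    Finset.sum_eq_zero fun m₃ _ => Finset.sum_eq_zero fun m₁ _ =>
      sum_ladderAct_mul b (fun k => F m₁ k m₃) fun k => G m₁ k m₃
  have h3 : ∑ m₃ ∈ Finset.Icc (-(c : ℤ)) c, ∑ m₁ ∈ Finset.Icc (-(a : ℤ)) a,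
      ∑ m₂ ∈ Finset.Icc (-(b : ℤ)) b, (ladderAct c (fun k => F m₁ m₂ k) m₃ * G m₁ m₂ m₃
          + F m₁ m₂ m₃ * ladderAct c (fun k => G m₁ m₂ k) m₃) = 0 := by
    rw [Finset.sum_comm]
    refine Finset.sum_eq_zero fun m₁ _ => ?_
    rw [Finset.sum_comm]
    exact Finset.sum_eq_zero fun m₂ _ => sum_ladderAct_mul c (fun k => F m₁ m₂ k) fun k => G m₁ m₂ k
  simp only [Finset.sum_add_distrib] at h1 h2 h3 ⊢
  linear_combination h1 + h2 + h3

/-- Families of functions which transform under rotations as a product of three multiplets. -/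
structure IsTripleMultiplet (a b c : ℕ) (B : ℤ → ℤ → ℤ → Space → ℂ) : Prop where
  cont : ∀ m₁ m₂ m₃, Continuous (B m₁ m₂ m₃)
  support : ∀ m₁ m₂ m₃, ¬ (|m₁| ≤ (a : ℤ) ∧ |m₂| ≤ (b : ℤ) ∧ |m₃| ≤ (c : ℤ)) → ∀ n, B m₁ m₂ m₃ n = 0
  rotY : ∀ m₁ m₂ m₃ n t, HasDerivAt (fun s => B m₁ m₂ m₃ (rotY s n))
    (tripleAct a b c (fun k₁ k₂ k₃ => B k₁ k₂ k₃ (rotY t n)) m₁ m₂ m₃) t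
  rotZ : ∀ m₁ m₂ m₃ n t, HasDerivAt (fun s => B m₁ m₂ m₃ (rotZ s n))
    (Complex.I * (m₁ + m₂ + m₃ : ℤ) * B m₁ m₂ m₃ (rotZ t n)) t

namespace IsTripleMultiplet

variable {a b c : ℕ} {B : ℤ → ℤ → ℤ → Space → ℂ}

lemma integrable (hB : IsTripleMultiplet a b c B) (m₁ m₂ m₃ : ℤ) :
    Integrable (fun n : Dir => B m₁ m₂ m₃ n) solidAngle :=
  integrable_dir ((hB.cont m₁ m₂ m₃).comp continuous_subtype_val)

/-- Integrals of infinitesimal rotations vanish. Rotation about the third axis forces the orders to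
add up to zero, and this selection rule separates the raising half from the lowering half of the
rotation about the second axis. -/
lemma isInvariantTensor_integral (hB : IsTripleMultiplet a b c B) :
    IsInvariantTensor a b c fun m₁ m₂ m₃ => ∫ n : Dir, B m₁ m₂ m₃ n ∂solidAngle := by
  have out : ∀ m₁ m₂ m₃, m₁ + m₂ + m₃ ≠ 0 → ∫ n : Dir, B m₁ m₂ m₃ n ∂solidAngle = 0 := by
    intro m₁ m₂ m₃ h
    have := integral_eq_zero_of_rotation (R := rotZEquiv) (p := B m₁ m₂ m₃)
      (q := fun n => Complex.I * (m₁ + m₂ + m₃ : ℤ) * B m₁ m₂ m₃ n) (hB.cont m₁ m₂ m₃)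
      (continuous_const.mul (hB.cont m₁ m₂ m₃)) (hB.rotZ m₁ m₂ m₃)
    rw [integral_const_mul] at this
    have hne : Complex.I * ((m₁ + m₂ + m₃ : ℤ) : ℂ) ≠ 0 :=
      mul_ne_zero Complex.I_ne_zero (by exact_mod_cast h)
    exact (mul_eq_zero.mp this).resolve_left hne
  have act : ∀ m₁ m₂ m₃, tripleAct a b c (fun k₁ k₂ k₃ => ∫ n : Dir, B k₁ k₂ k₃ n ∂solidAngle)
      m₁ m₂ m₃ = 0 := by
    intro m₁ m₂ m₃
    have hc : Continuous fun n => tripleAct a b c (fun k₁ k₂ k₃ => B k₁ k₂ k₃ n) m₁ m₂ m₃ := by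
      have := hB.cont
      unfold tripleAct ladderAct
      fun_prop
    have := integral_eq_zero_of_rotation (R := rotYEquiv) (p := B m₁ m₂ m₃)
      (q := fun n => tripleAct a b c (fun k₁ k₂ k₃ => B k₁ k₂ k₃ n) m₁ m₂ m₃) (hB.cont m₁ m₂ m₃)
      hc (hB.rotY m₁ m₂ m₃)
    rw [← this]
    have lin : ∀ (l : ℕ) (m : ℤ) (F : ℤ → Dir → ℂ), (∀ k, Integrable (F k) solidAngle) →
        Integrable (fun n => ladderAct l (fun k => F k n) m) solidAngle ∧
        ∫ n, ladderAct l (fun k => F k n) m ∂solidAngle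
          = ladderAct l (fun k => ∫ n, F k n ∂solidAngle) m := by
      intro l m F hF
      unfold ladderAct
      refine ⟨(((hF _).const_mul _).sub ((hF _).const_mul _)).div_const _, ?_⟩
      rw [integral_div, integral_sub ((hF _).const_mul _) ((hF _).const_mul _),
        integral_const_mul, integral_const_mul]
    have l1 := lin a m₁ (fun k n => B k m₂ m₃ n) fun k => hB.integrable _ _ _
    have l2 := lin b m₂ (fun k n => B m₁ k m₃ n) fun k => hB.integrable _ _ _
    have l3 := lin c m₃ (fun k n => B m₁ m₂ k n) fun k => hB.integrable _ _ _
    simp only [tripleAct]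
    refine (?_ : _ = ∫ n : Dir, (ladderAct a (fun k => B k m₂ m₃ n) m₁
      + ladderAct b (fun k => B m₁ k m₃ n) m₂) + ladderAct c (fun k => B m₁ m₂ k n) m₃ ∂solidAngle)
    rw [← l1.2, ← l2.2, ← l3.2, ← integral_add l1.1 l2.1]
    exact (integral_add (l1.1.add l2.1) l3.1).symm
  refine ⟨fun m₁ m₂ m₃ h => ?_, fun m₁ m₂ m₃ h => ?_, fun m₁ m₂ m₃ h => ?_⟩
  · by_cases hs : m₁ + m₂ + m₃ = 0
    · simp [hB.support m₁ m₂ m₃ fun hh => h ⟨hs, hh⟩]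
    · exact out _ _ _ hs
  · have := act m₁ m₂ m₃
    unfold tripleAct ladderAct at this
    simp only [out (m₁ - 1) m₂ m₃ (by omega), out m₁ (m₂ - 1) m₃ (by omega),
      out m₁ m₂ (m₃ - 1) (by omega)] at this
    linear_combination 2 * this
  · have := act m₁ m₂ m₃
    unfold tripleAct ladderAct at this
    simp only [out (m₁ + 1) m₂ m₃ (by omega), out m₁ (m₂ + 1) m₃ (by omega),
      out m₁ m₂ (m₃ + 1) (by omega)] at this
    linear_combination (-2) * this

/-- The integral over the sphere of a product of three multiplets, through its value at the pole. -/
theorem integral_eq (hB : IsTripleMultiplet a b c B) (m₁ m₂ m₃ : ℤ) :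
    ∫ n : Dir, B m₁ m₂ m₃ n ∂solidAngle
      = 4 * Real.pi * (∑ n₃ ∈ Finset.Icc (-(c : ℤ)) c, ∑ n₁ ∈ Finset.Icc (-(a : ℤ)) a,
        ∑ n₂ ∈ Finset.Icc (-(b : ℤ)) b, (threeJ a b c n₁ n₂ n₃ : ℂ) * B n₁ n₂ n₃ pole)
        * threeJ a b c m₁ m₂ m₃ := by
  rw [hB.isInvariantTensor_integral.eq_threeJ]
  congr 1
  -- Contraction with the invariant 3j tensor gives a rotation invariant function, which equals its
  -- pole value and integrates to 4π times it.
  set G : Space → ℂ := fun n => ∑ n₃ ∈ Finset.Icc (-(c : ℤ)) c, ∑ n₁ ∈ Finset.Icc (-(a : ℤ)) a,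
        ∑ n₂ ∈ Finset.Icc (-(b : ℤ)) b, (threeJ a b c n₁ n₂ n₃ : ℂ) * B n₁ n₂ n₃ n with hG
  have hinv : ∀ n : Dir, G n = G pole := by
    intro n
    refine eq_pole_of_invariant (fun n t => ?_) (fun n t => ?_) (norm_dir n)
    · refine (HasDerivAt.fun_sum fun n₃ _ => HasDerivAt.fun_sum fun n₁ _ => HasDerivAt.fun_sum
        fun n₂ _ => (hB.rotY n₁ n₂ n₃ n t).const_mul _).congr_deriv ?_
      rw [← sum_tripleAct_mul a b c (fun m₁ m₂ m₃ => (threeJ a b c m₁ m₂ m₃ : ℂ))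
        fun k₁ k₂ k₃ => B k₁ k₂ k₃ (EMWaves.rotY t n)]
      simp only [(isInvariantTensor_threeJ a b c).tripleAct_eq_zero, zero_mul, zero_add]
    · refine (HasDerivAt.fun_sum fun n₃ _ => HasDerivAt.fun_sum fun n₁ _ => HasDerivAt.fun_sum
        fun n₂ _ => (hB.rotZ n₁ n₂ n₃ n t).const_mul _).congr_deriv ?_
      refine Finset.sum_eq_zero fun n₃ _ => Finset.sum_eq_zero fun n₁ _ =>
        Finset.sum_eq_zero fun n₂ _ => ?_
      by_cases h : n₁ + n₂ + n₃ = 0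
      · rw [h]; simp
      · rw [threeJ_eq_zero_of_sum h]; simp
  have h1 : ∫ n : Dir, G n ∂solidAngle = 4 * Real.pi * G pole := by
    simp only [hinv]
    rw [integral_const, solidAngle_univ]
    simp
  rw [← h1, hG]
  rw [integral_finsetSum _ fun n₃ _ => integrable_finsetSum _ fun n₁ _ => integrable_finsetSum _
    fun n₂ _ => (hB.integrable n₁ n₂ n₃).const_mul _]
  refine Finset.sum_congr rfl fun n₃ _ => ?_
  rw [integral_finsetSum _ fun n₁ _ => integrable_finsetSum _
    fun n₂ _ => (hB.integrable n₁ n₂ n₃).const_mul _]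
  refine Finset.sum_congr rfl fun n₁ _ => ?_
  rw [integral_finsetSum _ fun n₂ _ => (hB.integrable n₁ n₂ n₃).const_mul _]
  exact Finset.sum_congr rfl fun n₂ _ => (integral_const_mul _ _).symm

end IsTripleMultiplet

lemma IsVectorMultiplet.triple {a b : ℕ} {V W : ℤ → Space → Fin 3 → ℂ}
    (hV : IsVectorMultiplet a V) (hW : IsVectorMultiplet b W) (c : ℕ) :
    IsTripleMultiplet a b c fun m₁ m₂ m₃ n => (∑ i, V m₁ n i * W m₂ n i) * solidY c m₃ n where
  cont m₁ m₂ m₃ := by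
    have := hV.cont
    have := hW.cont
    have := continuous_solidY c m₃
    fun_prop
  support m₁ m₂ m₃ h n := by
    by_cases h1 : |m₁| ≤ (a : ℤ)
    · by_cases h2 : |m₂| ≤ (b : ℤ)
      · rw [solidY_eq_zero (not_le.mp fun h3 => h ⟨h1, h2, h3⟩), mul_zero]
      · simp [hW.support m₂ (not_le.mp h2)]
    · simp [hV.support m₁ (not_le.mp h1)]
  rotY m₁ m₂ m₃ n t := by
    simp only [Fin.sum_univ_three]
    refine (((((hV.rotY m₁ n t 0).mul (hW.rotY m₂ n t 0)).add
      ((hV.rotY m₁ n t 1).mul (hW.rotY m₂ n t 1))).add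
      ((hV.rotY m₁ n t 2).mul (hW.rotY m₂ n t 2))).mul
      (hasDerivAt_solidY_rotY c m₃ n t)).congr_deriv ?_
    simp [tripleAct, ladderAct, crossY]
    ring
  rotZ m₁ m₂ m₃ n t := by
    simp only [Fin.sum_univ_three]
    refine (((((hV.rotZ m₁ n t 0).mul (hW.rotZ m₂ n t 0)).add
      ((hV.rotZ m₁ n t 1).mul (hW.rotZ m₂ n t 1))).add
      ((hV.rotZ m₁ n t 2).mul (hW.rotZ m₂ n t 2))).mul
      (hasDerivAt_solidY_rotZ c m₃ n t)).congr_deriv ?_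
    simp [crossZ]
    ring

/-! ### Evaluation of the triple angular integral. -/

lemma sum_sphericalBasis_mul_conj {q q' : ℤ} (hq : q ∈ Finset.Icc (-1 : ℤ) 1)
    (hq' : q' ∈ Finset.Icc (-1 : ℤ) 1) :
    ∑ i, conj (sphericalBasis q i) * sphericalBasis q' i = if q = q' then 1 else 0 := by
  have h2 := sqrt_two_sq
  have hne := sqrt_two_ne
  rw [Finset.mem_Icc] at hq hq'
  have c1 : q = -1 ∨ q = 0 ∨ q = 1 := by omega
  have c2 : q' = -1 ∨ q' = 0 ∨ q' = 1 := by omega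
  rcases c1 with rfl | rfl | rfl <;> rcases c2 with rfl | rfl | rfl
  all_goals simp [Fin.sum_univ_three, sphericalBasis]
  all_goals field_simp
  all_goals (try simp only [Complex.I_sq])
  all_goals (try rw [sq, h2])
  all_goals norm_num

/-- The polarisation sign relating the two pole amplitudes. -/
def polarisationSign (α : Fin 2) : ℝ := if α = 0 then -1 else 1

lemma transverseAmplitude_one_eq (α : Fin 2) (j : ℕ) : transverseAmplitude α j 1
    = polarisationSign α * Real.sqrt ((2 * j + 1) / (8 * Real.pi)) :=
  transverseAmplitude_one α j

/-- The integral `∫ Y_{j₃m₃} (conj Y^{(α)}_{j₁m₁} · Y^{(α')}_{j₂m₂})` through 3j symbols. -/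
lemma tripleIntegral_eq (p q : Mode) (s : ScalarIndex) : tripleIntegral p q s
    = ((-1) ^ p.m * (-(1 / 2) * dimFactor p.j q.j s.l * (threeJ p.j q.j s.l 1 (-1) 0
        + polarisationSign p.α * polarisationSign q.α * threeJ p.j q.j s.l (-1) 1 0)
        * threeJ p.j q.j s.l (-p.m) q.m s.m) : ℝ) := by
  obtain ⟨a, m₁, α, ha, hm₁⟩ := p
  obtain ⟨b, m₂, β, hb, hm₂⟩ := q
  obtain ⟨c, m₃, hm₃⟩ := s
  unfold tripleIntegral
  simp only
  -- Conjugation turns a multiplet into a multiplet with reversed orders and alternating signs;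
  -- hence -m₁ and the factor (-1)^m₁ in the result.
  have hB := (isVectorMultiplet_solidTransverse α a).conj_neg.triple
    (isVectorMultiplet_solidTransverse β b) c
  have h := hB.integral_eq (-m₁) m₂ m₃
  simp only [neg_neg] at h
  have e : ∀ n : Dir, sphericalHarmonic c m₃ n * ∑ i, conj (transverseHarmonic a m₁ α n i)
      * transverseHarmonic b m₂ β n i = (-1) ^ m₁ * ((∑ i, (-1) ^ (-m₁)
        * conj (solidTransverse α a m₁ n i) * solidTransverse β b m₂ n i) * solidY c m₃ n) := by
    intro n
    have hn := norm_dir n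
    rw [sphericalHarmonic_eq hm₃ hn]
    simp only [transverseHarmonic_eq _ _ _ hn, mul_assoc, ← Finset.mul_sum]
    have : (-1 : ℂ) ^ m₁ * (-1) ^ (-m₁) = 1 := by
      rw [← zpow_add₀ (by norm_num)]; simp
    linear_combination (-(∑ i, conj (solidTransverse α a m₁ n i) * solidTransverse β b m₂ n i)
      * solidY c m₃ n) * this
  simp only [e]
  rw [integral_const_mul, h]
  push_cast
  congr 2
  set A : ℝ := Real.sqrt ((2 * a + 1) / (8 * Real.pi)) with hA
  set B : ℝ := Real.sqrt ((2 * b + 1) / (8 * Real.pi)) with hBd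
  set C : ℝ := Real.sqrt ((2 * (c : ℝ) + 1) / (4 * Real.pi)) with hC
  -- At the pole transverse harmonics have only the orders ±1 and the basis vectors are orthonormal,
  -- so only the pairs (1, -1) and (-1, 1) contribute.
  have hpole : ∀ n₁ n₂, (∑ i, (-1) ^ n₁ * conj (solidTransverse α a (-n₁) pole i)
      * solidTransverse β b n₂ pole i) = if n₁ = 1 ∧ n₂ = -1 then (-(A * B) : ℂ)
        else if n₁ = -1 ∧ n₂ = 1 then -(polarisationSign α * polarisationSign β * A * B : ℂ) else 0 := by
    intro n₁ n₂
    have e2 : ∀ i, (-1) ^ n₁ * conj (solidTransverse α a (-n₁) pole i) * solidTransverse β b n₂ pole i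
        = (-1) ^ n₁ * transverseAmplitude α a (-n₁) * transverseAmplitude β b n₂
          * (conj (sphericalBasis (-n₁) i) * sphericalBasis n₂ i) := by
      intro i
      rw [solidTransverse_pole α ha, solidTransverse_pole β hb, map_mul, Complex.conj_ofReal]
      ring
    simp only [e2, ← Finset.mul_sum]
    by_cases h1 : -n₁ ∈ Finset.Icc (-1 : ℤ) 1
    swap
    · rw [Finset.mem_Icc] at h1
      rw [if_neg (by omega), if_neg (by omega)]
      have : transverseAmplitude α a (-n₁) = 0 := by
        rw [transverseAmplitude, if_neg (by omega), if_neg (by omega)]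
      simp [this]
    by_cases h2 : n₂ ∈ Finset.Icc (-1 : ℤ) 1
    swap
    · rw [Finset.mem_Icc] at h2
      rw [if_neg (by omega), if_neg (by omega)]
      have : transverseAmplitude β b n₂ = 0 := by
        rw [transverseAmplitude, if_neg (by omega), if_neg (by omega)]
      simp [this]
    rw [sum_sphericalBasis_mul_conj h1 h2]
    rw [Finset.mem_Icc] at h1 h2
    obtain rfl | rfl | rfl : n₁ = -1 ∨ n₁ = 0 ∨ n₁ = 1 := by omega
    · rw [neg_neg, transverseAmplitude_one_eq]
      by_cases h3 : n₂ = 1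
      · subst h3
        rw [transverseAmplitude_one_eq, if_pos rfl, if_neg (by norm_num), if_pos ⟨rfl, rfl⟩,
          ← hA, ← hBd]
        push_cast
        norm_num
        ring
      · rw [if_neg (show ¬ (1 : ℤ) = n₂ by omega), if_neg (by omega), if_neg (by omega), mul_zero]
    · simp [transverseAmplitude_zero]
    · rw [transverseAmplitude_neg_one]
      by_cases h3 : n₂ = -1
      · subst h3
        simp only [transverseAmplitude_neg_one]
        simp [← hA, ← hBd]
      · rw [if_neg (show ¬ (-1 : ℤ) = n₂ by omega), if_neg (by omega), if_neg (by omega), mul_zero]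
  have hABC : 4 * Real.pi * (A * B * C) = 1 / 2 * dimFactor a b c := by
    have : dimFactor a b c = 8 * Real.pi * (A * B * C) := by
      rw [hA, hBd, hC, ← Real.sqrt_mul (by positivity), ← Real.sqrt_mul (by positivity)]
      refine (mul_sqrt_eq_sqrt (by positivity) ?_).symm
      have := Real.pi_pos
      field_simp
    rw [this]; ring
  simp only [hpole, solidY_pole]
  have h0 : (0 : ℤ) ∈ Finset.Icc (-(c : ℤ)) c := by simp
  rw [Finset.sum_eq_single_of_mem _ h0 (by
    intro n₃ _ h3
    simp [h3])]
  have hsum : ∑ n₁ ∈ Finset.Icc (-(a : ℤ)) a, ∑ n₂ ∈ Finset.Icc (-(b : ℤ)) b,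
      (threeJ a b c n₁ n₂ 0 : ℂ) * ((if n₁ = 1 ∧ n₂ = -1 then (-(A * B) : ℂ)
        else if n₁ = -1 ∧ n₂ = 1 then -(polarisationSign α * polarisationSign β * A * B : ℂ) else 0)
        * (if (0 : ℤ) = 0 then (C : ℂ) else 0))
      = -(A * B * C) * (threeJ a b c 1 (-1) 0
        + polarisationSign α * polarisationSign β * threeJ a b c (-1) 1 0) := by
    rw [Finset.sum_eq_add_of_mem (1 : ℤ) (-1) (by rw [Finset.mem_Icc]; omega)
      (by rw [Finset.mem_Icc]; omega) (by norm_num)]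
    · rw [Finset.sum_eq_single_of_mem (-1 : ℤ) (by rw [Finset.mem_Icc]; omega),
        Finset.sum_eq_single_of_mem (1 : ℤ) (by rw [Finset.mem_Icc]; omega)]
      · simp; ring
      · intro n₂ _ hn; simp [hn]
      · intro n₂ _ hn; simp [hn]
    · intro n₁ _ hn
      simp [hn.1, hn.2]
  rw [hsum]
  have hABC' := congrArg Complex.ofReal hABC
  push_cast at hABC'
  linear_combination (-(threeJ a b c 1 (-1) 0
        + polarisationSign α * polarisationSign β * threeJ a b c (-1) 1 0 : ℂ)) * hABC'

/-- The two integrals are complex conjugates and the closed form is real. -/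
lemma couplingIntegral_eq (p q : Mode) (s : ScalarIndex) :
    couplingIntegral p q s = tripleIntegral p q s := by
  have h : couplingIntegral p q s = conj (tripleIntegral p q s) := by
    unfold couplingIntegral tripleIntegral
    rw [← integral_conj]
    congr 1
    funext n
    simp [mul_comm]
  rw [h, tripleIntegral_eq, Complex.conj_ofReal]

/-- Equal polarisations leave the sum of the symbols (1 -1 0) and (-1 1 0), which the Casimir
relation expresses through (0 0 0). -/
lemma tripleIntegral_of_same (p q : Mode) (s : ScalarIndex) (h : p.α = q.α) :
    tripleIntegral p q s = (equalPolarisationValue p.j q.j s.l p.m q.m s.m : ℂ) := by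
  rw [tripleIntegral_eq, h]
  congr 1
  have hs : polarisationSign q.α * polarisationSign q.α = 1 := by
    unfold polarisationSign; split_ifs <;> norm_num
  rw [hs, one_mul]
  unfold equalPolarisationValue
  have hc := threeJ_casimir p.j q.j s.l
  have h1 : (0 : ℝ) < p.j := by exact_mod_cast p.one_le_j
  have h2 : (0 : ℝ) < q.j := by exact_mod_cast q.one_le_j
  rw [Real.sqrt_mul (by positivity)]
  have k1 : Real.sqrt ((p.j : ℝ) * (p.j + 1)) ≠ 0 := (Real.sqrt_pos.mpr (by positivity)).ne'
  have k2 : Real.sqrt ((q.j : ℝ) * (q.j + 1)) ≠ 0 := (Real.sqrt_pos.mpr (by positivity)).ne'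
  field_simp
  linear_combination (-(dimFactor p.j q.j s.l * threeJ p.j q.j s.l (-p.m) q.m s.m)) * hc

lemma tripleIntegral_of_same_of_odd (p q : Mode) (s : ScalarIndex) (h : p.α = q.α)
    (ho : Odd (p.j + q.j + s.l)) : tripleIntegral p q s = 0 := by
  rw [tripleIntegral_of_same p q s h, equalPolarisationValue, threeJ_zero_of_odd ho]
  simp

lemma polarisationSign_mul_of_ne {α β : Fin 2} (h : α ≠ β) :
    polarisationSign α * polarisationSign β = -1 := by
  fin_cases α <;> fin_cases β <;> simp_all [polarisationSign]

/-- Different polarisations leave the difference of the symbols (1 -1 0) and (-1 1 0). Reversal of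
projections makes it cancel when the sum of the spins is even, and double when it is odd. -/
lemma tripleIntegral_of_ne_of_even (p q : Mode) (s : ScalarIndex) (h : p.α ≠ q.α)
    (he : Even (p.j + q.j + s.l)) : tripleIntegral p q s = 0 := by
  rw [tripleIntegral_eq, polarisationSign_mul_of_ne h]
  have := threeJ_neg p.j q.j s.l 1 (-1) 0
  rw [he.neg_one_pow] at this
  norm_num at this
  rw [this]
  simp

lemma tripleIntegral_of_ne_of_odd (p q : Mode) (s : ScalarIndex) (h : p.α ≠ q.α)
    (ho : Odd (p.j + q.j + s.l)) :
    tripleIntegral p q s = (mixedPolarisationValue p.j q.j s.l p.m q.m s.m : ℂ) := by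
  rw [tripleIntegral_eq, polarisationSign_mul_of_ne h]
  have := threeJ_neg p.j q.j s.l 1 (-1) 0
  rw [ho.neg_one_pow] at this
  norm_num at this
  rw [this]
  unfold mixedPolarisationValue
  rw [zpow_add_one₀ (by norm_num)]
  congr 1
  ring

lemma tripleIntegral_eq_zero {p q : Mode} {s : ScalarIndex}
    (h : ¬ ThreeJAdm p.j q.j s.l (-p.m) q.m s.m) : tripleIntegral p q s = 0 := by
  rw [tripleIntegral_eq, threeJ_of_not h]
  simp

/-! ### Completeness of the Clebsch-Gordan coefficients -/

/-- The spins occurring in the product of spin `l` with spin one. -/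
def productSpins (l : ℕ) : Finset ℕ :=
  (Finset.range (l + 2)).filter fun j => j ≤ l + 1 ∧ l ≤ 1 + j ∧ 1 ≤ l + j

lemma mem_productSpins {l j : ℕ} : j ∈ productSpins l ↔ j ≤ l + 1 ∧ l ≤ 1 + j ∧ 1 ≤ l + j := by
  unfold productSpins
  rw [Finset.mem_filter, Finset.mem_range]
  omega

lemma card_Icc_neg (l : ℕ) : (Finset.Icc (-(l : ℤ)) l).card = 2 * l + 1 := by
  rw [Int.card_Icc]; omega

lemma card_productSpins (l : ℕ) :
    ∑ j ∈ productSpins l, (2 * j + 1) = (2 * l + 1) * 3 := by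
  rcases Nat.eq_zero_or_pos l with rfl | hl
  · have : productSpins 0 = {1} := by decide
    simp [this]
  · obtain ⟨k, rfl⟩ : ∃ k, l = k + 1 := ⟨l - 1, by omega⟩
    have : productSpins (k + 1) = {k, k + 1, k + 2} := by
      ext j
      rw [mem_productSpins]
      simp only [Finset.mem_insert, Finset.mem_singleton]
      omega
    rw [this, Finset.sum_insert (by simp), Finset.sum_insert (by simp), Finset.sum_singleton]
    ring

/-- Orthonormality gives orthonormal rows of the coupling matrix. The matrix is square by the
dimension count `card_productSpins`, so its columns are orthonormal as well. -/
lemma sum_clebschGordan_complete (l : ℕ) {μ μ' q q' : ℤ} (hμ : μ ∈ Finset.Icc (-(l : ℤ)) l)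
    (hμ' : μ' ∈ Finset.Icc (-(l : ℤ)) l) (hq : q ∈ Finset.Icc (-1 : ℤ) 1)
    (hq' : q' ∈ Finset.Icc (-1 : ℤ) 1) :
    ∑ j ∈ productSpins l, ∑ m ∈ Finset.Icc (-(j : ℤ)) j,
      clebschGordan l μ 1 q j m * clebschGordan l μ' 1 q' j m
      = if μ = μ' ∧ q = q' then 1 else 0 := by
  let Rs : Finset (Σ _ : ℕ, ℤ) := (productSpins l).sigma fun j => Finset.Icc (-(j : ℤ)) j
  let Cs : Finset (ℤ × ℤ) := Finset.Icc (-(l : ℤ)) l ×ˢ Finset.Icc (-1 : ℤ) 1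
  let A : Matrix Rs Cs ℝ := fun r c => clebschGordan l c.1.1 1 c.1.2 r.1.1 r.1.2
  have hcard : Fintype.card Rs = Fintype.card Cs := by
    rw [Fintype.card_coe, Fintype.card_coe, Finset.card_sigma, Finset.card_product, card_Icc_neg]
    simp only [card_Icc_neg]
    rw [card_productSpins]
    congr 1
  have h1 : A * A.transpose = 1 := by
    ext ⟨⟨j, m⟩, hr⟩ ⟨⟨j', m'⟩, hr'⟩
    have hs : (A * A.transpose) ⟨⟨j, m⟩, hr⟩ ⟨⟨j', m'⟩, hr'⟩
        = ∑ m₁ ∈ Finset.Icc (-(l : ℤ)) l, ∑ m₂ ∈ Finset.Icc (-((1 : ℕ) : ℤ)) (1 : ℕ),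
          clebschGordan l m₁ 1 m₂ j m * clebschGordan l m₁ 1 m₂ j' m' := by
      rw [Matrix.mul_apply, ← Finset.sum_product']
      exact Finset.sum_coe_sort Cs fun c =>
        clebschGordan l c.1 1 c.2 j m * clebschGordan l c.1 1 c.2 j' m'
    rw [hs, Matrix.one_apply]
    rw [Finset.mem_sigma, mem_productSpins, Finset.mem_Icc] at hr hr'
    by_cases hm : m = m'
    · subst hm
      by_cases hj : j = j'
      · subst hj
        rw [sum_clebschGordan_mul (by omega) (abs_le.mpr hr.2), if_pos rfl]
      · rw [sum_clebschGordan_mul_of_ne hj, if_neg]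
        intro h
        simp only [Subtype.mk.injEq, Sigma.mk.injEq] at h
        exact hj h.1
    · rw [if_neg]
      · refine Finset.sum_eq_zero fun m₁ _ => Finset.sum_eq_zero fun m₂ _ => ?_
        by_cases h : m₁ + m₂ = m
        · rw [clebschGordan_eq_zero_of_sum (m := m') (by omega), mul_zero]
        · rw [clebschGordan_eq_zero_of_sum h, zero_mul]
      · intro h
        simp only [Subtype.mk.injEq, Sigma.mk.injEq] at h
        exact hm (eq_of_heq h.2)
  have h2 : A.transpose * A = 1 := (Matrix.mul_eq_one_comm_of_equiv (Fintype.card_eq.mp hcard).some).mp h1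
  have h3 := congrFun (congrFun h2 ⟨(μ, q), Finset.mk_mem_product hμ hq⟩)
    ⟨(μ', q'), Finset.mk_mem_product hμ' hq'⟩
  rw [Matrix.mul_apply, Matrix.one_apply] at h3
  rw [← Finset.sum_sigma (productSpins l) (fun j => Finset.Icc (-(j : ℤ)) j) fun r : Σ _ : ℕ, ℤ =>
    clebschGordan l μ 1 q r.1 r.2 * clebschGordan l μ' 1 q' r.1 r.2]
  rw [← Finset.sum_coe_sort Rs fun r => clebschGordan l μ 1 q r.1 r.2
    * clebschGordan l μ' 1 q' r.1 r.2]
  refine h3.trans ?_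
  simp

lemma sum_sphericalBasis_complete (i i' : Fin 3) :
    ∑ q ∈ Finset.Icc (-1 : ℤ) 1, sphericalBasis q i * conj (sphericalBasis q i')
      = if i = i' then 1 else 0 := by
  have h2 := sqrt_two_sq
  have hne := sqrt_two_ne
  have : Finset.Icc (-1 : ℤ) 1 = {-1, 0, 1} := by decide
  rw [this, Finset.sum_insert (by decide), Finset.sum_insert (by decide), Finset.sum_singleton]
  fin_cases i <;> fin_cases i' <;> simp [sphericalBasis]
  all_goals field_simp
  all_goals (try simp only [Complex.I_sq])
  all_goals (try rw [sq, h2])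
  all_goals norm_num

lemma solidVec_eq_sum (j l : ℕ) (m : ℤ) (n : Space) (i : Fin 3) : solidVec j l m n i
    = ∑ μ ∈ Finset.Icc (-(l : ℤ)) l, ∑ q ∈ Finset.Icc (-1 : ℤ) 1,
      (clebschGordan l μ 1 q j m : ℂ) * solidY l μ n * sphericalBasis q i := by
  unfold solidVec
  rw [Finset.sum_comm]
  refine Finset.sum_congr rfl fun q _ => ?_
  by_cases h : m - q ∈ Finset.Icc (-(l : ℤ)) l
  · rw [Finset.sum_eq_single_of_mem _ h]
    intro μ _ hμ
    rw [clebschGordan_eq_zero_of_sum (by omega)]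
    simp
  · rw [Finset.mem_Icc, ← abs_le] at h
    rw [solidY_eq_zero (not_le.mp h)]
    rw [Finset.sum_eq_zero]
    · simp
    · intro μ hμ
      rw [clebschGordan_eq_zero_of_sum]
      · simp
      · rintro rfl
        apply h
        rw [add_sub_cancel_right]
        exact abs_le.mpr (Finset.mem_Icc.mp hμ)

/-- The vector spherical harmonics built on `Y_l` form a complete system. -/
lemma sum_solidVec_mul_conj (l : ℕ) (n k : Space) (i i' : Fin 3) :
    ∑ j ∈ Finset.range (l + 2), ∑ m ∈ Finset.Icc (-(j : ℤ)) j,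
      solidVec j l m n i * conj (solidVec j l m k i') = if i = i' then zonal l n k else 0 := by
  have hres : ∑ j ∈ Finset.range (l + 2), ∑ m ∈ Finset.Icc (-(j : ℤ)) j,
      solidVec j l m n i * conj (solidVec j l m k i')
      = ∑ j ∈ productSpins l, ∑ m ∈ Finset.Icc (-(j : ℤ)) j,
        solidVec j l m n i * conj (solidVec j l m k i') := by
    symm
    refine Finset.sum_subset (Finset.filter_subset _ _) fun j _ hj => ?_
    refine Finset.sum_eq_zero fun m _ => ?_
    rw [mem_productSpins] at hj
    rw [solidVec_eq_zero hj, zero_mul]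
  have hterm : ∀ j m, solidVec j l m n i * conj (solidVec j l m k i')
      = ∑ μ ∈ Finset.Icc (-(l : ℤ)) l, ∑ q ∈ Finset.Icc (-1 : ℤ) 1,
        ∑ μ' ∈ Finset.Icc (-(l : ℤ)) l, ∑ q' ∈ Finset.Icc (-1 : ℤ) 1,
        (solidY l μ n * sphericalBasis q i * conj (solidY l μ' k * sphericalBasis q' i'))
          * ((clebschGordan l μ 1 q j m * clebschGordan l μ' 1 q' j m : ℝ) : ℂ) := by
    intro j m
    rw [solidVec_eq_sum, solidVec_eq_sum, map_sum, Finset.sum_mul]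
    refine Finset.sum_congr rfl fun μ _ => ?_
    rw [Finset.sum_mul]
    refine Finset.sum_congr rfl fun q _ => ?_
    rw [Finset.mul_sum]
    refine Finset.sum_congr rfl fun μ' _ => ?_
    rw [map_sum, Finset.mul_sum]
    refine Finset.sum_congr rfl fun q' _ => ?_
    simp only [map_mul, Complex.conj_ofReal]
    push_cast
    ring
  have hswap : ∀ (s : Finset ℕ) (t : ℕ → Finset ℤ) (a b c d : Finset ℤ)
      (x : ℤ → ℤ → ℤ → ℤ → ℂ) (y : ℤ → ℤ → ℤ → ℤ → ℕ → ℤ → ℝ),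
      ∑ j ∈ s, ∑ m ∈ t j, ∑ μ ∈ a, ∑ q ∈ b, ∑ μ' ∈ c, ∑ q' ∈ d, x μ q μ' q' * (y μ q μ' q' j m : ℂ)
      = ∑ μ ∈ a, ∑ q ∈ b, ∑ μ' ∈ c, ∑ q' ∈ d, x μ q μ' q' * ((∑ j ∈ s, ∑ m ∈ t j, y μ q μ' q' j m : ℝ) : ℂ) := by
    intro s t a b c d x y
    have sw : ∀ (e : Finset ℤ) (F : ℕ → ℤ → ℤ → ℂ), ∑ j ∈ s, ∑ m ∈ t j, ∑ μ ∈ e, F j m μ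
        = ∑ μ ∈ e, ∑ j ∈ s, ∑ m ∈ t j, F j m μ := by
      intro e F
      rw [Finset.sum_comm]
      exact Finset.sum_congr rfl fun j _ => Finset.sum_comm
    simp only [Complex.ofReal_sum, Finset.mul_sum]
    rw [sw]
    refine Finset.sum_congr rfl fun μ _ => ?_
    rw [sw]
    refine Finset.sum_congr rfl fun q _ => ?_
    rw [sw]
    refine Finset.sum_congr rfl fun μ' _ => ?_
    rw [sw]
  rw [hres]
  simp only [hterm]
  rw [hswap]
  have hd : ∀ μ ∈ Finset.Icc (-(l : ℤ)) l, ∀ q ∈ Finset.Icc (-1 : ℤ) 1,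
      ∑ μ' ∈ Finset.Icc (-(l : ℤ)) l, ∑ q' ∈ Finset.Icc (-1 : ℤ) 1,
        (solidY l μ n * sphericalBasis q i * conj (solidY l μ' k * sphericalBasis q' i'))
          * ((∑ j ∈ productSpins l, ∑ m ∈ Finset.Icc (-(j : ℤ)) j,
            clebschGordan l μ 1 q j m * clebschGordan l μ' 1 q' j m : ℝ) : ℂ)
      = (solidY l μ n * conj (solidY l μ k)) * (sphericalBasis q i * conj (sphericalBasis q i')) := by
    intro μ hμ q hq
    rw [Finset.sum_eq_single_of_mem μ hμ, Finset.sum_eq_single_of_mem q hq]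
    · rw [sum_clebschGordan_complete l hμ hμ hq hq, if_pos ⟨rfl, rfl⟩, map_mul]
      push_cast; ring
    · intro q' hq' hne
      rw [sum_clebschGordan_complete l hμ hμ hq hq', if_neg fun h => hne h.2.symm]
      simp
    · intro μ' hμ' hne
      refine Finset.sum_eq_zero fun q' hq' => ?_
      rw [sum_clebschGordan_complete l hμ hμ' hq hq', if_neg fun h => hne h.1.symm]
      simp
  rw [Finset.sum_congr rfl fun μ hμ => Finset.sum_congr rfl fun q hq => hd μ hμ q hq]
  simp only [← Finset.mul_sum, sum_sphericalBasis_complete]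
  rw [← Finset.sum_mul, ← zonal]
  split_ifs <;> simp

/-! ### The plane wave expansion -/

/-- The angular coefficient of order `N` in the expansion of a transverse plane wave. -/
def planeAmplitude (N : ℕ) (α : Fin 2) (j : ℕ) (m : ℤ) (n : Space) (i : Fin 3) : ℂ :=
  ∑ l ∈ Finset.range (N + 1),
    (4 * Real.pi * planeCoeff N l * tangentialCoeff α j l : ℝ) * solidVec j l m n i

lemma planeAmplitude_eq_zero {N j : ℕ} (h : j = 0 ∨ N + 2 ≤ j) (α : Fin 2) (m : ℤ) (n : Space)
    (i : Fin 3) : planeAmplitude N α j m n i = 0 := by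
  refine Finset.sum_eq_zero fun l hl => ?_
  rw [Finset.mem_range] at hl
  have : tangentialCoeff α j l = 0 := by
    rcases h with rfl | h
    · simp [tangentialCoeff]
    · exact tangentialCoeff_eq_zero (by omega)
  simp [this]

/-- Each zonal kernel times the unit matrix is resolved into vector harmonics by
`sum_solidVec_mul_conj`. Projecting the factor at `k` onto the tangent plane replaces it by
transverse harmonics through `solidVec_sub_radial`. -/
lemma dot_pow_mul_tangential (N : ℕ) {n k : Space} (hn : ‖n‖ = 1) (hk : ‖k‖ = 1) (i i' : Fin 3) :
    (dot k n : ℂ) ^ N / (N ! : ℕ) * ((if i = i' then 1 else 0) - (k i : ℂ) * k i')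
      = ∑ j ∈ Finset.range (N + 2), ∑ m ∈ Finset.Icc (-(j : ℤ)) j, ∑ α,
        planeAmplitude N α j m n i * conj (solidTransverse α j m k i') := by
  have hl : ∀ l, zonal l n k * ((if i = i' then 1 else 0) - (k i : ℂ) * k i')
      = ∑ j ∈ Finset.range (l + 2), ∑ m ∈ Finset.Icc (-(j : ℤ)) j, ∑ α,
        solidVec j l m n i * (tangentialCoeff α j l * conj (solidTransverse α j m k i')) := by
    intro l
    have hterm : ∀ j m, ∑ α, solidVec j l m n i
        * ((tangentialCoeff α j l : ℂ) * conj (solidTransverse α j m k i'))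
        = solidVec j l m n i * conj (solidVec j l m k i')
          - ∑ r, (k r * k i' : ℂ) * (solidVec j l m n i * conj (solidVec j l m k r)) := by
      intro j m
      have := congrArg conj (solidVec_sub_radial j l m hk i')
      simp only [map_sub, map_mul, map_sum, Complex.conj_ofReal] at this
      rw [← Finset.mul_sum, ← this, Fin.sum_univ_three, Fin.sum_univ_three]
      ring
    simp only [hterm, Finset.sum_sub_distrib, Fin.sum_univ_three, Finset.sum_add_distrib,
      ← Finset.mul_sum, sum_solidVec_mul_conj]
    fin_cases i <;> simp [mul_sub] <;> ring
  have hext : ∀ l ∈ Finset.range (N + 1), zonal l n k * ((if i = i' then 1 else 0) - (k i : ℂ) * k i')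
      = ∑ j ∈ Finset.range (N + 2), ∑ m ∈ Finset.Icc (-(j : ℤ)) j, ∑ α,
        solidVec j l m n i * (tangentialCoeff α j l * conj (solidTransverse α j m k i')) := by
    intro l hlN
    rw [Finset.mem_range] at hlN
    rw [hl]
    refine Finset.sum_subset (Finset.range_mono (by omega)) fun j _ hj => ?_
    rw [Finset.mem_range] at hj
    refine Finset.sum_eq_zero fun m _ => Finset.sum_eq_zero fun α _ => ?_
    rw [tangentialCoeff_eq_zero (by omega)]
    simp
  rw [dot_pow_eq N hk hn, Finset.sum_mul]
  simp only [mul_assoc ((4 * Real.pi * planeCoeff N _ : ℝ) : ℂ)]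
  rw [Finset.sum_congr rfl fun l hlN => by rw [hext l hlN]]
  simp only [planeAmplitude, Finset.mul_sum, Finset.sum_mul]
  rw [Finset.sum_comm]
  refine Finset.sum_congr rfl fun j _ => ?_
  rw [Finset.sum_comm]
  refine Finset.sum_congr rfl fun m _ => ?_
  rw [Finset.sum_comm]
  refine Finset.sum_congr rfl fun α _ => Finset.sum_congr rfl fun l _ => ?_
  push_cast
  ring

/-! ### The outgoing radial functions -/

/-- The coefficients `(l+k)! / (k! (l-k)!)` of the Hankel functions, zero for `k > l`. -/
def hankelCoeff (l k : ℕ) : ℝ := ((l + k)! : ℕ) * (invFact k * invFact ((l : ℤ) - k))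

lemma hankelCoeff_of_lt {l k : ℕ} (h : l < k) : hankelCoeff l k = 0 := by
  unfold hankelCoeff
  rw [invFact_of_neg (k := (l : ℤ) - k) (by omega)]; ring

lemma hankelCoeff_of_le {l k : ℕ} (h : k ≤ l) :
    hankelCoeff l k = ((l + k)! : ℕ) / ((k ! * (l - k)! : ℕ) : ℝ) := by
  unfold hankelCoeff
  rw [← Nat.cast_sub h, invFact_natCast, invFact_natCast]
  push_cast
  field_simp

lemma hankelCoeff_zero (l : ℕ) : hankelCoeff l 0 = 1 := by
  rw [hankelCoeff_of_le (Nat.zero_le l)]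
  have : ((l ! : ℕ) : ℝ) ≠ 0 := by positivity
  simp [this]

/-- The coefficient form of the three-term recurrence h_{n+2} = (2n+3) h_{n+1} / x - h_n. -/
lemma hankelCoeff_recurrence (n k : ℕ) : hankelCoeff (n + 2) (k + 1)
    = hankelCoeff n (k + 1) + 2 * (2 * n + 3) * hankelCoeff (n + 1) k := by
  unfold hankelCoeff
  have h1 := mul_invFact ((k : ℤ) + 1)
  have h2 := mul_invFact ((n : ℤ) + 1 - k)
  have h3 := mul_invFact ((n : ℤ) - k)
  rw [show (n : ℤ) + 1 - k - 1 = n - k by ring] at h2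
  rw [add_sub_cancel_right] at h1
  rw [show ((n + 2 : ℕ) : ℤ) - ((k + 1 : ℕ) : ℤ) = n + 1 - k by push_cast; ring,
    show (n : ℤ) - ((k + 1 : ℕ) : ℤ) = n - k - 1 by push_cast; ring,
    show ((n + 1 : ℕ) : ℤ) - k = n + 1 - k by push_cast; ring,
    show n + 2 + (k + 1) = n + 1 + k + 1 + 1 by ring, show n + (k + 1) = n + 1 + k by ring,
    Nat.factorial_succ, Nat.factorial_succ, ← h3, ← h2]
  rw [show ((k + 1 : ℕ) : ℤ) = (k : ℤ) + 1 by push_cast; ring, ← h1]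
  push_cast
  ring

/-- The polynomial factor of the Hankel functions. -/
def hankelPoly (l : ℕ) (u : ℂ) : ℂ := ∑ k ∈ Finset.range (l + 1), (hankelCoeff l k : ℂ) * u ^ k

lemma hankelPoly_eq {l K : ℕ} (h : l ≤ K) (u : ℂ) :
    hankelPoly l u = ∑ k ∈ Finset.range (K + 1), (hankelCoeff l k : ℂ) * u ^ k := by
  refine Finset.sum_subset (Finset.range_mono (by omega)) fun k _ hk => ?_
  rw [Finset.mem_range] at hk
  rw [hankelCoeff_of_lt (by omega)]
  simp

lemma hankelPoly_recurrence (n : ℕ) (u : ℂ) :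
    hankelPoly (n + 2) u = hankelPoly n u + 2 * (2 * n + 3) * u * hankelPoly (n + 1) u := by
  rw [hankelPoly_eq (K := n + 2) (by omega) u, hankelPoly_eq (l := n) (K := n + 2) (by omega) u,
    hankelPoly, Finset.sum_range_succ', Finset.sum_range_succ' (fun k => (hankelCoeff n k : ℂ) * u ^ k),
    hankelCoeff_zero, hankelCoeff_zero, Finset.mul_sum]
  have : ∀ k, (hankelCoeff (n + 2) (k + 1) : ℂ) * u ^ (k + 1)
      = (hankelCoeff n (k + 1) : ℂ) * u ^ (k + 1)
        + 2 * (2 * n + 3) * u * ((hankelCoeff (n + 1) k : ℂ) * u ^ k) := by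
    intro k
    rw [hankelCoeff_recurrence]
    push_cast
    ring
  simp only [this, Finset.sum_add_distrib]
  ring

/-- The entire-order-free factor `h_l(y) / y^l`, for complex argument. -/
def reducedHankel (l : ℕ) (y : ℂ) : ℂ :=
  (-Complex.I) ^ (l + 1) * Complex.exp (Complex.I * y) * hankelPoly l (Complex.I / (2 * y))
    / y ^ (l + 1)

lemma sphericalHankel_eq (l : ℕ) {x : ℝ} (hx : x ≠ 0) :
    sphericalHankel l x = x ^ l * reducedHankel l x := by
  have hx' : (x : ℂ) ≠ 0 := by exact_mod_cast hx
  have hp : ∑ k ∈ Finset.range (l + 1), Complex.I ^ k * (((l + k)! : ℕ) : ℂ)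
      / (((k ! * (l - k)! : ℕ) : ℂ) * (2 * (x : ℂ)) ^ k) = hankelPoly l (Complex.I / (2 * x)) := by
    refine Finset.sum_congr rfl fun k hk => ?_
    rw [Finset.mem_range] at hk
    rw [hankelCoeff_of_le (by omega), div_pow]
    push_cast
    field_simp
  unfold sphericalHankel reducedHankel
  rw [hp, pow_succ (x : ℂ) l]
  field_simp

lemma reducedHankel_recurrence (n : ℕ) {y : ℂ} (hy : y ≠ 0) :
    y ^ 2 * reducedHankel (n + 2) y = (2 * n + 3) * reducedHankel (n + 1) y - reducedHankel n y := by
  unfold reducedHankel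
  rw [hankelPoly_recurrence]
  have hI : Complex.I ^ 2 = -1 := Complex.I_sq
  set P := hankelPoly n (Complex.I / (2 * y))
  set Q := hankelPoly (n + 1) (Complex.I / (2 * y))
  set E := Complex.exp (Complex.I * y)
  have e1 : (-Complex.I) ^ (n + 2 + 1) = (-Complex.I) ^ (n + 1) * -1 := by
    rw [show n + 2 + 1 = n + 1 + 2 by ring, pow_add _ (n + 1) 2, neg_sq, hI]
  have e2 : (-Complex.I) ^ (n + 1 + 1) = (-Complex.I) ^ (n + 1) * -Complex.I := pow_succ _ _
  rw [e1, e2]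
  field_simp
  ring

lemma reducedHankel_zero (y : ℂ) :
    reducedHankel 0 y = -Complex.I * Complex.exp (Complex.I * y) / y := by
  unfold reducedHankel hankelPoly
  simp [hankelCoeff_zero]

lemma reducedHankel_one {y : ℂ} (hy : y ≠ 0) :
    y ^ 2 * reducedHankel 1 y = reducedHankel 0 y - Complex.exp (Complex.I * y) := by
  have h11 : hankelCoeff 1 1 = 2 := by
    rw [hankelCoeff_of_le le_rfl]; norm_num
  rw [reducedHankel_zero]
  unfold reducedHankel hankelPoly
  simp only [Finset.sum_range_succ, Finset.range_zero, Finset.sum_empty, hankelCoeff_zero, h11]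
  have hI : Complex.I ^ 2 = -1 := Complex.I_sq
  rw [show (1 + 1 : ℕ) = 2 by rfl, neg_sq, hI]
  field_simp
  push_cast
  ring

/-- The rule d/dy (h_l / y^l) = -h_{l+1} / y^l. The induction carries two consecutive orders,
because the step differentiates the three-term recurrence. -/
lemma hasDerivAt_reducedHankel (l : ℕ) {y : ℂ} (hy : y ≠ 0) :
    HasDerivAt (reducedHankel l) (-y * reducedHankel (l + 1) y) y := by
  have hE : ∀ y : ℂ, HasDerivAt (fun y => Complex.exp (Complex.I * y))
      (Complex.exp (Complex.I * y) * (Complex.I * 1)) y := fun y =>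
    ((hasDerivAt_id y).const_mul Complex.I).cexp
  have hI : Complex.I * Complex.I = -1 := Complex.I_mul_I
  have key : ∀ l : ℕ, (∀ y : ℂ, y ≠ 0 → HasDerivAt (reducedHankel l) (-y * reducedHankel (l + 1) y) y)
      ∧ (∀ y : ℂ, y ≠ 0 →
        HasDerivAt (reducedHankel (l + 1)) (-y * reducedHankel (l + 1 + 1) y) y) := by
    intro l
    induction l with
    | zero =>
      have h0 : ∀ y : ℂ, y ≠ 0 → HasDerivAt (reducedHankel 0) (-y * reducedHankel (0 + 1) y) y := by
        intro y hy
        have := ((hE y).const_mul (-Complex.I)).div (hasDerivAt_id y) hy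
        refine (this.congr_of_eventuallyEq ?_).congr_deriv ?_
        · exact Filter.Eventually.of_forall fun x => reducedHankel_zero x
        · have h1 := reducedHankel_one hy
          rw [reducedHankel_zero] at h1
          have h2 : reducedHankel (0 + 1) y = (-Complex.I * Complex.exp (Complex.I * y) / y
              - Complex.exp (Complex.I * y)) / y ^ 2 := by
            rw [← h1]; field_simp
          rw [h2]
          simp only [id]
          field_simp
          linear_combination (-y) * hI
      refine ⟨h0, fun y hy => ?_⟩
      have := ((h0 y hy).sub (hE y)).div (hasDerivAt_pow 2 y) (pow_ne_zero 2 hy)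
      refine (this.congr_of_eventuallyEq ?_).congr_deriv ?_
      · filter_upwards [isOpen_ne.mem_nhds hy] with x hx
        have h1 := reducedHankel_one hx
        simp only [Pi.div_apply, Pi.sub_apply]
        rw [← h1]
        have : x ≠ 0 := hx
        field_simp
      · have h1 := reducedHankel_one hy
        have h2 := reducedHankel_recurrence 0 hy
        have h0' := reducedHankel_zero y
        rw [show (0 : ℕ) + 2 = 2 by rfl, show (0 : ℕ) + 1 = 1 by rfl] at h2
        rw [show (0 + 1 + 1 : ℕ) = 2 by rfl, show (0 + 1 : ℕ) = 1 by rfl]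
        have h3 : reducedHankel 2 y = (3 * reducedHankel 1 y - reducedHankel 0 y) / y ^ 2 := by
          rw [eq_div_iff (pow_ne_zero 2 hy), mul_comm, h2]; simp
        simp only [Pi.sub_apply]
        rw [h3, ← h1]
        have h4 : Complex.exp (Complex.I * y) = y * (Complex.I * reducedHankel 0 y) := by
          rw [h0']; field_simp; linear_combination hI
        rw [h4]
        push_cast
        field_simp
        linear_combination (-reducedHankel 0 y) * hI
    | succ l ih =>
      refine ⟨ih.2, fun y hy => ?_⟩
      have := (((ih.2 y hy).const_mul (2 * (l : ℂ) + 3)).sub (ih.1 y hy)).div (hasDerivAt_pow 2 y)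
        (pow_ne_zero 2 hy)
      refine (this.congr_of_eventuallyEq ?_).congr_deriv ?_
      · filter_upwards [isOpen_ne.mem_nhds hy] with x hx
        have h1 := reducedHankel_recurrence l hx
        have : x ≠ 0 := hx
        simp only [Pi.div_apply, Pi.sub_apply]
        rw [← h1]
        field_simp
      · have h1 := reducedHankel_recurrence l hy
        have h2 := reducedHankel_recurrence (l + 1) hy
        rw [show ((fun z => (2 * (l : ℂ) + 3) * reducedHankel (l + 1) z) - reducedHankel l) y
          = y ^ 2 * reducedHankel (l + 2) y from h1.symm]
        have h3 : reducedHankel (l + 1 + 1 + 1) y = ((2 * l + 5) * reducedHankel (l + 2) y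
            - reducedHankel (l + 1) y) / y ^ 2 := by
          rw [eq_div_iff (pow_ne_zero 2 hy), mul_comm, h2]; push_cast; ring
        rw [h3]
        push_cast
        rw [show l + 1 + 1 = l + 2 by rfl]
        field_simp
        ring
  exact (key l).1 y hy

/-- The outgoing radial function `h_l(ωρ) / ρ^l` as a function of `R = ρ²`. -/
def outRadial (ω : ℝ) (l : ℕ) (R : ℂ) : ℂ := ω ^ l * reducedHankel l (ω * R ^ (1 / 2 : ℂ))

lemma cpow_half_sq (R : ℂ) : (R ^ (1 / 2 : ℂ)) ^ 2 = R := by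
  have := Complex.cpow_nat_inv_pow R (n := 2) (by norm_num)
  rw [one_div]
  exact_mod_cast this

lemma cpow_half_ne_zero {R : ℂ} (hR : R ≠ 0) : R ^ (1 / 2 : ℂ) ≠ 0 := by
  intro h
  have := cpow_half_sq R
  rw [h] at this
  exact hR (by rw [← this]; norm_num)

/-- In the variable R = ρ² differentiation merely raises the order, with no explicit power of ρ. The
slit plane is where the square root is holomorphic, so complex R is allowed; the translation
argument needs this. -/
lemma hasDerivAt_outRadial {ω : ℝ} (hω : 0 < ω) (l : ℕ) {R : ℂ} (hR : R ∈ Complex.slitPlane) :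
    HasDerivAt (outRadial ω l) (-(ω / 2) * outRadial ω (l + 1) R) R := by
  have hR0 := Complex.slitPlane_ne_zero hR
  have hne := cpow_half_ne_zero hR0
  have hω' : (ω : ℂ) ≠ 0 := by exact_mod_cast hω.ne'
  have h1 : HasDerivAt (fun R : ℂ => R ^ (1 / 2 : ℂ)) ((1 / 2) * R ^ (1 / 2 - 1 : ℂ) * 1) R :=
    (hasDerivAt_id R).cpow_const hR
  have h2 := ((hasDerivAt_reducedHankel l (mul_ne_zero hω' hne)).comp R
    (h1.const_mul (ω : ℂ))).const_mul ((ω : ℂ) ^ l)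
  refine h2.congr_deriv ?_
  rw [Complex.cpow_sub _ _ hR0, Complex.cpow_one]
  unfold outRadial
  have h3 := cpow_half_sq R
  set ρ := R ^ (1 / 2 : ℂ)
  rw [← h3, pow_succ (ω : ℂ) l]
  field_simp

lemma outRadial_recurrence {ω : ℝ} (hω : 0 < ω) (l : ℕ) {R : ℂ} (hR : R ≠ 0) :
    (2 * l + 3) * outRadial ω (l + 1) R = ω * (R * outRadial ω (l + 2) R + outRadial ω l R) := by
  have hne := cpow_half_ne_zero hR
  have hω' : (ω : ℂ) ≠ 0 := by exact_mod_cast hω.ne'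
  have h := reducedHankel_recurrence l (mul_ne_zero hω' hne)
  have h3 := cpow_half_sq R
  unfold outRadial
  rw [mul_pow, h3] at h
  linear_combination (-(ω : ℂ) ^ (l + 1)) * h

lemma outRadial_ofReal {ω r : ℝ} (hω : 0 < ω) (hr : 0 < r) (l : ℕ) :
    outRadial ω l ((r ^ 2 : ℝ) : ℂ) = sphericalHankel l (ω * r) / r ^ l := by
  have h1 : (((r ^ 2 : ℝ) : ℂ)) ^ (1 / 2 : ℂ) = r := by
    rw [show (1 / 2 : ℂ) = ((1 / 2 : ℝ) : ℂ) by push_cast; rfl, ← Complex.ofReal_cpow (by positivity),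
      ← Real.sqrt_eq_rpow, Real.sqrt_sq hr.le]
  have hr' : (r : ℂ) ≠ 0 := by exact_mod_cast hr.ne'
  rw [outRadial, h1, sphericalHankel_eq l (mul_pos hω hr).ne']
  push_cast
  rw [mul_pow]
  field_simp

/-! ### Polynomial functions on the sphere -/

/-- The functions on the sphere which are combinations of spherical harmonics of degree at
most `M`. -/
def harmonicSpan (M : ℕ∞) : Submodule ℂ (Dir → ℂ) :=
  Submodule.span ℂ {f | ∃ (l : ℕ) (m : ℤ), (l : ℕ∞) ≤ M ∧ f = fun n : Dir => solidAt l m n}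

lemma solidAt_mem {l : ℕ} {M : ℕ∞} (h : (l : ℕ∞) ≤ M) (m : ℤ) :
    (fun n : Dir => solidAt l m n) ∈ harmonicSpan M :=
  Submodule.subset_span ⟨l, m, h, rfl⟩

lemma harmonicSpan_mono {M N : ℕ∞} (h : M ≤ N) : harmonicSpan M ≤ harmonicSpan N :=
  Submodule.span_mono fun _ ⟨l, m, hl, hf⟩ => ⟨l, m, hl.trans h, hf⟩

lemma harmonicSpan_induction {M : ℕ∞} {P : (Dir → ℂ) → Prop}
    (hs : ∀ (l : ℕ) (m : ℤ), (l : ℕ∞) ≤ M → P fun n : Dir => solidAt l m n)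
    (h0 : P 0) (hadd : ∀ F G, F ∈ harmonicSpan M → G ∈ harmonicSpan M → P F → P G → P (F + G))
    (hsmul : ∀ (c : ℂ) F, F ∈ harmonicSpan M → P F → P (c • F)) {F : Dir → ℂ}
    (hF : F ∈ harmonicSpan M) : P F := by
  refine Submodule.span_induction (p := fun F _ => P F) ?_ h0 (fun F G hF hG => hadd F G hF hG)
    (fun c F hF => hsmul c F hF) hF
  rintro _ ⟨l, m, hl, rfl⟩
  exact hs l m hl

lemma continuous_of_mem_harmonicSpan {M : ℕ∞} {F : Dir → ℂ} (hF : F ∈ harmonicSpan M) :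
    Continuous F :=
  harmonicSpan_induction (P := Continuous)
    (fun l m _ => (continuous_solidAt l m).comp continuous_subtype_val) continuous_zero
    (fun _ _ _ _ h1 h2 => h1.add h2) (fun c _ _ h => h.const_smul c) hF

lemma const_mem_harmonicSpan (M : ℕ∞) (c : ℂ) : (fun _ : Dir => c) ∈ harmonicSpan M := by
  have h := (harmonicSpan M).smul_mem c (solidAt_mem (l := 0) (M := M) (by simp) 0)
  convert h using 1
  funext n
  simp [solidAt, solid_zero]

lemma solidY_mem {l : ℕ} {M : ℕ∞} (h : (l : ℕ∞) ≤ M) (m : ℤ) :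
    (fun n : Dir => solidY l m n) ∈ harmonicSpan M :=
  (harmonicSpan M).smul_mem (harmonicNorm l m : ℂ) (solidAt_mem h m)

/-- The coordinates used for solid harmonics, `x + iy`. -/
def xiOf (n : Space) : ℂ := (n 0 : ℂ) + Complex.I * n 1

/-- The coordinates used for solid harmonics, `x - iy`. -/
def etaOf (n : Space) : ℂ := (n 0 : ℂ) - Complex.I * n 1

lemma sphere_relation (n : Dir) :
    ((n : Space) 2 : ℂ) ^ 2 + xiOf n * etaOf n = 1 := by
  have h := norm_sq_eq (n : Space)
  rw [norm_dir] at h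
  have : ((n : Space) 0 : ℂ) ^ 2 + ((n : Space) 1 : ℂ) ^ 2 + ((n : Space) 2 : ℂ) ^ 2 = 1 := by
    exact_mod_cast (by linarith)
  unfold xiOf etaOf
  linear_combination this - ((n : Space) 1 : ℂ) ^ 2 * Complex.I_sq

lemma xiOf_eta_dot (w n : Space) : (dot w n : ℂ)
    = (n 2 : ℂ) * w 2 + (xiOf n * etaOf w + etaOf n * xiOf w) / 2 := by
  unfold dot xiOf etaOf
  push_cast
  linear_combination ((n 1 : ℂ) * w 1) * Complex.I_sq

/-- The part of degree `l + 1` of `(w · n)` times a solid harmonic. -/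
def upPart (w : Space) (l : ℕ) (m : ℤ) (n : Dir) : ℂ :=
  solidUp (xiOf n) (etaOf n) ((n : Space) 2) (xiOf w) (etaOf w) (w 2) l m

/-- The part of degree `l - 1` of `(w · n)` times a solid harmonic. -/
def downPart (w : Space) (l : ℕ) (m : ℤ) (n : Dir) : ℂ :=
  solidDeriv (xiOf n) (etaOf n) ((n : Space) 2) (xiOf w) (etaOf w) (w 2) l m

lemma dot_mul_solidAt (w : Space) (l : ℕ) (m : ℤ) (n : Dir) :
    (dot w n : ℂ) * solidAt l m n = (1 / (2 * l + 1)) * (upPart w l m n + downPart w l m n) := by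
  have h := linear_mul_solid (xiOf n) (etaOf n) ((n : Space) 2) (xiOf w) (etaOf w) (w 2) l m
  rw [sphere_relation, one_mul, ← xiOf_eta_dot] at h
  have hl : (2 * (l : ℂ) + 1) ≠ 0 := by exact_mod_cast Nat.succ_ne_zero (2 * l)
  have h' : solidAt l m (n : Space) = solid (xiOf n) (etaOf n) ((n : Space) 2) l m := rfl
  unfold upPart downPart
  rw [h', ← h]
  field_simp

lemma upPart_eq (w : Space) (l : ℕ) (m : ℤ) : upPart w l m
    = (((l + m + 1) * (l - m + 1) / (2 * (l + 1)) * w 2 : ℂ) • fun n : Dir => solidAt (l + 1) m n)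
      + ((((l + m + 1) * (l + m + 2) / (4 * (l + 1)) * etaOf w : ℂ) •
        fun n : Dir => solidAt (l + 1) (m + 1) n)
      + ((-((l - m + 1) * (l - m + 2) / (4 * (l + 1)) * xiOf w) : ℂ) •
        fun n : Dir => solidAt (l + 1) (m - 1) n)) := by
  funext n
  simp only [upPart, solidUp, solidAt, Pi.add_apply, Pi.smul_apply, smul_eq_mul, xiOf, etaOf]
  ring

lemma downPart_zero (w : Space) (m : ℤ) : downPart w 0 m = 0 := by
  funext n
  simp [downPart, solidDeriv, solidLow]

lemma downPart_succ (w : Space) (l : ℕ) (m : ℤ) : downPart w (l + 1) m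
    = ((xiOf w * (l + 1) : ℂ) • fun n : Dir => solidAt l (m - 1) n)
      + (((2 * w 2 * (l + 1) : ℂ) • fun n : Dir => solidAt l m n)
      + ((-(etaOf w * (l + 1)) : ℂ) • fun n : Dir => solidAt l (m + 1) n)) := by
  funext n
  simp only [downPart, solidDeriv, solidLow_succ, solidAt, Pi.add_apply, Pi.smul_apply,
    smul_eq_mul, xiOf, etaOf]
  ring

lemma upPart_mem (w : Space) {l : ℕ} {M : ℕ∞} (h : ((l + 1 : ℕ) : ℕ∞) ≤ M) (m : ℤ) :
    upPart w l m ∈ harmonicSpan M := by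
  rw [upPart_eq]
  exact add_mem (Submodule.smul_mem _ _ (solidAt_mem h _)) (add_mem
    (Submodule.smul_mem _ _ (solidAt_mem h _)) (Submodule.smul_mem _ _ (solidAt_mem h _)))

lemma downPart_mem (w : Space) {l : ℕ} {M : ℕ∞} (h : (l : ℕ∞) ≤ M) (m : ℤ) :
    downPart w l m ∈ harmonicSpan M := by
  cases l with
  | zero => rw [downPart_zero]; exact zero_mem _
  | succ l =>
    rw [downPart_succ]
    have h' : (l : ℕ∞) ≤ M := le_trans (by exact_mod_cast Nat.le_succ l) h
    exact add_mem (Submodule.smul_mem _ _ (solidAt_mem h' _)) (add_mem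
      (Submodule.smul_mem _ _ (solidAt_mem h' _)) (Submodule.smul_mem _ _ (solidAt_mem h' _)))

lemma dot_mul_mem (w : Space) {M : ℕ∞} {F : Dir → ℂ} (hF : F ∈ harmonicSpan M) :
    (fun n : Dir => (dot w n : ℂ) * F n) ∈ harmonicSpan (M + 1) := by
  refine harmonicSpan_induction (P := fun F => (fun n : Dir => (dot w n : ℂ) * F n) ∈ harmonicSpan (M + 1))
    (fun l m hl => ?_) ?_ (fun F G _ _ h1 h2 => ?_) (fun c F _ h => ?_) hF
  · have : (fun n : Dir => (dot w n : ℂ) * solidAt l m n)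
        = ((1 / (2 * l + 1) : ℂ)) • (upPart w l m + downPart w l m) := by
      funext n; exact dot_mul_solidAt w l m n
    rw [this]
    refine Submodule.smul_mem _ _ (add_mem (upPart_mem w ?_ m) (downPart_mem w (hl.trans ?_) m))
    · push_cast; gcongr
    · exact le_self_add
  · simp only [Pi.zero_apply, mul_zero]; exact zero_mem _
  · have := add_mem h1 h2
    convert this using 1
    funext n; simp [mul_add]
  · have := Submodule.smul_mem _ c h
    convert this using 1
    funext n; simp; ring

lemma coord_mul_mem (i : Fin 3) {M : ℕ∞} {F : Dir → ℂ} (hF : F ∈ harmonicSpan M) :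
    (fun n : Dir => ((n : Space) i : ℂ) * F n) ∈ harmonicSpan (M + 1) := by
  have := dot_mul_mem (EuclideanSpace.single i 1) hF
  convert this using 2 with n
  congr 1
  unfold dot
  fin_cases i <;> simp

lemma solidAt_mul_mem (l : ℕ) : ∀ (m : ℤ) {M : ℕ∞} {F : Dir → ℂ}, F ∈ harmonicSpan M →
    (fun n : Dir => solidAt l m n * F n) ∈ harmonicSpan (M + l) := by
  induction l with
  | zero =>
    intro m M F hF
    have := Submodule.smul_mem _ (if m = 0 then (1 : ℂ) else 0) hF
    convert this using 1
    · simp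
    · funext n; by_cases hm : m = 0 <;> simp [solidAt, solid_zero, hm]
  | succ l ih =>
    intro m M F hF
    have hx := coord_mul_mem 0 (ih (m - 1) hF)
    have hx' := coord_mul_mem 0 (ih (m + 1) hF)
    have hy := coord_mul_mem 1 (ih (m - 1) hF)
    have hy' := coord_mul_mem 1 (ih (m + 1) hF)
    have hz := coord_mul_mem 2 (ih m hF)
    have := add_mem (add_mem hx (Submodule.smul_mem _ Complex.I hy)) (add_mem
      (Submodule.smul_mem _ (2 : ℂ) hz) (add_mem (Submodule.smul_mem _ (-1 : ℂ) hx')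
        (Submodule.smul_mem _ Complex.I hy')))
    rw [show M + ((l + 1 : ℕ) : ℕ∞) = M + l + 1 by push_cast; rw [add_assoc]]
    convert this using 1
    funext n
    simp only [solidAt, solid_succ, Pi.add_apply, Pi.smul_apply, smul_eq_mul]
    ring

/-- Degrees add under multiplication. This bounds the order of the Hankel functions that occur in a
coupling coefficient. -/
lemma mul_mem_harmonicSpan {L M : ℕ∞} {F G : Dir → ℂ} (hF : F ∈ harmonicSpan L)
    (hG : G ∈ harmonicSpan M) : (fun n => F n * G n) ∈ harmonicSpan (L + M) := by
  refine harmonicSpan_induction (P := fun F => (fun n : Dir => F n * G n) ∈ harmonicSpan (L + M))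
    (fun l m hl => ?_) ?_ (fun F F' _ _ h1 h2 => ?_) (fun c F _ h => ?_) hF
  · refine harmonicSpan_mono ?_ (solidAt_mul_mem l m hG)
    rw [add_comm]; gcongr
  · simp only [Pi.zero_apply, zero_mul]; exact zero_mem _
  · have := add_mem h1 h2
    convert this using 1
    funext n; simp [add_mul]
  · have := Submodule.smul_mem _ c h
    convert this using 1
    funext n; simp; ring

lemma conj_mem_harmonicSpan {M : ℕ∞} {F : Dir → ℂ} (hF : F ∈ harmonicSpan M) :
    (fun n => conj (F n)) ∈ harmonicSpan M := by
  refine harmonicSpan_induction (P := fun F => (fun n : Dir => conj (F n)) ∈ harmonicSpan M)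
    (fun l m hl => ?_) ?_ (fun F F' _ _ h1 h2 => ?_) (fun c F _ h => ?_) hF
  · simp only [conj_solidAt]
    exact Submodule.smul_mem _ ((-1 : ℂ) ^ m) (solidAt_mem hl (-m))
  · simp only [Pi.zero_apply, map_zero]; exact zero_mem _
  · have := add_mem h1 h2
    convert this using 1
    funext n; simp
  · have := Submodule.smul_mem _ (conj c) h
    convert this using 1
    funext n; simp

lemma sum_mem_harmonicSpan {ι : Type*} {M : ℕ∞} {S : Finset ι} (w : ι → ℂ) {G : ι → Dir → ℂ}
    (h : ∀ q ∈ S, G q ∈ harmonicSpan M) : (fun n => ∑ q ∈ S, w q * G q n) ∈ harmonicSpan M := by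
  have := sum_mem fun q hq => Submodule.smul_mem _ (w q) (h q hq)
  convert this using 1
  funext n; simp

lemma solidVec_mem {j l : ℕ} {M : ℕ∞} (h : (l : ℕ∞) ≤ M) (m : ℤ) (i : Fin 3) :
    (fun n : Dir => solidVec j l m n i) ∈ harmonicSpan M := by
  have := sum_mem_harmonicSpan (S := Finset.Icc (-1 : ℤ) 1)
    (fun q => (clebschGordan l (m - q) 1 q j m : ℂ) * sphericalBasis q i)
    (G := fun q n => solidY l (m - q) n) fun q _ => solidY_mem h (m - q)
  convert this using 1
  funext n
  exact Finset.sum_congr rfl fun q _ => by ring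

lemma solidTransverse_mem (α : Fin 2) (j : ℕ) (m : ℤ) (i : Fin 3) :
    (fun n : Dir => solidTransverse α j m n i) ∈ harmonicSpan ((j + 1 : ℕ) : ℕ∞) := by
  by_cases h : α = 0
  · simp only [solidTransverse, h, if_true]
    exact solidVec_mem (by exact_mod_cast Nat.le_succ j) m i
  · simp only [solidTransverse, h, if_false]
    exact add_mem (Submodule.smul_mem _ _ (solidVec_mem (by exact_mod_cast (by omega)) m i))
      (Submodule.smul_mem _ _ (solidVec_mem le_rfl m i))

/-! ### Linear functionals on polynomial functions -/

/-- The coefficient of `Y_{lm}` in a function on the sphere. -/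
def harmonicCoeff (s : ScalarIndex) (F : Dir → ℂ) : ℂ :=
  ∫ n, conj (solidY s.l s.m n) * F n ∂solidAngle

lemma integrable_harmonicCoeff (s : ScalarIndex) {F : Dir → ℂ} (hF : Continuous F) :
    Integrable (fun n : Dir => conj (solidY s.l s.m n) * F n) solidAngle :=
  integrable_dir (((continuous_conj_solidY s.l s.m).comp continuous_subtype_val).mul hF)

lemma harmonicCoeff_add (s : ScalarIndex) {F G : Dir → ℂ} (hF : Continuous F) (hG : Continuous G) :
    harmonicCoeff s (F + G) = harmonicCoeff s F + harmonicCoeff s G := by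
  unfold harmonicCoeff
  rw [← integral_add (integrable_harmonicCoeff s hF) (integrable_harmonicCoeff s hG)]
  congr 1
  funext n; simp [mul_add]

lemma harmonicCoeff_smul (s : ScalarIndex) (c : ℂ) (F : Dir → ℂ) :
    harmonicCoeff s (c • F) = c * harmonicCoeff s F := by
  unfold harmonicCoeff
  rw [← integral_const_mul]
  congr 1
  funext n; simp; ring

lemma harmonicNorm_ne_zero (l : ℕ) (m : ℤ) : harmonicNorm l m ≠ 0 := by
  unfold harmonicNorm
  have h1 : (-1 : ℝ) ^ m ≠ 0 := zpow_ne_zero _ (by norm_num)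
  have h2 : Real.sqrt ((2 * (l : ℝ) + 1) / (4 * Real.pi)) ≠ 0 :=
    (Real.sqrt_pos.mpr (by positivity)).ne'
  have h3 := (ladderWeight_pos l m).ne'
  positivity

lemma harmonicCoeff_solidAt (s : ScalarIndex) (l : ℕ) (m : ℤ) :
    harmonicNorm s.l s.m * harmonicCoeff s (fun n => solidAt l m n)
      = if l = s.l ∧ m = s.m then 1 else 0 := by
  have h : (harmonicNorm l m : ℂ) * harmonicCoeff s (fun n => solidAt l m n)
      = harmonicInner l m s.l s.m := by
    unfold harmonicCoeff harmonicInner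
    rw [← integral_const_mul]
    congr 1
    funext n
    simp only [solidY]
    ring
  have hne : (harmonicNorm l m : ℂ) ≠ 0 := by exact_mod_cast harmonicNorm_ne_zero l m
  split_ifs with hc
  · rw [← hc.1, ← hc.2, h, hc.1, hc.2, harmonicInner_self s.abs_m_le]
  · have h0 : harmonicInner l m s.l s.m = 0 := by
      by_cases hl : l = s.l
      · exact harmonicInner_of_order_ne fun hm => hc ⟨hl, hm⟩
      · exact harmonicInner_of_degree_ne hl m s.m
    rw [h0] at h
    rw [(mul_eq_zero.mp h).resolve_left hne, mul_zero]

lemma harmonicCoeff_eq_zero {M : ℕ} {F : Dir → ℂ} (hF : F ∈ harmonicSpan M) {s : ScalarIndex}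
    (hs : M < s.l) : harmonicCoeff s F = 0 := by
  refine harmonicSpan_induction (P := fun F => harmonicCoeff s F = 0)
    (fun l m hl => ?_) ?_ (fun F F' h h' h1 h2 => ?_) (fun c F _ h => ?_) hF
  · have h := harmonicCoeff_solidAt s l m
    have hl' : l ≤ M := by exact_mod_cast hl
    rw [if_neg (by omega)] at h
    exact (mul_eq_zero.mp h).resolve_left (by exact_mod_cast harmonicNorm_ne_zero s.l s.m)
  · simp [harmonicCoeff]
  · rw [harmonicCoeff_add s (continuous_of_mem_harmonicSpan h) (continuous_of_mem_harmonicSpan h'),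
      h1, h2, add_zero]
  · rw [harmonicCoeff_smul, h, mul_zero]

/-- Polynomial functions have finitely many harmonic coefficients, so the functionals below are
finite sums and linear irrespective of the growth of the prescribed values. -/
lemma finite_support_harmonicCoeff {F : Dir → ℂ} (hF : F ∈ harmonicSpan ⊤) :
    (Function.support fun s => harmonicCoeff s F).Finite := by
  refine harmonicSpan_induction
    (P := fun F => (Function.support fun s => harmonicCoeff s F).Finite)
    (fun l m hl => ?_) ?_ (fun F F' h h' h1 h2 => ?_) (fun c F _ h => ?_) hF
  · by_cases hm : |m| ≤ (l : ℤ)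
    · refine (Set.finite_singleton (⟨l, m, hm⟩ : ScalarIndex)).subset fun s hs => ?_
      by_contra hne
      apply hs
      have h := harmonicCoeff_solidAt s l m
      rw [if_neg] at h
      · exact (mul_eq_zero.mp h).resolve_left (by exact_mod_cast harmonicNorm_ne_zero s.l s.m)
      · rintro ⟨rfl, rfl⟩; exact hne rfl
    · have : (fun n : Dir => solidAt l m n) = 0 := by
        funext n
        exact solid_eq_zero _ _ _ _ _ (not_le.mp hm)
      rw [this]; simp [harmonicCoeff]
  · simp [harmonicCoeff]
  · refine (h1.union h2).subset ?_
    have : (fun s => harmonicCoeff s (F + F')) = fun s => harmonicCoeff s F + harmonicCoeff s F' := by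
      funext s
      exact harmonicCoeff_add s (continuous_of_mem_harmonicSpan h) (continuous_of_mem_harmonicSpan h')
    rw [this]
    exact Function.support_add _ _
  · refine h.subset fun s hs => ?_
    simp only [Function.mem_support, harmonicCoeff_smul] at hs ⊢
    exact right_ne_zero_of_mul hs

/-- The linear functional on polynomial functions with prescribed values on solid harmonics. -/
def harmonicFunctional (d : ℕ → ℤ → ℂ) (F : Dir → ℂ) : ℂ :=
  ∑' s : ScalarIndex, harmonicNorm s.l s.m * d s.l s.m * harmonicCoeff s F

lemma summable_harmonicFunctional (d : ℕ → ℤ → ℂ) {F : Dir → ℂ} (hF : F ∈ harmonicSpan ⊤) :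
    Summable fun s : ScalarIndex => harmonicNorm s.l s.m * d s.l s.m * harmonicCoeff s F :=
  summable_of_hasFiniteSupport ((finite_support_harmonicCoeff hF).subset fun _ hs =>
    right_ne_zero_of_mul hs)

lemma harmonicFunctional_add (d : ℕ → ℤ → ℂ) {F G : Dir → ℂ} (hF : F ∈ harmonicSpan ⊤)
    (hG : G ∈ harmonicSpan ⊤) :
    harmonicFunctional d (F + G) = harmonicFunctional d F + harmonicFunctional d G := by
  unfold harmonicFunctional
  rw [← (summable_harmonicFunctional d hF).tsum_add (summable_harmonicFunctional d hG)]
  congr 1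
  funext s
  rw [harmonicCoeff_add s (continuous_of_mem_harmonicSpan hF) (continuous_of_mem_harmonicSpan hG)]
  ring

lemma harmonicFunctional_smul (d : ℕ → ℤ → ℂ) (c : ℂ) (F : Dir → ℂ) :
    harmonicFunctional d (c • F) = c * harmonicFunctional d F := by
  unfold harmonicFunctional
  rw [← tsum_mul_left]
  congr 1
  funext s
  rw [harmonicCoeff_smul]
  ring

lemma harmonicFunctional_zero (d : ℕ → ℤ → ℂ) : harmonicFunctional d 0 = 0 := by
  have := harmonicFunctional_smul d 0 0
  simpa using this

lemma harmonicFunctional_sum {ι : Type*} (d : ℕ → ℤ → ℂ) (S : Finset ι) (w : ι → ℂ)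
    {G : ι → Dir → ℂ} (h : ∀ q, G q ∈ harmonicSpan ⊤) :
    harmonicFunctional d (fun n => ∑ q ∈ S, w q * G q n) = ∑ q ∈ S, w q * harmonicFunctional d (G q) := by
  classical
  induction S using Finset.induction_on with
  | empty => simpa using! harmonicFunctional_zero d
  | insert a S ha ih =>
    rw [Finset.sum_insert ha, ← ih, ← harmonicFunctional_smul,
      ← harmonicFunctional_add d (Submodule.smul_mem _ _ (h a))
        (sum_mem_harmonicSpan w fun q _ => h q)]
    congr 1
    funext n
    simp [Finset.sum_insert ha]

lemma harmonicFunctional_solidAt {d : ℕ → ℤ → ℂ} (hd : ∀ (l : ℕ) (m : ℤ), (l : ℤ) < |m| → d l m = 0)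
    (l : ℕ) (m : ℤ) : harmonicFunctional d (fun n => solidAt l m n) = d l m := by
  unfold harmonicFunctional
  by_cases hm : |m| ≤ (l : ℤ)
  · rw [tsum_eq_single (⟨l, m, hm⟩ : ScalarIndex)]
    · have := harmonicCoeff_solidAt ⟨l, m, hm⟩ l m
      rw [if_pos ⟨rfl, rfl⟩] at this
      simp only at this ⊢
      linear_combination d l m * this
    · intro s hs
      have := harmonicCoeff_solidAt s l m
      rw [if_neg] at this
      · linear_combination d s.l s.m * this
      · rintro ⟨rfl, rfl⟩; exact hs rfl
  · have h0 : (fun n : Dir => solidAt l m n) = 0 := by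
      funext n
      exact solid_eq_zero _ _ _ _ _ (not_le.mp hm)
    rw [hd l m (not_le.mp hm), h0]
    simp [harmonicCoeff]

/-! ### The outgoing functional -/

/-- The outgoing wave with polynomial angular spectrum, at the complex point with coordinates
`(ξ, η, z)`, as a functional of the spectrum. -/
def outgoingAt (ω : ℝ) (ξ η z : ℂ) : (Dir → ℂ) → ℂ :=
  harmonicFunctional fun l m =>
    4 * Real.pi * Complex.I ^ l * outRadial ω l (z ^ 2 + ξ * η) * solid ξ η z l m

/-- The outgoing wave `4π ∑ i^l h_l(ω|r|) Y_{lm}(r̂) ∫ conj Y_{lm} F` with angular spectrum `F`. -/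
def outgoing (ω : ℝ) (r : Space) : (Dir → ℂ) → ℂ := outgoingAt ω (xiOf r) (etaOf r) (r 2)

lemma outgoingAt_solidAt (ω : ℝ) (ξ η z : ℂ) (l : ℕ) (m : ℤ) :
    outgoingAt ω ξ η z (fun n => solidAt l m n)
      = 4 * Real.pi * Complex.I ^ l * outRadial ω l (z ^ 2 + ξ * η) * solid ξ η z l m :=
  harmonicFunctional_solidAt (fun l m h => by rw [solid_eq_zero _ _ _ _ _ h, mul_zero]) l m

lemma solidAt_mem_top (l : ℕ) (m : ℤ) : (fun n : Dir => solidAt l m n) ∈ harmonicSpan ⊤ :=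
  solidAt_mem le_top m

lemma outgoingAt_upPart (ω : ℝ) (ξ η z : ℂ) (w : Space) (l : ℕ) (m : ℤ) :
    outgoingAt ω ξ η z (upPart w l m) = 4 * Real.pi * Complex.I ^ (l + 1)
      * outRadial ω (l + 1) (z ^ 2 + ξ * η) * solidUp ξ η z (xiOf w) (etaOf w) (w 2) l m := by
  have h := outgoingAt_solidAt ω ξ η z
  rw [upPart_eq]
  unfold outgoingAt at h ⊢
  rw [harmonicFunctional_add _ (Submodule.smul_mem _ _ (solidAt_mem_top _ _))
      (add_mem (Submodule.smul_mem _ _ (solidAt_mem_top _ _))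
        (Submodule.smul_mem _ _ (solidAt_mem_top _ _))),
    harmonicFunctional_add _ (Submodule.smul_mem _ _ (solidAt_mem_top _ _))
      (Submodule.smul_mem _ _ (solidAt_mem_top _ _)),
    harmonicFunctional_smul, harmonicFunctional_smul, harmonicFunctional_smul, h, h, h, solidUp]
  ring

lemma outgoingAt_downPart_zero (ω : ℝ) (ξ η z : ℂ) (w : Space) (m : ℤ) :
    outgoingAt ω ξ η z (downPart w 0 m) = 0 := by
  rw [downPart_zero]
  exact harmonicFunctional_zero _

lemma outgoingAt_downPart_succ (ω : ℝ) (ξ η z : ℂ) (w : Space) (l : ℕ) (m : ℤ) :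
    outgoingAt ω ξ η z (downPart w (l + 1) m) = 4 * Real.pi * Complex.I ^ l
      * outRadial ω l (z ^ 2 + ξ * η) * solidDeriv ξ η z (xiOf w) (etaOf w) (w 2) (l + 1) m := by
  have h := outgoingAt_solidAt ω ξ η z
  rw [downPart_succ]
  unfold outgoingAt at h ⊢
  rw [harmonicFunctional_add _ (Submodule.smul_mem _ _ (solidAt_mem_top _ _))
      (add_mem (Submodule.smul_mem _ _ (solidAt_mem_top _ _))
        (Submodule.smul_mem _ _ (solidAt_mem_top _ _))),
    harmonicFunctional_add _ (Submodule.smul_mem _ _ (solidAt_mem_top _ _))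
      (Submodule.smul_mem _ _ (solidAt_mem_top _ _)),
    harmonicFunctional_smul, harmonicFunctional_smul, harmonicFunctional_smul, h, h, h, solidDeriv]
  simp only [solidLow_succ]
  ring

/-- The coordinates of the point `a + t w` for complex `t`. -/
def pathXi (a w : Space) (t : ℂ) : ℂ := xiOf a + t * xiOf w

/-- The coordinates of the point `a + t w` for complex `t`. -/
def pathEta (a w : Space) (t : ℂ) : ℂ := etaOf a + t * etaOf w

/-- The coordinates of the point `a + t w` for complex `t`. -/
def pathZ (a w : Space) (t : ℂ) : ℂ := a 2 + t * w 2

/-- The square of the length of `a + t w` for complex `t`. -/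
def pathSq (a w : Space) (t : ℂ) : ℂ := pathZ a w t ^ 2 + pathXi a w t * pathEta a w t

/-- The outgoing wave along a complex line. -/
def outgoingPath (ω : ℝ) (a w : Space) (t : ℂ) : (Dir → ℂ) → ℂ :=
  outgoingAt ω (pathXi a w t) (pathEta a w t) (pathZ a w t)

lemma hasDerivAt_path (b c t : ℂ) : HasDerivAt (fun t : ℂ => b + t * c) c t := by
  simpa using ((hasDerivAt_id t).mul_const c).const_add b

lemma top_add_one : (⊤ : ℕ∞) + 1 = ⊤ := rfl

lemma dot_mul_mem_top (w : Space) {F : Dir → ℂ} (hF : F ∈ harmonicSpan ⊤) :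
    (fun n : Dir => (dot w n : ℂ) * F n) ∈ harmonicSpan ⊤ := by
  have := dot_mul_mem w hF
  rwa [top_add_one] at this

/-- For a single harmonic the product rule yields a term from the radial function and one from the
solid harmonic. `linear_mul_solid` and the Bessel-type recurrence regroup them into the parts of
degree l + 1 and l - 1 of (w·n) times the harmonic. Linearity extends this to all spectra. -/
lemma hasDerivAt_outgoingPath {ω : ℝ} (hω : 0 < ω) (a w : Space) {t : ℂ}
    (ht : pathSq a w t ∈ Complex.slitPlane) {F : Dir → ℂ} (hF : F ∈ harmonicSpan ⊤) :
    HasDerivAt (fun t => outgoingPath ω a w t F)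
      (Complex.I * ω * outgoingPath ω a w t fun n => (dot w n : ℂ) * F n) t := by
  have hx : HasDerivAt (pathXi a w) (xiOf w) t := hasDerivAt_path _ _ t
  have hy : HasDerivAt (pathEta a w) (etaOf w) t := hasDerivAt_path _ _ t
  have hz : HasDerivAt (pathZ a w) (w 2) t := hasDerivAt_path _ _ t
  refine harmonicSpan_induction (P := fun F => HasDerivAt (fun t => outgoingPath ω a w t F)
      (Complex.I * ω * outgoingPath ω a w t fun n => (dot w n : ℂ) * F n) t)
    (fun l m _ => ?_) ?_ (fun F G hF hG h1 h2 => ?_) (fun c F hF h => ?_) hF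
  · have hq : HasDerivAt (pathSq a w) (2 * pathZ a w t * w 2
        + (xiOf w * pathEta a w t + pathXi a w t * etaOf w)) t := by
      refine ((hz.pow 2).add (hx.mul hy)).congr_deriv ?_
      simp
    have hR := (hasDerivAt_outRadial hω l ht).comp t hq
    have hS := hasDerivAt_solid hx hy hz l m
    have hd := (hR.mul hS).const_mul (4 * Real.pi * Complex.I ^ l : ℂ)
    have hval : (fun t => outgoingPath ω a w t fun n => solidAt l m n)
        = fun t => (4 * Real.pi * Complex.I ^ l : ℂ) * ((outRadial ω l ∘ pathSq a w) t
          * solid (pathXi a w t) (pathEta a w t) (pathZ a w t) l m) := by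
      funext s
      unfold outgoingPath
      rw [outgoingAt_solidAt]
      simp only [Function.comp, pathSq]
      ring
    rw [hval]
    refine hd.congr_deriv ?_
    have hprod : (fun n : Dir => (dot w n : ℂ) * solidAt l m n)
        = ((1 / (2 * l + 1) : ℂ)) • (upPart w l m + downPart w l m) := by
      funext n; exact dot_mul_solidAt w l m n
    have hlin := linear_mul_solid (pathXi a w t) (pathEta a w t) (pathZ a w t) (xiOf w) (etaOf w)
      (w 2) l m
    have hout : outgoingPath ω a w t (fun n => (dot w n : ℂ) * solidAt l m n)
        = (1 / (2 * l + 1)) * (outgoingPath ω a w t (upPart w l m)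
          + outgoingPath ω a w t (downPart w l m)) := by
      rw [hprod]
      unfold outgoingPath outgoingAt
      rw [harmonicFunctional_smul, harmonicFunctional_add _ (upPart_mem w le_top m)
        (downPart_mem w le_top m)]
    rw [hout]
    unfold outgoingPath
    rw [outgoingAt_upPart]
    have hl : (2 * (l : ℂ) + 1) ≠ 0 := by exact_mod_cast Nat.succ_ne_zero (2 * l)
    have hI : Complex.I * Complex.I = -1 := Complex.I_mul_I
    simp only [Function.comp]
    rw [← pathSq] at hlin ⊢
    set R := pathSq a w t
    set S := solid (pathXi a w t) (pathEta a w t) (pathZ a w t) l m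
    set U := solidUp (pathXi a w t) (pathEta a w t) (pathZ a w t) (xiOf w) (etaOf w) (w 2) l m
    set D := solidDeriv (pathXi a w t) (pathEta a w t) (pathZ a w t) (xiOf w) (etaOf w) (w 2) l m
    have hS : (pathZ a w t * w 2 + (pathXi a w t * etaOf w + pathEta a w t * xiOf w) / 2) * S
        = (1 / (2 * l + 1)) * (U + R * D) := by
      rw [← hlin]; field_simp
    cases l with
    | zero =>
      have hD : D = 0 := by simp [D, solidDeriv, solidLow]
      rw [outgoingAt_downPart_zero]
      rw [hD] at hS ⊢
      simp only [CharP.cast_eq_zero] at hS ⊢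
      rw [zero_add, pow_zero, pow_one]
      linear_combination (-(4 * Real.pi * ω * outRadial ω 1 R)) * hS
        - (4 * Real.pi * ω * outRadial ω 1 R) * U * hI
    | succ l =>
      rw [outgoingAt_downPart_succ, ← pathSq]
      have hrec := outRadial_recurrence hω l (Complex.slitPlane_ne_zero ht)
      -- The radial function of order l + 1 is rewritten through orders l + 2 and `l`, which are the
      -- ones carried by the upper and lower parts of the product.
      have hrec' : outRadial ω (l + 1) R
          = (1 / (2 * ((l + 1 : ℕ) : ℂ) + 1)) * (ω * (R * outRadial ω (l + 2) R + outRadial ω l R)) := by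
        rw [← hrec]
        push_cast at hl ⊢
        have : (2 * ((l : ℂ) + 1) + 1) = 2 * l + 3 := by ring
        rw [this] at hl ⊢
        field_simp
      rw [show l + 1 + 1 = l + 2 by rfl]
      rw [hrec', pow_succ Complex.I (l + 1), pow_succ Complex.I l]
      linear_combination (-(4 * Real.pi * (Complex.I ^ l * Complex.I) * ω * outRadial ω (l + 2) R)) * hS
        - (4 * Real.pi * ω * (Complex.I ^ l * Complex.I) * outRadial ω (l + 2) R
            * (1 / (2 * ((l + 1 : ℕ) : ℂ) + 1)) * U) * hI
  · simp only [Pi.zero_apply, mul_zero]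
    have h0 : ∀ t, outgoingPath ω a w t 0 = 0 := fun t => by
      unfold outgoingPath outgoingAt; exact harmonicFunctional_zero _
    have h0' : ∀ t, outgoingPath ω a w t (fun _ => 0) = 0 := h0
    simp only [h0, h0', mul_zero]
    exact hasDerivAt_const t 0
  · have e : (fun n : Dir => (dot w n : ℂ) * (F + G) n)
        = (fun n : Dir => (dot w n : ℂ) * F n) + fun n : Dir => (dot w n : ℂ) * G n := by
      funext n; simp [mul_add]
    rw [e]
    unfold outgoingPath outgoingAt at h1 h2 ⊢
    simp only [harmonicFunctional_add _ hF hG,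
      harmonicFunctional_add _ (dot_mul_mem_top w hF) (dot_mul_mem_top w hG)]
    rw [mul_add]
    exact h1.add h2
  · have e : (fun n : Dir => (dot w n : ℂ) * (c • F) n)
        = c • (fun n : Dir => (dot w n : ℂ) * F n) := by
      funext n; simp; ring
    rw [e]
    unfold outgoingPath outgoingAt at h ⊢
    simp only [harmonicFunctional_smul]
    refine (h.const_mul c).congr_deriv ?_
    ring

/-! ### Holomorphy along complex lines and Taylor series of outgoing waves. -/

lemma norm_sq_eq_complex (a : Space) : (a 2 : ℂ) ^ 2 + xiOf a * etaOf a = ((‖a‖ ^ 2 : ℝ) : ℂ) := by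
  rw [norm_sq_eq]
  unfold xiOf etaOf
  push_cast
  linear_combination -((a 1 : ℂ) ^ 2) * Complex.I_sq

lemma pathSq_eq (a w : Space) (t : ℂ) :
    pathSq a w t = ((‖a‖ ^ 2 : ℝ) : ℂ) + 2 * t * dot a w + t ^ 2 * ((‖w‖ ^ 2 : ℝ) : ℂ) := by
  rw [← norm_sq_eq_complex a, ← norm_sq_eq_complex w, xiOf_eta_dot]
  unfold pathSq pathXi pathEta pathZ
  ring

lemma dot_eq_inner (a w : Space) : dot a w = inner ℝ a w := by
  rw [EuclideanSpace.inner_eq_star_dotProduct]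
  simp [dot, dotProduct, Fin.sum_univ_three]
  ring

/-- If the square of a + t w were a nonpositive real, its imaginary part would force t real or a·w =
-Re(t) |w|². In the first case the value is at least (|a| - |t||w|)² > 0, in the second it is |a|² -
|t|² |w|² > 0. -/
lemma pathSq_mem_slitPlane {a w : Space} {t : ℂ} (h : ‖t‖ * ‖w‖ < ‖a‖) :
    pathSq a w t ∈ Complex.slitPlane := by
  rw [pathSq_eq, Complex.mem_slitPlane_iff]
  have hre : (((‖a‖ ^ 2 : ℝ) : ℂ) + 2 * t * dot a w + t ^ 2 * ((‖w‖ ^ 2 : ℝ) : ℂ)).re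
      = ‖a‖ ^ 2 + 2 * t.re * dot a w + (t.re ^ 2 - t.im ^ 2) * ‖w‖ ^ 2 := by
    rw [Complex.add_re, Complex.add_re, Complex.re_mul_ofReal, Complex.re_mul_ofReal, Complex.ofReal_re]
    simp [sq]
  have him : (((‖a‖ ^ 2 : ℝ) : ℂ) + 2 * t * dot a w + t ^ 2 * ((‖w‖ ^ 2 : ℝ) : ℂ)).im
      = 2 * t.im * (dot a w + t.re * ‖w‖ ^ 2) := by
    rw [Complex.add_im, Complex.add_im, Complex.im_mul_ofReal, Complex.im_mul_ofReal, Complex.ofReal_im]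
    simp [sq]
    ring
  rw [hre, him]
  by_contra hcon
  push Not at hcon
  obtain ⟨h1, h2⟩ := hcon
  have hsq : (t.re ^ 2 + t.im ^ 2) * ‖w‖ ^ 2 < ‖a‖ ^ 2 := by
    have e : t.re ^ 2 + t.im ^ 2 = ‖t‖ ^ 2 := by
      rw [← Complex.normSq_eq_norm_sq, Complex.normSq_apply]; ring
    rw [e, ← mul_pow]
    have : 0 ≤ ‖t‖ * ‖w‖ := by positivity
    gcongr
  rcases mul_eq_zero.mp h2 with h3 | h3
  · have h3' : t.im = 0 := by linarith
    have hcs : |dot a w| ≤ ‖a‖ * ‖w‖ := by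
      rw [dot_eq_inner]; exact abs_real_inner_le_norm a w
    have hr : |t.re| ≤ ‖t‖ := Complex.abs_re_le_norm t
    rw [h3'] at h1
    have h4 : |t.re * dot a w| ≤ ‖t‖ * (‖a‖ * ‖w‖) := by
      rw [abs_mul]; gcongr
    have h5 := neg_abs_le (t.re * dot a w)
    have hn : ‖t‖ = |t.re| := by
      rw [← Complex.re_add_im t, h3']; simp
    have h6 : t.re ^ 2 = ‖t‖ ^ 2 := by rw [hn, sq_abs]
    rw [h6] at h1
    nlinarith [sq_nonneg (‖a‖ - ‖t‖ * ‖w‖), mul_pos (sub_pos.mpr h) (sub_pos.mpr h)]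
  · have : dot a w = -(t.re * ‖w‖ ^ 2) := by linarith
    rw [this] at h1
    nlinarith

lemma outgoingPath_ofReal (ω : ℝ) (a w : Space) (t : ℝ) (F : Dir → ℂ) :
    outgoingPath ω a w t F = outgoing ω (a + t • w) F := by
  unfold outgoingPath outgoing pathXi pathEta pathZ
  congr 1
  · simp [xiOf]; ring
  · simp [etaOf]; ring
  · simp

lemma dot_pow_mul_mem_top (w : Space) (c : ℂ) (N : ℕ) {F : Dir → ℂ} (hF : F ∈ harmonicSpan ⊤) :
    (fun n : Dir => (c * dot w n) ^ N * F n) ∈ harmonicSpan ⊤ := by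
  induction N with
  | zero => simpa using! hF
  | succ N ih =>
    have := Submodule.smul_mem _ c (dot_mul_mem_top w ih)
    convert this using 1
    funext n
    simp only [Pi.smul_apply, smul_eq_mul, pow_succ]
    ring

lemma outgoing_smul (ω : ℝ) (a : Space) (c : ℂ) (F : Dir → ℂ) :
    outgoing ω a (fun n => c * F n) = c * outgoing ω a F := by
  unfold outgoing outgoingAt
  exact harmonicFunctional_smul _ c F

/-- Translation of outgoing waves: the Taylor series converges inside the distance to the
singularity. -/
theorem hasSum_outgoing_add {ω : ℝ} (hω : 0 < ω) {a w : Space} (h : ‖w‖ < ‖a‖) {F : Dir → ℂ}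
    (hF : F ∈ harmonicSpan ⊤) :
    HasSum (fun N : ℕ => outgoing ω a fun n => (Complex.I * ω * dot w n) ^ N / (N ! : ℕ) * F n)
      (outgoing ω (a + w) F) := by
  have ha : 0 < ‖a‖ := (norm_nonneg w).trans_lt h
  -- A radius strictly larger than 1 with r |w| ≤ |a|; unlike |a|/|w| it is also defined for w = 0.
  -- The wave is holomorphic in t on this disc, which contains t = 1.
  set r : ℝ := 2 * ‖a‖ / (‖a‖ + ‖w‖) with hr
  have hden : 0 < ‖a‖ + ‖w‖ := by positivity
  have hr1 : 1 < r := by rw [hr, lt_div_iff₀ hden]; linarith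
  have hrw : r * ‖w‖ ≤ ‖a‖ := by
    rw [hr, div_mul_eq_mul_div, div_le_iff₀ hden]
    nlinarith [norm_nonneg w]
  have hslit : ∀ t ∈ Metric.ball (0 : ℂ) r, pathSq a w t ∈ Complex.slitPlane := by
    intro t ht
    rw [mem_ball_zero_iff] at ht
    apply pathSq_mem_slitPlane
    rcases (norm_nonneg w).eq_or_lt with h0 | h0
    · rw [← h0, mul_zero]; exact ha
    · exact (mul_lt_mul_of_pos_right ht h0).trans_le hrw
  set f : ℂ → ℂ := fun t => outgoingPath ω a w t F with hf
  -- Each derivative multiplies the spectrum by iω w·n, so the Taylor coefficients at t = 0 are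
  -- outgoing waves at `a`.
  have hiter : ∀ N : ℕ, ∀ t ∈ Metric.ball (0 : ℂ) r, iteratedDeriv N f t
      = outgoingPath ω a w t fun n => (Complex.I * ω * dot w n) ^ N * F n := by
    intro N
    induction N with
    | zero => intro t _; simp [hf]
    | succ N ih =>
      intro t ht
      rw [iteratedDeriv_succ]
      have hev : iteratedDeriv N f =ᶠ[nhds t]
          fun t => outgoingPath ω a w t fun n => (Complex.I * ω * dot w n) ^ N * F n := by
        filter_upwards [Metric.isOpen_ball.mem_nhds ht] with s hs
        exact ih s hs
      rw [hev.deriv_eq, (hasDerivAt_outgoingPath hω a w (hslit t ht)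
        (dot_pow_mul_mem_top w _ N hF)).deriv]
      unfold outgoingPath outgoingAt
      rw [← harmonicFunctional_smul]
      congr 1
      funext n
      simp only [Pi.smul_apply, smul_eq_mul, pow_succ]
      ring
  have hdiff : DifferentiableOn ℂ f (Metric.ball 0 r) := fun t ht =>
    (hasDerivAt_outgoingPath hω a w (hslit t ht) hF).differentiableAt.differentiableWithinAt
  have h1 : (1 : ℂ) ∈ Metric.ball (0 : ℂ) r := by
    rw [mem_ball_zero_iff]; simpa using hr1
  have hsum := Complex.hasSum_taylorSeries_on_ball hdiff h1
  have hz0 : (0 : ℂ) ∈ Metric.ball (0 : ℂ) r := Metric.mem_ball_self (by linarith)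
  have hfin : f 1 = outgoing ω (a + w) F := by
    have := outgoingPath_ofReal ω a w 1 F
    simpa [hf] using this
  rw [hfin] at hsum
  have h0 : ∀ G, outgoingPath ω a w 0 G = outgoing ω a G := by
    intro G
    have := outgoingPath_ofReal ω a w 0 G
    simpa using this
  refine hsum.congr_fun fun N => ?_
  rw [hiter N 0 hz0, h0]
  simp only [sub_zero, one_pow, smul_eq_mul, one_mul]
  rw [← outgoing_smul]
  congr 1
  funext n
  ring

/-- Translation of outgoing waves in terms of an expansion of the plane wave factor. -/
theorem hasSum_outgoing_expansion {ω : ℝ} (hω : 0 < ω) {a w : Space} (h : ‖w‖ < ‖a‖) {F : Dir → ℂ}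
    (hF : F ∈ harmonicSpan ⊤) {ι : Type*} {G : ι → Dir → ℂ} (hG : ∀ q, G q ∈ harmonicSpan ⊤)
    (S : ℕ → Finset ι) (c : ℕ → ι → ℂ) (hc : ∀ N q, q ∉ S N → c N q = 0)
    (hexp : ∀ N (n : Dir), (Complex.I * ω * dot w n) ^ N / (N ! : ℕ) * F n = ∑ q ∈ S N, c N q * G q n)
    (hsum : Summable fun p : ι × ℕ => ‖c p.2 p.1 * outgoing ω a (G p.1)‖) :
    HasSum (fun q => (∑' N, c N q) * outgoing ω a (G q)) (outgoing ω (a + w) F) := by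
  have h1 := hasSum_outgoing_add hω h hF
  have h2 : ∀ N, HasSum (fun q => c N q * outgoing ω a (G q))
      (outgoing ω a fun n => (Complex.I * ω * dot w n) ^ N / (N ! : ℕ) * F n) := by
    intro N
    have e : (fun n : Dir => (Complex.I * ω * dot w n) ^ N / (N ! : ℕ) * F n)
        = fun n => ∑ q ∈ S N, c N q * G q n := by
      funext n; exact hexp N n
    rw [e]
    unfold outgoing outgoingAt
    rw [harmonicFunctional_sum _ _ _ hG]
    refine hasSum_sum_of_ne_finset_zero fun q hq => ?_
    rw [hc N q hq, zero_mul]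
  have hs : Summable fun p : ι × ℕ => c p.2 p.1 * outgoing ω a (G p.1) := hsum.of_norm
  -- Absolute summability over pairs allows the sum over degrees and the sum over labels to be
  -- exchanged.
  have hswap : HasSum (fun p : ℕ × ι => c p.1 p.2 * outgoing ω a (G p.2)) (outgoing ω (a + w) F) := by
    have hs' : Summable fun p : ℕ × ι => c p.1 p.2 * outgoing ω a (G p.2) :=
      (Equiv.prodComm ℕ ι).summable_iff.mpr hs
    have := hs'.hasSum.prod_fiberwise h2
    rw [← this.unique h1]
    exact hs'.hasSum
  have hswap' : HasSum (fun p : ι × ℕ => c p.2 p.1 * outgoing ω a (G p.1)) (outgoing ω (a + w) F) :=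
    ((Equiv.prodComm ι ℕ).hasSum_iff (f := fun p : ℕ × ι => c p.1 p.2 * outgoing ω a (G p.2))).mpr
      hswap
  have h3 : ∀ q, HasSum (fun N => c N q * outgoing ω a (G q)) ((∑' N, c N q) * outgoing ω a (G q)) := by
    intro q
    have := (hs.prod_factor q).hasSum
    simp only [tsum_mul_right] at this
    exact this
  exact hswap'.prod_fiberwise h3

/-! ### The propagator as an outgoing wave -/

/-- The ratio of the scalar propagator and the outgoing wave with constant spectrum. -/
def propagatorFactor (ω : ℝ) : ℂ := -(Complex.I * ω / (16 * (Real.pi : ℂ) ^ 2))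

/-- A constant spectrum selects l = 0, and h_0(x) = -i e^{ix}/x. -/
lemma scalarPropagator_eq {ω : ℝ} (hω : 0 < ω) {z : Space} (hz : z ≠ 0) :
    scalarPropagator ω z = propagatorFactor ω * outgoing ω z (fun _ => 1) := by
  have hr : 0 < ‖z‖ := norm_pos_iff.mpr hz
  have h := outgoingAt_solidAt ω (xiOf z) (etaOf z) (z 2) 0 0
  have e : (fun n : Dir => solidAt 0 0 n) = fun _ => (1 : ℂ) := by
    funext n; simp [solidAt, solid]
  rw [e, norm_sq_eq_complex, outRadial_ofReal hω hr] at h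
  rw [outgoing, h]
  have hr' : (‖z‖ : ℂ) ≠ 0 := by exact_mod_cast hr.ne'
  have hω' : (ω : ℂ) ≠ 0 := by exact_mod_cast hω.ne'
  have hpi : (Real.pi : ℂ) ≠ 0 := by exact_mod_cast Real.pi_ne_zero
  simp only [sphericalHankel, scalarPropagator, propagatorFactor, solid, zero_add, pow_one, pow_zero,
    Finset.range_one, Finset.sum_singleton, Nat.factorial_zero, Nat.sub_zero]
  push_cast
  field_simp
  simp only [Complex.I_sq]
  ring

lemma hasDerivAt_outgoing_line {ω : ℝ} (hω : 0 < ω) {z : Space} (hz : z ≠ 0) (w : Space)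
    {F : Dir → ℂ} (hF : F ∈ harmonicSpan ⊤) :
    HasDerivAt (fun t : ℝ => outgoing ω (z + t • w) F)
      (Complex.I * ω * outgoing ω z fun n => (dot w n : ℂ) * F n) 0 := by
  have hs : pathSq z w 0 ∈ Complex.slitPlane :=
    pathSq_mem_slitPlane (by simpa using hz)
  have h := hasDerivAt_outgoingPath hω z w hs hF
  have h0 : ∀ G, outgoingPath ω z w 0 G = outgoing ω z G := by
    intro G
    have := outgoingPath_ofReal ω z w 0 G
    simpa using this
  rw [h0] at h
  have h' := HasDerivAt.comp_ofReal (z := 0) (by simpa using h)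
  simpa only [outgoingPath_ofReal] using h'

lemma partialDeriv_eq_of_line {i : Fin 3} {f : Space → ℂ} {z : Space} (hf : DifferentiableAt ℝ f z)
    {c : ℂ} (h : HasDerivAt (fun t : ℝ => f (z + t • EuclideanSpace.single i (1 : ℝ))) c 0) :
    partialDeriv i f z = c := by
  have hl : HasDerivAt (fun t : ℝ => z + t • EuclideanSpace.single i (1 : ℝ))
      (EuclideanSpace.single i (1 : ℝ) : Space) 0 := by
    simpa using ((hasDerivAt_id (0 : ℝ)).smul_const (EuclideanSpace.single i (1 : ℝ) : Space)).const_add z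
  have h0 : z + (0 : ℝ) • (EuclideanSpace.single i (1 : ℝ) : Space) = z := by simp
  have hf' : HasFDerivAt f (fderiv ℝ f z) (z + (0 : ℝ) • (EuclideanSpace.single i (1 : ℝ) : Space)) := by
    rw [h0]; exact hf.hasFDerivAt
  exact (hf'.comp_hasDerivAt 0 hl).unique h

lemma contDiffAt_scalarPropagator (ω : ℝ) {z : Space} (hz : z ≠ 0) :
    ContDiffAt ℝ 2 (scalarPropagator ω) z := by
  have hn : ContDiffAt ℝ 2 (fun z : Space => (‖z‖ : ℂ)) z :=
    Complex.ofRealCLM.contDiff.contDiffAt.comp z (contDiffAt_norm ℝ hz)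
  have hd : (4 * (Real.pi : ℂ) * (‖z‖ : ℂ)) ≠ 0 := by
    have : (‖z‖ : ℂ) ≠ 0 := by simpa using hz
    have hpi : (Real.pi : ℂ) ≠ 0 := by exact_mod_cast Real.pi_ne_zero
    exact mul_ne_zero (mul_ne_zero (by norm_num) hpi) this
  unfold scalarPropagator
  simp only [div_eq_mul_inv]
  exact ((contDiffAt_const.mul hn).cexp.neg).mul ((contDiffAt_const.mul hn).inv hd)

lemma dot_single (i : Fin 3) (n : Space) : dot (EuclideanSpace.single i 1) n = n i := by
  fin_cases i <;> simp [dot]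

/-- A coordinate derivative multiplies the spectrum by iω n_i. Differentiability is a separate
hypothesis because outgoing waves are differentiated only along lines, whereas `partialDeriv` uses
the full derivative. -/
lemma partialDeriv_outgoing {ω : ℝ} (hω : 0 < ω) (i : Fin 3) {f : Space → ℂ} {z : Space}
    (hz : z ≠ 0) (hf : DifferentiableAt ℝ f z) {c : ℂ} {F : Dir → ℂ} (hF : F ∈ harmonicSpan ⊤)
    (h : ∀ x : Space, x ≠ 0 → f x = c * outgoing ω x F) :
    partialDeriv i f z = c * (Complex.I * ω) * outgoing ω z fun n => (n : Space) i * F n := by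
  have hl := (hasDerivAt_outgoing_line hω hz (EuclideanSpace.single i 1) hF).const_mul c
  simp only [dot_single] at hl
  rw [mul_assoc]
  refine partialDeriv_eq_of_line hf (hl.congr_of_eventuallyEq ?_)
  have hc : Continuous fun t : ℝ => z + t • (EuclideanSpace.single i (1 : ℝ) : Space) := by fun_prop
  have : ∀ᶠ t : ℝ in nhds 0, z + t • (EuclideanSpace.single i (1 : ℝ) : Space) ≠ 0 :=
    hc.continuousAt.eventually_ne (by simpa using hz)
  filter_upwards [this] with t ht
  exact h _ ht

lemma one_mem_top : (fun _ : Dir => (1 : ℂ)) ∈ harmonicSpan ⊤ := const_mem_harmonicSpan _ _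

lemma coord_mul_mem_top (i : Fin 3) {F : Dir → ℂ} (hF : F ∈ harmonicSpan ⊤) :
    (fun n : Dir => ((n : Space) i : ℂ) * F n) ∈ harmonicSpan ⊤ := by
  have := coord_mul_mem i hF
  rwa [top_add_one] at this

/-- The angular spectrum of the electromagnetic propagator. -/
def transverseProjector (i k : Fin 3) (n : Dir) : ℂ :=
  (if i = k then 1 else 0) - ((n : Space) i : ℂ) * (n : Space) k

lemma transverseProjector_eq (i k : Fin 3) : transverseProjector i k
    = (if i = k then (1 : ℂ) else 0) • (fun _ : Dir => (1 : ℂ))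
      + (-1 : ℂ) • fun n : Dir => ((n : Space) i : ℂ) * (((n : Space) k : ℂ) * 1) := by
  funext n
  simp only [transverseProjector, Pi.add_apply, Pi.smul_apply, smul_eq_mul, mul_one]
  ring

lemma transverseProjector_mem (i k : Fin 3) : transverseProjector i k ∈ harmonicSpan ⊤ := by
  rw [transverseProjector_eq]
  exact add_mem (Submodule.smul_mem _ _ one_mem_top)
    (Submodule.smul_mem _ _ (coord_mul_mem_top i (coord_mul_mem_top k one_mem_top)))

/-- Two derivatives multiply the spectrum by -ω² n_i n_k, so δ_ik + ω⁻² ∂_i ∂_k becomes the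
projector onto the tangent plane. -/
theorem emPropagator_eq {ω : ℝ} (hω : 0 < ω) {x y : Space} (h : x ≠ y) (i k : Fin 3) :
    emPropagator ω x y i k = propagatorFactor ω * outgoing ω (x - y) (transverseProjector i k) := by
  have hz : x - y ≠ 0 := sub_ne_zero.mpr h
  have h1 : ∀ z : Space, z ≠ 0 → partialDeriv k (scalarPropagator ω) z
      = propagatorFactor ω * (Complex.I * ω) * outgoing ω z fun n => ((n : Space) k : ℂ) * 1 :=
    fun z hz => partialDeriv_outgoing hω k hz
      ((contDiffAt_scalarPropagator ω hz).differentiableAt (by norm_num)) one_mem_top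
      fun x hx => scalarPropagator_eq hω hx
  have hd : DifferentiableAt ℝ (partialDeriv k (scalarPropagator ω)) (x - y) := by
    have := (contDiffAt_scalarPropagator ω hz).fderiv_right (m := 1) (by norm_num)
    exact (this.differentiableAt (by norm_num)).clm_apply (differentiableAt_const _)
  have h2 := partialDeriv_outgoing hω i hz hd (coord_mul_mem_top k one_mem_top) h1
  rw [emPropagator, h2, scalarPropagator_eq hω hz, transverseProjector_eq]
  have hω' : (ω : ℂ) ≠ 0 := by exact_mod_cast hω.ne'
  unfold outgoing outgoingAt
  rw [harmonicFunctional_add _ (Submodule.smul_mem _ _ one_mem_top)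
    (Submodule.smul_mem _ _ (coord_mul_mem_top i (coord_mul_mem_top k one_mem_top))),
    harmonicFunctional_smul, harmonicFunctional_smul]
  have hI : Complex.I ^ 2 = -1 := Complex.I_sq
  split_ifs <;> field_simp <;> rw [hI] <;> ring

/-! ### Multipole waves as superpositions of powers -/

lemma planeCoeff_nonneg (n l : ℕ) : 0 ≤ planeCoeff n l := by
  unfold planeCoeff; split_ifs <;> positivity

/-- From (2l)!! ≤ (2l+2k+1)!!, which splits off the factor y^l / (2^l l!) and leaves the terms of an
exponential series in y²/2. -/
lemma pow_mul_planeCoeff_add_le {y : ℝ} (hy : 0 ≤ y) (l k : ℕ) :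
    y ^ (l + 2 * k) * planeCoeff (l + 2 * k) l
      ≤ y ^ l / (2 ^ l * (l ! : ℕ)) * ((y ^ 2 / 2) ^ k / (k ! : ℕ)) := by
  have h1 : (2 * l)‼ ≤ (2 * l + 2 * k + 1)‼ := by
    induction k with
    | zero =>
      induction l with
      | zero => simp
      | succ l ih =>
        rw [show 2 * (l + 1) = 2 * l + 2 by ring, show 2 * l + 2 + 2 * 0 + 1 = 2 * l + 1 + 2 by ring,
          Nat.doubleFactorial_add_two, Nat.doubleFactorial_add_two]
        exact Nat.mul_le_mul (by omega) ih
    | succ k ih =>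
      rw [show 2 * l + 2 * (k + 1) + 1 = 2 * l + 2 * k + 1 + 2 by ring, Nat.doubleFactorial_add_two]
      exact ih.trans (Nat.le_mul_of_pos_left _ (by omega))
  rw [Nat.doubleFactorial_two_mul] at h1
  have h2 : (((2 ^ l * l ! : ℕ)) : ℝ) ≤ (((2 * l + 2 * k + 1)‼ : ℕ) : ℝ) := by exact_mod_cast h1
  rw [planeCoeff_add, Nat.doubleFactorial_two_mul]
  push_cast at h2 ⊢
  have e : y ^ l / (2 ^ l * (l ! : ℕ)) * ((y ^ 2 / 2) ^ k / (k ! : ℕ))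
      = y ^ (l + 2 * k) * (1 / ((2 ^ k * (k ! : ℕ)) * (2 ^ l * (l ! : ℕ)))) := by
    rw [pow_add, pow_mul, div_pow]; field_simp
  rw [e]
  gcongr

lemma injective_add_two_mul (l : ℕ) : Function.Injective fun k : ℕ => l + 2 * k :=
  fun a b h => by simpa using h

lemma planeCoeff_eq_zero_of_notMem {n l : ℕ} (h : n ∉ Set.range fun k : ℕ => l + 2 * k) :
    planeCoeff n l = 0 := by
  rw [planeCoeff, if_neg]
  rintro ⟨h1, k, hk⟩
  exact h ⟨k, by simp only; omega⟩

lemma summable_pow_mul_planeCoeff {y : ℝ} (hy : 0 ≤ y) (l : ℕ) :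
    Summable fun n => y ^ n * planeCoeff n l := by
  rw [← (injective_add_two_mul l).summable_iff
    (fun n hn => by rw [planeCoeff_eq_zero_of_notMem hn, mul_zero])]
  refine Summable.of_nonneg_of_le (fun k => mul_nonneg (pow_nonneg hy _) (planeCoeff_nonneg _ _))
    (fun k => pow_mul_planeCoeff_add_le hy l k) ?_
  exact (Real.summable_pow_div_factorial _).mul_left _

lemma tsum_pow_mul_planeCoeff_le {y : ℝ} (hy : 0 ≤ y) (l : ℕ) :
    ∑' n, y ^ n * planeCoeff n l ≤ y ^ l / (2 ^ l * (l ! : ℕ)) * Real.exp (y ^ 2 / 2) := by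
  have hs : Function.support (fun n => y ^ n * planeCoeff n l) ⊆ Set.range fun k : ℕ => l + 2 * k := by
    intro n hn
    by_contra h
    exact hn (by simp only [planeCoeff_eq_zero_of_notMem h, mul_zero])
  have h1 : Summable fun k : ℕ => y ^ (l + 2 * k) * planeCoeff (l + 2 * k) l :=
    (summable_pow_mul_planeCoeff hy l).comp_injective (injective_add_two_mul l)
  have h2 : Summable fun k : ℕ => y ^ l / (2 ^ l * (l ! : ℕ)) * ((y ^ 2 / 2) ^ k / (k ! : ℕ)) :=
    (Real.summable_pow_div_factorial _).mul_left _
  rw [← (injective_add_two_mul l).tsum_eq hs, Real.exp_eq_exp_ℝ, NormedSpace.exp_eq_tsum_div,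
    ← tsum_mul_left]
  exact h1.tsum_le_tsum (fun k => pow_mul_planeCoeff_add_le hy l k) h2

/-- Only n = l + 2k contributes, and i^(l+2k) = i^l (-1)^k reproduces the Bessel series. -/
lemma hasSum_sphericalBessel {x : ℝ} (hx : 0 ≤ x) (l : ℕ) :
    HasSum (fun n => (Complex.I * x) ^ n * planeCoeff n l) (Complex.I ^ l * sphericalBessel l x) := by
  have hz : ∀ n ∉ Set.range fun k : ℕ => l + 2 * k, (Complex.I * x) ^ n * (planeCoeff n l : ℂ) = 0 :=
    fun n hn => by rw [planeCoeff_eq_zero_of_notMem hn]; simp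
  have hS : Summable fun n => (Complex.I * x) ^ n * (planeCoeff n l : ℂ) := by
    refine Summable.of_norm ((summable_pow_mul_planeCoeff hx l).congr fun n => ?_)
    simp [abs_of_nonneg hx, abs_of_nonneg (planeCoeff_nonneg n l)]
  have he : ∀ k : ℕ, (Complex.I * x) ^ (l + 2 * k) * (planeCoeff (l + 2 * k) l : ℂ)
      = Complex.I ^ l * ((-1 : ℝ) ^ k * x ^ (l + 2 * k)
          / ((2 ^ k * k ! * Nat.doubleFactorial (2 * l + 2 * k + 1) : ℕ) : ℝ) : ℝ) := by
    intro k
    rw [planeCoeff_add, Nat.doubleFactorial_two_mul, mul_pow, pow_add Complex.I, pow_mul Complex.I,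
      Complex.I_sq]
    push_cast
    ring
  have := (injective_add_two_mul l).tsum_eq
    (f := fun n => (Complex.I * x) ^ n * (planeCoeff n l : ℂ)) (by
      intro n hn
      by_contra h
      exact hn (hz n h))
  simp only [he] at this
  rw [tsum_mul_left, ← Complex.ofReal_tsum] at this
  rw [sphericalBessel, this]
  exact hS.hasSum

/-- The direction of a vector, with an arbitrary value for the zero vector. -/
def unitDirection (v : Space) : Space := if v = 0 then pole else direction v

lemma norm_direction {v : Space} (hv : v ≠ 0) : ‖direction v‖ = 1 := by
  rw [direction, norm_smul, norm_inv, norm_norm, inv_mul_cancel₀ (norm_ne_zero_iff.mpr hv)]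

lemma norm_smul_direction (v : Space) : ‖v‖ • direction v = v := by
  rcases eq_or_ne v 0 with rfl | hv
  · simp
  · rw [direction, smul_smul, mul_inv_cancel₀ (norm_ne_zero_iff.mpr hv), one_smul]

lemma norm_unitDirection (v : Space) : ‖unitDirection v‖ = 1 := by
  unfold unitDirection
  split_ifs with h
  · exact norm_pole
  · exact norm_direction h

lemma norm_smul_unitDirection (v : Space) : ‖v‖ • unitDirection v = v := by
  unfold unitDirection
  split_ifs with h
  · simp [h]
  · exact norm_smul_direction v

lemma dot_eq_norm_mul (v n : Space) : dot v n = ‖v‖ * dot n (unitDirection v) := by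
  conv_lhs => rw [← norm_smul_unitDirection v]
  simp only [dot, PiLp.smul_apply, smul_eq_mul]
  ring

lemma sphericalBessel_zero {l : ℕ} (hl : l ≠ 0) : sphericalBessel l 0 = 0 := by
  simp [sphericalBessel, hl]

lemma sphericalHarmonic_zero_const (m : ℤ) (n n' : Space) :
    sphericalHarmonic 0 m n = sphericalHarmonic 0 m n' := by
  have h : ∀ k, sphericalHarmonicNat 0 k n = sphericalHarmonicNat 0 k n' := by
    intro k
    unfold sphericalHarmonicNat
    cases k with
    | zero => simp
    | succ k => simp
  simp [sphericalHarmonic, h]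

/-- At the origin `direction` is zero and not a unit vector. This does no harm: for l > 0 the Bessel
factor vanishes there, and for l = 0 the harmonic is constant. -/
lemma vectorWave_eq (ω : ℝ) (j l : ℕ) (m : ℤ) (v : Space) (i : Fin 3) :
    vectorWave ω j l m v i = (Real.sqrt (2 * ω ^ 2 / Real.pi) : ℂ) * sphericalBessel l (ω * ‖v‖)
      * solidVec j l m (unitDirection v) i := by
  rw [vectorWave, ← vectorHarmonic_eq _ _ _ (norm_unitDirection v)]
  rcases eq_or_ne v 0 with rfl | hv
  · rcases eq_or_ne l 0 with rfl | hl
    · congr 1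
      unfold vectorHarmonic
      simp only [sphericalHarmonic_zero_const _ (direction 0) (unitDirection 0)]
    · simp [sphericalBessel_zero hl]
  · rw [unitDirection, if_neg hv]

lemma planeAmplitude_eq_sum (N : ℕ) (α : Fin 2) (j : ℕ) (m : ℤ) (n : Space) (i : Fin 3) :
    planeAmplitude N α j m n i = ∑ l ∈ Finset.range (j + 2),
      (4 * Real.pi * planeCoeff N l * tangentialCoeff α j l : ℝ) * solidVec j l m n i := by
  unfold planeAmplitude
  rw [Finset.sum_subset (Finset.range_mono (show N + 1 ≤ N + 1 + (j + 2) by omega)),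
    Finset.sum_subset (Finset.range_mono (show j + 2 ≤ N + 1 + (j + 2) by omega))]
  · intro l _ hl
    rw [Finset.mem_range] at hl
    rw [tangentialCoeff_eq_zero (by omega)]; simp
  · intro l _ hl
    rw [Finset.mem_range] at hl
    rw [planeCoeff_of_lt (by omega)]; simp

/-- The homogeneous terms of a multipole wave. -/
def waveTerm (ω : ℝ) (p : Mode) (v : Space) (i : Fin 3) (N : ℕ) : ℂ :=
  (Complex.I * (ω * ‖v‖ : ℝ)) ^ N * planeAmplitude N p.α p.j p.m (unitDirection v) i

/-- The phase `i^{j-α}`. -/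
def modePhase (p : Mode) : ℂ := Complex.I ^ ((p.j : ℤ) - ((p.α : ℕ) : ℤ))

/-- The normalisation `√(2ω²/π)` of the waves. -/
def waveNorm (ω : ℝ) : ℝ := Real.sqrt (2 * ω ^ 2 / Real.pi)

lemma waveNorm_sq (ω : ℝ) : (waveNorm ω : ℂ) * waveNorm ω = 2 * ω ^ 2 / Real.pi := by
  rw [← Complex.ofReal_mul, waveNorm, Real.mul_self_sqrt (by positivity)]
  push_cast; rfl

lemma waveNorm_ne_zero {ω : ℝ} (hω : 0 < ω) : (waveNorm ω : ℂ) ≠ 0 := by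
  have : 0 < waveNorm ω := Real.sqrt_pos.mpr (by positivity)
  exact_mod_cast this.ne'

/-- Summing over the degree N turns `planeCoeff` into i^l j_l. The phases of l = j - 1 and l = j + 1
differ by i² = -1, which is why the TM wave carries a minus sign where the harmonic Y^(1) has a
plus. -/
theorem hasSum_waveTerm {ω : ℝ} (hω : 0 < ω) (p : Mode) (v : Space) (i : Fin 3) :
    HasSum (waveTerm ω p v i) (4 * Real.pi * modePhase p / waveNorm ω * modeWave ω p v i) := by
  have hx : 0 ≤ ω * ‖v‖ := by positivity
  have h := hasSum_sum (s := Finset.range (p.j + 2)) fun l _ =>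
    (hasSum_sphericalBessel hx l).mul_right
      ((4 * Real.pi * tangentialCoeff p.α p.j l : ℝ) * solidVec p.j l p.m (unitDirection v) i)
  have hw := waveNorm_ne_zero hω
  have hval : ∑ l ∈ Finset.range (p.j + 2), Complex.I ^ l * sphericalBessel l (ω * ‖v‖)
      * ((4 * Real.pi * tangentialCoeff p.α p.j l : ℝ) * solidVec p.j l p.m (unitDirection v) i)
      = 4 * Real.pi * modePhase p / waveNorm ω * modeWave ω p v i := by
    obtain ⟨j, m, α, hj, hm⟩ := p
    simp only [modeWave, vectorWave_eq, modePhase]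
    rw [← waveNorm]
    have hj0 : j ≠ 0 := by omega
    by_cases hα : α = 0
    · subst hα
      rw [if_pos rfl, Finset.sum_eq_single_of_mem j (by simp)]
      · simp only [tangentialCoeff, if_neg hj0, if_true]
        simp only [Fin.val_zero, Nat.cast_zero, sub_zero, zpow_natCast]
        push_cast
        field_simp
      · intro l _ hl
        simp [tangentialCoeff, hj0, hl]
    · have hα1 : α = 1 := by omega
      subst hα1
      obtain ⟨j, rfl⟩ : ∃ j', j = j' + 1 := ⟨j - 1, by omega⟩
      rw [if_neg hα, Finset.sum_range_succ, Finset.sum_range_succ, Finset.sum_range_succ,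
        Finset.sum_eq_zero]
      · simp only [tangentialCoeff, if_neg hj0, if_neg hα, if_pos, Nat.add_sub_cancel]
        rw [if_neg (show ¬ j + 1 + 1 = j + 1 by omega), if_neg (show ¬ j + 1 = j + 1 + 1 by omega),
          if_neg (show ¬ j + 2 + 1 = j + 1 by omega)]
        have : Complex.I ^ (((j + 1 : ℕ) : ℤ) - (((1 : Fin 2) : ℕ) : ℤ)) = Complex.I ^ j := by
          rw [← zpow_natCast]; congr 1; push_cast; simp
        rw [this, pow_add Complex.I j 2, Complex.I_sq]
        push_cast
        field_simp
        ring
      · intro l hl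
        rw [Finset.mem_range] at hl
        simp only [tangentialCoeff, if_neg hj0, if_neg hα]
        rw [if_neg (by omega), if_neg (by omega)]
        simp
  rw [hval] at h
  refine h.congr_fun fun N => ?_
  rw [waveTerm, planeAmplitude_eq_sum, Finset.mul_sum]
  refine Finset.sum_congr rfl fun l _ => ?_
  push_cast
  ring

/-! ### Finite sets of modes -/

/-- The labels of a mode as an element of a dependent sum. -/
def modeKey (p : Mode) : Σ _ : ℕ, ℤ × Fin 2 := ⟨p.j, (p.m, p.α)⟩

lemma modeKey_injective : Function.Injective modeKey := by
  rintro ⟨j, m, α, h1, h2⟩ ⟨j', m', α', h1', h2'⟩ h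
  simp only [modeKey, Sigma.mk.injEq, heq_eq_eq, Prod.mk.injEq] at h
  obtain ⟨rfl, rfl, rfl⟩ := h
  rfl

/-- The modes with `j < M`. -/
def modesBelow (M : ℕ) : Finset Mode :=
  ((Finset.range M).sigma fun j => Finset.Icc (-(j : ℤ)) j ×ˢ Finset.univ).preimage modeKey
    modeKey_injective.injOn

lemma mem_modesBelow {M : ℕ} {p : Mode} : p ∈ modesBelow M ↔ p.j < M := by
  have := abs_le.mp p.abs_m_le
  simp [modesBelow, modeKey, this]

lemma sum_modesBelow {A : Type*} [AddCommMonoid A] (M : ℕ) (f : ℕ → ℤ → Fin 2 → A)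
    (h0 : ∀ m α, f 0 m α = 0) :
    ∑ p ∈ modesBelow M, f p.j p.m p.α
      = ∑ j ∈ Finset.range M, ∑ m ∈ Finset.Icc (-(j : ℤ)) j, ∑ α, f j m α := by
  have := Finset.sum_preimage modeKey
    ((Finset.range M).sigma fun j => Finset.Icc (-(j : ℤ)) j ×ˢ (Finset.univ : Finset (Fin 2)))
    modeKey_injective.injOn (fun x => f x.1 x.2.1 x.2.2) (by
      rintro ⟨j, m, α⟩ hx hne
      -- Labels with j = 0 are not modes; their terms vanish by hypothesis.
      rcases Nat.eq_zero_or_pos j with rfl | hj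
      · exact h0 _ _
      · exfalso
        simp only [Finset.mem_sigma, Finset.mem_range, Finset.mem_product, Finset.mem_Icc] at hx
        exact hne ⟨⟨j, m, α, hj, abs_le.mpr hx.2.1⟩, rfl⟩)
  rw [Finset.sum_sigma] at this
  simp only [Finset.sum_product] at this
  exact this

/-- The degree N part of the tangential plane wave e^{iω v·n} (δ - n n). Both re-expansions of the
propagator come from it. -/
lemma planeWave_mul_tangential {ω : ℝ} (v : Space) (N : ℕ) (n : Dir) (i i' : Fin 3) :
    (Complex.I * ω * dot v n) ^ N / (N ! : ℕ)
        * ((if i = i' then 1 else 0) - ((n : Space) i : ℂ) * (n : Space) i')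
      = ∑ p ∈ modesBelow (N + 2), waveTerm ω p v i N * conj (solidTransverse p.α p.j p.m n i') := by
  have h := dot_pow_mul_tangential N (norm_unitDirection v) (norm_dir n) i i'
  rw [← sum_modesBelow (N + 2) (fun j m α => planeAmplitude N α j m (unitDirection v) i
    * conj (solidTransverse α j m n i')) (fun m α => by
      rw [planeAmplitude_eq_zero (Or.inl rfl), zero_mul])] at h
  simp only [waveTerm, mul_assoc]
  rw [← Finset.mul_sum, ← h, dot_eq_norm_mul]
  push_cast
  ring

/-! ### The coupling coefficients as outgoing waves -/

/-- The product of two transverse harmonics. -/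
def coupledSpectrum (p q : Mode) (n : Dir) : ℂ :=
  ∑ i, conj (solidTransverse q.α q.j q.m n i) * solidTransverse p.α p.j p.m n i

lemma outgoing_eq {ω : ℝ} (hω : 0 < ω) {a : Space} (ha : a ≠ 0) (F : Dir → ℂ) :
    outgoing ω a F = ∑' s : ScalarIndex, 4 * Real.pi * Complex.I ^ s.l * sphericalHankel s.l (ω * ‖a‖)
      * solidY s.l s.m (direction a) * harmonicCoeff s F := by
  have hr : 0 < ‖a‖ := norm_pos_iff.mpr ha
  have hr' : (‖a‖ : ℂ) ≠ 0 := by exact_mod_cast hr.ne'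
  unfold outgoing outgoingAt harmonicFunctional
  refine tsum_congr fun s => ?_
  beta_reduce
  rw [norm_sq_eq_complex, outRadial_ofReal hω hr]
  have h : solid (xiOf a) (etaOf a) (a 2) s.l s.m = (‖a‖ : ℂ) ^ s.l * solidAt s.l s.m (direction a) := by
    rw [solidAt, ← solid_smul]
    have hc : ∀ k, (a k : ℂ) = ‖a‖ * direction a k := by
      intro k
      conv_lhs => rw [← norm_smul_direction a]
      simp
    congr 1
    · rw [xiOf, hc 0, hc 1]; ring
    · rw [etaOf, hc 0, hc 1]; ring
    · exact hc 2
  rw [h, solidY]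
  field_simp

lemma harmonicCoeff_coupledSpectrum (p q : Mode) (s : ScalarIndex) :
    harmonicCoeff s (coupledSpectrum p q) = couplingIntegral p q s := by
  unfold harmonicCoeff couplingIntegral coupledSpectrum
  congr 1
  funext n
  rw [sphericalHarmonic_eq s.abs_m_le (norm_dir n)]
  simp only [transverseHarmonic_eq _ _ _ (norm_dir n), mul_comm]

/-- The power i^l'' belongs to the outgoing wave; what is left of the phase is a ratio of two mode
phases and does not depend on the summation labels. -/
theorem coupling_eq {ω : ℝ} (hω : 0 < ω) {a : Space} (ha : a ≠ 0) (p q : Mode) :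
    coupling ω a p q = -(Complex.I * Real.pi / (2 * ω)) * (modePhase q / modePhase p)
      * outgoing ω a (coupledSpectrum p q) := by
  rw [coupling, outgoing_eq hω ha, ← tsum_mul_left, ← tsum_mul_left]
  refine tsum_congr fun s => ?_
  rw [couplingTerm, harmonicCoeff_coupledSpectrum, sphericalHarmonic_eq s.abs_m_le (norm_direction ha)]
  have hph : Complex.I ^ ((s.l : ℤ) + q.j - p.j + ((p.α : ℕ) : ℤ) - ((q.α : ℕ) : ℤ))
      = Complex.I ^ s.l * (modePhase q / modePhase p) := by
    rw [modePhase, modePhase, ← zpow_natCast, ← zpow_sub₀ Complex.I_ne_zero,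
      ← zpow_add₀ Complex.I_ne_zero]
    congr 1
    ring
  rw [hph]
  ring

/-! ### Bounds for outgoing waves -/

/-- With (l+k)! ≤ 2^(l+k) l! k! the k-th term is at most 2^l l! / x^l times x^(l-k)/(l-k)!, and
these last factors form a partial sum of e^x. -/
lemma norm_sphericalHankel_le {x : ℝ} (hx : 0 < x) (l : ℕ) :
    ‖sphericalHankel l x‖ ≤ Real.exp x * (2 ^ l * (l ! : ℕ) / x ^ (l + 1)) := by
  have hterm : ∀ k ∈ Finset.range (l + 1), ‖Complex.I ^ k * (((l + k)! : ℕ) : ℂ)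
      / (((k ! * (l - k)! : ℕ) : ℂ) * (2 * (x : ℂ)) ^ k)‖
      ≤ 2 ^ l * (l ! : ℕ) / x ^ l * (x ^ (l - k) / ((l - k)! : ℕ)) := by
    intro k hk
    have hk' : k ≤ l := by rw [Finset.mem_range] at hk; omega
    have hc : (l + k)! ≤ 2 ^ (l + k) * (l ! * k !) := by
      rw [← Nat.add_choose_mul_factorial_mul_factorial l k, mul_assoc]
      exact Nat.mul_le_mul_right _ (Nat.choose_le_two_pow _ _)
    have hc' : (((l + k)! : ℕ) : ℝ) ≤ 2 ^ (l + k) * ((l ! : ℕ) * (k ! : ℕ)) := by exact_mod_cast hc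
    have hn : ‖Complex.I ^ k * (((l + k)! : ℕ) : ℂ)
        / (((k ! * (l - k)! : ℕ) : ℂ) * (2 * (x : ℂ)) ^ k)‖
        = ((l + k)! : ℕ) / ((k ! : ℕ) * ((l - k)! : ℕ) * (2 * x) ^ k) := by
      simp [abs_of_pos hx]
    rw [hn, div_le_iff₀ (by positivity)]
    refine hc'.trans (le_of_eq ?_)
    obtain ⟨d, rfl⟩ := Nat.exists_eq_add_of_le hk'
    rw [Nat.add_sub_cancel_left, mul_pow]
    field_simp
    ring
  have hsum : ∑ k ∈ Finset.range (l + 1), x ^ (l - k) / ((l - k)! : ℕ) ≤ Real.exp x := by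
    have := Finset.sum_range_reflect (fun k => x ^ k / (k ! : ℕ)) (l + 1)
    simp only [Nat.add_sub_cancel] at this
    rw [this]
    exact Real.sum_le_exp_of_nonneg hx.le _
  have h1 : ‖(-Complex.I) ^ (l + 1) * (Complex.exp (Complex.I * (x : ℂ)) / (x : ℂ))‖ = 1 / x := by
    rw [norm_mul, norm_pow, norm_neg, Complex.norm_I, one_pow, one_mul, norm_div, mul_comm Complex.I,
      Complex.norm_exp_ofReal_mul_I, Complex.norm_real, Real.norm_of_nonneg hx.le]
  rw [sphericalHankel, norm_mul, h1]
  refine (mul_le_mul_of_nonneg_left ((norm_sum_le _ _).trans (Finset.sum_le_sum hterm))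
    (by positivity)).trans ?_
  rw [← Finset.mul_sum]
  refine (mul_le_mul_of_nonneg_left (mul_le_mul_of_nonneg_left hsum (by positivity))
    (by positivity)).trans (le_of_eq ?_)
  rw [pow_succ]
  field_simp

/-- A bound uniform in l ≤ M. It must hold also for large x, where the bound is not monotone in `l`;
the defect x^d / d! with d = M - l is absorbed in a second exponential. -/
lemma norm_sphericalHankel_le_of_le {x : ℝ} (hx : 0 < x) {l M : ℕ} (h : l ≤ M) :
    ‖sphericalHankel l x‖ ≤ Real.exp (2 * x) * (2 ^ M * (M ! : ℕ) / x ^ (M + 1)) := by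
  obtain ⟨d, rfl⟩ := Nat.exists_eq_add_of_le h
  have h1 : x ^ d / (d ! : ℕ) ≤ Real.exp x := Real.pow_div_factorial_le_exp x hx.le d
  have h2 : ((l ! : ℕ) : ℝ) * (d ! : ℕ) ≤ ((l + d)! : ℕ) := by
    exact_mod_cast Nat.le_of_dvd (Nat.factorial_pos _) (Nat.factorial_mul_factorial_dvd_factorial_add l d)
  refine (norm_sphericalHankel_le hx l).trans ?_
  rw [two_mul, Real.exp_add, mul_assoc]
  refine mul_le_mul_of_nonneg_left ?_ (Real.exp_nonneg x)
  have h3 : (2 ^ l * (l ! : ℕ) / x ^ (l + 1) : ℝ)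
      ≤ x ^ d / (d ! : ℕ) * (2 ^ (l + d) * ((l + d)! : ℕ) / x ^ (l + d + 1)) := by
    rw [div_mul_div_comm, div_le_div_iff₀ (by positivity) (by positivity)]
    have h4 : (1 : ℝ) ≤ 2 ^ d := one_le_pow₀ (by norm_num)
    calc (2 ^ l * (l ! : ℕ) * ((d ! : ℕ) * x ^ (l + d + 1)) : ℝ)
        = 2 ^ l * x ^ d * x ^ (l + 1) * ((l ! : ℕ) * (d ! : ℕ)) * 1 := by ring
      _ ≤ 2 ^ l * x ^ d * x ^ (l + 1) * ((l + d)! : ℕ) * 2 ^ d := by gcongr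
      _ = _ := by ring
  exact h3.trans (mul_le_mul_of_nonneg_right h1 (by positivity))

lemma norm_solidY_le (l : ℕ) (m : ℤ) {n : Space} (hn : ‖n‖ = 1) :
    ‖solidY l m n‖ ≤ Real.sqrt ((2 * l + 1) / (4 * Real.pi)) :=
  Real.le_sqrt_of_sq_le (norm_solidY_sq_le l m hn)

lemma norm_harmonicCoeff_le (s : ScalarIndex) {F : Dir → ℂ} {B : ℝ} (hB : ∀ n, ‖F n‖ ≤ B) :
    ‖harmonicCoeff s F‖ ≤ Real.sqrt ((2 * s.l + 1) / (4 * Real.pi)) * B * (4 * Real.pi) := by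
  have := norm_integral_le_of_norm_le_const (μ := solidAngle)
    (f := fun n : Dir => conj (solidY s.l s.m n) * F n)
    (C := Real.sqrt ((2 * s.l + 1) / (4 * Real.pi)) * B) (Filter.Eventually.of_forall fun n => by
      rw [norm_mul, RCLike.norm_conj]
      exact mul_le_mul (norm_solidY_le _ _ (norm_dir n)) (hB n) (norm_nonneg _) (Real.sqrt_nonneg _))
  rwa [solidAngle_univ] at this

lemma scalarKey_injective : Function.Injective fun s : ScalarIndex => (s.l, s.m) := by
  rintro ⟨l, m, h⟩ ⟨l', m', h'⟩ he
  simp only [Prod.mk.injEq] at he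
  obtain ⟨rfl, rfl⟩ := he
  rfl

/-- The scalar labels with `l ≤ M`. -/
def scalarsUpTo (M : ℕ) : Finset ScalarIndex :=
  (Finset.range (M + 1) ×ˢ Finset.Icc (-(M : ℤ)) M).preimage _ scalarKey_injective.injOn

lemma mem_scalarsUpTo {M : ℕ} {s : ScalarIndex} : s ∈ scalarsUpTo M ↔ s.l ≤ M := by
  have := abs_le.mp s.abs_m_le
  simp only [scalarsUpTo, Finset.mem_preimage, Finset.mem_product, Finset.mem_range, Finset.mem_Icc]
  omega

lemma card_scalarsUpTo_le (M : ℕ) : (scalarsUpTo M).card ≤ (M + 1) * (2 * M + 1) := by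
  classical
  rw [scalarsUpTo, Finset.card_preimage]
  refine (Finset.card_filter_le _ _).trans ?_
  rw [Finset.card_product, Finset.card_range, Int.card_Icc]
  apply Nat.mul_le_mul_left
  omega

/-- Only degrees up to M occur. Two powers of M + 1 count the labels, and one comes from the product
of the bounds for the harmonic and for its coefficient. -/
theorem norm_outgoing_le {ω : ℝ} (hω : 0 < ω) {a : Space} (ha : a ≠ 0) {M : ℕ} {F : Dir → ℂ}
    (hF : F ∈ harmonicSpan M) {B : ℝ} (hB : ∀ n, ‖F n‖ ≤ B) :
    ‖outgoing ω a F‖ ≤ 16 * Real.pi * Real.exp (2 * (ω * ‖a‖))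
      * ((M + 1) ^ 3 * B * (2 ^ M * (M ! : ℕ) / (ω * ‖a‖) ^ (M + 1))) := by
  have hx : 0 < ω * ‖a‖ := mul_pos hω (norm_pos_iff.mpr ha)
  have hB0 : 0 ≤ B := (norm_nonneg _).trans (hB ⟨pole, mem_sphere_zero_iff_norm.mpr norm_pole⟩)
  rw [outgoing_eq hω ha, tsum_eq_sum (s := scalarsUpTo M) fun s hs => by
    rw [harmonicCoeff_eq_zero hF (by rw [mem_scalarsUpTo] at hs; omega), mul_zero]]
  set K := Real.exp (2 * (ω * ‖a‖)) * (2 ^ M * (M ! : ℕ) / (ω * ‖a‖) ^ (M + 1)) with hK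
  have hK0 : 0 ≤ K := by positivity
  have hterm : ∀ s ∈ scalarsUpTo M, ‖4 * Real.pi * Complex.I ^ s.l * sphericalHankel s.l (ω * ‖a‖)
      * solidY s.l s.m (direction a) * harmonicCoeff s F‖ ≤ 4 * Real.pi * K * (B * (2 * M + 1)) := by
    intro s hs
    rw [mem_scalarsUpTo] at hs
    have h1 := norm_sphericalHankel_le_of_le hx hs
    rw [← hK] at h1
    have h2 := norm_solidY_le s.l s.m (norm_direction ha)
    have h3 := norm_harmonicCoeff_le s hB
    have hs' : (s.l : ℝ) ≤ M := by exact_mod_cast hs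
    have h4 : Real.sqrt ((2 * s.l + 1) / (4 * Real.pi))
        * (Real.sqrt ((2 * s.l + 1) / (4 * Real.pi)) * B * (4 * Real.pi)) = B * (2 * s.l + 1) := by
      have : Real.sqrt ((2 * s.l + 1) / (4 * Real.pi)) * Real.sqrt ((2 * s.l + 1) / (4 * Real.pi))
        = (2 * s.l + 1) / (4 * Real.pi) := Real.mul_self_sqrt (by positivity)
      calc _ = Real.sqrt ((2 * s.l + 1) / (4 * Real.pi)) * Real.sqrt ((2 * s.l + 1) / (4 * Real.pi))
            * B * (4 * Real.pi) := by ring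
        _ = _ := by rw [this]; field_simp
    calc ‖4 * Real.pi * Complex.I ^ s.l * sphericalHankel s.l (ω * ‖a‖)
          * solidY s.l s.m (direction a) * harmonicCoeff s F‖
        = 4 * Real.pi * ‖sphericalHankel s.l (ω * ‖a‖)‖
          * (‖solidY s.l s.m (direction a)‖ * ‖harmonicCoeff s F‖) := by
          simp [abs_of_pos Real.pi_pos]; ring
      _ ≤ 4 * Real.pi * K * (Real.sqrt ((2 * s.l + 1) / (4 * Real.pi))
        * (Real.sqrt ((2 * s.l + 1) / (4 * Real.pi)) * B * (4 * Real.pi))) := by gcongr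
      _ = 4 * Real.pi * K * (B * (2 * s.l + 1)) := by rw [h4]
      _ ≤ _ := by gcongr
  refine (norm_sum_le _ _).trans ((Finset.sum_le_card_nsmul _ _ _ hterm).trans ?_)
  rw [nsmul_eq_mul]
  have hcard : ((scalarsUpTo M).card : ℝ) ≤ (M + 1) * (2 * M + 1) := by
    exact_mod_cast card_scalarsUpTo_le M
  calc ((scalarsUpTo M).card : ℝ) * (4 * Real.pi * K * (B * (2 * M + 1)))
      ≤ ((M + 1) * (2 * (M + 1))) * (4 * Real.pi * K * (B * (2 * (M + 1)))) := by
        refine mul_le_mul (hcard.trans ?_) ?_ (by positivity) (by positivity)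
        · gcongr; linarith
        · gcongr; linarith
    _ = _ := by rw [hK]; ring

/-! ### Bounds for multipole waves -/

lemma norm_sphericalBasis_le (q : ℤ) (i : Fin 3) : ‖sphericalBasis q i‖ ≤ 1 := by
  have h : (Real.sqrt 2)⁻¹ ≤ 1 := inv_le_one_of_one_le₀ (Real.one_le_sqrt.mpr (by norm_num))
  unfold sphericalBasis
  split_ifs <;> fin_cases i <;> simp [abs_of_nonneg (Real.sqrt_nonneg 2), h]

lemma norm_solidVec_le (j l : ℕ) (m : ℤ) {n : Space} (hn : ‖n‖ = 1) (i : Fin 3) :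
    ‖solidVec j l m n i‖ ≤ 3 * (2 * l + 1) := by
  have hY : ∀ m, ‖solidY l m n‖ ≤ 2 * l + 1 := by
    intro m
    refine (norm_solidY_le l m hn).trans (Real.sqrt_le_iff.mpr ⟨by positivity, ?_⟩)
    rw [div_le_iff₀ (by positivity)]
    have h1 : (1 : ℝ) ≤ 2 * l + 1 := by linarith [Nat.cast_nonneg (α := ℝ) l]
    nlinarith [Real.pi_gt_three]
  have := Finset.sum_le_card_nsmul (Finset.Icc (-1 : ℤ) 1)
    (fun q => ‖(clebschGordan l (m - q) 1 q j m : ℂ) * solidY l (m - q) n * sphericalBasis q i‖)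
    (2 * l + 1) (fun q _ => by
      rw [norm_mul, norm_mul, Complex.norm_real, Real.norm_eq_abs]
      calc |clebschGordan l (m - q) 1 q j m| * ‖solidY l (m - q) n‖ * ‖sphericalBasis q i‖
          ≤ 1 * (2 * l + 1) * 1 := by
            gcongr
            · exact abs_clebschGordan_le _ _ _ _ _ _
            · exact hY _
            · exact norm_sphericalBasis_le q i
        _ = 2 * l + 1 := by ring)
  refine (norm_sum_le _ _).trans (this.trans (le_of_eq ?_))
  simp
  ring

lemma sqrt_div_le_one {x y : ℝ} (hy : 0 < y) (h : x ≤ y) : Real.sqrt (x / y) ≤ 1 :=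
  Real.sqrt_le_one.mpr ((div_le_one hy).mpr h)

lemma norm_solidTransverse_le (α : Fin 2) (j : ℕ) (m : ℤ) {n : Space} (hn : ‖n‖ = 1) (i : Fin 3) :
    ‖solidTransverse α j m n i‖ ≤ 18 * (j + 1) := by
  have hj : (0 : ℝ) ≤ j := Nat.cast_nonneg j
  unfold solidTransverse
  split_ifs
  · refine (norm_solidVec_le j j m hn i).trans ?_
    linarith
  · have h1 := norm_solidVec_le j (j - 1) m hn i
    have h2 := norm_solidVec_le j (j + 1) m hn i
    have h3 : ((j - 1 : ℕ) : ℝ) ≤ j := by exact_mod_cast Nat.sub_le j 1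
    have s1 := sqrt_div_le_one (show (0 : ℝ) < 2 * j + 1 by positivity) (show (j : ℝ) + 1 ≤ 2 * j + 1 by linarith)
    have s2 := sqrt_div_le_one (show (0 : ℝ) < 2 * j + 1 by positivity) (show (j : ℝ) ≤ 2 * j + 1 by linarith)
    refine (norm_add_le _ _).trans ?_
    rw [norm_mul, norm_mul, Complex.norm_real, Complex.norm_real, Real.norm_of_nonneg (Real.sqrt_nonneg _),
      Real.norm_of_nonneg (Real.sqrt_nonneg _)]
    have e1 := mul_le_mul s1 h1 (norm_nonneg _) zero_le_one
    have e2 := mul_le_mul s2 h2 (norm_nonneg _) zero_le_one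
    push_cast at e2
    linarith

lemma abs_tangentialCoeff_le (α : Fin 2) (j l : ℕ) : |tangentialCoeff α j l| ≤ 1 := by
  have hj : (0 : ℝ) ≤ j := Nat.cast_nonneg j
  have s1 := sqrt_div_le_one (show (0 : ℝ) < 2 * j + 1 by positivity) (show (j : ℝ) + 1 ≤ 2 * j + 1 by linarith)
  have s2 := sqrt_div_le_one (show (0 : ℝ) < 2 * j + 1 by positivity) (show (j : ℝ) ≤ 2 * j + 1 by linarith)
  unfold tangentialCoeff
  split_ifs
  · simp
  · simp
  · simp
  · rwa [abs_of_nonneg (Real.sqrt_nonneg _)]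
  · rwa [abs_of_nonneg (Real.sqrt_nonneg _)]
  · simp

/-- The size of a multipole wave of degree `j` at distance `y / ω`. -/
def waveMajorant (j : ℕ) (y : ℝ) : ℝ := (j + 1) ^ 3 * (y ^ j / (2 ^ j * (j ! : ℕ)))

lemma waveMajorant_pos (j : ℕ) {y : ℝ} (hy : 0 < y) : 0 < waveMajorant j y := by
  unfold waveMajorant; positivity

/-- Changing the degree by one changes y^l / (2^l l!) by 2(l+1)/y or y/(2(j+1)), that is by a factor
linear in the degree with a constant depending on y. -/
lemma pow_div_factorial_le_of_near {y : ℝ} (hy : 0 < y) {j l : ℕ} (h : j ≤ l + 1 ∧ l ≤ j + 1) :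
    y ^ l / (2 ^ l * (l ! : ℕ)) ≤ (2 / y + 1 + y) * (j + 1) * (y ^ j / (2 ^ j * (j ! : ℕ))) := by
  have hj : (0 : ℝ) ≤ j := Nat.cast_nonneg j
  have hA : 0 < y ^ j / (2 ^ j * (j ! : ℕ)) := by positivity
  have h2y : 0 < 2 / y := by positivity
  rcases (show j = l + 1 ∨ l = j ∨ l = j + 1 by omega) with rfl | rfl | rfl
  · have e : y ^ l / (2 ^ l * (l ! : ℕ))
        = (2 / y) * ((l + 1 : ℕ) : ℝ) * (y ^ (l + 1) / (2 ^ (l + 1) * ((l + 1)! : ℕ))) := by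
      rw [Nat.factorial_succ]
      push_cast
      field_simp
      ring
    rw [e]
    gcongr <;> linarith
  · calc y ^ l / (2 ^ l * (l ! : ℕ)) = 1 * 1 * (y ^ l / (2 ^ l * (l ! : ℕ))) := by ring
      _ ≤ _ := by gcongr <;> linarith
  · have e : y ^ (j + 1) / (2 ^ (j + 1) * ((j + 1)! : ℕ))
        = (y / (2 * (j + 1))) * (y ^ j / (2 ^ j * (j ! : ℕ))) := by
      rw [Nat.factorial_succ]
      push_cast
      field_simp
      ring
    rw [e]
    gcongr
    calc y / (2 * (j + 1)) ≤ y := div_le_self hy.le (by linarith)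
      _ = y * 1 := by ring
      _ ≤ _ := by gcongr <;> linarith

/-- The bound is for the sum of the norms of the homogeneous terms, not just for the wave, since
sums over degrees and modes are exchanged later. The constant depends only on ω and on the bound y
for ω |v|. -/
theorem exists_waveTerm_bound {ω y : ℝ} (hω : 0 < ω) (hy : 0 < y) :
    ∃ C : ℝ, 0 ≤ C ∧ ∀ (p : Mode) (v : Space) (i : Fin 3), ω * ‖v‖ ≤ y →
      Summable (fun N => ‖waveTerm ω p v i N‖) ∧
      ∑' N, ‖waveTerm ω p v i N‖ ≤ C * waveMajorant p.j y := by
  refine ⟨2 * (36 * Real.pi * ((2 / y + 1 + y) * Real.exp (y ^ 2 / 2))), by positivity,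
    fun p v i hv => ?_⟩
  set j := p.j with hj
  set D : ℕ → ℝ := fun l => 4 * Real.pi * |tangentialCoeff p.α j l| * (3 * (2 * l + 1)) with hD
  have hle : ∀ N, ‖waveTerm ω p v i N‖ ≤ ∑ l ∈ Finset.range (j + 2), y ^ N * planeCoeff N l * D l := by
    intro N
    rw [waveTerm, planeAmplitude_eq_sum, norm_mul, norm_pow, norm_mul, Complex.norm_I, one_mul,
      Complex.norm_real, Real.norm_of_nonneg (by positivity)]
    calc (ω * ‖v‖) ^ N * ‖∑ l ∈ Finset.range (j + 2),
          ((4 * Real.pi * planeCoeff N l * tangentialCoeff p.α j l : ℝ) : ℂ)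
            * solidVec j l p.m (unitDirection v) i‖
        ≤ y ^ N * ∑ l ∈ Finset.range (j + 2), planeCoeff N l * D l := by
          refine mul_le_mul (pow_le_pow_left₀ (by positivity) hv N) ?_ (norm_nonneg _) (by positivity)
          refine norm_sum_le_of_le _ fun l _ => ?_
          rw [norm_mul, Complex.norm_real, Real.norm_eq_abs, abs_mul, abs_mul, abs_mul,
            abs_of_nonneg (planeCoeff_nonneg N l), abs_of_pos Real.pi_pos,
            abs_of_pos (show (0 : ℝ) < 4 by norm_num)]
          have h1 := norm_solidVec_le j l p.m (norm_unitDirection v) i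
          have h2 := planeCoeff_nonneg N l
          calc 4 * Real.pi * planeCoeff N l * |tangentialCoeff p.α j l|
                * ‖solidVec j l p.m (unitDirection v) i‖
              ≤ 4 * Real.pi * planeCoeff N l * |tangentialCoeff p.α j l| * (3 * (2 * l + 1)) := by
                gcongr
            _ = _ := by rw [hD]; ring
      _ = _ := by rw [Finset.mul_sum]; exact Finset.sum_congr rfl fun l _ => by ring
  have hs : Summable fun N => ∑ l ∈ Finset.range (j + 2), y ^ N * planeCoeff N l * D l :=
    summable_sum fun l _ => (summable_pow_mul_planeCoeff hy.le l).mul_right _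
  have hS : Summable fun N => ‖waveTerm ω p v i N‖ :=
    Summable.of_nonneg_of_le (fun _ => norm_nonneg _) hle hs
  refine ⟨hS, (hS.tsum_le_tsum hle hs).trans ?_⟩
  rw [Summable.tsum_finsetSum fun l _ => (summable_pow_mul_planeCoeff hy.le l).mul_right _]
  set A := (j + 1 : ℝ) ^ 2 * (y ^ j / (2 ^ j * (j ! : ℕ))) with hA
  have hj0 : (0 : ℝ) ≤ j := Nat.cast_nonneg j
  have hterm : ∀ l ∈ Finset.range (j + 2), ∑' N, y ^ N * planeCoeff N l * D l
      ≤ 36 * Real.pi * ((2 / y + 1 + y) * Real.exp (y ^ 2 / 2)) * A := by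
    intro l hl
    rw [tsum_mul_right]
    by_cases h : j ≤ l + 1 ∧ l ≤ j + 1
    · have h1 := tsum_pow_mul_planeCoeff_le hy.le l
      have h2 := pow_div_factorial_le_of_near hy h
      have h3 := abs_tangentialCoeff_le p.α j l
      have hl' : (l : ℝ) ≤ j + 1 := by exact_mod_cast h.2
      have hD' : D l ≤ 36 * Real.pi * (j + 1) := by
        calc D l ≤ 4 * Real.pi * 1 * (3 * (2 * (j + 1) + 1)) := by rw [hD]; beta_reduce; gcongr
          _ ≤ 4 * Real.pi * 1 * (9 * (j + 1)) :=
            mul_le_mul_of_nonneg_left (by linarith) (by positivity)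
          _ = _ := by ring
      have hD0 : 0 ≤ D l := by rw [hD]; positivity
      calc (∑' N, y ^ N * planeCoeff N l) * D l
          ≤ ((2 / y + 1 + y) * (j + 1) * (y ^ j / (2 ^ j * (j ! : ℕ))) * Real.exp (y ^ 2 / 2))
              * (36 * Real.pi * (j + 1)) := by
            refine mul_le_mul (h1.trans ?_) hD' hD0 (by positivity)
            gcongr
        _ = _ := by rw [hA]; ring
    · have : D l = 0 := by simp [hD, tangentialCoeff_eq_zero h]
      rw [this, mul_zero]
      positivity
  refine (Finset.sum_le_card_nsmul _ _ _ hterm).trans ?_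
  rw [Finset.card_range, nsmul_eq_mul]
  push_cast
  calc ((j : ℝ) + 2) * (36 * Real.pi * ((2 / y + 1 + y) * Real.exp (y ^ 2 / 2)) * A)
      ≤ (2 * (j + 1)) * (36 * Real.pi * ((2 / y + 1 + y) * Real.exp (y ^ 2 / 2)) * A) := by
        gcongr; linarith
    _ = _ := by rw [hA, waveMajorant]; ring

/-! ### Summability over pairs of modes -/

lemma exists_pow_mul_pow_le (K : ℕ) {t : ℝ} (h0 : 0 < t) (h1 : t < 1) :
    ∃ C : ℝ, 0 ≤ C ∧ ∀ n : ℕ, ((n : ℝ) + 3) ^ K * t ^ n ≤ C := by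
  have h := tendsto_pow_const_mul_const_pow_of_abs_lt_one K (r := t) (by rwa [abs_of_pos h0])
  obtain ⟨C, hC⟩ := h.bddAbove_range
  have hC' : ∀ n : ℕ, (n : ℝ) ^ K * t ^ n ≤ C := fun n => hC ⟨n, rfl⟩
  have hC0 : 0 ≤ C := le_trans (by positivity) (hC' 0)
  refine ⟨C / t ^ 3, by positivity, fun n => ?_⟩
  rw [le_div_iff₀ (by positivity)]
  have := hC' (n + 3)
  rw [pow_add] at this
  push_cast at this
  linarith

/-- On the antidiagonal of n the terms add up to (x + y)^n, leaving a geometric series. -/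
lemma summable_choose_mul {x y : ℝ} (hx : 0 ≤ x) (hy : 0 ≤ y) (h : x + y < 1) :
    Summable fun k : ℕ × ℕ => ((k.1 + k.2).choose k.1 : ℝ) * (x ^ k.1 * y ^ k.2) := by
  rw [← (Finset.HasAntidiagonal.sigmaAntidiagonalEquivProd (A := ℕ)).summable_iff,
    summable_sigma_of_nonneg fun _ => by simp only [Function.comp]; positivity]
  refine ⟨fun n => (hasSum_fintype _).summable, ?_⟩
  have : ∀ n : ℕ, ∑' k : Finset.HasAntidiagonal.antidiagonal n,
      ((fun k : ℕ × ℕ => ((k.1 + k.2).choose k.1 : ℝ) * (x ^ k.1 * y ^ k.2))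
        ∘ Finset.HasAntidiagonal.sigmaAntidiagonalEquivProd) ⟨n, k⟩ = (x + y) ^ n := by
    intro n
    rw [(Commute.all x y).add_pow', tsum_fintype, Finset.univ_eq_attach,
      ← Finset.sum_attach (Finset.HasAntidiagonal.antidiagonal n)]
    refine Finset.sum_congr rfl fun k _ => ?_
    have hk := Finset.HasAntidiagonal.mem_antidiagonal.mp k.2
    simp [Finset.HasAntidiagonal.sigmaAntidiagonalEquivProd, hk]
  simp only [this]
  exact summable_geometric_of_lt_one (by positivity) h

/-- The labels of a mode of given degree. -/
def modeOrder (p : Mode) : ℕ × Fin 2 := ((p.m + p.j).toNat, p.α)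

lemma modeOrder_injective : Function.Injective fun p : Mode => (p.j, modeOrder p) := by
  rintro ⟨j, m, α, h1, h2⟩ ⟨j', m', α', h1', h2'⟩ h
  simp only [modeOrder, Prod.mk.injEq] at h
  obtain ⟨rfl, h3, rfl⟩ := h
  rw [abs_le] at h2 h2'
  obtain rfl : m = m' := by omega
  rfl

lemma one_div_sq_modeOrder_ge (p : Mode) :
    1 ≤ (2 * (p.j : ℝ) + 1) ^ 2 * (1 / (((modeOrder p).1 : ℝ) + 1) ^ 2) := by
  have h : (modeOrder p).1 ≤ 2 * p.j := by
    have := abs_le.mp p.abs_m_le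
    simp only [modeOrder]; omega
  have h' : ((modeOrder p).1 : ℝ) ≤ 2 * p.j := by exact_mod_cast h
  rw [mul_one_div, one_le_div (by positivity)]
  gcongr

/-- The finitely many orders of each degree are dominated by the convergent series of 1/(k+1)², at
the price of a factor (2j+1)² per mode. Modes thus embed into a product of summable families. -/
lemma summable_mode_pairs {g : ℕ × ℕ → ℝ} (hg : ∀ k, 0 ≤ g k)
    (h : Summable fun k : ℕ × ℕ => g k * ((2 * (k.1 : ℝ) + 1) ^ 2 * (2 * (k.2 : ℝ) + 1) ^ 2)) :
    Summable fun pq : Mode × Mode => g (pq.1.j, pq.2.j) := by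
  have h1 : Summable fun κ : ℕ × Fin 2 => 1 / ((κ.1 : ℝ) + 1) ^ 2 := by
    have a1 : Summable fun k : ℕ => 1 / ((k : ℝ) + 1) ^ 2 := by
      have := (summable_nat_add_iff 1).mpr (Real.summable_one_div_nat_pow.mpr (show 1 < 2 by norm_num))
      simpa using this
    have a2 : Summable fun _ : Fin 2 => (1 : ℝ) := (hasSum_fintype _).summable
    have := a1.mul_of_nonneg a2 (fun _ => by positivity) (fun _ => zero_le_one)
    simpa using this
  have h2 := h1.mul_of_nonneg h1 (fun _ => by positivity) (fun _ => by positivity)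
  have h3 := h.mul_of_nonneg h2 (fun k => mul_nonneg (hg k) (by positivity)) (fun _ => by positivity)
  have hinj : Function.Injective fun pq : Mode × Mode =>
      (((pq.1.j, pq.2.j), (modeOrder pq.1, modeOrder pq.2)) :
        (ℕ × ℕ) × ((ℕ × Fin 2) × (ℕ × Fin 2))) := by
    rintro ⟨p, q⟩ ⟨p', q'⟩ he
    simp only [Prod.mk.injEq] at he
    obtain ⟨⟨e1, e2⟩, e3, e4⟩ := he
    rw [Prod.mk.injEq]
    exact ⟨modeOrder_injective (Prod.ext e1 e3), modeOrder_injective (Prod.ext e2 e4)⟩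
  refine Summable.of_nonneg_of_le (fun _ => hg _) (fun pq => ?_) (h3.comp_injective hinj)
  have e1 := one_div_sq_modeOrder_ge pq.1
  have e2 := one_div_sq_modeOrder_ge pq.2
  simp only [Function.comp]
  calc g (pq.1.j, pq.2.j) = g (pq.1.j, pq.2.j) * (1 * 1) := by ring
    _ ≤ g (pq.1.j, pq.2.j) * (((2 * (pq.1.j : ℝ) + 1) ^ 2 * (1 / (((modeOrder pq.1).1 : ℝ) + 1) ^ 2))
        * ((2 * (pq.2.j : ℝ) + 1) ^ 2 * (1 / (((modeOrder pq.2).1 : ℝ) + 1) ^ 2))) :=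
        mul_le_mul_of_nonneg_left (mul_le_mul e1 e2 zero_le_one (by positivity)) (hg _)
    _ = _ := by ring

/-- The size of the coupling between multipoles of degrees `j` and `j'` at distance `x / ω`. -/
def couplingMajorant (j j' : ℕ) (x : ℝ) : ℝ :=
  ((j + j' : ℕ) + 3) ^ 3 * ((j + 1) * (j' + 1))
    * (2 ^ (j + j' + 2) * ((j + j' + 2)! : ℕ) / x ^ (j + j' + 3))

lemma couplingMajorant_nonneg (j j' : ℕ) {x : ℝ} (hx : 0 < x) : 0 ≤ couplingMajorant j j' x := by
  unfold couplingMajorant; positivity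

/-- The powers of two cancel, and (j+j'+2)! / (j! j'!) is the binomial coefficient times a quadratic
polynomial. Each polynomial factor is bounded by powers of J = j + j' + 3: the degrees are 4 + 4 + 3
+ 2 + 4 = 17, and 64 = 4 · 16. -/
lemma majorant_product_le {x y y' : ℝ} (hx : 0 < x) (hy : 0 < y) (hy' : 0 < y') (j j' : ℕ) :
    waveMajorant j y * waveMajorant j' y' * couplingMajorant j j' x
        * ((2 * (j : ℝ) + 1) ^ 2 * (2 * (j' : ℝ) + 1) ^ 2)
      ≤ 64 / x ^ 3 * (((j + j' : ℕ) + 3) ^ 17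
        * (((j + j').choose j : ℝ) * ((y / x) ^ j * (y' / x) ^ j'))) := by
  have hf : (((j + j' + 2)! : ℕ) : ℝ)
      = (((j + j' : ℕ) : ℝ) + 2) * (((j + j' : ℕ) : ℝ) + 1)
        * (((j + j').choose j : ℝ) * (j ! : ℕ) * (j' ! : ℕ)) := by
    rw [Nat.factorial_succ, Nat.factorial_succ, ← Nat.add_choose_mul_factorial_mul_factorial j j',
      Nat.choose_symm_add]
    push_cast; ring
  have hj : (0 : ℝ) ≤ j := Nat.cast_nonneg j
  have hj' : (0 : ℝ) ≤ j' := Nat.cast_nonneg j'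
  set J : ℝ := ((j + j' : ℕ) : ℝ) + 3 with hJ
  have hJ' : J = j + j' + 3 := by rw [hJ]; push_cast; ring
  set Q : ℝ := 4 / x ^ 3 * (((j + j').choose j : ℝ) * ((y / x) ^ j * (y' / x) ^ j')) with hQ
  have hQ0 : 0 ≤ Q := by positivity
  have e : waveMajorant j y * waveMajorant j' y' * couplingMajorant j j' x
        * ((2 * (j : ℝ) + 1) ^ 2 * (2 * (j' : ℝ) + 1) ^ 2)
      = Q * ((j + 1) ^ 4 * (j' + 1) ^ 4 * J ^ 3 * ((J - 1) * (J - 2))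
        * ((2 * (j : ℝ) + 1) ^ 2 * (2 * (j' : ℝ) + 1) ^ 2)) := by
    unfold waveMajorant couplingMajorant
    rw [hf, ← hJ, show ((j + j' : ℕ) : ℝ) + 2 = J - 1 by rw [hJ]; ring,
      show ((j + j' : ℕ) : ℝ) + 1 = J - 2 by rw [hJ]; ring, hQ, div_pow, div_pow]
    simp only [pow_add]
    field_simp
    ring
  rw [e]
  have b1 : (j : ℝ) + 1 ≤ J := by rw [hJ']; linarith
  have b2 : (j' : ℝ) + 1 ≤ J := by rw [hJ']; linarith
  have b3 : 2 * (j : ℝ) + 1 ≤ 2 * J := by rw [hJ']; linarith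
  have b4 : 2 * (j' : ℝ) + 1 ≤ 2 * J := by rw [hJ']; linarith
  have b0 : 3 ≤ J := by rw [hJ']; linarith
  clear_value J Q
  clear e hf
  calc Q * ((j + 1) ^ 4 * (j' + 1) ^ 4 * J ^ 3 * ((J - 1) * (J - 2))
        * ((2 * (j : ℝ) + 1) ^ 2 * (2 * (j' : ℝ) + 1) ^ 2))
      ≤ Q * (J ^ 4 * J ^ 4 * J ^ 3 * (J * J) * ((2 * J) ^ 2 * (2 * J) ^ 2)) := by
        have : (J - 1) * (J - 2) ≤ J * J := by nlinarith
        have h0 : 0 ≤ (J - 1) * (J - 2) := mul_nonneg (by linarith) (by linarith)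
        gcongr
    _ = 16 * Q * J ^ 17 := by ring
    _ = _ := by rw [hQ]; ring

theorem summable_majorant {x y y' : ℝ} (hy : 0 < y) (hy' : 0 < y') (h : y + y' < x) :
    Summable fun pq : Mode × Mode =>
      waveMajorant pq.1.j y * waveMajorant pq.2.j y' * couplingMajorant pq.1.j pq.2.j x := by
  have hx : 0 < x := by linarith
  refine summable_mode_pairs (g := fun k => waveMajorant k.1 y * waveMajorant k.2 y'
      * couplingMajorant k.1 k.2 x)
    (fun k => mul_nonneg (mul_pos (waveMajorant_pos _ hy) (waveMajorant_pos _ hy')).le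
      (couplingMajorant_nonneg _ _ hx)) ?_
  -- The slack between (y + y')/x and 1 is split: t^n absorbs the polynomial factor, and dividing
  -- both arguments by t keeps their sum below one.
  obtain ⟨t, ht1, ht2⟩ := exists_between (show (y + y') / x < 1 by rwa [div_lt_one hx])
  have ht : 0 < t := lt_trans (by positivity) ht1
  obtain ⟨C, hC0, hC⟩ := exists_pow_mul_pow_le 17 ht ht2
  have hs := summable_choose_mul (x := y / x / t) (y := y' / x / t) (by positivity) (by positivity)
    (by rw [← add_div, ← add_div, div_lt_one ht]; exact ht1)
  refine Summable.of_nonneg_of_le (fun k => ?_) (fun k => ?_) (hs.mul_left (64 / x ^ 3 * C))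
  · have := (waveMajorant_pos k.1 hy).le
    have := (waveMajorant_pos k.2 hy').le
    have := couplingMajorant_nonneg k.1 k.2 hx
    positivity
  · refine (majorant_product_le hx hy hy' k.1 k.2).trans ?_
    rw [mul_assoc (64 / x ^ 3)]
    refine mul_le_mul_of_nonneg_left ?_ (by positivity)
    have e : ((y / x) ^ k.1 * (y' / x) ^ k.2)
        = t ^ (k.1 + k.2) * ((y / x / t) ^ k.1 * (y' / x / t) ^ k.2) := by
      rw [pow_add, div_pow (y / x) t, div_pow (y' / x) t]; field_simp
    have hck := hC (k.1 + k.2)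
    calc (((k.1 + k.2 : ℕ) : ℝ) + 3) ^ 17
          * (((k.1 + k.2).choose k.1 : ℝ) * ((y / x) ^ k.1 * (y' / x) ^ k.2))
        = ((((k.1 + k.2 : ℕ) : ℝ) + 3) ^ 17 * t ^ (k.1 + k.2))
          * (((k.1 + k.2).choose k.1 : ℝ) * ((y / x / t) ^ k.1 * (y' / x / t) ^ k.2)) := by
          rw [e]; ring
      _ ≤ _ := mul_le_mul_of_nonneg_right hck (by positivity)

/-! ### The expansion -/

/-- The components of a transverse harmonic as functions on the sphere. -/
def transverseSpectrum (p : Mode) (i : Fin 3) (n : Dir) : ℂ := solidTransverse p.α p.j p.m n i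

lemma transverseSpectrum_mem (p : Mode) (i : Fin 3) :
    transverseSpectrum p i ∈ harmonicSpan ((p.j + 1 : ℕ) : ℕ∞) := solidTransverse_mem _ _ _ _

lemma coupledSpectrum_mem (p q : Mode) :
    coupledSpectrum p q ∈ harmonicSpan ((p.j + q.j + 2 : ℕ) : ℕ∞) := by
  have h : ∀ i, (fun n => conj (transverseSpectrum q i n) * transverseSpectrum p i n)
      ∈ harmonicSpan ((p.j + q.j + 2 : ℕ) : ℕ∞) := by
    intro i
    have := mul_mem_harmonicSpan (conj_mem_harmonicSpan (transverseSpectrum_mem q i))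
      (transverseSpectrum_mem p i)
    rw [← Nat.cast_add, show q.j + 1 + (p.j + 1) = p.j + q.j + 2 by ring] at this
    exact this
  have := Submodule.sum_mem (harmonicSpan ((p.j + q.j + 2 : ℕ) : ℕ∞)) (t := Finset.univ)
    (f := fun i n => conj (transverseSpectrum q i n) * transverseSpectrum p i n) (fun i _ => h i)
  convert this using 1
  funext n
  rw [Finset.sum_apply]
  rfl

lemma norm_coupledSpectrum_le (p q : Mode) (n : Dir) :
    ‖coupledSpectrum p q n‖ ≤ 972 * ((p.j + 1) * (q.j + 1)) := by
  have := Finset.sum_le_card_nsmul Finset.univ (fun i : Fin 3 =>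
    ‖conj (solidTransverse q.α q.j q.m n i) * solidTransverse p.α p.j p.m n i‖)
    ((18 * (q.j + 1)) * (18 * (p.j + 1))) (fun i _ => by
      rw [norm_mul, RCLike.norm_conj]
      exact mul_le_mul (norm_solidTransverse_le _ _ _ (norm_dir n) _)
        (norm_solidTransverse_le _ _ _ (norm_dir n) _) (norm_nonneg _) (by positivity))
  refine (norm_sum_le _ _).trans (this.trans (le_of_eq ?_))
  simp
  ring

lemma norm_outgoing_le_couplingMajorant {ω : ℝ} (hω : 0 < ω) {a : Space} (ha : a ≠ 0) {j j' : ℕ}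
    {F : Dir → ℂ} (hF : F ∈ harmonicSpan ((j + j' + 2 : ℕ) : ℕ∞))
    (hB : ∀ n, ‖F n‖ ≤ 972 * ((j + 1) * (j' + 1))) :
    ‖outgoing ω a F‖ ≤ 16 * Real.pi * Real.exp (2 * (ω * ‖a‖)) * 972
      * couplingMajorant j j' (ω * ‖a‖) := by
  refine (norm_outgoing_le hω ha hF hB).trans (le_of_eq ?_)
  unfold couplingMajorant
  push_cast
  ring

lemma norm_outgoing_coupledSpectrum_le {ω : ℝ} (hω : 0 < ω) {a : Space} (ha : a ≠ 0) (p q : Mode) :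
    ‖outgoing ω a (coupledSpectrum p q)‖ ≤ 16 * Real.pi * Real.exp (2 * (ω * ‖a‖)) * 972
      * couplingMajorant p.j q.j (ω * ‖a‖) :=
  norm_outgoing_le_couplingMajorant hω ha (coupledSpectrum_mem p q) (norm_coupledSpectrum_le p q)

lemma norm_outgoing_transverseSpectrum_le {ω : ℝ} (hω : 0 < ω) {a : Space} (ha : a ≠ 0) (p : Mode)
    (i : Fin 3) : ‖outgoing ω a (transverseSpectrum p i)‖ ≤ 16 * Real.pi
      * Real.exp (2 * (ω * ‖a‖)) * 972 * couplingMajorant p.j 1 (ω * ‖a‖) := by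
  refine norm_outgoing_le_couplingMajorant (j := p.j) (j' := 1) hω ha
    (harmonicSpan_mono ?_ (transverseSpectrum_mem p i))
    fun n => (norm_solidTransverse_le p.α p.j p.m (norm_dir n) i).trans ?_
  · exact_mod_cast (by omega : p.j + 1 ≤ p.j + 1 + 2)
  · have : (0 : ℝ) ≤ p.j := Nat.cast_nonneg _
    push_cast
    linarith

lemma summable_waveTerm_mul {ω y : ℝ} (hω : 0 < ω) (hy : 0 < y) {v : Space} (hv : ω * ‖v‖ ≤ y)
    (i : Fin 3) {f : Mode → ℂ} {b : Mode → ℝ} {K : ℝ} (hf : ∀ p, ‖f p‖ ≤ K * b p)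
    (hb : Summable fun p : Mode => waveMajorant p.j y * b p) :
    Summable fun pN : Mode × ℕ => ‖waveTerm ω pN.1 v i pN.2 * f pN.1‖ := by
  obtain ⟨C, hC0, hC⟩ := exists_waveTerm_bound hω hy
  have h1 : ∀ p, Summable fun N => ‖waveTerm ω p v i N * f p‖ := fun p => by
    simp only [norm_mul]
    exact ((hC p v i hv).1).mul_right _
  refine (summable_prod_of_nonneg
    (f := fun pN : Mode × ℕ => ‖waveTerm ω pN.1 v i pN.2 * f pN.1‖) fun _ => norm_nonneg _).mpr
    ⟨h1, ?_⟩
  refine Summable.of_nonneg_of_le (fun p => tsum_nonneg fun _ => norm_nonneg _)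
    (fun p => ?_) (hb.mul_left (C * K))
  simp only [norm_mul, tsum_mul_right]
  calc (∑' N, ‖waveTerm ω p v i N‖) * ‖f p‖ ≤ (C * waveMajorant p.j y) * (K * b p) :=
        mul_le_mul (hC p v i hv).2 (hf p) (norm_nonneg _)
          (mul_nonneg hC0 (waveMajorant_pos _ hy).le)
    _ = _ := by ring

lemma exists_radius {ω r x : ℝ} (hω : 0 < ω) (h : r < x) (hr : 0 ≤ r) :
    ∃ y, 0 < y ∧ ω * r ≤ y ∧ y < ω * x := by
  have h' : ω * r < ω * x := mul_lt_mul_of_pos_left h hω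
  obtain ⟨y, h1, h2⟩ := exists_between h'
  exact ⟨y, lt_of_le_of_lt (by positivity) h1, h1.le, h2⟩

lemma waveTerm_eq_zero {ω : ℝ} {p : Mode} {N : ℕ} (h : p ∉ modesBelow (N + 2)) (v : Space)
    (i : Fin 3) : waveTerm ω p v i N = 0 := by
  rw [mem_modesBelow, not_lt] at h
  rw [waveTerm, planeAmplitude_eq_zero (Or.inr h), mul_zero]

/-- The factor between a multipole wave and the sum of its homogeneous terms. -/
def waveFactor (ω : ℝ) (p : Mode) : ℂ := 4 * Real.pi * modePhase p / waveNorm ω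

/-- Translation of an outgoing multipole wave. -/
theorem hasSum_outgoing_transverseSpectrum {ω : ℝ} (hω : 0 < ω) {a v : Space} (h : ‖v‖ < ‖a‖)
    (p : Mode) (i : Fin 3) :
    HasSum (fun q => waveFactor ω q * modeWave ω q v i * outgoing ω a (coupledSpectrum p q))
      (outgoing ω (a + v) (transverseSpectrum p i)) := by
  have ha : a ≠ 0 := norm_pos_iff.mp ((norm_nonneg v).trans_lt h)
  obtain ⟨y, hy, hvy, hya⟩ := exists_radius hω h (norm_nonneg v)
  have hs : Summable fun q : Mode => waveMajorant q.j y * couplingMajorant p.j q.j (ω * ‖a‖) := by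
    -- An auxiliary radius for the fixed mode `p` allows the single series to be read off as a
    -- section of the summable double majorant.
    obtain ⟨z, hz, hz'⟩ := exists_between (sub_pos.mpr hya)
    have := (summable_majorant hz hy (show z + y < ω * ‖a‖ by linarith)).prod_factor p
    simp only [mul_assoc] at this
    exact (summable_mul_left_iff (waveMajorant_pos p.j hz).ne').mp this
  have hs2 := summable_waveTerm_mul (f := fun q => outgoing ω a (coupledSpectrum p q))
    (b := fun q => couplingMajorant p.j q.j (ω * ‖a‖)) hω hy hvy i
    (fun q => norm_outgoing_coupledSpectrum_le hω ha p q) hs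
  have := hasSum_outgoing_expansion hω h (harmonicSpan_mono le_top (transverseSpectrum_mem p i))
    (G := fun q => coupledSpectrum p q)
    (fun q => harmonicSpan_mono le_top (coupledSpectrum_mem p q)) (fun N => modesBelow (N + 2))
    (fun N q => waveTerm ω q v i N) (fun N q hq => waveTerm_eq_zero hq v i) (fun N n => ?_)
    hs2
  · simp only [(hasSum_waveTerm hω _ v i).tsum_eq] at this
    exact this
  -- The spectrum is tangential, so the projector δ - n n may be inserted in front of it. This turns
  -- the plane wave factor into one with a multipole expansion.
  · have ht := solidTransverse_tangential p.α p.one_le_j p.m (norm_dir n)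
    have e : transverseSpectrum p i n = ∑ i', ((if i = i' then 1 else 0)
        - ((n : Space) i : ℂ) * (n : Space) i') * transverseSpectrum p i' n := by
      simp only [sub_mul, Finset.sum_sub_distrib, mul_assoc]
      rw [← Finset.mul_sum]
      simp only [transverseSpectrum] at ht ⊢
      rw [ht]
      simp
    rw [e, Finset.mul_sum]
    simp only [← mul_assoc, planeWave_mul_tangential, Finset.sum_mul]
    rw [Finset.sum_comm]
    refine Finset.sum_congr rfl fun q _ => ?_
    rw [coupledSpectrum, Finset.mul_sum]
    exact Finset.sum_congr rfl fun k _ => by rw [transverseSpectrum]; ring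

/-- The expansion of the propagator in regular waves around one centre. -/
theorem hasSum_outgoing_transverseProjector {ω : ℝ} (hω : 0 < ω) {b u : Space} (h : ‖u‖ < ‖b‖)
    (i k : Fin 3) :
    HasSum (fun p => conj (waveFactor ω p * modeWave ω p u k) * outgoing ω b (transverseSpectrum p i))
      (outgoing ω (b - u) (transverseProjector i k)) := by
  have hb : b ≠ 0 := norm_pos_iff.mp ((norm_nonneg u).trans_lt h)
  obtain ⟨y, hy, hvy, hya⟩ := exists_radius hω h (norm_nonneg u)
  have hs : Summable fun p : Mode => waveMajorant p.j y * couplingMajorant p.j 1 (ω * ‖b‖) := by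
    obtain ⟨z, hz, hz'⟩ := exists_between (sub_pos.mpr hya)
    -- The spectrum has a single multipole, so the majorant with second degree 1 suffices; it is the
    -- section of the double series at an arbitrary mode of degree one.
    have := (summable_majorant hy hz (show y + z < ω * ‖b‖ by linarith)).prod_symm.prod_factor
      (⟨1, 0, 0, le_rfl, by norm_num⟩ : Mode)
    refine (summable_mul_left_iff (waveMajorant_pos 1 hz).ne').mp (this.congr fun p => ?_)
    simp only [Prod.swap]
    ring
  have hs2 := summable_waveTerm_mul (f := fun p => outgoing ω b (transverseSpectrum p i))
    (b := fun p => couplingMajorant p.j 1 (ω * ‖b‖)) hω hy hvy k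
    (fun p => norm_outgoing_transverseSpectrum_le hω hb p i) hs
  -- The displacement is -u, whose plane wave factor is the complex conjugate of the one for `u`.
  -- This is why conjugated waves appear around the first centre.
  have := hasSum_outgoing_expansion hω (a := b) (w := -u) (by rwa [norm_neg]) (transverseProjector_mem i k)
    (G := fun p => transverseSpectrum p i)
    (fun p => harmonicSpan_mono le_top (transverseSpectrum_mem p i)) (fun N => modesBelow (N + 2))
    (fun N p => conj (waveTerm ω p u k N))
    (fun N p hp => by rw [waveTerm_eq_zero hp, map_zero]) (fun N n => ?_)
    (by simpa only [norm_mul, RCLike.norm_conj] using hs2)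
  · have hc : ∀ p, ∑' N, conj (waveTerm ω p u k N) = conj (waveFactor ω p * modeWave ω p u k) :=
      fun p => (hasSum_waveTerm hω p u k).star.tsum_eq
    simp only [hc, ← sub_eq_add_neg] at this
    exact this
  · have := congrArg conj (planeWave_mul_tangential (ω := ω) u N n k i)
    rw [map_sum] at this
    simp only [map_mul, Complex.conj_conj] at this
    simp only [transverseSpectrum]
    rw [← this, transverseProjector]
    have hd : dot (-u) n = -dot u n := by simp [dot]; ring
    simp only [map_div₀, map_pow, map_mul, map_sub, Complex.conj_I, Complex.conj_ofReal, hd,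
      Complex.conj_natCast, eq_comm (a := k)]
    have e : Complex.I * ω * ((-dot u n : ℝ) : ℂ) = -Complex.I * ω * dot u n := by push_cast; ring
    rw [e]
    split_ifs <;> simp only [map_one, map_zero] <;> ring

lemma modePhase_ne_zero (p : Mode) : modePhase p ≠ 0 := zpow_ne_zero _ Complex.I_ne_zero

lemma conj_modePhase_mul (p : Mode) : conj (modePhase p) * modePhase p = 1 := by
  unfold modePhase
  rw [map_zpow₀, Complex.conj_I, ← mul_zpow]
  simp

theorem hasSum_coupling {ω : ℝ} (hω : 0 < ω) {a v : Space} (h : ‖v‖ < ‖a‖) (p : Mode) (i : Fin 3) :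
    HasSum (fun q => modeWave ω q v i * coupling ω a p q)
      (-(Complex.I * Real.pi / (2 * ω)) * (waveNorm ω / (4 * Real.pi * modePhase p))
        * outgoing ω (a + v) (transverseSpectrum p i)) := by
  have ha : a ≠ 0 := norm_pos_iff.mp ((norm_nonneg v).trans_lt h)
  have hw := waveNorm_ne_zero hω
  have hpi : (Real.pi : ℂ) ≠ 0 := by exact_mod_cast Real.pi_ne_zero
  refine ((hasSum_outgoing_transverseSpectrum hω h p i).mul_left _).congr_fun fun q => ?_
  rw [coupling_eq hω ha, waveFactor]
  have := modePhase_ne_zero p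
  field_simp

/-- Two translations in succession: the propagator is expanded around the first centre, and each
outgoing wave so produced, evaluated at a + v, is expanded around the second. No joint summability
is needed, hence the larger domain. -/
theorem hasSum_emPropagator {ω : ℝ} (hω : 0 < ω) {a v u : Space} (h : ‖v‖ < ‖a‖)
    (h' : ‖u‖ < ‖a + v‖) (i k : Fin 3) :
    HasSum (fun p => (∑' q, modeWave ω q v i * coupling ω a p q) * conj (modeWave ω p u k))
      (propagatorFactor ω * outgoing ω (a + v - u) (transverseProjector i k)) := by
  have hw := waveNorm_ne_zero hω
  have hpi : (Real.pi : ℂ) ≠ 0 := by exact_mod_cast Real.pi_ne_zero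
  have hω' : (ω : ℂ) ≠ 0 := by exact_mod_cast hω.ne'
  refine ((hasSum_outgoing_transverseProjector hω h' i k).mul_left _).congr_fun fun p => ?_
  rw [(hasSum_coupling hω h p i).tsum_eq, waveFactor, propagatorFactor]
  have hp := modePhase_ne_zero p
  have hc : conj (modePhase p) = 1 / modePhase p := by
    rw [eq_div_iff hp, conj_modePhase_mul]
  simp only [map_mul, map_div₀, Complex.conj_ofReal, hc, map_ofNat]
  have hsq := waveNorm_sq ω
  rw [eq_div_iff hpi] at hsq
  field_simp
  linear_combination (-(16 * outgoing ω (a + v) (transverseSpectrum p i)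
    * conj (modeWave ω p u k))) * hsq

/-- The gap in |u| + |v| < |a| leaves room for radii y and y' above ω|u| and ω|v| with y + y' <
ω|a|, the condition under which the majorant is summable. -/
theorem summable_modeWave_coupling {ω : ℝ} (hω : 0 < ω) {a v u : Space} (h : ‖u‖ + ‖v‖ < ‖a‖)
    (i k : Fin 3) :
    Summable fun pq : Mode × Mode =>
      modeWave ω pq.2 v i * coupling ω a pq.1 pq.2 * conj (modeWave ω pq.1 u k) := by
  have ha : a ≠ 0 := norm_pos_iff.mp (lt_of_le_of_lt (by positivity) h)
  obtain ⟨y, hy, huy, hya⟩ := exists_radius hω (show ‖u‖ < ‖a‖ - ‖v‖ by linarith) (norm_nonneg u)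
  obtain ⟨y', hvy', hya'⟩ := exists_between (show ω * ‖v‖ < ω * ‖a‖ - y by linarith)
  have hy' : 0 < y' := lt_of_le_of_lt (by positivity) hvy'
  obtain ⟨C, hC0, hC⟩ := exists_waveTerm_bound hω hy
  obtain ⟨C', hC0', hC'⟩ := exists_waveTerm_bound hω hy'
  have hs := summable_majorant hy hy' (show y + y' < ω * ‖a‖ by linarith)
  have hw := waveNorm_ne_zero hω
  have hpi : (Real.pi : ℂ) ≠ 0 := by exact_mod_cast Real.pi_ne_zero
  have hwave : ∀ {C y : ℝ} {p : Mode} {w : Space} {r : Fin 3},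
      Summable (fun N => ‖waveTerm ω p w r N‖) ∧ ∑' N, ‖waveTerm ω p w r N‖ ≤ C * waveMajorant p.j y →
      ‖waveFactor ω p * modeWave ω p w r‖ ≤ C * waveMajorant p.j y := by
    intro C y p w r hb
    have := (hasSum_waveTerm hω p w r).tsum_eq
    rw [waveFactor, ← this]
    exact (norm_tsum_le_tsum_norm hb.1).trans hb.2
  set D := 16 * Real.pi * Real.exp (2 * (ω * ‖a‖)) * 972
  refine Summable.of_norm_bounded (hs.mul_left (‖propagatorFactor ω‖ * (D * C * C'))) fun pq => ?_
  obtain ⟨p, q⟩ := pq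
  have e : modeWave ω q v i * coupling ω a p q * conj (modeWave ω p u k)
      = propagatorFactor ω * (outgoing ω a (coupledSpectrum p q)
        * conj (waveFactor ω p * modeWave ω p u k) * (waveFactor ω q * modeWave ω q v i)) := by
    have hp := modePhase_ne_zero p
    have hω' : (ω : ℂ) ≠ 0 := by exact_mod_cast hω.ne'
    have hc : conj (modePhase p) = 1 / modePhase p := by
      rw [eq_div_iff hp, conj_modePhase_mul]
    have hsq := waveNorm_sq ω
    rw [eq_div_iff hpi] at hsq
    rw [coupling_eq hω ha, waveFactor, waveFactor, propagatorFactor]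
    simp only [map_mul, map_div₀, Complex.conj_ofReal, hc, map_ofNat]
    field_simp
    linear_combination (-(16 * modeWave ω q v i * modePhase q * outgoing ω a (coupledSpectrum p q)
      * conj (modeWave ω p u k))) * hsq
  rw [e, norm_mul, norm_mul, norm_mul, RCLike.norm_conj]
  have b1 := norm_outgoing_coupledSpectrum_le hω ha p q
  have b2 := hwave (hC p u k huy)
  have b3 := hwave (hC' q v i hvy'.le)
  have m1 := couplingMajorant_nonneg p.j q.j (show 0 < ω * ‖a‖ by linarith)
  have m2 := (waveMajorant_pos p.j hy).le
  calc ‖propagatorFactor ω‖ * (‖outgoing ω a (coupledSpectrum p q)‖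
        * ‖waveFactor ω p * modeWave ω p u k‖ * ‖waveFactor ω q * modeWave ω q v i‖)
      ≤ ‖propagatorFactor ω‖ * (D * couplingMajorant p.j q.j (ω * ‖a‖)
        * (C * waveMajorant p.j y) * (C' * waveMajorant q.j y')) := by gcongr
    _ = _ := by ring

/-- By the triangle rule the angular integral vanishes for l'' > j + j'. -/
lemma finite_support_couplingTerm (ω : ℝ) (a : Space) (p q : Mode) :
    (Function.support (couplingTerm ω a p q)).Finite := by
  refine (scalarsUpTo (p.j + q.j)).finite_toSet.subset fun s hs => ?_
  by_contra h
  rw [Finset.mem_coe, mem_scalarsUpTo] at h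
  apply hs
  rw [couplingTerm, couplingIntegral_eq, tripleIntegral_eq_zero fun hh => h (by
    have := hh.2.2.2.2.1; omega), mul_zero]

/-- The iterated expansion of the propagator in waves centred at two points. -/
theorem hasSum_emPropagator_iterated {ω : ℝ} (hω : 0 < ω) {PA PB x y : Space}
    (h : ‖y - PB‖ < ‖PB - PA‖) (h' : ‖x - PA‖ < ‖y - PA‖) (i k : Fin 3) :
    HasSum (fun p => (∑' q, modeWave ω q (y - PB) i * coupling ω (PB - PA) p q)
      * conj (modeWave ω p (x - PA) k)) (emPropagator ω y x i k) := by
  have hne : y ≠ x := by rintro rfl; exact lt_irrefl _ h'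
  have e : PB - PA + (y - PB) = y - PA := by abel
  have := hasSum_emPropagator hω h (u := x - PA) (by rwa [e]) i k
  rwa [e, sub_sub_sub_cancel_right, ← emPropagator_eq hω hne] at this

/-- The double series expansion of the propagator in waves centred at two points. -/
theorem hasSum_emPropagator_pairs {ω : ℝ} (hω : 0 < ω) {PA PB x y : Space}
    (h : ‖x - PA‖ + ‖y - PB‖ < ‖PB - PA‖) (i k : Fin 3) :
    HasSum (fun pq : Mode × Mode => modeWave ω pq.2 (y - PB) i * coupling ω (PB - PA) pq.1 pq.2
      * conj (modeWave ω pq.1 (x - PA) k)) (emPropagator ω y x i k) := by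
  have hv : ‖y - PB‖ < ‖PB - PA‖ := by linarith [norm_nonneg (x - PA)]
  -- By the triangle inequality the domain of the double series lies inside that of the iterated
  -- one.
  have hu : ‖x - PA‖ < ‖y - PA‖ := by
    have : ‖PB - PA‖ ≤ ‖y - PA‖ + ‖y - PB‖ := by
      rw [show PB - PA = (y - PA) - (y - PB) by abel]
      exact norm_sub_le _ _
    linarith
  have hs := (summable_modeWave_coupling hω h i k).hasSum
  -- An unconditionally convergent double series may be summed iteratively, so its value is the one
  -- already found.
  have h1 := hs.prod_fiberwise fun p =>
    (hasSum_coupling hω hv p i).summable.hasSum.mul_right (conj (modeWave ω p (x - PA) k))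
  rwa [h1.unique (hasSum_emPropagator_iterated hω hv hu i k)] at hs

end EMWaves

end

theorem mainTheorem7 :
    -- the sum over `l'', m''` in each coefficient is finite
    (∀ (ω : ℝ) (a : Space) (p q : Mode), (Function.support (couplingTerm ω a p q)).Finite) ∧
    -- the expansion as an unconditionally convergent double series
    (∀ (ω : ℝ) (PA PB x y : Space), 0 < ω → ‖x - PA‖ + ‖y - PB‖ < ‖PB - PA‖ →
      ∀ i k : Fin 3,
        HasSum
          (fun pq : Mode × Mode =>
            modeWave ω pq.2 (y - PB) i * coupling ω (PB - PA) pq.1 pq.2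
              * conj (modeWave ω pq.1 (x - PA) k))
          (emPropagator ω y x i k)) ∧
    -- the expansion as an iterated series, on the larger domain
    (∀ (ω : ℝ) (PA PB x y : Space), 0 < ω → ‖y - PB‖ < ‖PB - PA‖ → ‖x - PA‖ < ‖y - PA‖ →
      ∀ i k : Fin 3,
        (∀ p : Mode, Summable
          (fun q : Mode => modeWave ω q (y - PB) i * coupling ω (PB - PA) p q)) ∧
        HasSum
          (fun p : Mode =>
            (∑' q : Mode, modeWave ω q (y - PB) i * coupling ω (PB - PA) p q)
              * conj (modeWave ω p (x - PA) k))
          (emPropagator ω y x i k)) ∧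
    -- the angular integrals
    (∀ (p q : Mode) (s : ScalarIndex),
      couplingIntegral p q s = tripleIntegral p q s ∧
      (p.α = q.α →
        tripleIntegral p q s = (equalPolarisationValue p.j q.j s.l p.m q.m s.m : ℂ) ∧
        (Odd (p.j + q.j + s.l) → tripleIntegral p q s = 0)) ∧
      (p.α ≠ q.α →
        (Even (p.j + q.j + s.l) → tripleIntegral p q s = 0) ∧
        (Odd (p.j + q.j + s.l) →
          tripleIntegral p q s = (mixedPolarisationValue p.j q.j s.l p.m q.m s.m : ℂ)))) := by
  refine ⟨finite_support_couplingTerm, ?_, ?_, fun p q s => ⟨couplingIntegral_eq p q s,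
    fun h => ⟨tripleIntegral_of_same p q s h, tripleIntegral_of_same_of_odd p q s h⟩,
    fun h => ⟨tripleIntegral_of_ne_of_even p q s h, tripleIntegral_of_ne_of_odd p q s h⟩⟩⟩
  · intro ω PA PB x y hω h i k
    exact hasSum_emPropagator_pairs hω h i k
  · intro ω PA PB x y hω h h' i k
    exact ⟨fun p => (hasSum_coupling hω h p i).summable, hasSum_emPropagator_iterated hω h h' i k⟩
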